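/- **Setting.** Let $n\ge 1$. A tiling of a rectangle $S$ by $n$ rectangles (all sides horizontal or vertical) is *generic* if no point is a corner of four distinct tiles. A tile $U$ is *left of* a tile $V$ if the right edge of $U$ meets the left edge of $V$ in a line segment, and $U$ is *below* $V$ if the top edge of $U$ meets the bottom edge of $V$ in a line segment. Two tilings are combinatorially equivalent if some bijection between their tiles preserves exactly the relations "left of" and "below"; a *generic rectangulation* is an equivalence class of generic tilings, and $\mathrm{gRec}_n$ is the set of generic rectangulations with $n$ rectangles. The *diagonal* of $S$ is the segment from its top-left to its bottom-right corner. A *diagonal rectangulation* is one that has a representative in which the interior of every tile meets the diagonal; its tiles are numbered $1,\dots,n$ in the order in which they meet the diagonal, from top-left to bottom-right. A *wall* is a line segment in $S$, not contained in an edge of $S$, that is maximal with respect to meeting the interior of no tile. A *wall slide* along a wall $W$ takes two walls that end in $W$ from opposite sides, consecutively along $W$, and slides them past each other, changing no other adjacency. Two generic rectangulations are *mosaic equivalent* if they are related by a sequence of wall slides; numberings of the tiles are carried along by wall slides. Let the tiles be numbered. With a vertical wall $W$ associate two sequences, read from bottom to top: the numbers of the tiles whose right edge lies in $W$, except the bottom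 one, each recorded at the height of its bottom edge; and the numbers of the tiles whose left edge lies in $W$, except the top one, each recorded at the height of its top edge. With a horizontal wall $W$ associate two sequences, read from left to right: the numbers of the tiles whose bottom edge lies in $W$, except the rightmost one, each recorded at its right edge; and the numbers of the tiles whose top edge lies in $W$, except the leftmost one, each recorded at its left edge. The *wall shuffle* $\sigma_W$ of a numbered generic tiling is the sequence of all these numbers in the order in which they are recorded along $W$. A *choice of a wall shuffle* for $W$ is an arbitrary shuffle of the two sequences associated with $W$. *The map $\rho$.* Let $x=x_1\cdots x_n\in S_n$. Put $n+1$ distinct diagonal points on the diagonal of $S$, the first one at the top-left and the last one at the bottom-right corner of $S$, and number the spaces between them $1,\dots,n$ from top-left to bottom-right. For $i=1,\dots,n$ let $T$ be the union of the left and bottom edges of $S$ with the rectangles drawn in the first $i-1$ steps, and let $p$ and $p'$ be the diagonal points immediately above/left of and below/right of the space $x_i$. Draw the rectangle (numbered $x_i$) whose top-left corner is the rightmost point of $T$ directly left of $p$ if $p\notin T$, and the highest point of $T$ directly above $p$ if $p\in T$, and whose bottom-right corner is the highest point of $T$ directly below $p'$ if $p'\notin T$, and the rightmost point of $T$ directly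 right of $p'$ if $p'\in T$. (A point of $T$ itself counts as directly above, or right of, itself.) The resulting diagonal rectangulation is $\rho(x)$. *The map $\gamma$.* For $x\in S_n$, $\gamma(x)\in\mathrm{gRec}_n$ is the generic rectangulation that is mosaic equivalent to $\rho(x)$ and in which, with the numbering carried over from $\rho(x)$, the wall shuffle of every wall is a subsequence of $x_1\cdots x_n$. **Proposition.** For every $n\ge1$: 1. $\gamma:S_n\to\mathrm{gRec}_n$ is a well-defined map (for every $x\in S_n$ there is exactly one generic rectangulation with the defining property of $\gamma(x)$), and it is surjective. 2. Equivalently, for every diagonal rectangulation $R'$ with $n$ rectangles and every choice of a wall shuffle for each wall of $R'$, there is a permutation $x=x_1\cdots x_n\in S_n$ such that $\rho(x)=R'$ (with the same numbering of the rectangles) and every chosen wall shuffle is a subsequence of $x_1\cdots x_n$. -/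

import Mathlib

namespace Rectangulation

/-- An axis-parallel rectangle `[x0, x1] × [y0, y1]` in the plane
(a genuine rectangle when `Nondeg` holds). -/
@[ext] structure Rect where
  x0 : ℝ
  x1 : ℝ
  y0 : ℝ
  y1 : ℝ

namespace Rect

def Nondeg (r : Rect) : Prop := r.x0 < r.x1 ∧ r.y0 < r.y1

/-- The closed rectangle. -/
def toSet (r : Rect) : Set (ℝ × ℝ) := Set.Icc r.x0 r.x1 ×ˢ Set.Icc r.y0 r.y1

/-- The interior of the rectangle. -/
def inner (r : Rect) : Set (ℝ × ℝ) := Set.Ioo r.x0 r.x1 ×ˢ Set.Ioo r.y0 r.y1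

/-- The four corners. -/
def corners (r : Rect) : Set (ℝ × ℝ) :=
  {(r.x0, r.y0), (r.x0, r.y1), (r.x1, r.y0), (r.x1, r.y1)}

/-- The diagonal: from the top-left corner to the bottom-right corner. -/
def diagonal (r : Rect) : Set (ℝ × ℝ) := segment ℝ (r.x0, r.y1) (r.x1, r.y0)

/-- `r` is left of `s`: the right edge of `r` meets the left edge of `s` in a line segment. -/
def LeftOf (r s : Rect) : Prop := r.x1 = s.x0 ∧ max r.y0 s.y0 < min r.y1 s.y1

/-- `r` is below `s`: the top edge of `r` meets the bottom edge of `s` in a line segment. -/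
def Below (r s : Rect) : Prop := r.y1 = s.y0 ∧ max r.x0 s.x0 < min r.x1 s.x1

end Rect

/-- A tiling of a rectangle `outer` by `n` rectangles, which carry labels in `Fin n`. -/
structure Tiling (n : ℕ) where
  outer : Rect
  tile : Fin n → Rect
  outer_nondeg : outer.Nondeg
  tile_nondeg : ∀ i, (tile i).Nondeg
  disjoint : ∀ i j, i ≠ j → Disjoint (tile i).inner (tile j).inner
  cover : (⋃ i, (tile i).toSet) = outer.toSet

/-- The two families of rectangles have the same relations "left of" and "below",
labels being matched identically. -/
def SameRel {n : ℕ} (R R' : Fin n → Rect) : Prop :=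
  ∀ i j, ((R i).LeftOf (R j) ↔ (R' i).LeftOf (R' j)) ∧ ((R i).Below (R j) ↔ (R' i).Below (R' j))

/-- Combinatorial equivalence: after some relabelling the relations "left of" and "below" agree. -/
def CombEquiv {n : ℕ} (R R' : Fin n → Rect) : Prop :=
  ∃ e : Equiv.Perm (Fin n), SameRel R (R' ∘ e)

/-- A tiling is generic if no point is a corner of four distinct tiles. -/
def Tiling.IsGeneric {n : ℕ} (R : Tiling n) : Prop :=
  ∀ p : ℝ × ℝ, {i : Fin n | p ∈ (R.tile i).corners}.ncard < 4

/-- Generic tilings by `n` labelled rectangles. -/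
def GenericTiling (n : ℕ) : Type := {R : Tiling n // R.IsGeneric}

instance genericTilingSetoid (n : ℕ) : Setoid (GenericTiling n) where
  r R R' := CombEquiv R.1.tile R'.1.tile
  iseqv :=
    { refl := fun R => ⟨1, fun _ _ => ⟨Iff.rfl, Iff.rfl⟩⟩
      symm := by
        rintro R R' ⟨e, he⟩
        refine ⟨e.symm, fun i j => ?_⟩
        have h := he (e.symm i) (e.symm j)
        simp only [Function.comp_apply, Equiv.apply_symm_apply] at h ⊢
        exact ⟨h.1.symm, h.2.symm⟩
      trans := by
        rintro R R' R'' ⟨e, he⟩ ⟨f, hf⟩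
        refine ⟨e.trans f, fun i j => ?_⟩
        have h := he i j
        have h' := hf (e i) (e j)
        simp only [Function.comp_apply, Equiv.trans_apply] at h h' ⊢
        exact ⟨h.1.trans h'.1, h.2.trans h'.2⟩ }

/-- The set of generic rectangulations with `n` rectangles: generic tilings up to
combinatorial equivalence. -/
def GRec (n : ℕ) : Type := Quotient (genericTilingSetoid n)

/-! ### Diagonal rectangulations -/

/-- The interior of every tile meets the diagonal of the outer rectangle, and the tiles are
labelled in the order in which they meet the diagonal, from top-left to bottom-right. -/
def Tiling.IsDiagonal {n : ℕ} (R : Tiling n) : Prop :=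
  (∀ i, (R.outer.diagonal ∩ (R.tile i).inner).Nonempty) ∧
  ∀ i j, i < j → ∀ p ∈ R.outer.diagonal ∩ (R.tile i).inner,
    ∀ q ∈ R.outer.diagonal ∩ (R.tile j).inner, p.1 < q.1

/-! ### The map `ρ`

The outer rectangle is `[0, n] × [0, n]`, the diagonal points are `(k, n - k)` for `0 ≤ k ≤ n`,
and the label `a : Fin n` stands for the space between the diagonal points number `a` and
`a + 1`. -/

/-- The diagonal point number `k`. -/
def diagPoint (n k : ℕ) : ℝ × ℝ := ((k : ℝ), (n : ℝ) - k)

open Classical in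
/-- The top-left corner of the rectangle with label `a` that is drawn when the region `T` is
already present. With `p` the diagonal point above/left of the label: the rightmost point of `T`
directly left of `p` if `p ∉ T`, and the highest point of `T` directly above `p` otherwise. -/
noncomputable def rhoTopLeft (n : ℕ) (T : Set (ℝ × ℝ)) (a : ℕ) : ℝ × ℝ :=
  let p := diagPoint n a
  if p ∈ T then (p.1, sSup {v : ℝ | p.2 ≤ v ∧ (p.1, v) ∈ T})
  else (sSup {u : ℝ | u ≤ p.1 ∧ (u, p.2) ∈ T}, p.2)

open Classical in
/-- The bottom-right corner of the rectangle with label `a` that is drawn when the region `T` is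
already present. With `p` the diagonal point below/right of the label: the highest point of `T`
directly below `p` if `p ∉ T`, and the rightmost point of `T` directly right of `p` otherwise. -/
noncomputable def rhoBottomRight (n : ℕ) (T : Set (ℝ × ℝ)) (a : ℕ) : ℝ × ℝ :=
  let p := diagPoint n (a + 1)
  if p ∈ T then (sSup {u : ℝ | p.1 ≤ u ∧ (u, p.2) ∈ T}, p.2)
  else (p.1, sSup {v : ℝ | v ≤ p.2 ∧ (p.1, v) ∈ T})

/-- The rectangle with label `a` that is drawn when the region `T` is already present. -/
noncomputable def rhoRect (n : ℕ) (T : Set (ℝ × ℝ)) (a : ℕ) : Rect where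
  x0 := (rhoTopLeft n T a).1
  x1 := (rhoBottomRight n T a).1
  y0 := (rhoBottomRight n T a).2
  y1 := (rhoTopLeft n T a).2

/-- The region `T` present after `i` steps: the left and bottom edges of the outer rectangle
together with the first `i` rectangles. -/
noncomputable def rhoRegion {n : ℕ} (x : Equiv.Perm (Fin n)) : ℕ → Set (ℝ × ℝ)
  | 0 => ({0} ×ˢ Set.Icc (0 : ℝ) n) ∪ (Set.Icc (0 : ℝ) n ×ˢ {0})
  | i + 1 => rhoRegion x i ∪
      {p | ∃ h : i < n, p ∈ (rhoRect n (rhoRegion x i) (x ⟨i, h⟩)).toSet}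

/-- The rectangles of `ρ(x)`: the rectangle with label `a` is drawn in the step at which `a`
is read in the word `x`. -/
noncomputable def rho {n : ℕ} (x : Equiv.Perm (Fin n)) : Fin n → Rect :=
  fun a => rhoRect n (rhoRegion x (x.symm a)) a

/-- The one-line word `x_1 x_2 ⋯ x_n` of a permutation. -/
def word {n : ℕ} (x : Equiv.Perm (Fin n)) : List (Fin n) := List.ofFn x

/-! ### Walls -/

/-- Vertical and horizontal segments: `vert x a b` is `{x} × [a, b]` and `horiz y a b` is
`[a, b] × {y}`. -/
inductive Seg where
  | vert (x a b : ℝ)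
  | horiz (y a b : ℝ)

namespace Seg

def toSet : Seg → Set (ℝ × ℝ)
  | vert x a b => {x} ×ˢ Set.Icc a b
  | horiz y a b => Set.Icc a b ×ˢ {y}

def Nondeg : Seg → Prop
  | vert _ a b => a < b
  | horiz _ a b => a < b

end Seg

/-- The four edges of a rectangle. -/
def Rect.edges (r : Rect) : Set Seg :=
  {Seg.vert r.x0 r.y0 r.y1, Seg.vert r.x1 r.y0 r.y1,
    Seg.horiz r.y0 r.x0 r.x1, Seg.horiz r.y1 r.x0 r.x1}

/-- `W` is a line segment in the outer rectangle that meets the interior of no tile. -/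
def Tiling.Avoids {n : ℕ} (R : Tiling n) (W : Seg) : Prop :=
  W.Nondeg ∧ W.toSet ⊆ R.outer.toSet ∧ ∀ i, Disjoint W.toSet (R.tile i).inner

/-- Walls: line segments not contained in an edge of the outer rectangle, and maximal with
respect to not meeting the interior of a tile. -/
def Tiling.IsWall {n : ℕ} (R : Tiling n) (W : Seg) : Prop :=
  R.Avoids W ∧ (∀ E ∈ R.outer.edges, ¬ W.toSet ⊆ E.toSet) ∧
  ∀ W', R.Avoids W' → W.toSet ⊆ W'.toSet → W'.toSet ⊆ W.toSet

/-! ### Wall shuffles -/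

/-- `r` is recorded at the point with coordinate `t` along the wall `W`, as a rectangle on the
left side of a vertical wall, respectively on the upper side of a horizontal wall.
* `W` vertical: the right edge of `r` lies in `W`, and `r` is not the bottom such rectangle;
  it is recorded where its bottom edge meets `W`.
* `W` horizontal: the bottom edge of `r` lies in `W`, and `r` is not the rightmost such rectangle;
  it is recorded where its right edge meets `W`. -/
def Seg.MarkLU : Seg → Rect → ℝ → Prop
  | vert x a b, r, t => r.x1 = x ∧ a < r.y0 ∧ r.y1 ≤ b ∧ t = r.y0
  | horiz y a b, r, t => r.y0 = y ∧ a ≤ r.x0 ∧ r.x1 < b ∧ t = r.x1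

/-- `r` is recorded at the point with coordinate `t` along the wall `W`, as a rectangle on the
right side of a vertical wall, respectively on the lower side of a horizontal wall.
* `W` vertical: the left edge of `r` lies in `W`, and `r` is not the top such rectangle;
  it is recorded where its top edge meets `W`.
* `W` horizontal: the top edge of `r` lies in `W`, and `r` is not the leftmost such rectangle;
  it is recorded where its left edge meets `W`. -/
def Seg.MarkRD : Seg → Rect → ℝ → Prop
  | vert x a b, r, t => r.x0 = x ∧ a ≤ r.y0 ∧ r.y1 < b ∧ t = r.y1
  | horiz y a b, r, t => r.y1 = y ∧ a < r.x0 ∧ r.x1 ≤ b ∧ t = r.x0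

/-- `r` is recorded at the point with coordinate `t` along the wall `W`. -/
def Seg.Mark (W : Seg) (r : Rect) (t : ℝ) : Prop := W.MarkLU r t ∨ W.MarkRD r t

/-- `l` is the wall shuffle of the wall `W` of `R`: the labels of all recorded rectangles, in the
order in which they are met along `W` (bottom to top, respectively left to right). -/
def IsWallShuffle {n : ℕ} (R : Fin n → Rect) (W : Seg) (l : List (Fin n)) : Prop :=
  (∀ i, i ∈ l ↔ ∃ t, W.Mark (R i) t) ∧
  l.Pairwise fun i j => ∀ s t, W.Mark (R i) s → W.Mark (R j) t → s < t

/-- `l` is an admissible choice of a wall shuffle for the wall `W`: an arbitrary shuffle of the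
sequence of labels recorded on one side of `W` with the sequence of labels recorded on the other
side, both sequences being read along `W` (bottom to top, respectively left to right). -/
def IsShuffleChoice {n : ℕ} (R : Fin n → Rect) (W : Seg) (l : List (Fin n)) : Prop :=
  l.Nodup ∧ (∀ i, i ∈ l ↔ ∃ t, W.Mark (R i) t) ∧
  l.Pairwise fun i j =>
    (∀ s t, W.MarkLU (R i) s → W.MarkLU (R j) t → s < t) ∧
    (∀ s t, W.MarkRD (R i) s → W.MarkRD (R j) t → s < t)

/-! ### Wall slides and mosaic equivalence -/

/-- The effect of a wall slide on the adjacency relations. Read with `L` = "left of" and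
`B` = "below" it is a slide along a vertical wall `W`: on the left of `W` lie `a` and `b`, with `a`
below `b`, and on the right of `W` lie `c` and `d`, with `c` below `d`. The wall separating `a` from
`b` ends in `W`, and the next wall ending in `W` above it, from the other side, is the one
separating `c` from `d`. Sliding the two past each other destroys the adjacency of `b` and `c`,
creates the adjacency of `a` and `d`, and changes nothing else. With the roles of "left of" and
"below" exchanged it is a slide along a horizontal wall. -/
def SlideRel {n : ℕ} (L B L' B' : Fin n → Fin n → Prop) : Prop :=
  (∀ i j, B' i j ↔ B i j) ∧
  ∃ a b c d, B a b ∧ B c d ∧ L a c ∧ L b c ∧ L b d ∧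
    ∀ i j, L' i j ↔ (L i j ∧ ¬ (i = b ∧ j = c)) ∨ (i = a ∧ j = d)

/-- `R'` arises from `R` by a wall slide along a vertical or a horizontal wall; each rectangle
keeps its label. -/
def WallSlide {n : ℕ} (R R' : Fin n → Rect) : Prop :=
  SlideRel (fun i j => (R i).LeftOf (R j)) (fun i j => (R i).Below (R j))
    (fun i j => (R' i).LeftOf (R' j)) (fun i j => (R' i).Below (R' j)) ∨
  SlideRel (fun i j => (R i).Below (R j)) (fun i j => (R i).LeftOf (R j))
    (fun i j => (R' i).Below (R' j)) (fun i j => (R' i).LeftOf (R' j))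

/-- Equivalence as mosaic floorplans, with the labels propagated: the generic tilings are
connected by a sequence of wall slides, performed up to combinatorial equivalence. -/
def MosaicEquiv {n : ℕ} : GenericTiling n → GenericTiling n → Prop :=
  Relation.EqvGen fun R R' => SameRel R.1.tile R'.1.tile ∨ WallSlide R.1.tile R'.1.tile

/-! ### The map `γ` -/

/-- The defining property of the value `γ(x)`: the generic rectangulation `G` is equivalent to
`ρ(x)` as a mosaic floorplan, and, in the numbering inherited from `ρ(x)`, the wall shuffle of
every wall of `G` is a subsequence of `x_1 ⋯ x_n`. -/
def IsGamma {n : ℕ} (x : Equiv.Perm (Fin n)) (G : GRec n) : Prop :=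
  ∃ R₀ R : GenericTiling n, R₀.1.tile = rho x ∧ MosaicEquiv R₀ R ∧
    (∀ W, R.1.IsWall W → ∃ l, IsWallShuffle R.1.tile W l ∧ l.Sublist (word x)) ∧
    G = Quotient.mk (genericTilingSetoid n) R

end Rectangulation

/-! Write `t a` for the position of the label `a` in `x`. The rectangle `a` of `ρ(x)` lies between
the vertical lines `lf t a` and `rt n t a` and between the horizontal lines `bo n t a` and `tp t a`.
Each of these indices (the ids of `a`) is the end of a run of labels next to `a` that are all later,
or all earlier, than `a`. An index `v` strictly between 0 and `n` names one wall: a vertical one if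
`t (v - 1) < t v`, a horizontal one otherwise. The ids do not involve coordinates. The lines may be
moved as long as the rectangles stay nondegenerate and separated in the way that labels and times
prescribe (`Build`); the result is again a tiling, and its adjacencies depend only on the ids and on
the order of opposite marks along each wall (`Build.sameRel`).

Existence of `γ(x)`. The coordinates can be chosen so that along every wall the marks come in the
order of time (`exists_markedBuild`); the wall shuffles are then subwords of `x`. This tiling is
mosaic equivalent to `ρ(x)`: the tiling `ρ(x)` reads its own marks in the order of some permutation
`x₀` with the same ids as `x`, and `x` can be sorted into `x₀` by exchanging neighbouring entries.
Each exchange keeps the ids and reverses at most one pair of marks, which are consecutive on their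
wall, so it is a wall slide or no change at all (`MarkedBuild.step_of_lt`,
`mosaicEquiv_of_sameIds`).

Uniqueness. Two tiles lie on opposite sides of one wall exactly if a zigzag of adjacencies across
the wall joins them, and wall slides preserve this (`SlideRel.zigzag`). The common walls determine
labels and ids (`eq_one_and_sameIds`), and the wall shuffles then determine the order of the marks,
hence the generic rectangulation (`isGamma_iff`).

Surjectivity and the second part both rest on `exists_labelling`. Given a generic tiling and a
consistent order for opposite marks, the tiles are drawn one after another from the bottom-left
corner, so that the drawn region is always a staircase. The tile in a gap of the staircase may have
to wait for something to its right or for something above it to its left. Two neighbouring gaps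
never wait for each other (`Corner.not_blocked`), the last gap does not wait for its right and the
first does not wait for its left, so some gap is free. The order of drawing is the permutation, and
the order from left to right along the staircase gives the labels. For surjectivity the order of the
marks is the geometric one. For a diagonal rectangulation it is given by the chosen shuffles; that
rectangulation is determined by its ids (`Build.sameRel_of_meetsDiag`), so it is `ρ` of the
permutation found.

Horizontal walls are treated by transposition: exchange the coordinates and reverse the labels. -/

namespace Rectangulation

/-! ### Combinatorics of time functions -/

/-- The left end of the maximal run of labels below `k` that satisfy `P`. -/
noncomputable def runStart (P : ℕ → Prop) (k : ℕ) : ℕ :=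
  sInf {f | f ≤ k ∧ ∀ m, f ≤ m → m < k → P m}

/-- The right end (exclusive) of the maximal run of labels in `[k, n)` that satisfy `P`. -/
noncomputable def runEnd (n : ℕ) (P : ℕ → Prop) (k : ℕ) : ℕ :=
  sInf {l | k ≤ l ∧ (n ≤ l ∨ ¬ P l)}

theorem runStart_spec (P : ℕ → Prop) (k : ℕ) :
    runStart P k ≤ k ∧ (∀ m, runStart P k ≤ m → m < k → P m) ∧
      (0 < runStart P k → ¬ P (runStart P k - 1)) := by
  have h := Nat.sInf_mem (s := {f | f ≤ k ∧ ∀ m, f ≤ m → m < k → P m})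
    ⟨k, le_rfl, fun m h1 h2 => absurd h1 (by omega)⟩
  refine ⟨h.1, h.2, fun h0 hP => ?_⟩
  have : runStart P k ≤ runStart P k - 1 := by
    apply Nat.sInf_le
    refine ⟨by have := h.1; change runStart P k ≤ k at this; omega, fun m h1 h2 => ?_⟩
    by_cases hm : m = runStart P k - 1
    · rw [hm]; exact hP
    · exact h.2 m (by change runStart P k ≤ m; omega) h2
  omega

theorem runStart_eq {P : ℕ → Prop} {k f : ℕ} (h1 : f ≤ k) (h2 : ∀ m, f ≤ m → m < k → P m)
    (h3 : 0 < f → ¬ P (f - 1)) : runStart P k = f := by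
  obtain ⟨g1, g2, g3⟩ := runStart_spec P k
  rcases lt_trichotomy (runStart P k) f with h | h | h
  · exact absurd (g2 (f - 1) (by omega) (by omega)) (h3 (by omega))
  · exact h
  · exact absurd (h2 (runStart P k - 1) (by omega) (by omega)) (g3 (by omega))

theorem runEnd_spec (n : ℕ) (P : ℕ → Prop) (k : ℕ) (hk : k ≤ n) :
    k ≤ runEnd n P k ∧ runEnd n P k ≤ n ∧ (∀ m, k ≤ m → m < runEnd n P k → P m) ∧
      (runEnd n P k < n → ¬ P (runEnd n P k)) := by
  have h := Nat.sInf_mem (s := {l | k ≤ l ∧ (n ≤ l ∨ ¬ P l)}) ⟨n, hk, Or.inl le_rfl⟩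
  refine ⟨h.1, Nat.sInf_le ⟨hk, Or.inl le_rfl⟩, fun m h1 h2 => ?_, fun h0 => ?_⟩
  · by_contra hP
    have := Nat.notMem_of_lt_sInf h2
    exact this ⟨h1, Or.inr hP⟩
  · rcases h.2 with h' | h'
    · exact absurd h0 (not_lt.2 h')
    · exact h'

theorem runEnd_eq {n : ℕ} {P : ℕ → Prop} {k l : ℕ} (h1 : k ≤ l) (h0 : l ≤ n)
    (h2 : ∀ m, k ≤ m → m < l → P m) (h3 : l < n → ¬ P l) : runEnd n P k = l := by
  obtain ⟨g1, g2, g3, g4⟩ := runEnd_spec n P k (h1.trans h0)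
  rcases lt_trichotomy (runEnd n P k) l with h | h | h
  · exact absurd (h2 _ g1 h) (g4 (by omega))
  · exact h
  · exact absurd (g3 l h1 h) (h3 (by omega))

/-- Distinct labels have distinct times. -/
def TimeInj (n : ℕ) (t : ℕ → ℕ) : Prop := ∀ i j, i < n → j < n → t i = t j → i = j

/-- Index of the vertical line carrying the left edge. -/
noncomputable def lf (t : ℕ → ℕ) (a : ℕ) : ℕ := runStart (fun m => t a < t m) a

/-- Index of the horizontal line carrying the top edge. -/
noncomputable def tp (t : ℕ → ℕ) (a : ℕ) : ℕ := runStart (fun m => t m < t a) a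

/-- Index of the vertical line carrying the right edge. -/
noncomputable def rt (n : ℕ) (t : ℕ → ℕ) (a : ℕ) : ℕ := runEnd n (fun m => t m < t a) (a + 1)

/-- Index of the horizontal line carrying the bottom edge. -/
noncomputable def bo (n : ℕ) (t : ℕ → ℕ) (a : ℕ) : ℕ := runEnd n (fun m => t a < t m) (a + 1)

/-! ### Inequalities that define the ids, and their symmetry under reversal of the labels. -/

section ids
variable {n : ℕ} {t : ℕ → ℕ} (hT : TimeInj n t)
include hT

theorem TimeInj.lf_spec {a : ℕ} (ha : a < n) :
    lf t a ≤ a ∧ (∀ m, lf t a ≤ m → m < a → t a < t m) ∧ (0 < lf t a → t (lf t a - 1) < t a) := by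
  obtain ⟨h1, h2, h3⟩ := runStart_spec (fun m => t a < t m) a
  change lf t a ≤ a at h1
  refine ⟨h1, h2, fun h => ?_⟩
  have h4 : ¬ t a < t (lf t a - 1) := h3 h
  have := hT (lf t a - 1) a (by omega) ha
  omega

theorem TimeInj.tp_spec {a : ℕ} (ha : a < n) :
    tp t a ≤ a ∧ (∀ m, tp t a ≤ m → m < a → t m < t a) ∧ (0 < tp t a → t a < t (tp t a - 1)) := by
  obtain ⟨h1, h2, h3⟩ := runStart_spec (fun m => t m < t a) a
  change tp t a ≤ a at h1
  refine ⟨h1, h2, fun h => ?_⟩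
  have h4 : ¬ t (tp t a - 1) < t a := h3 h
  have := hT (tp t a - 1) a (by omega) ha
  omega

theorem TimeInj.rt_spec {a : ℕ} (ha : a < n) :
    a + 1 ≤ rt n t a ∧ rt n t a ≤ n ∧ (∀ m, a < m → m < rt n t a → t m < t a) ∧
      (rt n t a < n → t a < t (rt n t a)) := by
  obtain ⟨h1, h0, h2, h3⟩ := runEnd_spec n (fun m => t m < t a) (a + 1) ha
  change a + 1 ≤ rt n t a at h1
  refine ⟨h1, h0, fun m hm => h2 m hm, fun h => ?_⟩
  have h4 : ¬ t (rt n t a) < t a := h3 h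
  have := hT (rt n t a) a (by omega) ha
  omega

theorem TimeInj.bo_spec {a : ℕ} (ha : a < n) :
    a + 1 ≤ bo n t a ∧ bo n t a ≤ n ∧ (∀ m, a < m → m < bo n t a → t a < t m) ∧
      (bo n t a < n → t (bo n t a) < t a) := by
  obtain ⟨h1, h0, h2, h3⟩ := runEnd_spec n (fun m => t a < t m) (a + 1) ha
  change a + 1 ≤ bo n t a at h1
  refine ⟨h1, h0, fun m hm => h2 m hm, fun h => ?_⟩
  have h4 : ¬ t a < t (bo n t a) := h3 h
  have := hT (bo n t a) a (by omega) ha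
  omega

omit hT in
theorem lf_eq {a f : ℕ} (h1 : f ≤ a) (h2 : ∀ m, f ≤ m → m < a → t a < t m)
    (h3 : 0 < f → t (f - 1) ≤ t a) : lf t a = f :=
  runStart_eq h1 h2 fun h => not_lt.2 (h3 h)

omit hT in
theorem tp_eq {a f : ℕ} (h1 : f ≤ a) (h2 : ∀ m, f ≤ m → m < a → t m < t a)
    (h3 : 0 < f → t a ≤ t (f - 1)) : tp t a = f :=
  runStart_eq h1 h2 fun h => not_lt.2 (h3 h)

omit hT in
theorem rt_eq {a l : ℕ} (h1 : a + 1 ≤ l) (h0 : l ≤ n) (h2 : ∀ m, a < m → m < l → t m < t a)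
    (h3 : l < n → t a ≤ t l) : rt n t a = l :=
  runEnd_eq h1 h0 (fun m hm => h2 m hm) fun h => not_lt.2 (h3 h)

omit hT in
theorem bo_eq {a l : ℕ} (h1 : a + 1 ≤ l) (h0 : l ≤ n) (h2 : ∀ m, a < m → m < l → t a < t m)
    (h3 : l < n → t l ≤ t a) : bo n t a = l :=
  runEnd_eq h1 h0 (fun m hm => h2 m hm) fun h => not_lt.2 (h3 h)

/-- Reversing the labels. -/
def flipT (n : ℕ) (t : ℕ → ℕ) : ℕ → ℕ := fun m => t (n - 1 - m)

theorem TimeInj.flip : TimeInj n (flipT n t) := by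
  intro i j hi hj h
  have := hT (n - 1 - i) (n - 1 - j) (by omega) (by omega) h
  omega

omit hT in
theorem flipT_flip {a : ℕ} (ha : a < n) : flipT n t (n - 1 - a) = t a := by
  unfold flipT; congr 1; omega

/-- Reading the labels backwards exchanges runs before `a` with runs after `a`, so `lf` trades
places with `bo`, and `tp` with `rt`. This is the combinatorial side of transposing a tiling. -/
theorem TimeInj.lf_flip {a : ℕ} (ha : a < n) : lf (flipT n t) (n - 1 - a) = n - bo n t a := by
  obtain ⟨h1, h0, h2, h3⟩ := hT.bo_spec ha
  apply lf_eq
  · omega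
  · intro m hm1 hm2
    rw [flipT_flip ha]
    exact h2 (n - 1 - m) (by omega) (by omega)
  · intro h
    rw [flipT_flip ha]
    unfold flipT
    rw [show n - 1 - (n - bo n t a - 1) = bo n t a by omega]
    exact (h3 (by omega)).le

theorem TimeInj.tp_flip {a : ℕ} (ha : a < n) : tp (flipT n t) (n - 1 - a) = n - rt n t a := by
  obtain ⟨h1, h0, h2, h3⟩ := hT.rt_spec ha
  apply tp_eq
  · omega
  · intro m hm1 hm2
    rw [flipT_flip ha]
    exact h2 (n - 1 - m) (by omega) (by omega)
  · intro h
    rw [flipT_flip ha]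
    unfold flipT
    rw [show n - 1 - (n - rt n t a - 1) = rt n t a by omega]
    exact (h3 (by omega)).le

theorem TimeInj.bo_flip {a : ℕ} (ha : a < n) : bo n (flipT n t) (n - 1 - a) = n - lf t a := by
  obtain ⟨h1, h2, h3⟩ := hT.lf_spec ha
  apply bo_eq
  · omega
  · omega
  · intro m hm1 hm2
    rw [flipT_flip ha]
    exact h2 (n - 1 - m) (by omega) (by omega)
  · intro h
    rw [flipT_flip ha]
    unfold flipT
    rw [show n - 1 - (n - lf t a) = lf t a - 1 by omega]
    exact (h3 (by omega)).le

theorem TimeInj.rt_flip {a : ℕ} (ha : a < n) : rt n (flipT n t) (n - 1 - a) = n - tp t a := by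
  obtain ⟨h1, h2, h3⟩ := hT.tp_spec ha
  apply rt_eq
  · omega
  · omega
  · intro m hm1 hm2
    rw [flipT_flip ha]
    exact h2 (n - 1 - m) (by omega) (by omega)
  · intro h
    rw [flipT_flip ha]
    unfold flipT
    rw [show n - 1 - (n - tp t a) = tp t a - 1 by omega]
    exact (h3 (by omega)).le

end ids

/-- Two time functions induce the same indices of lines. -/
def SameIds (n : ℕ) (t t' : ℕ → ℕ) : Prop :=
  ∀ a, a < n → lf t a = lf t' a ∧ rt n t a = rt n t' a ∧ tp t a = tp t' a ∧ bo n t a = bo n t' a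

theorem SameIds.flip {n : ℕ} {t t' : ℕ → ℕ} (hT : TimeInj n t) (hT' : TimeInj n t')
    (h : SameIds n t t') : SameIds n (flipT n t) (flipT n t') := by
  intro a ha
  obtain ⟨b, hb, rfl⟩ : ∃ b, b < n ∧ a = n - 1 - b := ⟨n - 1 - a, by omega, by omega⟩
  obtain ⟨h1, h2, h3, h4⟩ := h b hb
  rw [hT.lf_flip hb, hT.rt_flip hb, hT.tp_flip hb, hT.bo_flip hb,
    hT'.lf_flip hb, hT'.rt_flip hb, hT'.tp_flip hb, hT'.bo_flip hb, h1, h2, h3, h4]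
  exact ⟨rfl, rfl, rfl, rfl⟩

/-- The ids are determined by the relations "on the same wall". -/
theorem sameIds_of_iff {n : ℕ} {t t' : ℕ → ℕ} (hT : TimeInj n t) (hT' : TimeInj n t')
    (hV : ∀ i j, i < n → j < n → (rt n t i = lf t j ↔ rt n t' i = lf t' j))
    (hH : ∀ i j, i < n → j < n → (tp t i = bo n t j ↔ tp t' i = bo n t' j)) :
    SameIds n t t' := by
  -- If `lf t' a` is positive, then under `t'` the right edge of the label `lf t' a - 1` lies on the
  -- line `lf t' a`. By `hV` it lies on the line `lf t a` under `t`, and an `rt` always exceeds its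
  -- label, so `lf t' a ≤ lf t a`. The bound for `rt` is the mirror image; exchanging `t` and `t'`
  -- turns both into equalities.
  have key : ∀ {t t' : ℕ → ℕ}, TimeInj n t → TimeInj n t' →
      (∀ i j, i < n → j < n → (rt n t i = lf t j ↔ rt n t' i = lf t' j)) →
      ∀ a, a < n → lf t' a ≤ lf t a ∧ rt n t a ≤ rt n t' a := by
    intro t t' hT hT' hV a ha
    have h1 := hT.lf_spec ha
    have h1' := hT'.lf_spec ha
    have h2 := hT.rt_spec ha
    have h2' := hT'.rt_spec ha
    constructor
    · by_contra hlt
      push Not at hlt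
      have hv : rt n t' (lf t' a - 1) = lf t' a := by
        apply rt_eq
        · omega
        · omega
        · intro m h3 h4; omega
        · intro h
          have h5 := h1'.2.2 (by omega)
          by_cases h6 : lf t' a = a
          · rw [h6] at h5 ⊢; exact h5.le
          · have := h1'.2.1 (lf t' a) le_rfl (by omega); omega
      have h3 := (hV (lf t' a - 1) a (by omega) ha).2 hv
      have h4 := hT.rt_spec (a := lf t' a - 1) (by omega)
      omega
    · by_contra hlt
      push Not at hlt
      have hv : lf t' (rt n t' a) = rt n t' a := by
        apply lf_eq le_rfl
        · intro m h3 h4; omega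
        · intro h
          have h5 := h2'.2.2.2 (by omega)
          by_cases h6 : rt n t' a - 1 = a
          · rw [h6]; exact h5.le
          · have := h2'.2.2.1 (rt n t' a - 1) (by omega) (by omega); omega
      have h3 := (hV a (rt n t' a) ha (by omega)).2 hv.symm
      have h4 := hT.lf_spec (a := rt n t' a) (by omega)
      omega
  have hV' := fun i j hi hj => (hV i j hi hj).symm
  have hF : ∀ {t t' : ℕ → ℕ}, TimeInj n t → TimeInj n t' →
      (∀ i j, i < n → j < n → (tp t i = bo n t j ↔ tp t' i = bo n t' j)) →
      ∀ i j, i < n → j < n → (rt n (flipT n t) i = lf (flipT n t) j ↔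
        rt n (flipT n t') i = lf (flipT n t') j) := by
    intro t t' hT hT' hH i j hi hj
    obtain ⟨b, hb, rfl⟩ : ∃ b, b < n ∧ i = n - 1 - b := ⟨n - 1 - i, by omega, by omega⟩
    obtain ⟨c, hc, rfl⟩ : ∃ b, b < n ∧ j = n - 1 - b := ⟨n - 1 - j, by omega, by omega⟩
    have := hH b c hb hc
    rw [hT.lf_flip hc, hT.rt_flip hb, hT'.lf_flip hc, hT'.rt_flip hb]
    have e1 := (hT.tp_spec hb).1
    have e2 := (hT'.tp_spec hb).1
    have e3 := (hT.bo_spec hc).2.1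
    have e4 := (hT'.bo_spec hc).2.1
    constructor <;> intro h
    · have := this.1 (by omega); omega
    · have := this.2 (by omega); omega
  intro a ha
  have k1 := key hT hT' hV a ha
  have k2 := key hT' hT hV' a ha
  have k3 := key hT.flip hT'.flip (hF hT hT' hH) (n - 1 - a) (by omega)
  have k4 := key hT'.flip hT.flip (fun i j hi hj => (hF hT hT' hH i j hi hj).symm)
    (n - 1 - a) (by omega)
  rw [hT.lf_flip ha, hT.rt_flip ha, hT'.lf_flip ha, hT'.rt_flip ha] at k3 k4
  have e1 := (hT.tp_spec ha).1
  have e2 := (hT'.tp_spec ha).1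
  have e3 := (hT.bo_spec ha).2.1
  have e4 := (hT'.bo_spec ha).2.1
  exact ⟨by omega, by omega, by omega, by omega⟩

end Rectangulation

namespace Rectangulation

/-! ### Rectangulations built from a time function and coordinates of lines -/

/-- The rectangle with label `a` whose edges lie on the lines given by the ids of `a`. -/
noncomputable def lineRect (n : ℕ) (t : ℕ → ℕ) (X Y : ℕ → ℝ) (a : ℕ) : Rect :=
  ⟨X (lf t a), X (rt n t a), Y (bo n t a), Y (tp t a)⟩

/-- The rectangles `lineRect n t X Y a` are nondegenerate, and of two of them the one with the
smaller label lies to the left if it comes first in time, and above if it comes last. -/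
structure Build (n : ℕ) (t : ℕ → ℕ) (X Y : ℕ → ℝ) : Prop where
  inj : TimeInj n t
  ndx : ∀ a, a < n → X (lf t a) < X (rt n t a)
  ndy : ∀ a, a < n → Y (bo n t a) < Y (tp t a)
  cx : ∀ i j, i < j → j < n → t i < t j → X (rt n t i) ≤ X (lf t j)
  cy : ∀ i j, i < j → j < n → t j < t i → Y (tp t j) ≤ Y (bo n t i)

/-- Along the vertical wall with id `v`, labels increase downwards on either side. The lowest tile
on the left is `v - 1` and the highest on the right is `v`; this lemma and `TimeInj.lf_rt` find
these two tiles. They are the ones that a wall shuffle omits. -/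
theorem TimeInj.rt_pred_lf {n : ℕ} {t : ℕ → ℕ} (hT : TimeInj n t) {a : ℕ} (ha : a < n)
    (h0 : 0 < lf t a) : rt n t (lf t a - 1) = lf t a := by
  obtain ⟨h1, h2, h3⟩ := hT.lf_spec ha
  apply rt_eq
  · omega
  · omega
  · intro m h4 h5; omega
  · intro h
    have h5 := h3 h0
    by_cases h6 : lf t a = a
    · rw [h6] at h5 ⊢; exact h5.le
    · have := h2 (lf t a) le_rfl (by omega); omega

theorem TimeInj.lf_rt {n : ℕ} {t : ℕ → ℕ} (hT : TimeInj n t) {a : ℕ} (ha : a < n)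
    (h0 : rt n t a < n) : lf t (rt n t a) = rt n t a := by
  obtain ⟨h1, h2, h3, h4⟩ := hT.rt_spec ha
  apply lf_eq le_rfl
  · intro m h3 h4; omega
  · intro h
    have h5 := h4 (by omega)
    by_cases h6 : rt n t a - 1 = a
    · rw [h6]; exact h5.le
    · have := h3 (rt n t a - 1) (by omega) (by omega); omega

/-- Reversing the numbering of the lines. -/
def flipLine (n : ℕ) (X : ℕ → ℝ) : ℕ → ℝ := fun v => X (n - v)

theorem flipLine_sub {n v : ℕ} (X : ℕ → ℝ) (h : v ≤ n) : flipLine n X (n - v) = X v := by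
  unfold flipLine; congr 1; omega

/-- Transposition: labels are reversed, and the roles of the coordinates are exchanged. -/
theorem lineRect_flip {n : ℕ} {t : ℕ → ℕ} (hT : TimeInj n t) (X Y : ℕ → ℝ) {a : ℕ} (ha : a < n) :
    lineRect n (flipT n t) (flipLine n Y) (flipLine n X) (n - 1 - a) =
      ⟨Y (bo n t a), Y (tp t a), X (lf t a), X (rt n t a)⟩ := by
  have h1 := hT.lf_spec ha
  have h2 := hT.tp_spec ha
  have h3 := hT.rt_spec ha
  have h4 := hT.bo_spec ha
  unfold lineRect
  rw [hT.lf_flip ha, hT.rt_flip ha, hT.tp_flip ha, hT.bo_flip ha,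
    flipLine_sub _ (by omega), flipLine_sub _ (by omega), flipLine_sub _ (by omega),
    flipLine_sub _ (by omega)]

theorem Build.flip {n : ℕ} {t : ℕ → ℕ} {X Y : ℕ → ℝ} (h : Build n t X Y) :
    Build n (flipT n t) (flipLine n Y) (flipLine n X) := by
  have hT := h.inj
  have key : ∀ a, a < n → flipLine n Y (lf (flipT n t) (n - 1 - a)) = Y (bo n t a) ∧
      flipLine n Y (rt n (flipT n t) (n - 1 - a)) = Y (tp t a) ∧
      flipLine n X (bo n (flipT n t) (n - 1 - a)) = X (lf t a) ∧
      flipLine n X (tp (flipT n t) (n - 1 - a)) = X (rt n t a) := by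
    intro a ha
    have := lineRect_flip hT X Y ha
    unfold lineRect at this
    simp only [Rect.mk.injEq] at this
    exact this
  have rep : ∀ a, a < n → ∃ b, b < n ∧ a = n - 1 - b := fun a ha =>
    ⟨n - 1 - a, by omega, by omega⟩
  refine ⟨hT.flip, ?_, ?_, ?_, ?_⟩
  · intro a ha
    obtain ⟨b, hb, rfl⟩ := rep a ha
    rw [(key b hb).1, (key b hb).2.1]; exact h.ndy b hb
  · intro a ha
    obtain ⟨b, hb, rfl⟩ := rep a ha
    rw [(key b hb).2.2.1, (key b hb).2.2.2]; exact h.ndx b hb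
  · intro i j hij hj htt
    obtain ⟨b, hb, rfl⟩ := rep i (by omega)
    obtain ⟨c, hc, rfl⟩ := rep j hj
    rw [flipT_flip hb, flipT_flip hc] at htt
    rw [(key b hb).2.1, (key c hc).1]
    exact h.cy c b (by omega) hb htt
  · intro i j hij hj htt
    obtain ⟨b, hb, rfl⟩ := rep i (by omega)
    obtain ⟨c, hc, rfl⟩ := rep j hj
    rw [flipT_flip hb, flipT_flip hc] at htt
    rw [(key b hb).2.2.1, (key c hc).2.2.2]
    exact h.cx c b (by omega) hb htt

section build
variable {n : ℕ} {t : ℕ → ℕ} {X Y : ℕ → ℝ} (h : Build n t X Y)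
include h

theorem Build.lf_ge {a : ℕ} (ha : a < n) : X 0 ≤ X (lf t a) := by
  induction a using Nat.strong_induction_on with
  | _ a ih =>
    rcases Nat.eq_zero_or_pos (lf t a) with h0 | h0
    · rw [h0]
    · have h1 := h.inj.lf_spec ha
      have h2 := h.ndx (lf t a - 1) (by omega)
      rw [h.inj.rt_pred_lf ha h0] at h2
      exact (ih (lf t a - 1) (by omega) (by omega)).trans h2.le

theorem Build.rt_le {a : ℕ} (ha : a < n) : X (rt n t a) ≤ X n := by
  induction hk : n - a using Nat.strong_induction_on generalizing a with
  | _ k ih =>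
    obtain ⟨h1, h2, -, -⟩ := h.inj.rt_spec ha
    rcases Nat.lt_or_ge (rt n t a) n with h0 | h0
    · have h3 := h.ndx (rt n t a) h0
      rw [h.inj.lf_rt ha h0] at h3
      exact h3.le.trans (ih (n - rt n t a) (by omega) h0 rfl)
    · rw [le_antisymm h2 h0]

theorem Build.bo_ge {a : ℕ} (ha : a < n) : Y n ≤ Y (bo n t a) := by
  have := h.flip.lf_ge (a := n - 1 - a) (by omega)
  have h4 := h.inj.bo_spec ha
  rw [h.inj.lf_flip ha, flipLine_sub _ (by omega)] at this
  simpa [flipLine] using this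

theorem Build.tp_le {a : ℕ} (ha : a < n) : Y (tp t a) ≤ Y 0 := by
  have := h.flip.rt_le (a := n - 1 - a) (by omega)
  have h4 := h.inj.tp_spec ha
  rw [h.inj.rt_flip ha, flipLine_sub _ (by omega)] at this
  simpa [flipLine] using this

end build

/-- The staircase region covered at time `k`. -/
def staircase (n : ℕ) (t : ℕ → ℕ) (X Y : ℕ → ℝ) (k : ℕ) : Set (ℝ × ℝ) :=
  {p | (X 0 ≤ p.1 ∧ p.1 ≤ X n) ∧ (Y n ≤ p.2 ∧ p.2 ≤ Y 0) ∧ ∀ g, g < n → k ≤ t g →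
    p.1 ≤ X (runStart (fun m => k ≤ t m) g) ∨ p.2 ≤ Y (runEnd n (fun m => k ≤ t m) (g + 1))}

theorem TimeInj.runStart_self {n : ℕ} {t : ℕ → ℕ} (hT : TimeInj n t) {a : ℕ} (ha : a < n) :
    runStart (fun m => t a ≤ t m) a = lf t a := by
  obtain ⟨h1, h2, h3⟩ := hT.lf_spec ha
  exact runStart_eq h1 (fun m h4 h5 => (h2 m h4 h5).le) fun h => not_le.2 (h3 h)

theorem TimeInj.runEnd_self {n : ℕ} {t : ℕ → ℕ} (hT : TimeInj n t) {a : ℕ} (ha : a < n) :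
    runEnd n (fun m => t a ≤ t m) (a + 1) = bo n t a := by
  obtain ⟨h1, h0, h2, h3⟩ := hT.bo_spec ha
  exact runEnd_eq h1 h0 (fun m h4 h5 => (h2 m h4 h5).le) fun h => not_le.2 (h3 h)

/-- The maximal runs of undrawn labels are the gaps of the staircase: a gap with run `[lo, hi)`
removes the open quadrant to the right of line `lo` and above line `hi`. Drawing `a` changes only
the gap that contains `a`. A point freed by this lies in the tile `a`, since beyond the right or the
top edge of `a` it would still belong to the quadrant of a remaining gap. -/
theorem Build.staircase_succ_subset {n : ℕ} {t : ℕ → ℕ} {X Y : ℕ → ℝ} (h : Build n t X Y)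
    {a : ℕ} (ha : a < n) {p : ℝ × ℝ} (hp : p ∈ staircase n t X Y (t a + 1))
    (hp' : p ∉ staircase n t X Y (t a)) : p ∈ (lineRect n t X Y a).toSet := by
  have hT := h.inj
  obtain ⟨hx, hy, hst⟩ := hp
  have : ∃ g, g < n ∧ t a ≤ t g ∧ X (runStart (fun m => t a ≤ t m) g) < p.1 ∧
      Y (runEnd n (fun m => t a ≤ t m) (g + 1)) < p.2 := by
    by_contra hcon
    push Not at hcon
    refine hp' ⟨hx, hy, fun g hg hk => ?_⟩
    by_cases h1 : p.1 ≤ X (runStart (fun m => t a ≤ t m) g)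
    · exact Or.inl h1
    · exact Or.inr (hcon g hg hk (not_le.1 h1))
  obtain ⟨g, hg, htg, hgx, hgy⟩ := this
  obtain ⟨s1, s2, s3⟩ := runStart_spec (fun m => t a ≤ t m) g
  obtain ⟨e1, e0, e2, e3⟩ := runEnd_spec n (fun m => t a ≤ t m) (g + 1) hg
  obtain ⟨l1, l2, l3⟩ := hT.lf_spec ha
  obtain ⟨b1, b0, b2, b3⟩ := hT.bo_spec ha
  obtain ⟨r1, r0, r2, r3⟩ := hT.rt_spec ha
  obtain ⟨u1, u2, u3⟩ := hT.tp_spec ha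
  have hne : ∀ m, m < n → t m = t a → m = a := fun m hm e => hT m a hm ha e
  by_cases hin : runStart (fun m => t a ≤ t m) g ≤ a ∧ a < runEnd n (fun m => t a ≤ t m) (g + 1)
  · obtain ⟨hin1, hin2⟩ := hin
    have hall : ∀ m, runStart (fun m => t a ≤ t m) g ≤ m →
        m < runEnd n (fun m => t a ≤ t m) (g + 1) → t a ≤ t m := by
      intro m h4 h5
      rcases lt_trichotomy m g with h6 | h6 | h6
      · exact s2 m h4 h6
      · rw [h6]; exact htg
      · exact e2 m h6 h5
    have hlo : runStart (fun m => t a ≤ t m) g = lf t a := by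
      rw [← hT.runStart_self ha]
      exact (runStart_eq hin1 (fun m h4 h5 => hall m h4 (by omega)) s3).symm
    have hhi : runEnd n (fun m => t a ≤ t m) (g + 1) = bo n t a := by
      rw [← hT.runEnd_self ha]
      exact (runEnd_eq hin2 e0 (fun m h4 h5 => hall m (by omega) h5) e3).symm
    rw [hlo] at hgx
    rw [hhi] at hgy
    refine ⟨⟨hgx.le, ?_⟩, hgy.le, ?_⟩
    · change p.1 ≤ X (rt n t a)
      rcases Nat.lt_or_ge (rt n t a) n with hr | hr
      · have hlt := r3 hr
        have hs : runStart (fun m => t a + 1 ≤ t m) (rt n t a) = rt n t a := by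
          apply runStart_eq le_rfl (fun m h4 h5 => by omega)
          intro _
          by_cases h6 : rt n t a - 1 = a
          · rw [h6]; omega
          · have := r2 (rt n t a - 1) (by omega) (by omega); omega
        rcases hst (rt n t a) hr hlt with h4 | h4
        · rwa [hs] at h4
        -- The gap that begins at line `rt n t a` ends at a line `e` which is either the bottom of
        -- the outer rectangle or the top of a tile drawn before `a`. In both cases it is not higher
        -- than the bottom of `a`.
        · exfalso
          obtain ⟨q1, q0, q2, q3⟩ := runEnd_spec n (fun m => t a + 1 ≤ t m) (rt n t a + 1) hr
          set e := runEnd n (fun m => t a + 1 ≤ t m) (rt n t a + 1)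
          rcases Nat.lt_or_ge e n with hen | hen
          · have hte := q3 hen
            have h5 : t e < t a := by
              have := hne e hen; omega
            have h6 := h.cy a e (by omega) hen h5
            have h7 : tp t e = e := by
              apply tp_eq le_rfl (fun m h4 h5 => by omega)
              intro _
              by_cases h8 : e - 1 = rt n t a
              · rw [h8]; omega
              · have := q2 (e - 1) (by omega) (by omega); omega
            rw [h7] at h6
            linarith
          · rw [le_antisymm q0 hen] at h4
            have := h.bo_ge ha
            linarith
      · rw [le_antisymm r0 hr]; exact hx.2
    · change p.2 ≤ Y (tp t a)
      rcases Nat.eq_zero_or_pos (tp t a) with hf | hf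
      · rw [hf]; exact hy.2
      · have hlt := u3 hf
        have hs : runEnd n (fun m => t a + 1 ≤ t m) (tp t a - 1 + 1) = tp t a := by
          rw [show tp t a - 1 + 1 = tp t a by omega]
          apply runEnd_eq le_rfl (by omega) (fun m h4 h5 => by omega)
          intro _
          by_cases h6 : tp t a = a
          · rw [h6]; omega
          · have := u2 (tp t a) le_rfl (by omega); omega
        rcases hst (tp t a - 1) (by omega) hlt with h4 | h4
        · exfalso
          obtain ⟨q1, q2, q3⟩ := runStart_spec (fun m => t a + 1 ≤ t m) (tp t a - 1)
          set e := runStart (fun m => t a + 1 ≤ t m) (tp t a - 1)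
          rcases Nat.eq_zero_or_pos e with he | he
          · rw [he] at h4
            have := h.lf_ge ha
            linarith
          · have hte := q3 he
            have h5 : t (e - 1) < t a := by
              have := hne (e - 1) (by omega); omega
            have h6 := h.cx (e - 1) a (by omega) ha h5
            have h7 : rt n t (e - 1) = e := by
              apply rt_eq (by omega) (by omega) (fun m h4 h5 => by omega)
              intro _
              by_cases h8 : e = tp t a - 1
              · rw [h8] at h5 ⊢; omega
              · have := q2 e le_rfl (by omega); omega
            rw [h7] at h6
            linarith
        · rwa [hs] at h4
  -- The gap of `g` does not contain `a`, so it is the same at time `t a + 1`.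
  · exfalso
    have hga : g ≠ a := by
      rintro rfl
      exact hin ⟨s1, by omega⟩
    have h1 : runStart (fun m => t a + 1 ≤ t m) g = runStart (fun m => t a ≤ t m) g := by
      apply runStart_eq s1
      · intro m h4 h5
        have h6 := s2 m h4 h5
        have := hne m (by omega)
        have : m ≠ a := by rintro rfl; exact hin ⟨h4, by omega⟩
        omega
      · intro h4
        have := s3 h4
        omega
    have h2 : runEnd n (fun m => t a + 1 ≤ t m) (g + 1) =
        runEnd n (fun m => t a ≤ t m) (g + 1) := by
      apply runEnd_eq e1 e0
      · intro m h4 h5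
        have h6 := e2 m h4 h5
        have := hne m (by omega)
        have : m ≠ a := by rintro rfl; exact hin ⟨by omega, h5⟩
        omega
      · intro h4
        have := e3 h4
        omega
    have h3 : t a + 1 ≤ t g := by
      have := hne g hg; omega
    rcases hst g hg h3 with h4 | h4
    · rw [h1] at h4; linarith
    · rw [h2] at h4; linarith

/-- At time 0 the staircase is contained in the left and bottom edges, which the half-open intervals
exclude; after the last time there is no gap left. So some step adds the point, and the tile of that
step contains it. -/
theorem Build.exists_tile_of_Ioc {n : ℕ} {t : ℕ → ℕ} {X Y : ℕ → ℝ} (h : Build n t X Y)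
    (hn : 1 ≤ n) {p : ℝ × ℝ}
    (hx : p.1 ∈ Set.Ioc (X 0) (X n)) (hy : p.2 ∈ Set.Ioc (Y n) (Y 0)) :
    ∃ a, a < n ∧ p ∈ (lineRect n t X Y a).toSet := by
  by_contra hcon
  push Not at hcon
  have hall : ∀ k, p ∉ staircase n t X Y k := by
    intro k
    induction k with
    | zero =>
      rintro ⟨-, -, h3⟩
      rcases h3 0 hn (Nat.zero_le _) with h4 | h4
      · rw [runStart_eq (f := 0) le_rfl (fun m _ h => by omega) (fun h => by omega)] at h4
        exact absurd hx.1 (not_lt.2 h4)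
      · rw [runEnd_eq (l := n) hn le_rfl (fun m _ _ => Nat.zero_le _) (fun h => by omega)] at h4
        exact absurd hy.1 (not_lt.2 h4)
    | succ k ih =>
      intro hp
      by_cases hk : ∃ a, a < n ∧ t a = k
      · obtain ⟨a, ha, rfl⟩ := hk
        exact hcon a ha (h.staircase_succ_subset ha hp ih)
      · have hP : ∀ m, m < n → (k + 1 ≤ t m ↔ k ≤ t m) := by
          intro m hm
          have : t m ≠ k := fun e => hk ⟨m, hm, e⟩
          omega
        refine ih ⟨hp.1, hp.2.1, fun g hg hkg => ?_⟩
        obtain ⟨s1, s2, s3⟩ := runStart_spec (fun m => k ≤ t m) g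
        obtain ⟨e1, e0, e2, e3⟩ := runEnd_spec n (fun m => k ≤ t m) (g + 1) hg
        have h1 : runStart (fun m => k + 1 ≤ t m) g = runStart (fun m => k ≤ t m) g :=
          runStart_eq s1 (fun m h4 h5 => (hP m (by omega)).2 (s2 m h4 h5))
            (fun h4 h5 => s3 h4 ((hP _ (by omega)).1 h5))
        have h2 : runEnd n (fun m => k + 1 ≤ t m) (g + 1) =
            runEnd n (fun m => k ≤ t m) (g + 1) :=
          runEnd_eq e1 e0 (fun m h4 h5 => (hP m (by omega)).2 (e2 m h4 h5))
            (fun h4 h5 => e3 h4 ((hP _ (by omega)).1 h5))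
        have := hp.2.2 g hg ((hP g hg).2 hkg)
        rwa [h1, h2] at this
  obtain ⟨N, hN⟩ : ∃ N, ∀ g, g < n → t g < N :=
    ⟨(Finset.range n).sup t + 1, fun g hg =>
      Nat.lt_succ_of_le (Finset.le_sup (f := t) (Finset.mem_range.2 hg))⟩
  refine hall N ⟨⟨hx.1.le, hx.2⟩, ⟨hy.1.le, hy.2⟩, fun g hg hk => ?_⟩
  have := hN g hg
  omega

/-- The tiling given by a build. -/
noncomputable def Build.tiling {n : ℕ} {t : ℕ → ℕ} {X Y : ℕ → ℝ} (h : Build n t X Y)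
    (hn : 1 ≤ n) : Tiling n where
  outer := ⟨X 0, X n, Y n, Y 0⟩
  tile i := lineRect n t X Y i
  outer_nondeg := ⟨(h.lf_ge hn).trans_lt ((h.ndx 0 hn).trans_le (h.rt_le hn)),
    (h.bo_ge hn).trans_lt ((h.ndy 0 hn).trans_le (h.tp_le hn))⟩
  tile_nondeg i := ⟨h.ndx i i.2, h.ndy i i.2⟩
  disjoint := by
    have key : ∀ i j : Fin n, i < j →
        Disjoint (lineRect n t X Y i).inner (lineRect n t X Y j).inner := by
      intro i j hij
      rw [Set.disjoint_left]
      rintro p ⟨⟨h1, h2⟩, h3, h4⟩ ⟨⟨h5, h6⟩, h7, h8⟩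
      change X (lf t i) < p.1 at h1
      change p.1 < X (rt n t i) at h2
      change Y (bo n t i) < p.2 at h3
      change p.2 < Y (tp t i) at h4
      change X (lf t j) < p.1 at h5
      change p.1 < X (rt n t j) at h6
      change Y (bo n t j) < p.2 at h7
      change p.2 < Y (tp t j) at h8
      rcases lt_trichotomy (t i) (t j) with h9 | h9 | h9
      · have := h.cx i j hij j.2 h9; linarith
      · exact absurd (h.inj i j i.2 j.2 h9) (by have : (i : ℕ) < j := hij; omega)
      · have := h.cy i j hij j.2 h9; linarith
    intro i j hij
    rcases lt_or_gt_of_ne hij with h1 | h1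
    · exact key i j h1
    · exact (key j i h1).symm
  cover := by
    apply Set.Subset.antisymm
    · refine Set.iUnion_subset fun i => ?_
      rintro p ⟨⟨h1, h2⟩, h3, h4⟩
      exact ⟨⟨(h.lf_ge i.2).trans h1, h2.trans (h.rt_le i.2)⟩,
        (h.bo_ge i.2).trans h3, h4.trans (h.tp_le i.2)⟩
    -- The left and bottom edges are not covered by `exists_tile_of_Ioc`; they are recovered by
    -- taking closures.
    · have hclosed : IsClosed (⋃ i : Fin n, (lineRect n t X Y i).toSet) :=
        isClosed_iUnion_of_finite fun i => isClosed_Icc.prod isClosed_Icc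
      have hx : X 0 < X n := (h.lf_ge hn).trans_lt ((h.ndx 0 hn).trans_le (h.rt_le hn))
      have hy : Y n < Y 0 := (h.bo_ge hn).trans_lt ((h.ndy 0 hn).trans_le (h.tp_le hn))
      have hsub : Set.Ioc (X 0) (X n) ×ˢ Set.Ioc (Y n) (Y 0) ⊆
          ⋃ i : Fin n, (lineRect n t X Y i).toSet := by
        rintro p ⟨h1, h2⟩
        obtain ⟨a, ha, hp⟩ := h.exists_tile_of_Ioc hn h1 h2
        exact Set.mem_iUnion.2 ⟨⟨a, ha⟩, hp⟩
      have := closure_minimal hsub hclosed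
      rwa [closure_prod_eq, closure_Ioc hx.ne, closure_Ioc hy.ne] at this

end Rectangulation

namespace Rectangulation

/-! ### The map `ρ` in terms of time functions -/

/-- The position of a label in the word of a permutation. -/
def timeOf {n : ℕ} (x : Equiv.Perm (Fin n)) (m : ℕ) : ℕ :=
  if h : m < n then (x.symm ⟨m, h⟩ : ℕ) else m

theorem timeOf_fin {n : ℕ} (x : Equiv.Perm (Fin n)) (a : Fin n) : timeOf x a = x.symm a := by
  simp [timeOf]

theorem timeOf_lt {n : ℕ} (x : Equiv.Perm (Fin n)) {m : ℕ} (h : m < n) : timeOf x m < n := by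
  simp [timeOf, h]

theorem timeOf_inj {n : ℕ} (x : Equiv.Perm (Fin n)) : TimeInj n (timeOf x) := by
  intro i j hi hj h
  simp only [timeOf, hi, hj, dif_pos] at h
  have := x.symm.injective (Fin.ext h)
  simpa using this

/-- The vertical lines of `ρ`. -/
noncomputable def stdX (v : ℕ) : ℝ := v

/-- The horizontal lines of `ρ`. -/
noncomputable def stdY (n : ℕ) (v : ℕ) : ℝ := (n : ℝ) - v

/-- The label `lf t j` has time at least `t j`, which is later than `i`, so it cannot belong to the
run of labels after `i` that are earlier than `i`. -/
theorem TimeInj.rt_le_lf {n : ℕ} {t : ℕ → ℕ} (hT : TimeInj n t) {i j : ℕ} (hij : i < j)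
    (hj : j < n) (htt : t i < t j) : rt n t i ≤ lf t j := by
  obtain ⟨r1, r0, r2, r3⟩ := hT.rt_spec (a := i) (by omega)
  obtain ⟨l1, l2, l3⟩ := hT.lf_spec hj
  by_contra hcon
  push Not at hcon
  have h1 : i < lf t j := by
    by_contra h2
    have := l2 i (by omega) hij
    omega
  have h2 := r2 _ h1 hcon
  by_cases h3 : lf t j = j
  · rw [h3] at h2; omega
  · have := l2 _ le_rfl (by omega)
    omega

theorem TimeInj.bo_le_tp {n : ℕ} {t : ℕ → ℕ} (hT : TimeInj n t) {i j : ℕ} (hij : i < j)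
    (hj : j < n) (htt : t j < t i) : bo n t i ≤ tp t j := by
  obtain ⟨r1, r0, r2, r3⟩ := hT.bo_spec (a := i) (by omega)
  obtain ⟨l1, l2, l3⟩ := hT.tp_spec hj
  by_contra hcon
  push Not at hcon
  have h1 : i < tp t j := by
    by_contra h2
    have := l2 i (by omega) hij
    omega
  have h2 := r2 _ h1 hcon
  by_cases h3 : tp t j = j
  · rw [h3] at h2; omega
  · have := l2 _ le_rfl (by omega)
    omega

theorem TimeInj.stdBuild {n : ℕ} {t : ℕ → ℕ} (hT : TimeInj n t) : Build n t stdX (stdY n) where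
  inj := hT
  ndx a ha := by
    have h1 := (hT.lf_spec ha).1
    have h2 := (hT.rt_spec ha).1
    exact Nat.cast_lt.2 (by omega)
  ndy a ha := by
    have h1 := (hT.tp_spec ha).1
    have h2 := (hT.bo_spec ha).1
    exact sub_lt_sub_left (Nat.cast_lt.2 (by omega)) _
  cx i j hij hj htt := Nat.cast_le.2 (hT.rt_le_lf hij hj htt)
  cy i j hij hj htt := sub_le_sub_left (Nat.cast_le.2 (hT.bo_le_tp hij hj htt)) _

/-! ### The drawing rule of `ρ` produces the standard lines. -/

section std
variable {n : ℕ} {t : ℕ → ℕ} (hT : TimeInj n t)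
include hT

/-- A gap that remains after `a` has been drawn lies on one side of `a`. It cannot reach into the
runs `[tp t a, a]` or `[a, rt n t a)`, whose labels are already drawn, so its quadrant is above the
top or to the right of the right edge of `a`. -/
theorem TimeInj.lineRect_subset_staircase {a : ℕ} (ha : a < n) :
    (lineRect n t stdX (stdY n) a).toSet ⊆ staircase n t stdX (stdY n) (t a + 1) := by
  have hB := hT.stdBuild
  rintro p ⟨⟨h1, h2⟩, h3, h4⟩
  refine ⟨⟨(hB.lf_ge ha).trans h1, h2.trans (hB.rt_le ha)⟩,
    ⟨(hB.bo_ge ha).trans h3, h4.trans (hB.tp_le ha)⟩, fun g hg hk => ?_⟩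
  obtain ⟨r1, r0, r2, r3⟩ := hT.rt_spec ha
  obtain ⟨u1, u2, u3⟩ := hT.tp_spec ha
  obtain ⟨s1, s2, s3⟩ := runStart_spec (fun m => t a + 1 ≤ t m) g
  obtain ⟨e1, e0, e2, e3⟩ := runEnd_spec n (fun m => t a + 1 ≤ t m) (g + 1) hg
  rcases lt_trichotomy g a with h5 | h5 | h5
  · right
    refine h4.trans (sub_le_sub_left (Nat.cast_le.2 ?_) _)
    by_contra h6
    push Not at h6
    have h7 : g < tp t a := by
      by_contra h8
      have := u2 g (by omega) h5
      omega
    have h9 := e2 (tp t a) h7 h6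
    by_cases h10 : tp t a = a
    · rw [h10] at h9; omega
    · have := u2 (tp t a) le_rfl (by omega); omega
  · subst h5; omega
  · left
    refine h2.trans (Nat.cast_le.2 ?_)
    by_contra h6
    push Not at h6
    change _ < rt n t a at h6
    have h7 : rt n t a ≤ g := by
      by_contra h8
      have := r2 g (by omega) (by omega)
      omega
    have h9 := s2 (rt n t a - 1) (by omega) (by omega)
    by_cases h10 : rt n t a - 1 = a
    · rw [h10] at h9; omega
    · have := r2 (rt n t a - 1) (by omega) (by omega); omega

omit hT in
theorem staircase_mono_std (k : ℕ) :
    staircase n t stdX (stdY n) k ⊆ staircase n t stdX (stdY n) (k + 1) := by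
  rintro p ⟨h1, h2, h3⟩
  refine ⟨h1, h2, fun g hg hk => ?_⟩
  obtain ⟨s1, s2, s3⟩ := runStart_spec (fun m => k + 1 ≤ t m) g
  obtain ⟨e1, e0, e2, e3⟩ := runEnd_spec n (fun m => k + 1 ≤ t m) (g + 1) hg
  obtain ⟨s1', s2', s3'⟩ := runStart_spec (fun m => k ≤ t m) g
  obtain ⟨e1', e0', e2', e3'⟩ := runEnd_spec n (fun m => k ≤ t m) (g + 1) hg
  rcases h3 g hg (by omega) with h4 | h4
  · left
    refine h4.trans (Nat.cast_le.2 ?_)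
    by_contra h5
    push Not at h5
    have := s2 (runStart (fun m => k ≤ t m) g - 1) (by omega) (by omega)
    have := s3' (by omega)
    omega
  · right
    refine h4.trans (sub_le_sub_left (Nat.cast_le.2 ?_) _)
    by_contra h5
    push Not at h5
    have := e2 (runEnd n (fun m => k ≤ t m) (g + 1)) (by omega) (by omega)
    have := e3' (by omega)
    omega

theorem TimeInj.staircase_succ {a : ℕ} (ha : a < n) :
    staircase n t stdX (stdY n) (t a + 1) =
      staircase n t stdX (stdY n) (t a) ∪ (lineRect n t stdX (stdY n) a).toSet := by
  apply Set.Subset.antisymm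
  · intro p hp
    by_cases h : p ∈ staircase n t stdX (stdY n) (t a)
    · exact Or.inl h
    · exact Or.inr (hT.stdBuild.staircase_succ_subset ha hp h)
  · exact Set.union_subset (staircase_mono_std _) (hT.lineRect_subset_staircase ha)

omit hT in
theorem staircase_zero (hn : 1 ≤ n) : staircase n t stdX (stdY n) 0 =
    ({0} ×ˢ Set.Icc (0 : ℝ) n) ∪ (Set.Icc (0 : ℝ) n ×ˢ {0}) := by
  have h0 : ∀ g, runStart (fun m => 0 ≤ t m) g = 0 := fun g =>
    runStart_eq (Nat.zero_le _) (fun m _ h => Nat.zero_le _) (fun h => by omega)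
  have h1 : ∀ g, g < n → runEnd n (fun m => 0 ≤ t m) (g + 1) = n := fun g hg =>
    runEnd_eq (l := n) hg le_rfl (fun m _ _ => Nat.zero_le _) (fun h => by omega)
  have hn' : (0 : ℝ) ≤ n := Nat.cast_nonneg n
  ext ⟨u, v⟩
  simp only [staircase, stdX, stdY, Set.mem_ofPred_eq, Set.mem_union, Set.mem_prod,
    Set.mem_singleton_iff, Set.mem_Icc, Nat.cast_zero, sub_self, sub_zero]
  constructor
  · rintro ⟨h2, h3, h4⟩
    have h5 := h4 0 hn (Nat.zero_le _)
    rw [h0, h1 0 hn] at h5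
    simp only [Nat.cast_zero, sub_self] at h5
    rcases h5 with h5 | h5
    · exact Or.inl ⟨le_antisymm h5 h2.1, h3⟩
    · exact Or.inr ⟨h2, le_antisymm h5 h3.1⟩
  · rintro (⟨rfl, h⟩ | ⟨h, rfl⟩)
    · exact ⟨⟨le_rfl, hn'⟩, h, fun g hg _ => Or.inl (by rw [h0]; simp)⟩
    · exact ⟨h, ⟨le_rfl, hn'⟩, fun g hg _ => Or.inr (by rw [h1 g hg]; simp)⟩

omit hT in
/-- Membership in the staircase for points with coordinates `u`, `n - w`. -/
theorem mem_staircase_of {k u w : ℕ} (hu : u ≤ n) (hw : w ≤ n)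
    (h1 : ∀ g, g < n → k ≤ t g → u ≤ runStart (fun m => k ≤ t m) g ∨
      runEnd n (fun m => k ≤ t m) (g + 1) ≤ w) :
    ((u : ℝ), (n : ℝ) - w) ∈ staircase n t stdX (stdY n) k := by
  have hu' : (u : ℝ) ≤ n := Nat.cast_le.2 hu
  have hw' : (w : ℝ) ≤ n := Nat.cast_le.2 hw
  have hw0 : (0 : ℝ) ≤ w := Nat.cast_nonneg w
  refine ⟨⟨by simp [stdX], hu'⟩, ⟨by simp [stdY]; linarith, by simp [stdY]⟩,
    fun g hg hk => ?_⟩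
  rcases h1 g hg hk with h2 | h2
  · exact Or.inl (Nat.cast_le.2 h2)
  · exact Or.inr (sub_le_sub_left (Nat.cast_le.2 h2) _)

-- The diagonal point between `a - 1` and `a` is uncovered exactly if both labels are undrawn. When
-- `a` is about to be drawn, this depends on `a - 1` alone: if `a - 1` is drawn or `a = 0`, the
-- point is covered and `lf t a = a`; otherwise it is uncovered and `tp t a = a`. These are the two
-- cases in the rule for the top-left corner.
omit hT in
theorem diagPoint_mem {a : ℕ} (ha : a < n) (h0 : 0 < a → t (a - 1) < t a) :
    diagPoint n a ∈ staircase n t stdX (stdY n) (t a) := by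
  apply mem_staircase_of (by omega) (by omega)
  intro g hg hk
  obtain ⟨s1, s2, s3⟩ := runStart_spec (fun m => t a ≤ t m) g
  obtain ⟨e1, e0, e2, e3⟩ := runEnd_spec n (fun m => t a ≤ t m) (g + 1) hg
  rcases Nat.lt_or_ge g a with h1 | h1
  · right
    by_contra h2
    have h4 := h0 (by omega)
    by_cases h3 : g = a - 1
    · rw [h3] at hk; omega
    · have := e2 (a - 1) (by omega) (by omega); omega
  · left
    by_contra h2
    have h4 := h0 (by omega)
    have := s2 (a - 1) (by omega) (by omega); omega

omit hT in
theorem diagPoint_notMem {a : ℕ} (ha : a < n) (h0 : 0 < a) (h1 : t a < t (a - 1)) :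
    diagPoint n a ∉ staircase n t stdX (stdY n) (t a) := by
  rintro ⟨-, -, h3⟩
  obtain ⟨s1, s2, s3⟩ := runStart_spec (fun m => t a ≤ t m) (a - 1)
  obtain ⟨e1, e0, e2, e3⟩ := runEnd_spec n (fun m => t a ≤ t m) (a - 1 + 1) (by omega)
  rcases h3 (a - 1) (by omega) h1.le with h4 | h4
  · have : a ≤ runStart (fun m => t a ≤ t m) (a - 1) := Nat.cast_le.1 h4
    omega
  · have h5 : (n : ℝ) - a ≤ (n : ℝ) - runEnd n (fun m => t a ≤ t m) (a - 1 + 1) := h4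
    have h6 : (runEnd n (fun m => t a ≤ t m) (a - 1 + 1) : ℝ) ≤ a := by linarith
    have h7 := Nat.cast_le.1 h6
    have := e3 (by omega)
    rw [show runEnd n (fun m => t a ≤ t m) (a - 1 + 1) = a by omega] at this
    omega

omit hT in
theorem diagPoint_succ_mem {a : ℕ} (ha : a < n) (h0 : a + 1 < n → t (a + 1) < t a) :
    diagPoint n (a + 1) ∈ staircase n t stdX (stdY n) (t a) := by
  apply mem_staircase_of (by omega) (by omega)
  intro g hg hk
  obtain ⟨s1, s2, s3⟩ := runStart_spec (fun m => t a ≤ t m) g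
  obtain ⟨e1, e0, e2, e3⟩ := runEnd_spec n (fun m => t a ≤ t m) (g + 1) hg
  rcases Nat.lt_or_ge a g with h1 | h1
  · left
    by_contra h2
    have h4 := h0 (by omega)
    by_cases h3 : g = a + 1
    · rw [h3] at hk; omega
    · have := s2 (a + 1) (by omega) (by omega); omega
  · right
    by_contra h2
    have h4 := h0 (by omega)
    have := e2 (a + 1) (by omega) (by omega); omega

omit hT in
theorem diagPoint_succ_notMem {a : ℕ} (h0 : a + 1 < n)
    (h1 : t a < t (a + 1)) : diagPoint n (a + 1) ∉ staircase n t stdX (stdY n) (t a) := by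
  rintro ⟨-, -, h3⟩
  obtain ⟨s1, s2, s3⟩ := runStart_spec (fun m => t a ≤ t m) (a + 1)
  obtain ⟨e1, e0, e2, e3⟩ := runEnd_spec n (fun m => t a ≤ t m) (a + 1 + 1) (by omega)
  rcases h3 (a + 1) (by omega) h1.le with h4 | h4
  · have : a + 1 ≤ runStart (fun m => t a ≤ t m) (a + 1) := Nat.cast_le.1 h4
    have := s3 (by omega)
    rw [show runStart (fun m => t a ≤ t m) (a + 1) = a + 1 by omega] at this
    simp at this
  · have h5 : (n : ℝ) - (a + 1 : ℕ) ≤ (n : ℝ) - runEnd n (fun m => t a ≤ t m) (a + 1 + 1) := h4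
    have h6 : (runEnd n (fun m => t a ≤ t m) (a + 1 + 1) : ℝ) ≤ (a + 1 : ℕ) := by linarith
    have h7 := Nat.cast_le.1 h6
    omega

theorem TimeInj.rhoTopLeft_eq {a : ℕ} (ha : a < n) :
    rhoTopLeft n (staircase n t stdX (stdY n) (t a)) a = (stdX (lf t a), stdY n (tp t a)) := by
  obtain ⟨l1, l2, l3⟩ := hT.lf_spec ha
  obtain ⟨u1, u2, u3⟩ := hT.tp_spec ha
  unfold rhoTopLeft
  by_cases h0 : 0 < a → t (a - 1) < t a
  · simp only [diagPoint_mem ha h0, if_true]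
    have hlf : lf t a = a := lf_eq le_rfl (fun m h1 h2 => by omega) fun h => (h0 h).le
    rw [hlf]
    refine Prod.ext rfl ?_
    change sSup {v : ℝ | (n : ℝ) - a ≤ v ∧ ((a : ℝ), v) ∈ staircase n t stdX (stdY n) (t a)} =
      (n : ℝ) - tp t a
    apply IsGreatest.csSup_eq
    constructor
    · refine ⟨sub_le_sub_left (Nat.cast_le.2 u1) _, ?_⟩
      apply mem_staircase_of (by omega) (by omega)
      intro g hg hk
      obtain ⟨s1, s2, s3⟩ := runStart_spec (fun m => t a ≤ t m) g
      obtain ⟨e1, e0, e2, e3⟩ := runEnd_spec n (fun m => t a ≤ t m) (g + 1) hg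
      rcases Nat.lt_or_ge g a with h1 | h1
      · right
        by_contra h2
        have h4 := h0 (by omega)
        have h5 : g < tp t a := by
          by_contra h6
          have := u2 g (by omega) h1; omega
        have h6 := e2 (tp t a) (by omega) (by omega)
        by_cases h7 : tp t a = a
        · have := u3 (by omega); rw [h7] at this; omega
        · have := u2 (tp t a) le_rfl (by omega); omega
      · left
        by_contra h2
        have h4 := h0 (by omega)
        have := s2 (a - 1) (by omega) (by omega); omega
    · rintro v ⟨-, hv⟩
      obtain ⟨-, h1, h2⟩ := hv
      rcases Nat.eq_zero_or_pos (tp t a) with h3 | h3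
      · rw [h3]; exact h1.2
      · have h4 := u3 h3
        -- The label `tp t a - 1` is undrawn and its gap ends no earlier than line `tp t a`; this
        -- bounds the height of the region above the diagonal point.
        rcases h2 (tp t a - 1) (by omega) h4.le with h5 | h5
        · have h6 := Nat.cast_le.1 h5
          have h7 := (runStart_spec (fun m => t a ≤ t m) (tp t a - 1)).1
          omega
        · refine le_trans h5 (sub_le_sub_left (Nat.cast_le.2 ?_) _)
          have := (runEnd_spec n (fun m => t a ≤ t m) (tp t a - 1 + 1) (by omega)).1
          omega
  · push Not at h0
    obtain ⟨h0, h0'⟩ := h0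
    have h1 : t a < t (a - 1) := by
      have := hT (a - 1) a (by omega) ha; omega
    simp only [diagPoint_notMem ha h0 h1, if_false]
    have htp : tp t a = a := tp_eq le_rfl (fun m h1 h2 => by omega) fun h => h0'
    rw [htp]
    refine Prod.ext ?_ rfl
    change sSup {u : ℝ | u ≤ (a : ℝ) ∧ (u, (n : ℝ) - a) ∈ staircase n t stdX (stdY n) (t a)} =
      (lf t a : ℝ)
    apply IsGreatest.csSup_eq
    constructor
    · refine ⟨Nat.cast_le.2 l1, ?_⟩
      apply mem_staircase_of (by omega) (by omega)
      intro g hg hk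
      obtain ⟨s1, s2, s3⟩ := runStart_spec (fun m => t a ≤ t m) g
      obtain ⟨e1, e0, e2, e3⟩ := runEnd_spec n (fun m => t a ≤ t m) (g + 1) hg
      rcases Nat.lt_or_ge g (lf t a) with h1 | h1
      · right
        have h4 := l3 (by omega)
        by_contra h2
        by_cases h3 : g = lf t a - 1
        · rw [h3] at hk; omega
        · have := e2 (lf t a - 1) (by omega) (by omega); omega
      · left
        by_contra h2
        have h4 := l3 (by omega)
        have := s2 (lf t a - 1) (by omega) (by omega); omega
    · rintro v ⟨-, hv⟩
      obtain ⟨h1, -, h2⟩ := hv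
      rcases h2 (a - 1) (by omega) (by omega) with h5 | h5
      · refine le_trans h5 (Nat.cast_le.2 ?_)
        obtain ⟨s1, s2, s3⟩ := runStart_spec (fun m => t a ≤ t m) (a - 1)
        by_contra h6
        have := l2 (runStart (fun m => t a ≤ t m) (a - 1) - 1) (by omega) (by omega)
        have := s3 (by omega)
        omega
      · exfalso
        obtain ⟨e1, e0, e2, e3⟩ := runEnd_spec n (fun m => t a ≤ t m) (a - 1 + 1) (by omega)
        change (n : ℝ) - a ≤ (n : ℝ) - runEnd n (fun m => t a ≤ t m) (a - 1 + 1) at h5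
        have h6 : (runEnd n (fun m => t a ≤ t m) (a - 1 + 1) : ℝ) ≤ a := by linarith
        have h7 := Nat.cast_le.1 h6
        have := e3 (by omega)
        rw [show runEnd n (fun m => t a ≤ t m) (a - 1 + 1) = a by omega] at this
        omega

theorem TimeInj.rhoBottomRight_eq {a : ℕ} (ha : a < n) :
    rhoBottomRight n (staircase n t stdX (stdY n) (t a)) a =
      (stdX (rt n t a), stdY n (bo n t a)) := by
  obtain ⟨r1, r0, r2, r3⟩ := hT.rt_spec ha
  obtain ⟨b1, b0, b2, b3⟩ := hT.bo_spec ha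
  unfold rhoBottomRight
  by_cases h0 : a + 1 < n → t (a + 1) < t a
  · simp only [diagPoint_succ_mem ha h0, if_true]
    have hbo : bo n t a = a + 1 := bo_eq le_rfl ha (fun m h1 h2 => by omega) fun h => (h0 h).le
    rw [hbo]
    refine Prod.ext ?_ rfl
    change sSup {u : ℝ | ((a + 1 : ℕ) : ℝ) ≤ u ∧
      (u, (n : ℝ) - (a + 1 : ℕ)) ∈ staircase n t stdX (stdY n) (t a)} = (rt n t a : ℝ)
    apply IsGreatest.csSup_eq
    constructor
    · refine ⟨Nat.cast_le.2 r1, ?_⟩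
      apply mem_staircase_of (by omega) (by omega)
      intro g hg hk
      obtain ⟨s1, s2, s3⟩ := runStart_spec (fun m => t a ≤ t m) g
      obtain ⟨e1, e0, e2, e3⟩ := runEnd_spec n (fun m => t a ≤ t m) (g + 1) hg
      rcases Nat.lt_or_ge a g with h1 | h1
      · left
        by_contra h2
        have h4 := h0 (by omega)
        have h5 : rt n t a ≤ g := by
          by_contra h6
          have := r2 g (by omega) (by omega); omega
        have h6 := s2 (rt n t a - 1) (by omega) (by omega)
        by_cases h7 : rt n t a - 1 = a
        · have := r3 (by omega)
          rw [show rt n t a = a + 1 by omega] at this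
          omega
        · have := r2 (rt n t a - 1) (by omega) (by omega); omega
      · right
        by_contra h2
        have h4 := h0 (by omega)
        have := e2 (a + 1) (by omega) (by omega); omega
    · rintro v ⟨-, hv⟩
      obtain ⟨h1, -, h2⟩ := hv
      rcases Nat.lt_or_ge (rt n t a) n with h3 | h3
      · have h4 := r3 h3
        rcases h2 (rt n t a) h3 h4.le with h5 | h5
        · refine le_trans h5 (Nat.cast_le.2 ?_)
          exact (runStart_spec (fun m => t a ≤ t m) (rt n t a)).1
        · exfalso
          have h6 := (runEnd_spec n (fun m => t a ≤ t m) (rt n t a + 1) h3).1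
          change (n : ℝ) - (a + 1 : ℕ) ≤
            (n : ℝ) - runEnd n (fun m => t a ≤ t m) (rt n t a + 1) at h5
          have h7 : (runEnd n (fun m => t a ≤ t m) (rt n t a + 1) : ℝ) ≤ (a + 1 : ℕ) := by
            linarith
          have h8 := Nat.cast_le.1 h7
          omega
      · rw [le_antisymm r0 h3]; exact h1.2
  · push Not at h0
    obtain ⟨h0, h0'⟩ := h0
    have h1 : t a < t (a + 1) := by
      have := hT (a + 1) a (by omega) ha; omega
    simp only [diagPoint_succ_notMem h0 h1, if_false]
    have hrt : rt n t a = a + 1 := rt_eq le_rfl ha (fun m h1 h2 => by omega) fun h => h0'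
    rw [hrt]
    refine Prod.ext rfl ?_
    change sSup {v : ℝ | v ≤ (n : ℝ) - (a + 1 : ℕ) ∧
      (((a + 1 : ℕ) : ℝ), v) ∈ staircase n t stdX (stdY n) (t a)} = (n : ℝ) - bo n t a
    apply IsGreatest.csSup_eq
    constructor
    · refine ⟨sub_le_sub_left (Nat.cast_le.2 b1) _, ?_⟩
      apply mem_staircase_of (by omega) (by omega)
      intro g hg hk
      obtain ⟨s1, s2, s3⟩ := runStart_spec (fun m => t a ≤ t m) g
      obtain ⟨e1, e0, e2, e3⟩ := runEnd_spec n (fun m => t a ≤ t m) (g + 1) hg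
      rcases Nat.lt_or_ge g (bo n t a) with h1 | h1
      · right
        by_contra h2
        have h4 := b3 (by omega)
        have := e2 (bo n t a) (by omega) (by omega); omega
      · left
        by_contra h2
        have h4 := b3 (by omega)
        by_cases h3 : g = bo n t a
        · rw [h3] at hk; omega
        · have := s2 (bo n t a) (by omega) (by omega); omega
    · rintro v ⟨-, hv⟩
      obtain ⟨-, h1, h2⟩ := hv
      rcases h2 (a + 1) h0 (by omega) with h5 | h5
      · exfalso
        obtain ⟨s1, s2, s3⟩ := runStart_spec (fun m => t a ≤ t m) (a + 1)
        have h7 := Nat.cast_le.1 h5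
        have := s3 (by omega)
        rw [show runStart (fun m => t a ≤ t m) (a + 1) = a + 1 by omega] at this
        simp at this
      · refine le_trans h5 (sub_le_sub_left (Nat.cast_le.2 ?_) _)
        obtain ⟨e1, e0, e2, e3⟩ := runEnd_spec n (fun m => t a ≤ t m) (a + 1 + 1) (by omega)
        by_contra h6
        have := b2 (runEnd n (fun m => t a ≤ t m) (a + 1 + 1)) (by omega) (by omega)
        have := e3 (by omega)
        omega

theorem TimeInj.rhoRect_eq {a : ℕ} (ha : a < n) :
    rhoRect n (staircase n t stdX (stdY n) (t a)) a = lineRect n t stdX (stdY n) a := by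
  unfold rhoRect lineRect
  rw [hT.rhoTopLeft_eq ha, hT.rhoBottomRight_eq ha]

end std

theorem rhoRegion_eq {n : ℕ} (hn : 1 ≤ n) (x : Equiv.Perm (Fin n)) {k : ℕ} (hk : k ≤ n) :
    rhoRegion x k = staircase n (timeOf x) stdX (stdY n) k := by
  induction k with
  | zero => rw [staircase_zero hn]; rfl
  | succ k ih =>
    have hT := timeOf_inj x
    have ht : timeOf x (x ⟨k, hk⟩ : ℕ) = k := by rw [timeOf_fin]; simp
    have h1 := hT.staircase_succ (a := x ⟨k, hk⟩) (x ⟨k, hk⟩).2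
    have h2 := hT.rhoRect_eq (a := x ⟨k, hk⟩) (x ⟨k, hk⟩).2
    rw [ht] at h1 h2
    rw [h1, ← h2, ← ih (by omega)]
    change rhoRegion x k ∪ _ = _
    congr 1
    ext p
    constructor
    · rintro ⟨_, hp⟩; exact hp
    · exact fun hp => ⟨hk, hp⟩

theorem rho_eq {n : ℕ} (hn : 1 ≤ n) (x : Equiv.Perm (Fin n)) (a : Fin n) :
    rho x a = lineRect n (timeOf x) stdX (stdY n) a := by
  rw [← (timeOf_inj x).rhoRect_eq a.2, timeOf_fin, ← rhoRegion_eq hn x (x.symm a).2.le]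
  rfl

end Rectangulation

namespace Rectangulation

/-! ### Transposition of tilings -/

/-- Exchange of the two coordinates. -/
def Rect.swap (r : Rect) : Rect := ⟨r.y0, r.y1, r.x0, r.x1⟩

theorem Rect.mem_swap_toSet (r : Rect) (p : ℝ × ℝ) : p ∈ r.swap.toSet ↔ p.swap ∈ r.toSet :=
  and_comm

theorem Rect.mem_swap_inner (r : Rect) (p : ℝ × ℝ) : p ∈ r.swap.inner ↔ p.swap ∈ r.inner :=
  and_comm

theorem Rect.mem_swap_corners (r : Rect) (p : ℝ × ℝ) :
    p ∈ r.swap.corners ↔ p.swap ∈ r.corners := by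
  obtain ⟨u, v⟩ := p
  simp only [corners, swap, Set.mem_insert_iff, Set.mem_singleton_iff, Prod.mk.injEq,
    Prod.swap_prod_mk]
  tauto

theorem Rect.leftOf_swap (r s : Rect) : r.swap.LeftOf s.swap ↔ r.Below s := Iff.rfl

theorem Rect.below_swap (r s : Rect) : r.swap.Below s.swap ↔ r.LeftOf s := Iff.rfl

/-- The transposed tiling, with the same labels. -/
def Tiling.swap {n : ℕ} (R : Tiling n) : Tiling n where
  outer := R.outer.swap
  tile i := (R.tile i).swap
  outer_nondeg := R.outer_nondeg.symm
  tile_nondeg i := (R.tile_nondeg i).symm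
  disjoint i j hij := by
    rw [Set.disjoint_left]
    intro p h1 h2
    rw [Rect.mem_swap_inner] at h1 h2
    exact Set.disjoint_left.1 (R.disjoint i j hij) h1 h2
  cover := by
    ext p
    rw [Rect.mem_swap_toSet, ← R.cover]
    simp only [Set.mem_iUnion, Rect.mem_swap_toSet]

theorem Tiling.IsGeneric.swap {n : ℕ} {R : Tiling n} (h : R.IsGeneric) : R.swap.IsGeneric := by
  intro p
  have := h p.swap
  simpa only [Tiling.swap, Rect.mem_swap_corners] using this

/-- The transposed segment. -/
def Seg.swap : Seg → Seg
  | vert x a b => horiz x a b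
  | horiz y a b => vert y a b

theorem Seg.swap_swap (W : Seg) : W.swap.swap = W := by cases W <;> rfl

theorem Seg.mem_swap (W : Seg) (p : ℝ × ℝ) : p ∈ W.swap.toSet ↔ p.swap ∈ W.toSet := by
  cases W <;> exact and_comm

theorem Seg.swap_subset_iff (W V : Seg) : W.swap.toSet ⊆ V.toSet ↔ W.toSet ⊆ V.swap.toSet := by
  constructor
  · intro h p hp
    rw [Seg.mem_swap]; apply h; rw [Seg.mem_swap]; exact hp
  · intro h p hp
    rw [Seg.mem_swap] at hp
    have := h hp
    rw [Seg.mem_swap] at this; exact this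

theorem Tiling.avoids_swap {n : ℕ} (R : Tiling n) (W : Seg) : R.swap.Avoids W ↔
    R.Avoids W.swap := by
  have h1 : W.swap.Nondeg ↔ W.Nondeg := by cases W <;> rfl
  unfold Tiling.Avoids
  rw [h1]
  refine and_congr Iff.rfl (and_congr ?_ (forall_congr' fun i => ?_))
  · constructor
    · intro h p hp
      rw [Seg.mem_swap] at hp
      have := h hp
      rwa [Tiling.swap, Rect.mem_swap_toSet] at this
    · intro h p hp
      rw [Tiling.swap, Rect.mem_swap_toSet]
      exact h ((Seg.mem_swap _ _).2 hp)
  · simp only [Set.disjoint_left]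
    constructor
    · intro h p hp h2
      rw [Seg.mem_swap] at hp
      exact h hp ((Rect.mem_swap_inner _ _).2 h2)
    · intro h p hp h2
      exact h ((Seg.mem_swap W p.swap).2 hp) ((Rect.mem_swap_inner _ _).1 h2)

theorem Rect.mem_edges_swap (r : Rect) (E : Seg) : E ∈ r.swap.edges ↔ E.swap ∈ r.edges := by
  cases E <;> simp [edges, Rect.swap, Seg.swap]

theorem Tiling.IsWall.swap {n : ℕ} {R : Tiling n} {W : Seg} (h : R.IsWall W) :
    R.swap.IsWall W.swap := by
  obtain ⟨h1, h2, h3⟩ := h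
  refine ⟨?_, ?_, ?_⟩
  · rw [Tiling.avoids_swap, Seg.swap_swap]; exact h1
  · intro E hE hsub
    rw [Seg.swap_subset_iff] at hsub
    exact h2 _ ((Rect.mem_edges_swap _ _).1 hE) hsub
  · intro W' hW' hsub
    rw [Seg.swap_subset_iff] at hsub
    have := h3 _ ((Tiling.avoids_swap _ _).1 hW') hsub
    rw [Seg.swap_subset_iff] at this
    exact this

/-! ### Order-theoretic description of tilings -/

section geometry
variable {n : ℕ} (R : Tiling n)

theorem Tiling.hx (i : Fin n) : (R.tile i).x0 < (R.tile i).x1 := (R.tile_nondeg i).1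

theorem Tiling.hy (i : Fin n) : (R.tile i).y0 < (R.tile i).y1 := (R.tile_nondeg i).2

theorem Tiling.tile_eq {i j : Fin n} (h1 : (R.tile i).x0 < (R.tile j).x1)
    (h2 : (R.tile j).x0 < (R.tile i).x1) (h3 : (R.tile i).y0 < (R.tile j).y1)
    (h4 : (R.tile j).y0 < (R.tile i).y1) : i = j := by
  by_contra hne
  have hd := Set.disjoint_left.1 (R.disjoint i j hne)
  obtain ⟨u, hu1, hu2⟩ := exists_between
    (max_lt (lt_min (R.hx i) h1) (lt_min h2 (R.hx j)))
  obtain ⟨v, hv1, hv2⟩ := exists_between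
    (max_lt (lt_min (R.hy i) h3) (lt_min h4 (R.hy j)))
  rw [max_lt_iff] at hu1 hv1
  rw [lt_min_iff] at hu2 hv2
  exact hd (a := (u, v)) ⟨⟨hu1.1, hu2.1⟩, hv1.1, hv2.1⟩ ⟨⟨hu1.2, hu2.2⟩, hv1.2, hv2.2⟩

theorem Tiling.tile_subset (i : Fin n) : (R.tile i).toSet ⊆ R.outer.toSet :=
  R.cover ▸ Set.subset_iUnion (fun i => (R.tile i).toSet) i

theorem Tiling.bounds (i : Fin n) : R.outer.x0 ≤ (R.tile i).x0 ∧ (R.tile i).x1 ≤ R.outer.x1 ∧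
    R.outer.y0 ≤ (R.tile i).y0 ∧ (R.tile i).y1 ≤ R.outer.y1 := by
  have h1 := R.tile_subset i (a := ((R.tile i).x0, (R.tile i).y0))
    ⟨⟨le_rfl, (R.hx i).le⟩, le_rfl, (R.hy i).le⟩
  have h2 := R.tile_subset i (a := ((R.tile i).x1, (R.tile i).y1))
    ⟨⟨(R.hx i).le, le_rfl⟩, (R.hy i).le, le_rfl⟩
  exact ⟨h1.1.1, h2.1.2, h1.2.1, h2.2.2⟩

theorem Tiling.exists_mem {u v : ℝ} (hu : R.outer.x0 ≤ u) (hu' : u ≤ R.outer.x1)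
    (hv : R.outer.y0 ≤ v) (hv' : v ≤ R.outer.y1) :
    ∃ i, (R.tile i).x0 ≤ u ∧ u ≤ (R.tile i).x1 ∧ (R.tile i).y0 ≤ v ∧ v ≤ (R.tile i).y1 := by
  have : (u, v) ∈ ⋃ i, (R.tile i).toSet := by
    rw [R.cover]; exact ⟨⟨hu, hu'⟩, hv, hv'⟩
  obtain ⟨i, ⟨h1, h2⟩, h3, h4⟩ := Set.mem_iUnion.1 this
  exact ⟨i, h1, h2, h3, h4⟩

/-- A small enough step to the right of `p` crosses none of finitely many coordinates. Through such
steps the closed covering by tiles yields a tile in each quadrant at a given point. -/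
theorem exists_gt_forall_lt {S : Set ℝ} (hS : S.Finite) (p : ℝ) :
    ∃ q, p < q ∧ ∀ c ∈ S, p < c → q < c := by
  induction S, hS using Set.Finite.induction_on with
  | empty => exact ⟨p + 1, by linarith, by simp⟩
  | @insert a s _ _ ih =>
    obtain ⟨q, h1, h2⟩ := ih
    by_cases ha : p < a
    · obtain ⟨r, h3, h4⟩ := exists_between (lt_min h1 ha)
      rw [lt_min_iff] at h4
      refine ⟨r, h3, fun c hc hpc => ?_⟩
      rcases hc with rfl | hc
      · exact h4.2
      · exact h4.1.trans (h2 c hc hpc)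
    · refine ⟨q, h1, fun c hc hpc => ?_⟩
      rcases hc with rfl | hc
      · exact absurd hpc ha
      · exact h2 c hc hpc

theorem exists_lt_forall_gt {S : Set ℝ} (hS : S.Finite) (p : ℝ) :
    ∃ q, q < p ∧ ∀ c ∈ S, c < p → c < q := by
  obtain ⟨q, h1, h2⟩ := exists_gt_forall_lt (hS.image (fun x => -x)) (-p)
  refine ⟨-q, by linarith, fun c hc hcp => ?_⟩
  have := h2 (-c) ⟨c, hc, rfl⟩ (by linarith)
  linarith

/-- The coordinates of vertical edges. -/
def Tiling.xs : Set ℝ :=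
  {R.outer.x0, R.outer.x1} ∪ (Set.range (fun i => (R.tile i).x0) ∪
    Set.range (fun i => (R.tile i).x1))

theorem Tiling.xs_finite : R.xs.Finite :=
  (Set.toFinite _).union ((Set.finite_range _).union (Set.finite_range _))

theorem Tiling.xs_right (u : ℝ) : ∃ q, u < q ∧ (u < R.outer.x1 → q < R.outer.x1) ∧
    ∀ i, ((R.tile i).x0 ≤ q → (R.tile i).x0 ≤ u) ∧ (q ≤ (R.tile i).x1 → u < (R.tile i).x1) := by
  obtain ⟨q, h1, h2⟩ := exists_gt_forall_lt R.xs_finite u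
  refine ⟨q, h1, h2 _ (by simp [Tiling.xs]), fun i => ⟨fun h => ?_, fun h => h1.trans_le h⟩⟩
  by_contra hc
  have := h2 (R.tile i).x0 (Or.inr (Or.inl ⟨i, rfl⟩)) (not_le.1 hc)
  linarith

theorem Tiling.xs_left (u : ℝ) : ∃ q, q < u ∧ (R.outer.x0 < u → R.outer.x0 < q) ∧
    ∀ i, ((R.tile i).x0 ≤ q → (R.tile i).x0 < u) ∧ (q ≤ (R.tile i).x1 → u ≤ (R.tile i).x1) := by
  obtain ⟨q, h1, h2⟩ := exists_lt_forall_gt R.xs_finite u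
  refine ⟨q, h1, h2 _ (by simp [Tiling.xs]), fun i => ⟨fun h => h.trans_lt h1, fun h => ?_⟩⟩
  by_contra hc
  have := h2 (R.tile i).x1 (Or.inr (Or.inr ⟨i, rfl⟩)) (not_le.1 hc)
  linarith

/-- The point is moved slightly to the north-east, past no edge of a tile; a tile that contains the
moved point contains the germ of the north-east quadrant at the original one. The suffixes `nw`,
`se`, `sw` refer to the other quadrants. -/
theorem Tiling.exists_ne {u v : ℝ} (hu : R.outer.x0 ≤ u) (hu' : u < R.outer.x1)
    (hv : R.outer.y0 ≤ v) (hv' : v < R.outer.y1) :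
    ∃ i, (R.tile i).x0 ≤ u ∧ u < (R.tile i).x1 ∧ (R.tile i).y0 ≤ v ∧ v < (R.tile i).y1 := by
  obtain ⟨q, h1, h2, h3⟩ := R.xs_right u
  obtain ⟨r, g1, g2, g3⟩ := R.swap.xs_right v
  obtain ⟨i, k1, k2, k3, k4⟩ := R.exists_mem (hu.trans h1.le) (h2 hu').le (hv.trans g1.le)
    (show r ≤ R.outer.y1 from (g2 hv').le)
  exact ⟨i, (h3 i).1 k1, (h3 i).2 k2, (g3 i).1 k3, (g3 i).2 k4⟩

theorem Tiling.exists_nw {u v : ℝ} (hu : R.outer.x0 < u) (hu' : u ≤ R.outer.x1)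
    (hv : R.outer.y0 ≤ v) (hv' : v < R.outer.y1) :
    ∃ i, (R.tile i).x0 < u ∧ u ≤ (R.tile i).x1 ∧ (R.tile i).y0 ≤ v ∧ v < (R.tile i).y1 := by
  obtain ⟨q, h1, h2, h3⟩ := R.xs_left u
  obtain ⟨r, g1, g2, g3⟩ := R.swap.xs_right v
  obtain ⟨i, k1, k2, k3, k4⟩ := R.exists_mem (h2 hu).le (h1.le.trans hu') (hv.trans g1.le)
    (show r ≤ R.outer.y1 from (g2 hv').le)
  exact ⟨i, (h3 i).1 k1, (h3 i).2 k2, (g3 i).1 k3, (g3 i).2 k4⟩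

theorem Tiling.exists_se {u v : ℝ} (hu : R.outer.x0 ≤ u) (hu' : u < R.outer.x1)
    (hv : R.outer.y0 < v) (hv' : v ≤ R.outer.y1) :
    ∃ i, (R.tile i).x0 ≤ u ∧ u < (R.tile i).x1 ∧ (R.tile i).y0 < v ∧ v ≤ (R.tile i).y1 := by
  obtain ⟨q, h1, h2, h3⟩ := R.xs_right u
  obtain ⟨r, g1, g2, g3⟩ := R.swap.xs_left v
  obtain ⟨i, k1, k2, k3, k4⟩ := R.exists_mem (hu.trans h1.le) (h2 hu').le
    (show R.outer.y0 ≤ r from (g2 hv).le) (g1.le.trans hv')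
  exact ⟨i, (h3 i).1 k1, (h3 i).2 k2, (g3 i).1 k3, (g3 i).2 k4⟩

theorem Tiling.exists_sw {u v : ℝ} (hu : R.outer.x0 < u) (hu' : u ≤ R.outer.x1)
    (hv : R.outer.y0 < v) (hv' : v ≤ R.outer.y1) :
    ∃ i, (R.tile i).x0 < u ∧ u ≤ (R.tile i).x1 ∧ (R.tile i).y0 < v ∧ v ≤ (R.tile i).y1 := by
  obtain ⟨q, h1, h2, h3⟩ := R.xs_left u
  obtain ⟨r, g1, g2, g3⟩ := R.swap.xs_left v
  obtain ⟨i, k1, k2, k3, k4⟩ := R.exists_mem (h2 hu).le (h1.le.trans hu')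
    (show R.outer.y0 ≤ r from (g2 hv).le) (g1.le.trans hv')
  exact ⟨i, (h3 i).1 k1, (h3 i).2 k2, (g3 i).1 k3, (g3 i).2 k4⟩

/-- The open vertical segment `{u} × (a, b)` meets no interior of a tile. -/
def Tiling.Clear (u a b : ℝ) : Prop :=
  ∀ m, (R.tile m).x0 < u → u < (R.tile m).x1 → b ≤ (R.tile m).y0 ∨ (R.tile m).y1 ≤ a

variable {R}

theorem Tiling.Clear.mono {u a b c d : ℝ} (h : R.Clear u a b) (hc : a ≤ c) (hd : d ≤ b) :
    R.Clear u c d := fun m h1 h2 =>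
  (h m h1 h2).imp (fun h => hd.trans h) (fun h => h.trans hc)

theorem Tiling.Clear.union {u a b c d : ℝ} (h : R.Clear u a b) (h' : R.Clear u c d)
    (hcb : c ≤ b) : R.Clear u a d := by
  intro m h1 h2
  have := R.hy m
  rcases h m h1 h2 with h3 | h3
  · rcases h' m h1 h2 with h4 | h4
    · exact Or.inl h4
    · linarith
  · exact Or.inr h3

theorem Tiling.avoids_vert_iff {u a b : ℝ} : R.Avoids (Seg.vert u a b) ↔
    a < b ∧ R.outer.x0 ≤ u ∧ u ≤ R.outer.x1 ∧ R.outer.y0 ≤ a ∧ b ≤ R.outer.y1 ∧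
      R.Clear u a b := by
  constructor
  · rintro ⟨h1, h2, h3⟩
    have h1' : a < b := h1
    have ha := h2 (a := (u, a)) ⟨rfl, le_rfl, h1'.le⟩
    have hb := h2 (a := (u, b)) ⟨rfl, h1'.le, le_rfl⟩
    refine ⟨h1, ha.1.1, ha.1.2, ha.2.1, hb.2.2, fun m h4 h5 => ?_⟩
    by_contra hcon
    push Not at hcon
    obtain ⟨v, hv1, hv2⟩ := exists_between
      (max_lt (lt_min h1' hcon.2) (lt_min hcon.1 (R.hy m)))
    rw [max_lt_iff] at hv1
    rw [lt_min_iff] at hv2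
    have hd := Set.disjoint_left.1 (h3 m)
    exact hd (a := (u, v)) ⟨rfl, hv1.1.le, hv2.1.le⟩ ⟨⟨h4, h5⟩, hv1.2, hv2.2⟩
  · rintro ⟨h1, h2, h3, h4, h5, h6⟩
    refine ⟨h1, ?_, fun m => Set.disjoint_left.2 ?_⟩
    · rintro ⟨p, q⟩ ⟨rfl, h7, h8⟩
      exact ⟨⟨h2, h3⟩, h4.trans h7, h8.trans h5⟩
    · rintro ⟨p, q⟩ ⟨h0, h7, h8⟩ ⟨⟨h9, h10⟩, h11, h12⟩
      change p = u at h0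
      subst h0
      rcases h6 m h9 h10 with h | h
      · exact absurd (h11.trans_le h8) (not_lt.2 h)
      · exact absurd (h7.trans_lt h12) (not_lt.2 h)

theorem vert_subset_vert {u a b u' c d : ℝ} (hab : a < b)
    (h : (Seg.vert u a b).toSet ⊆ (Seg.vert u' c d).toSet) : u = u' ∧ c ≤ a ∧ b ≤ d := by
  have h1 := h (a := (u, a)) ⟨rfl, le_rfl, hab.le⟩
  have h2 := h (a := (u, b)) ⟨rfl, hab.le, le_rfl⟩
  exact ⟨h1.1, h1.2.1, h2.2.2⟩

theorem not_vert_subset_horiz {u a b v c d : ℝ} (hab : a < b) :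
    ¬ (Seg.vert u a b).toSet ⊆ (Seg.horiz v c d).toSet := by
  intro h
  have h1 := h (a := (u, a)) ⟨rfl, le_rfl, hab.le⟩
  have h2 := h (a := (u, b)) ⟨rfl, hab.le, le_rfl⟩
  have e1 : a = v := h1.2
  have e2 : b = v := h2.2
  exact hab.ne (e1.trans e2.symm)

theorem Tiling.isWall_vert {u a b : ℝ} (h : R.IsWall (Seg.vert u a b)) :
    a < b ∧ R.outer.x0 < u ∧ u < R.outer.x1 ∧ R.outer.y0 ≤ a ∧ b ≤ R.outer.y1 ∧ R.Clear u a b := by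
  obtain ⟨h1, h2, h3⟩ := h
  obtain ⟨g1, g2, g3, g4, g5, g6⟩ := Tiling.avoids_vert_iff.1 h1
  refine ⟨g1, lt_of_le_of_ne g2 fun e => ?_, lt_of_le_of_ne g3 fun e => ?_, g4, g5, g6⟩
  · apply h2 (Seg.vert R.outer.x0 R.outer.y0 R.outer.y1) (by simp [Rect.edges])
    rintro ⟨p, q⟩ ⟨h7, h8, h9⟩
    exact ⟨h7.trans e.symm, g4.trans h8, h9.trans g5⟩
  · apply h2 (Seg.vert R.outer.x1 R.outer.y0 R.outer.y1) (by simp [Rect.edges])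
    rintro ⟨p, q⟩ ⟨h7, h8, h9⟩
    exact ⟨h7.trans e, g4.trans h8, h9.trans g5⟩

/-- A clear segment that touches the wall can be united with it, and the wall is maximal. -/
theorem Tiling.IsWall.clear_le {u a b c d : ℝ} (h : R.IsWall (Seg.vert u a b))
    (hc : R.Clear u c d) (h1 : R.outer.y0 ≤ c) (h2 : d ≤ R.outer.y1) (h3 : c ≤ b) (h4 : a ≤ d) :
    a ≤ c ∧ d ≤ b := by
  obtain ⟨g1, g2, g3, g4, g5, g6⟩ := Tiling.isWall_vert h
  have key : R.Clear u (min a c) (max b d) := by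
    rcases le_total a c with h5 | h5 <;> rcases le_total b d with h6 | h6
    · rw [min_eq_left h5, max_eq_right h6]; exact g6.union hc h3
    · rw [min_eq_left h5, max_eq_left h6]; exact g6
    · rw [min_eq_right h5, max_eq_right h6]; exact hc
    · rw [min_eq_right h5, max_eq_left h6]; exact hc.union g6 h4
  have hab : min a c < max b d := (min_le_left _ _).trans_lt (g1.trans_le (le_max_left _ _))
  have := h.2.2 (Seg.vert u (min a c) (max b d)) (Tiling.avoids_vert_iff.2
    ⟨hab, g2.le, g3.le, le_min g4 h1, max_le g5 h2, key⟩) (by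
      rintro ⟨p, q⟩ ⟨h7, h8, h9⟩
      exact ⟨h7, (min_le_left _ _).trans h8, h9.trans (le_max_left _ _)⟩)
  obtain ⟨-, h5, h6⟩ := vert_subset_vert hab this
  exact ⟨h5.trans (min_le_right _ _), (le_max_right _ _).trans h6⟩

/-- The segment is prolonged upwards to the lowest bottom edge of a tile that the line crosses above
it, or to the outer rectangle, and downwards in the same way. The tiles at the ends prevent any
further extension. -/
theorem Tiling.exists_wall {u a b : ℝ} (hab : a < b) (hu : R.outer.x0 < u) (hu' : u < R.outer.x1)
    (ha : R.outer.y0 ≤ a) (hb : b ≤ R.outer.y1) (hc : R.Clear u a b) :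
    ∃ c d, c ≤ a ∧ b ≤ d ∧ R.IsWall (Seg.vert u c d) := by
  classical
  have hup : ∃ d, b ≤ d ∧ d ≤ R.outer.y1 ∧ R.Clear u a d ∧
      (d = R.outer.y1 ∨ ∃ m, (R.tile m).x0 < u ∧ u < (R.tile m).x1 ∧ (R.tile m).y0 = d) := by
    let S := Finset.univ.filter fun m =>
      (R.tile m).x0 < u ∧ u < (R.tile m).x1 ∧ b ≤ (R.tile m).y0
    rcases S.eq_empty_or_nonempty with hS | hS
    · refine ⟨R.outer.y1, hb, le_rfl, fun m h1 h2 => ?_, Or.inl rfl⟩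
      rcases hc m h1 h2 with h3 | h3
      · have : m ∈ S := by simp [S, h1, h2, h3]
        rw [hS] at this; simp at this
      · exact Or.inr h3
    · obtain ⟨m, hm, hmin⟩ := S.exists_min_image (fun m => (R.tile m).y0) hS
      simp only [S, Finset.mem_filter, Finset.mem_univ, true_and] at hm
      refine ⟨(R.tile m).y0, hm.2.2, (R.hy m).le.trans (R.bounds m).2.2.2, fun k h1 h2 => ?_,
        Or.inr ⟨m, hm.1, hm.2.1, rfl⟩⟩
      rcases hc k h1 h2 with h3 | h3
      · exact Or.inl (hmin k (by simp [S, h1, h2, h3]))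
      · exact Or.inr h3
  obtain ⟨d, hd1, hd2, hd3, hd4⟩ := hup
  have hdown : ∃ c, c ≤ a ∧ R.outer.y0 ≤ c ∧ R.Clear u c d ∧
      (c = R.outer.y0 ∨ ∃ m, (R.tile m).x0 < u ∧ u < (R.tile m).x1 ∧ (R.tile m).y1 = c) := by
    let S := Finset.univ.filter fun m =>
      (R.tile m).x0 < u ∧ u < (R.tile m).x1 ∧ (R.tile m).y1 ≤ a
    rcases S.eq_empty_or_nonempty with hS | hS
    · refine ⟨R.outer.y0, ha, le_rfl, fun m h1 h2 => ?_, Or.inl rfl⟩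
      rcases hd3 m h1 h2 with h3 | h3
      · exact Or.inl h3
      · have : m ∈ S := by simp [S, h1, h2, h3]
        rw [hS] at this; simp at this
    · obtain ⟨m, hm, hmax⟩ := S.exists_max_image (fun m => (R.tile m).y1) hS
      simp only [S, Finset.mem_filter, Finset.mem_univ, true_and] at hm
      refine ⟨(R.tile m).y1, hm.2.2, (R.bounds m).2.2.1.trans (R.hy m).le, fun k h1 h2 => ?_,
        Or.inr ⟨m, hm.1, hm.2.1, rfl⟩⟩
      rcases hd3 k h1 h2 with h3 | h3
      · exact Or.inl h3
      · exact Or.inr (hmax k (by simp [S, h1, h2, h3]))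
  obtain ⟨c, hc1, hc2, hc3, hc4⟩ := hdown
  have hcd : c < d := hc1.trans_lt (hab.trans_le hd1)
  refine ⟨c, d, hc1, hd1, Tiling.avoids_vert_iff.2 ⟨hcd, hu.le, hu'.le, hc2, hd2, hc3⟩, ?_, ?_⟩
  · intro E hE hsub
    simp only [Rect.edges, Set.mem_insert_iff, Set.mem_singleton_iff] at hE
    rcases hE with rfl | rfl | rfl | rfl
    · have := (vert_subset_vert hcd hsub).1; linarith
    · have := (vert_subset_vert hcd hsub).1; linarith
    · exact not_vert_subset_horiz hcd hsub
    · exact not_vert_subset_horiz hcd hsub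
  · intro W' hW' hsub
    cases W' with
    | horiz v e f => exact absurd hsub (not_vert_subset_horiz hcd)
    | vert u' e f =>
      obtain ⟨rfl, h1, h2⟩ := vert_subset_vert hcd hsub
      obtain ⟨g1, g2, g3, g4, g5, g6⟩ := Tiling.avoids_vert_iff.1 hW'
      have hfd : f ≤ d := by
        rcases hd4 with rfl | ⟨m, hm1, hm2, hm3⟩
        · exact g5
        · have := R.hy m
          rcases g6 m hm1 hm2 with h3 | h3 <;> linarith
      have hce : c ≤ e := by
        rcases hc4 with rfl | ⟨m, hm1, hm2, hm3⟩
        · exact g4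
        · have := R.hy m
          rcases g6 m hm1 hm2 with h3 | h3 <;> linarith
      rintro ⟨p, q⟩ ⟨h7, h8, h9⟩
      exact ⟨h7, hce.trans h8, h9.trans hfd⟩

/-! ### Corners -/

theorem Tiling.IsGeneric.no_cross (hR : R.IsGeneric) {u v : ℝ} {a b c d : Fin n}
    (ha : (R.tile a).x0 = u ∧ (R.tile a).y0 = v) (hb : (R.tile b).x1 = u ∧ (R.tile b).y0 = v)
    (hc : (R.tile c).x1 = u ∧ (R.tile c).y1 = v) (hd : (R.tile d).x0 = u ∧ (R.tile d).y1 = v) :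
    False := by
  have h := hR (u, v)
  have hsub : (({a, b, c, d} : Finset (Fin n)) : Set (Fin n)) ⊆
      {i | (u, v) ∈ (R.tile i).corners} := by
    intro i hi
    simp only [Finset.coe_insert, Finset.coe_singleton, Set.mem_insert_iff,
      Set.mem_singleton_iff] at hi
    rcases hi with rfl | rfl | rfl | rfl
    · exact Or.inl (Prod.ext ha.1.symm ha.2.symm)
    · exact Or.inr (Or.inr (Or.inl (Prod.ext hb.1.symm hb.2.symm)))
    · exact Or.inr (Or.inr (Or.inr (Prod.ext hc.1.symm hc.2.symm)))
    · exact Or.inr (Or.inl (Prod.ext hd.1.symm hd.2.symm))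
  have hle := Set.ncard_le_ncard hsub (Set.toFinite _)
  rw [Set.ncard_coe_finset] at hle
  have hax := R.hx a
  have hbx := R.hx b
  have hcx := R.hx c
  have hdx := R.hx d
  have hay := R.hy a
  have hby := R.hy b
  have hcy := R.hy c
  have hdy := R.hy d
  have hab : a ≠ b := by rintro rfl; linarith [ha.1, hb.1]
  have hac : a ≠ c := by rintro rfl; linarith [ha.1, hc.1]
  have had : a ≠ d := by rintro rfl; linarith [ha.2, hd.2]
  have hbc : b ≠ c := by rintro rfl; linarith [hb.2, hc.2]
  have hbd : b ≠ d := by rintro rfl; linarith [hb.2, hd.2]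
  have hcd : c ≠ d := by rintro rfl; linarith [hc.1, hd.1]
  have : ({a, b, c, d} : Finset (Fin n)).card = 4 := by
    rw [Finset.card_insert_of_notMem (by simp [hab, hac, had]),
      Finset.card_insert_of_notMem (by simp [hbc, hbd]),
      Finset.card_insert_of_notMem (by simp [hcd]), Finset.card_singleton]
  omega

/-- A point can be the bottom-left corner of at most one tile, and similarly for the other three
kinds of corner. So four tiles with a common corner realize each kind once. -/
theorem Tiling.isGeneric_of_no_cross (h : ∀ (u v : ℝ) (a b c d : Fin n),
    ((R.tile a).x0 = u ∧ (R.tile a).y0 = v) → ((R.tile b).x1 = u ∧ (R.tile b).y0 = v) →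
    ((R.tile c).x1 = u ∧ (R.tile c).y1 = v) → ((R.tile d).x0 = u ∧ (R.tile d).y1 = v) → False) :
    R.IsGeneric := by
  classical
  rintro ⟨u, v⟩
  by_contra hcon
  rw [not_lt] at hcon
  let A : Set (Fin n) := {i | (R.tile i).x0 = u ∧ (R.tile i).y0 = v}
  let B : Set (Fin n) := {i | (R.tile i).x1 = u ∧ (R.tile i).y0 = v}
  let C : Set (Fin n) := {i | (R.tile i).x1 = u ∧ (R.tile i).y1 = v}
  let D : Set (Fin n) := {i | (R.tile i).x0 = u ∧ (R.tile i).y1 = v}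
  have hsub : {i : Fin n | (u, v) ∈ (R.tile i).corners} ⊆ A ∪ (B ∪ (C ∪ D)) := by
    intro i hi
    rcases hi with hi | hi | hi | hi
    · rw [Prod.mk.injEq] at hi
      exact Or.inl ⟨hi.1.symm, hi.2.symm⟩
    · rw [Prod.mk.injEq] at hi
      exact Or.inr (Or.inr (Or.inr ⟨hi.1.symm, hi.2.symm⟩))
    · rw [Prod.mk.injEq] at hi
      exact Or.inr (Or.inl ⟨hi.1.symm, hi.2.symm⟩)
    · have hi' := Prod.mk.inj hi
      exact Or.inr (Or.inr (Or.inl ⟨hi'.1.symm, hi'.2.symm⟩))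
  have hA : A.ncard ≤ 1 := (Set.ncard_le_one (Set.toFinite _)).2 fun i hi j hj => by
    have := R.hx i; have := R.hx j; have := R.hy i; have := R.hy j
    apply R.tile_eq <;> linarith [hi.1, hi.2, hj.1, hj.2]
  have hB : B.ncard ≤ 1 := (Set.ncard_le_one (Set.toFinite _)).2 fun i hi j hj => by
    have := R.hx i; have := R.hx j; have := R.hy i; have := R.hy j
    apply R.tile_eq <;> linarith [hi.1, hi.2, hj.1, hj.2]
  have hC : C.ncard ≤ 1 := (Set.ncard_le_one (Set.toFinite _)).2 fun i hi j hj => by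
    have := R.hx i; have := R.hx j; have := R.hy i; have := R.hy j
    apply R.tile_eq <;> linarith [hi.1, hi.2, hj.1, hj.2]
  have hD : D.ncard ≤ 1 := (Set.ncard_le_one (Set.toFinite _)).2 fun i hi j hj => by
    have := R.hx i; have := R.hx j; have := R.hy i; have := R.hy j
    apply R.tile_eq <;> linarith [hi.1, hi.2, hj.1, hj.2]
  have h0 := Set.ncard_le_ncard hsub (Set.toFinite _)
  have h1 := Set.ncard_union_le A (B ∪ (C ∪ D))
  have h2 := Set.ncard_union_le B (C ∪ D)
  have h3 := Set.ncard_union_le C D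
  obtain ⟨a, ha⟩ := Set.nonempty_of_ncard_ne_zero (s := A) (by omega)
  obtain ⟨b, hb⟩ := Set.nonempty_of_ncard_ne_zero (s := B) (by omega)
  obtain ⟨c, hc⟩ := Set.nonempty_of_ncard_ne_zero (s := C) (by omega)
  obtain ⟨d, hd⟩ := Set.nonempty_of_ncard_ne_zero (s := D) (by omega)
  exact h u v a b c d ha hb hc hd

end geometry

end Rectangulation

namespace Rectangulation

/-! ### Tiles on opposite sides of a wall -/

section wall
variable {n : ℕ} {R : Tiling n}

/-- The right edge of `i` and the left edge of `j` lie on a common wall. -/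
def Tiling.SameV (R : Tiling n) (i j : Fin n) : Prop :=
  (R.tile i).x1 = (R.tile j).x0 ∧
    R.Clear (R.tile i).x1 (min (R.tile i).y0 (R.tile j).y0) (max (R.tile i).y1 (R.tile j).y1)

/-- The closure of adjacency along walls: `inl i` stands for one edge of the tile `i` and `inr i`
for the opposite one. -/
def Zigzag {ι : Type*} (L : ι → ι → Prop) : ι ⊕ ι → ι ⊕ ι → Prop :=
  Relation.EqvGen fun u v => ∃ i j, u = Sum.inl i ∧ v = Sum.inr j ∧ L i j

theorem Zigzag.of {ι : Type*} {L : ι → ι → Prop} {i j : ι} (h : L i j) :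
    Zigzag L (Sum.inl i) (Sum.inr j) := Relation.EqvGen.rel _ _ ⟨i, j, rfl, rfl, h⟩

theorem leftOf_iff (r s : Rect) (hr : r.y0 < r.y1) (hs : s.y0 < s.y1) :
    r.LeftOf s ↔ r.x1 = s.x0 ∧ r.y0 < s.y1 ∧ s.y0 < r.y1 := by
  unfold Rect.LeftOf
  rw [max_lt_iff, lt_min_iff, lt_min_iff]
  tauto

theorem Tiling.leftOf_iff (R : Tiling n) (i j : Fin n) : (R.tile i).LeftOf (R.tile j) ↔
    (R.tile i).x1 = (R.tile j).x0 ∧ (R.tile i).y0 < (R.tile j).y1 ∧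
      (R.tile j).y0 < (R.tile i).y1 :=
  Rectangulation.leftOf_iff _ _ (R.hy i) (R.hy j)

/-! ### Tiles that touch a clear vertical segment at a given height. -/

section germs
variable {u a b : ℝ} (hc : R.Clear u a b)
include hc

theorem Tiling.Clear.exists_ne {v : ℝ} (h0 : R.outer.x0 ≤ u) (h1 : u < R.outer.x1)
    (h2 : R.outer.y0 ≤ v) (h3 : v < R.outer.y1) (hav : a ≤ v) (hvb : v < b) :
    ∃ i, (R.tile i).x0 = u ∧ (R.tile i).y0 ≤ v ∧ v < (R.tile i).y1 := by
  obtain ⟨i, g1, g2, g3, g4⟩ := R.exists_ne h0 h1 h2 h3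
  refine ⟨i, le_antisymm g1 (not_lt.1 fun h => ?_), g3, g4⟩
  rcases hc i h g2 with h5 | h5 <;> linarith

theorem Tiling.Clear.exists_nw {v : ℝ} (h0 : R.outer.x0 < u) (h1 : u ≤ R.outer.x1)
    (h2 : R.outer.y0 ≤ v) (h3 : v < R.outer.y1) (hav : a ≤ v) (hvb : v < b) :
    ∃ i, (R.tile i).x1 = u ∧ (R.tile i).y0 ≤ v ∧ v < (R.tile i).y1 := by
  obtain ⟨i, g1, g2, g3, g4⟩ := R.exists_nw h0 h1 h2 h3
  refine ⟨i, le_antisymm (not_lt.1 fun h => ?_) g2, g3, g4⟩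
  rcases hc i g1 h with h5 | h5 <;> linarith

theorem Tiling.Clear.exists_se {v : ℝ} (h0 : R.outer.x0 ≤ u) (h1 : u < R.outer.x1)
    (h2 : R.outer.y0 < v) (h3 : v ≤ R.outer.y1) (hav : a < v) (hvb : v ≤ b) :
    ∃ i, (R.tile i).x0 = u ∧ (R.tile i).y0 < v ∧ v ≤ (R.tile i).y1 := by
  obtain ⟨i, g1, g2, g3, g4⟩ := R.exists_se h0 h1 h2 h3
  refine ⟨i, le_antisymm g1 (not_lt.1 fun h => ?_), g3, g4⟩
  rcases hc i h g2 with h5 | h5 <;> linarith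

theorem Tiling.Clear.exists_sw {v : ℝ} (h0 : R.outer.x0 < u) (h1 : u ≤ R.outer.x1)
    (h2 : R.outer.y0 < v) (h3 : v ≤ R.outer.y1) (hav : a < v) (hvb : v ≤ b) :
    ∃ i, (R.tile i).x1 = u ∧ (R.tile i).y0 < v ∧ v ≤ (R.tile i).y1 := by
  obtain ⟨i, g1, g2, g3, g4⟩ := R.exists_sw h0 h1 h2 h3
  refine ⟨i, le_antisymm (not_lt.1 fun h => ?_) g2, g3, g4⟩
  rcases hc i g1 h with h5 | h5 <;> linarith

end germs

theorem Tiling.eq_of_x0 (R : Tiling n) {i j : Fin n} (h : (R.tile i).x0 = (R.tile j).x0)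
    (h3 : (R.tile i).y0 < (R.tile j).y1) (h4 : (R.tile j).y0 < (R.tile i).y1) : i = j :=
  R.tile_eq (h ▸ R.hx j) (h ▸ R.hx i) h3 h4

theorem Tiling.eq_of_x1 (R : Tiling n) {i j : Fin n} (h : (R.tile i).x1 = (R.tile j).x1)
    (h3 : (R.tile i).y0 < (R.tile j).y1) (h4 : (R.tile j).y0 < (R.tile i).y1) : i = j :=
  R.tile_eq (h ▸ R.hx i) (h ▸ R.hx j) h3 h4

/-- If the bottom of `i` and the top of `j` met the wall at the same point, the tile below `i` and
the tile above `j` would complete a crossing there. -/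
theorem Tiling.IsGeneric.ne_of_sameV (hR : R.IsGeneric) {i j : Fin n} (h : R.SameV i j) :
    (R.tile i).y0 ≠ (R.tile j).y1 := by
  intro he
  obtain ⟨hx, hc⟩ := h
  have hxi := R.hx i
  have hxj := R.hx j
  have hyi := R.hy i
  have hyj := R.hy j
  obtain ⟨bi1, bi2, bi3, bi4⟩ := R.bounds i
  obtain ⟨bj1, bj2, bj3, bj4⟩ := R.bounds j
  rw [min_eq_right (by linarith), max_eq_left (by linarith)] at hc
  obtain ⟨a, a1, a2, a3⟩ := hc.exists_ne (v := (R.tile i).y0) (by linarith) (by linarith)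
    (by linarith) (by linarith) (by linarith) (by linarith)
  obtain ⟨c, c1, c2, c3⟩ := hc.exists_sw (v := (R.tile i).y0) (by linarith) (by linarith)
    (by linarith) (by linarith) (by linarith) (by linarith)
  have ha : (R.tile a).y0 = (R.tile i).y0 := by
    by_contra hne
    have hlt := lt_of_le_of_ne a2 hne
    have := R.eq_of_x0 (i := a) (j := j) (by linarith) (by linarith) (by linarith)
    subst this
    linarith
  have hc' : (R.tile c).y1 = (R.tile i).y0 := by
    by_contra hne
    have hlt := lt_of_le_of_ne c3 (Ne.symm hne)
    have := R.eq_of_x1 (i := c) (j := i) (by linarith) (by linarith) (by linarith)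
    subst this
    linarith
  exact hR.no_cross (a := a) (b := i) (c := c) (d := j) ⟨a1, ha⟩ ⟨rfl, rfl⟩ ⟨c1, hc'⟩
    ⟨hx.symm, he.symm⟩

/-- Of the two tiles, consider the one whose bottom edge is higher, and the tile directly below it
on the same side of the wall. By genericity no wall ends at this junction from the other side, so
one opposite tile is adjacent to both. This replaces the higher tile by the lower one; the induction
is on the ranks of the bottom edges. -/
theorem Tiling.IsGeneric.zigzag_of_sameV (hR : R.IsGeneric) {i j : Fin n} (h : R.SameV i j) :
    Zigzag (fun a b => (R.tile a).LeftOf (R.tile b)) (Sum.inl i) (Sum.inr j) := by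
  classical
  let rk : Fin n → ℕ := fun k => (Finset.univ.filter fun m => (R.tile m).y0 < (R.tile k).y0).card
  have hrk : ∀ k l, (R.tile k).y0 < (R.tile l).y0 → rk k < rk l := by
    intro k l hkl
    apply Finset.card_lt_card
    rw [Finset.ssubset_iff_of_subset]
    · exact ⟨k, by simp [hkl], by simp⟩
    · intro m hm
      simp only [Finset.mem_filter, Finset.mem_univ, true_and] at hm ⊢
      exact hm.trans hkl
  induction hN : rk i + rk j using Nat.strong_induction_on generalizing i j with
  | _ N ih =>
    have h0 := h
    obtain ⟨hx, hc⟩ := h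
    have hxi := R.hx i
    have hxj := R.hx j
    have hyi := R.hy i
    have hyj := R.hy j
    obtain ⟨bi1, bi2, bi3, bi4⟩ := R.bounds i
    obtain ⟨bj1, bj2, bj3, bj4⟩ := R.bounds j
    have hmin1 := min_le_left (R.tile i).y0 (R.tile j).y0
    have hmin2 := min_le_right (R.tile i).y0 (R.tile j).y0
    have hmax1 := le_max_left (R.tile i).y1 (R.tile j).y1
    have hmax2 := le_max_right (R.tile i).y1 (R.tile j).y1
    rcases lt_trichotomy (R.tile i).y0 (R.tile j).y0 with hlt | heq | hlt
    · obtain ⟨a, a1, a2, a3⟩ := hc.exists_nw (v := (R.tile j).y0) (by linarith) (by linarith)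
        (by linarith) (by linarith) (by linarith) (by linarith)
      obtain ⟨c, c1, c2, c3⟩ := hc.exists_se (v := (R.tile j).y0) (by linarith) (by linarith)
        (by linarith) (by linarith) (by linarith) (by linarith)
      obtain ⟨d, d1, d2, d3⟩ := hc.exists_sw (v := (R.tile j).y0) (by linarith) (by linarith)
        (by linarith) (by linarith) (by linarith) (by linarith)
      have hc1 : (R.tile c).y1 = (R.tile j).y0 := by
        by_contra hne
        have hlt := lt_of_le_of_ne c3 (Ne.symm hne)
        have := R.eq_of_x0 (i := c) (j := j) (by linarith) (by linarith) (by linarith)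
        subst this
        linarith
      have haj : (R.tile a).LeftOf (R.tile j) :=
        (R.leftOf_iff _ _).2 ⟨by linarith, by linarith, by linarith⟩
      have ha0 : (R.tile a).y0 < (R.tile j).y0 := by
        refine lt_of_le_of_ne a2 fun e => ?_
        have hd : (R.tile d).y1 = (R.tile j).y0 := by
          by_contra hne
          have hlt := lt_of_le_of_ne d3 (Ne.symm hne)
          have := R.eq_of_x1 (i := d) (j := a) (by linarith) (by linarith) (by linarith)
          subst this
          linarith
        exact hR.no_cross (a := j) (b := a) (c := d) (d := c) ⟨hx.symm, rfl⟩ ⟨a1, e⟩ ⟨d1, hd⟩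
          ⟨c1, hc1⟩
      have hyc := R.hy c
      have hac : (R.tile a).LeftOf (R.tile c) :=
        (R.leftOf_iff _ _).2 ⟨by linarith, by linarith, by linarith⟩
      have hic : Zigzag (fun a b => (R.tile a).LeftOf (R.tile b)) (Sum.inl i) (Sum.inr c) := by
        by_cases hov : (R.tile c).y0 < (R.tile i).y1
        · exact Zigzag.of ((R.leftOf_iff _ _).2 ⟨c1.symm, by linarith, hov⟩)
        · refine ih (rk i + rk c) (by have := hrk c j c2; omega) ⟨c1.symm, ?_⟩ rfl
          refine hc.mono ?_ ?_
          · exact le_min hmin1 (by linarith)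
          · exact max_le hmax1 (by linarith)
      exact (hic.trans _ _ _ ((Zigzag.of (L := fun a b => (R.tile a).LeftOf (R.tile b)) hac).symm)).trans _ _ _
        (Zigzag.of (L := fun a b => (R.tile a).LeftOf (R.tile b)) haj)
    · exact Zigzag.of ((R.leftOf_iff _ _).2 ⟨hx, by linarith, by linarith⟩)
    · obtain ⟨a, a1, a2, a3⟩ := hc.exists_ne (v := (R.tile i).y0) (by linarith) (by linarith)
        (by linarith) (by linarith) (by linarith) (by linarith)
      obtain ⟨c, c1, c2, c3⟩ := hc.exists_sw (v := (R.tile i).y0) (by linarith) (by linarith)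
        (by linarith) (by linarith) (by linarith) (by linarith)
      obtain ⟨d, d1, d2, d3⟩ := hc.exists_se (v := (R.tile i).y0) (by linarith) (by linarith)
        (by linarith) (by linarith) (by linarith) (by linarith)
      have hc1 : (R.tile c).y1 = (R.tile i).y0 := by
        by_contra hne
        have hlt := lt_of_le_of_ne c3 (Ne.symm hne)
        have := R.eq_of_x1 (i := c) (j := i) (by linarith) (by linarith) (by linarith)
        subst this
        linarith
      have hia : (R.tile i).LeftOf (R.tile a) :=
        (R.leftOf_iff _ _).2 ⟨by linarith, by linarith, by linarith⟩
      have ha0 : (R.tile a).y0 < (R.tile i).y0 := by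
        refine lt_of_le_of_ne a2 fun e => ?_
        have hd : (R.tile d).y1 = (R.tile i).y0 := by
          by_contra hne
          have hlt := lt_of_le_of_ne d3 (Ne.symm hne)
          have := R.eq_of_x0 (i := d) (j := a) (by linarith) (by linarith) (by linarith)
          subst this
          linarith
        exact hR.no_cross (a := a) (b := i) (c := c) (d := d) ⟨a1, e⟩ ⟨rfl, rfl⟩ ⟨c1, hc1⟩
          ⟨d1, hd⟩
      have hyc := R.hy c
      have hca : (R.tile c).LeftOf (R.tile a) :=
        (R.leftOf_iff _ _).2 ⟨by linarith, by linarith, by linarith⟩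
      have hcj : Zigzag (fun a b => (R.tile a).LeftOf (R.tile b)) (Sum.inl c) (Sum.inr j) := by
        by_cases hov : (R.tile c).y0 < (R.tile j).y1
        · exact Zigzag.of ((R.leftOf_iff _ _).2 ⟨by linarith, hov, by linarith⟩)
        · refine ih (rk c + rk j) (by have := hrk c i c2; omega) ⟨by linarith, ?_⟩ rfl
          rw [c1]
          refine hc.mono ?_ ?_
          · exact le_min (by linarith) hmin2
          · exact max_le (by linarith) hmax2
      exact ((Zigzag.of (L := fun a b => (R.tile a).LeftOf (R.tile b)) hia).trans _ _ _
        ((Zigzag.of (L := fun a b => (R.tile a).LeftOf (R.tile b)) hca).symm)).trans _ _ _ hcj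

end wall

end Rectangulation

namespace Rectangulation

/-! ### Adjacency in a build -/

section ids
variable {n : ℕ} {t : ℕ → ℕ} (hT : TimeInj n t)
include hT

theorem TimeInj.bo_pred_tp {a : ℕ} (ha : a < n) (h0 : 0 < tp t a) :
    bo n t (tp t a - 1) = tp t a := by
  obtain ⟨h1, h2, h3⟩ := hT.tp_spec ha
  apply bo_eq
  · omega
  · omega
  · intro m h4 h5; omega
  · intro h
    have h5 := h3 h0
    by_cases h6 : tp t a = a
    · rw [h6] at h5 ⊢; exact h5.le
    · have := h2 (tp t a) le_rfl (by omega); omega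

theorem TimeInj.tp_bo {a : ℕ} (ha : a < n) (h0 : bo n t a < n) : tp t (bo n t a) = bo n t a := by
  obtain ⟨h1, h2, h3, h4⟩ := hT.bo_spec ha
  apply tp_eq le_rfl
  · intro m h3 h4; omega
  · intro h
    have h5 := h4 (by omega)
    by_cases h6 : bo n t a - 1 = a
    · rw [h6]; exact h5.le
    · have := h3 (bo n t a - 1) (by omega) (by omega); omega

/-- If the tile `tp t i - 1`, which rests on the top line of `i`, does not end on the wall at the
right of `i`, then `i` is the highest tile on the left of that wall. The wall stops there, and the
highest tile `rt n t i` on its right has the same top line. -/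
theorem TimeInj.tp_rt_of_top {i : ℕ} (hi : i < n) (hv : rt n t i < n)
    (h : 0 < tp t i → rt n t (tp t i - 1) ≠ rt n t i) : tp t (rt n t i) = tp t i := by
  obtain ⟨r1, r0, r2, r3⟩ := hT.rt_spec hi
  obtain ⟨u1, u2, u3⟩ := hT.tp_spec hi
  have h3 := r3 hv
  apply tp_eq (by omega)
  · intro m h4 h5
    rcases lt_trichotomy m i with h6 | h6 | h6
    · have := u2 m h4 h6; omega
    · rw [h6]; exact h3
    · have := r2 m h6 h5; omega
  · intro h0
    by_contra hlt
    apply h h0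
    have h7 := u3 h0
    apply rt_eq (by omega) r0
    · intro m h4 h5
      rcases lt_trichotomy m i with h6 | h6 | h6
      · have := u2 m (by omega) h6; omega
      · rw [h6]; exact h7
      · have := r2 m h6 h5; omega
    · intro _; omega

/-- The same at the lower end of the wall: if `j` is the lowest tile on the right, the lowest tile
`lf t j - 1` on the left has the same bottom line. -/
theorem TimeInj.bo_lf_of_bot {j : ℕ} (hj : j < n) (hv : 0 < lf t j)
    (h : bo n t j < n → lf t (bo n t j) ≠ lf t j) : bo n t (lf t j - 1) = bo n t j := by
  obtain ⟨l1, l2, l3⟩ := hT.lf_spec hj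
  obtain ⟨b1, b0, b2, b3⟩ := hT.bo_spec hj
  have h3 := l3 hv
  apply bo_eq (by omega) b0
  · intro m h4 h5
    rcases lt_trichotomy m j with h6 | h6 | h6
    · have := l2 m (by omega) h6; omega
    · rw [h6]; exact h3
    · have := b2 m h6 h5; omega
  · intro h0
    by_contra hlt
    apply h h0
    have h7 := b3 h0
    apply lf_eq (by omega)
    · intro m h4 h5
      rcases lt_trichotomy m j with h6 | h6 | h6
      · have := l2 m (by omega) h6; omega
      · rw [h6]; exact h7
      · have := b2 m h6 h5; omega
    · intro _; omega

end ids

section build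
variable {n : ℕ} {t : ℕ → ℕ} {X Y : ℕ → ℝ} (h : Build n t X Y)
include h

/-- The coordinates `X` need not be injective, so two different walls may lie on one vertical line.
Tiles on different walls cannot be adjacent, however: between the two ids there is a tile of
positive width separating the walls horizontally, or a horizontal line that separates `i` from `j`.
-/
theorem Build.ids_of_leftOf {i j : ℕ} (hi : i < n) (hj : j < n) (hX : X (rt n t i) = X (lf t j))
    (h1 : Y (bo n t i) < Y (tp t j)) (h2 : Y (bo n t j) < Y (tp t i)) :
    rt n t i = lf t j := by
  have hT := h.inj
  have hxi := h.ndx i hi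
  have hxj := h.ndx j hj
  obtain ⟨hij, htt⟩ : i < j ∧ t i < t j := by
    rcases lt_trichotomy i j with h3 | h3 | h3
    · rcases lt_trichotomy (t i) (t j) with h4 | h4 | h4
      · exact ⟨h3, h4⟩
      · have := hT i j hi hj h4; omega
      · have := h.cy i j h3 hj h4; linarith
    · subst h3; linarith
    · rcases lt_trichotomy (t i) (t j) with h4 | h4 | h4
      · have := h.cy j i h3 hi h4; linarith
      · have := hT i j hi hj h4; omega
      · have := h.cx j i h3 hi h4; linarith
  by_contra hne
  have hle := hT.rt_le_lf hij hj htt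
  obtain ⟨r1, r0, r2, r3⟩ := hT.rt_spec hi
  obtain ⟨l1, l2, l3⟩ := hT.lf_spec hj
  -- Let `m` be the first label from `rt n t i` on that is earlier than `j`. If it is later than
  -- `i`, its left edge lies on line `rt n t i` and its right edge is not to the right of line `lf t
  -- j`, although both lines have the same coordinate. If it is earlier than `i`, the horizontal
  -- line `m` is above `j` and below `i`.
  have hex : ∃ m, rt n t i ≤ m ∧ t m < t j := ⟨lf t j - 1, by omega, l3 (by omega)⟩
  classical
  obtain ⟨m1, m2⟩ := Nat.find_spec hex
  have m3 : ∀ k, rt n t i ≤ k → k < Nat.find hex → t j ≤ t k := fun k h4 h5 => by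
    by_contra h6
    exact Nat.find_min hex h5 ⟨h4, not_le.1 h6⟩
  have m4 : Nat.find hex ≤ lf t j - 1 := Nat.find_min' hex ⟨by omega, l3 (by omega)⟩
  set m := Nat.find hex
  have hmj := h.cx m j (by omega) hj m2
  have hmx := h.ndx m (by omega)
  have hpv : t (rt n t i - 1) ≤ t i := by
    by_cases h4 : rt n t i - 1 = i
    · rw [h4]
    · exact (r2 _ (by omega) (by omega)).le
  have hlf : t i < t m → False := by
    intro h4
    have : lf t m = rt n t i := lf_eq m1 (fun k h5 h6 => by have := m3 k h5 h6; omega)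
      (fun _ => by omega)
    rw [this] at hmx
    linarith
  by_cases h5 : m = rt n t i
  · apply hlf
    have := r3 (by omega)
    rwa [h5]
  · have h6 := m3 (m - 1) (by omega) (by omega)
    have h7 : t m < t i := by
      have : t m ≠ t i := fun e => by have := hT m i (by omega) hi e; omega
      by_contra h8
      exact hlf (by omega)
    have htp : tp t m = m := tp_eq le_rfl (fun k _ _ => by omega) (fun _ => by omega)
    have hbo : bo n t (m - 1) = m :=
      bo_eq (by omega) (by omega) (fun k _ _ => by omega) (fun _ => by omega)
    have h8 := h.cy i m (by omega) (by omega) h7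
    have h9 : t j < t (m - 1) := by
      have : t (m - 1) ≠ t j := fun e => by have := hT (m - 1) j (by omega) hj e; omega
      omega
    have h10 := h.cy (m - 1) j (by omega) hj h9
    rw [htp] at h8
    rw [hbo] at h10
    linarith

/-- On a common wall, `i` and `j` overlap if the mark of `i` comes before that of `j`, and the mark
of the tile above `i` does not come before that of the tile below `j`. These two tiles are `tp t i -
1` and `bo n t j`, if they reach the wall. If one of them does not, the wall ends with `i` or `j` on
that side and the second condition holds by itself. So adjacency is a matter of ids and of the order
of marks. -/
theorem Build.leftOf_line_iff
    (hne : ∀ i j, i < n → j < n → rt n t i = lf t j → Y (bo n t i) ≠ Y (tp t j))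
    {i j : ℕ} (hi : i < n) (hj : j < n) :
    (lineRect n t X Y i).LeftOf (lineRect n t X Y j) ↔
      rt n t i = lf t j ∧ Y (bo n t i) < Y (tp t j) ∧
      ∀ i' j', i' < n → j' < n → i' + 1 = tp t i → j' = bo n t j → rt n t i' = rt n t i →
        lf t j' = lf t j → ¬ Y (bo n t i') < Y (tp t j') := by
  have hT := h.inj
  rw [Rectangulation.leftOf_iff _ _ (h.ndy i hi) (h.ndy j hj)]
  change (X (rt n t i) = X (lf t j) ∧ Y (bo n t i) < Y (tp t j) ∧ Y (bo n t j) < Y (tp t i)) ↔ _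
  constructor
  · rintro ⟨h1, h2, h3⟩
    refine ⟨h.ids_of_leftOf hi hj h1 h2 h3, h2, fun i' j' hi' hj' e1 e2 _ _ => ?_⟩
    have e3 : bo n t i' = tp t i := by
      rw [← hT.bo_pred_tp hi (by omega)]; congr 1; omega
    have e4 : tp t j' = bo n t j := by rw [e2, hT.tp_bo hj (by omega)]
    rw [e3, e4]
    exact h3.not_gt
  · rintro ⟨h1, h2, h3⟩
    refine ⟨by rw [h1], h2, ?_⟩
    obtain ⟨r1, r0, r2, r3⟩ := hT.rt_spec hi
    obtain ⟨l1, l2, l3⟩ := hT.lf_spec hj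
    by_cases hb : 0 < tp t i → rt n t (tp t i - 1) ≠ rt n t i
    · rw [← hT.tp_rt_of_top hi (by omega) hb]
      have hvj : rt n t i = j ∨ Y (tp t j) ≤ Y (bo n t (rt n t i)) := by
        by_cases h4 : rt n t i = j
        · exact Or.inl h4
        · right
          exact h.cy _ _ (by omega) hj (l2 _ (by omega) (by omega))
      rcases hvj with h4 | h4
      · rw [h4]; exact h.ndy j hj
      · exact (h.ndy j hj).trans_le (h4.trans (h.ndy _ (by omega)).le)
    · by_cases hb' : bo n t j < n → lf t (bo n t j) ≠ lf t j
      · rw [← hT.bo_lf_of_bot hj (by omega) hb', ← h1]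
        have hvi : rt n t i - 1 = i ∨ Y (tp t (rt n t i - 1)) ≤ Y (bo n t i) := by
          by_cases h4 : rt n t i - 1 = i
          · exact Or.inl h4
          · right
            exact h.cy _ _ (by omega) (by omega) (r2 _ (by omega) (by omega))
        rcases hvi with h4 | h4
        · rw [h4]; exact h.ndy i hi
        · exact (h.ndy _ (by omega)).trans_le (h4.trans (h.ndy i hi).le)
      · push Not at hb hb'
        have u1 := (hT.tp_spec hi).1
        have h4 := h3 (tp t i - 1) (bo n t j) (by omega) hb'.1 (by omega) rfl hb.2 hb'.2
        have h5 := hne (tp t i - 1) (bo n t j) (by omega) hb'.1 (by rw [hb.2, hb'.2, h1])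
        rw [hT.bo_pred_tp hi hb.1, hT.tp_bo hj hb'.1] at h4 h5
        exact lt_of_le_of_ne (not_lt.1 h4) h5.symm

theorem Build.below_line_iff
    (hne : ∀ i j, i < n → j < n → tp t i = bo n t j → X (lf t i) ≠ X (rt n t j))
    {i j : ℕ} (hi : i < n) (hj : j < n) :
    (lineRect n t X Y i).Below (lineRect n t X Y j) ↔
      tp t i = bo n t j ∧ X (lf t i) < X (rt n t j) ∧
      ∀ i' j', i' < n → j' < n → i' = rt n t i → j' + 1 = lf t j → tp t i' = tp t i →
        bo n t j' = bo n t j → ¬ X (lf t i') < X (rt n t j') := by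
  have hT := h.inj
  have rep : ∀ a, a < n → ∃ b, b < n ∧ a = n - 1 - b := fun a ha =>
    ⟨n - 1 - a, by omega, by omega⟩
  have key : ∀ a, a < n → flipLine n Y (lf (flipT n t) (n - 1 - a)) = Y (bo n t a) ∧
      flipLine n Y (rt n (flipT n t) (n - 1 - a)) = Y (tp t a) ∧
      flipLine n X (bo n (flipT n t) (n - 1 - a)) = X (lf t a) ∧
      flipLine n X (tp (flipT n t) (n - 1 - a)) = X (rt n t a) := by
    intro a ha
    have := lineRect_flip hT X Y ha
    unfold lineRect at this
    simp only [Rect.mk.injEq] at this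
    exact this
  have hle : ∀ a, a < n → tp t a ≤ n ∧ bo n t a ≤ n ∧ rt n t a ≤ n ∧ lf t a ≤ n := fun a ha =>
    ⟨by have := hT.tp_spec ha; omega, (hT.bo_spec ha).2.1, (hT.rt_spec ha).2.1,
      by have := hT.lf_spec ha; omega⟩
  have hk := h.flip.leftOf_line_iff (by
    intro i j hi hj e
    obtain ⟨a, ha, rfl⟩ := rep i hi
    obtain ⟨b, hb, rfl⟩ := rep j hj
    rw [(key a ha).2.2.1, (key b hb).2.2.2]
    rw [hT.rt_flip ha, hT.lf_flip hb] at e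
    have := hle a ha
    have := hle b hb
    exact hne a b ha hb (by omega)) (i := n - 1 - i) (j := n - 1 - j) (by omega) (by omega)
  rw [lineRect_flip hT X Y hi, lineRect_flip hT X Y hj] at hk
  refine Iff.trans hk ?_
  rw [(key i hi).2.2.1, (key j hj).2.2.2, hT.rt_flip hi, hT.lf_flip hj, hT.tp_flip hi,
    hT.bo_flip hj]
  have hli := hle i hi
  have hlj := hle j hj
  refine and_congr (by omega) (and_congr Iff.rfl ?_)
  constructor
  · intro hall i' j' hi' hj' e1 e2 e3 e4
    have hli' := hle i' hi'
    have hlj' := hle j' hj'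
    have := hall (n - 1 - i') (n - 1 - j') (by omega) (by omega) (by omega) (by omega)
      (by rw [hT.rt_flip hi', e3]) (by rw [hT.lf_flip hj', e4])
    rwa [(key i' hi').2.2.1, (key j' hj').2.2.2] at this
  · intro hall i' j' hi' hj' e1 e2 e3 e4
    obtain ⟨a, ha, rfl⟩ := rep i' hi'
    obtain ⟨b, hb, rfl⟩ := rep j' hj'
    have hla := hle a ha
    have hlb := hle b hb
    rw [hT.rt_flip ha] at e3
    rw [hT.lf_flip hb] at e4
    rw [(key a ha).2.2.1, (key b hb).2.2.2]
    exact hall a b ha hb (by omega) (by omega) (by omega) (by omega)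

end build

/-- Two builds with the same ids and the same order of the marks on all walls have the same
adjacencies. -/
theorem Build.sameRel {n : ℕ} {t t' : ℕ → ℕ} {X Y X' Y' : ℕ → ℝ} (h : Build n t X Y)
    (h' : Build n t' X' Y') (hid : SameIds n t t')
    (hV : ∀ i j, i < n → j < n → rt n t i = lf t j → Y (bo n t i) ≠ Y (tp t j))
    (hV' : ∀ i j, i < n → j < n → rt n t i = lf t j → Y' (bo n t i) ≠ Y' (tp t j))
    (hH : ∀ i j, i < n → j < n → tp t i = bo n t j → X (lf t i) ≠ X (rt n t j))
    (hH' : ∀ i j, i < n → j < n → tp t i = bo n t j → X' (lf t i) ≠ X' (rt n t j))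
    (hcV : ∀ i j, i < n → j < n → rt n t i = lf t j →
      (Y (bo n t i) < Y (tp t j) ↔ Y' (bo n t i) < Y' (tp t j)))
    (hcH : ∀ i j, i < n → j < n → tp t i = bo n t j →
      (X (lf t i) < X (rt n t j) ↔ X' (lf t i) < X' (rt n t j))) :
    SameRel (fun i : Fin n => lineRect n t X Y i) (fun i => lineRect n t' X' Y' i) := by
  have e1 : ∀ a, a < n → lf t' a = lf t a := fun a ha => (hid a ha).1.symm
  have e2 : ∀ a, a < n → rt n t' a = rt n t a := fun a ha => (hid a ha).2.1.symm
  have e3 : ∀ a, a < n → tp t' a = tp t a := fun a ha => (hid a ha).2.2.1.symm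
  have e4 : ∀ a, a < n → bo n t' a = bo n t a := fun a ha => (hid a ha).2.2.2.symm
  intro i j
  have hi := i.2
  have hj := j.2
  constructor
  · rw [h.leftOf_line_iff hV hi hj, h'.leftOf_line_iff (fun i j hi hj => by
      rw [e2 i hi, e1 j hj, e4 i hi, e3 j hj]; exact hV' i j hi hj) hi hj,
      e2 _ hi, e1 _ hj, e4 _ hi, e3 _ hj, e3 _ hi, e4 _ hj]
    refine and_congr_right fun hw => and_congr (hcV i j hi hj hw) ?_
    refine forall_congr' fun i' => forall_congr' fun j' => forall_congr' fun hi' =>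
      forall_congr' fun hj' => ?_
    rw [e2 _ hi', e1 _ hj', e4 _ hi', e3 _ hj']
    refine forall_congr' fun _ => forall_congr' fun _ => forall_congr' fun k1 =>
      forall_congr' fun k2 => not_congr (hcV i' j' hi' hj' (by rw [k1, k2, hw]))
  · rw [h.below_line_iff hH hi hj, h'.below_line_iff (fun i j hi hj => by
      rw [e3 i hi, e4 j hj, e1 i hi, e2 j hj]; exact hH' i j hi hj) hi hj,
      e3 _ hi, e4 _ hj, e1 _ hi, e2 _ hj, e2 _ hi, e1 _ hj]
    refine and_congr_right fun hw => and_congr (hcH i j hi hj hw) ?_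
    refine forall_congr' fun i' => forall_congr' fun j' => forall_congr' fun hi' =>
      forall_congr' fun hj' => ?_
    rw [e3 _ hi', e4 _ hj', e1 _ hi', e2 _ hj']
    refine forall_congr' fun _ => forall_congr' fun _ => forall_congr' fun k1 =>
      forall_congr' fun k2 => not_congr (hcH i' j' hi' hj' (by rw [k1, k2, hw]))

end Rectangulation

namespace Rectangulation

/-! ### Relabelling, and walls of tilings given by builds -/

theorem Zigzag.map {ι κ : Type*} {L : ι → ι → Prop} {L' : κ → κ → Prop} (e : ι → κ)
    (hL : ∀ a b, L a b → L' (e a) (e b)) {u v : ι ⊕ ι} (h : Zigzag L u v) :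
    Zigzag L' (u.map e e) (v.map e e) := by
  induction h with
  | rel u v h =>
    obtain ⟨i, j, rfl, rfl, h⟩ := h
    exact Zigzag.of (hL i j h)
  | refl u => exact Relation.EqvGen.refl _
  | symm u v _ ih => exact ih.symm
  | trans u v w _ _ ih1 ih2 => exact Relation.EqvGen.trans _ _ _ ih1 ih2

theorem Zigzag.elim {ι κ : Type*} {L : ι → ι → Prop} (f g : ι → κ)
    (hL : ∀ a b, L a b → f a = g b) {u v : ι ⊕ ι} (h : Zigzag L u v) :
    Sum.elim f g u = Sum.elim f g v := by
  induction h with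
  | rel u v h =>
    obtain ⟨i, j, rfl, rfl, h⟩ := h
    exact hL i j h
  | refl u => rfl
  | symm u v _ ih => exact ih.symm
  | trans u v w _ _ ih1 ih2 => exact ih1.trans ih2

/-- Permuting the labels of a tiling. -/
def Tiling.relabel {n : ℕ} (R : Tiling n) (e : Equiv.Perm (Fin n)) : Tiling n where
  outer := R.outer
  tile i := R.tile (e i)
  outer_nondeg := R.outer_nondeg
  tile_nondeg i := R.tile_nondeg (e i)
  disjoint i j hij := R.disjoint _ _ fun h => hij (e.injective h)
  cover := by
    rw [← R.cover]
    exact e.surjective.iUnion_comp fun i => (R.tile i).toSet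

theorem Tiling.IsGeneric.relabel {n : ℕ} {R : Tiling n} (h : R.IsGeneric)
    (e : Equiv.Perm (Fin n)) : (R.relabel e).IsGeneric := by
  intro p
  have h1 := h p
  have h2 : {i | p ∈ ((R.relabel e).tile i).corners} = e ⁻¹' {i | p ∈ (R.tile i).corners} := rfl
  rw [h2, Set.ncard_preimage_of_injective_subset_range e.injective (by simp)]
  exact h1

theorem Tiling.clear_relabel {n : ℕ} {R : Tiling n} (e : Equiv.Perm (Fin n)) {u a b : ℝ} :
    (R.relabel e).Clear u a b ↔ R.Clear u a b :=
  ⟨fun h m => by simpa [Tiling.relabel] using h (e.symm m), fun h m => h (e m)⟩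

theorem Tiling.sameV_relabel {n : ℕ} {R : Tiling n} (e : Equiv.Perm (Fin n)) (i j : Fin n) :
    (R.relabel e).SameV i j ↔ R.SameV (e i) (e j) :=
  and_congr Iff.rfl (Tiling.clear_relabel e)

theorem Tiling.avoids_relabel {n : ℕ} {R : Tiling n} (e : Equiv.Perm (Fin n)) (W : Seg) :
    (R.relabel e).Avoids W ↔ R.Avoids W :=
  and_congr Iff.rfl (and_congr Iff.rfl (e.forall_congr_left.symm.symm.trans (by
    simp [Tiling.relabel])))

theorem Tiling.isWall_relabel {n : ℕ} {R : Tiling n} (e : Equiv.Perm (Fin n)) (W : Seg) :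
    (R.relabel e).IsWall W ↔ R.IsWall W := by
  unfold Tiling.IsWall
  simp only [Tiling.avoids_relabel]
  rfl

/-- The transposed tiling with reversed labels. -/
def Tiling.flip {n : ℕ} (R : Tiling n) : Tiling n := R.swap.relabel Fin.revPerm

section
variable {n : ℕ} {t : ℕ → ℕ} {X Y : ℕ → ℝ} {R : Tiling n}

/-- The tiles of `R` are given by the lines `X`, `Y`. -/
def Tiling.HasLines (R : Tiling n) (t : ℕ → ℕ) (X Y : ℕ → ℝ) : Prop :=
  ∀ i : Fin n, R.tile i = lineRect n t X Y i

theorem Tiling.HasLines.flip (hT : TimeInj n t) (hR : R.HasLines t X Y) :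
    R.flip.HasLines (flipT n t) (flipLine n Y) (flipLine n X) := by
  intro i
  have h1 : ((i.rev : Fin n) : ℕ) = n - 1 - i := by rw [Fin.val_rev]; omega
  have h2 : (i : ℕ) = n - 1 - (i.rev : Fin n) := by omega
  rw [h2, lineRect_flip hT X Y i.rev.2]
  change (R.tile i.rev).swap = _
  rw [hR i.rev]
  rfl

/-- The tiles whose left edge has the id `v` form an unbroken column on the right, from the top of
tile `v` down to the bottom line of tile `v - 1`. A tile crossing the line in this range would
overlap a tile of the column, and the edges of `i` and `j` lie in the range. -/
theorem Build.sameV_of_ids (h : Build n t X Y) (hR : R.HasLines t X Y) {i j : Fin n}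
    (hij : rt n t i = lf t j) : R.SameV i j := by
  have hT := h.inj
  obtain ⟨r1, r0, r2, r3⟩ := hT.rt_spec i.2
  obtain ⟨l1, l2, l3⟩ := hT.lf_spec j.2
  have hv0 : 0 < lf t j := by omega
  have hvn : rt n t i < n := by omega
  have hjlast := l3 hv0
  have hifirst := r3 hvn
  have bot : ∀ d, ∀ j : ℕ, n - j = d → j < n → lf t j = rt n t i →
      Y (bo n t (rt n t i - 1)) ≤ Y (bo n t j) := by
    intro d
    induction d using Nat.strong_induction_on with
    | _ d ih =>
      intro j hd hj hlj
      by_cases hb : bo n t j < n → lf t (bo n t j) ≠ lf t j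
      · rw [← hlj, hT.bo_lf_of_bot hj (by omega) hb]
      · push Not at hb
        have h1 := (hT.bo_spec hj).1
        have h2 := ih (n - bo n t j) (by omega) _ rfl hb.1 (by omega)
        have h3 := h.ndy _ hb.1
        rw [hT.tp_bo hj hb.1] at h3
        exact h2.trans h3.le
  have top : ∀ i' : ℕ, i' < n → rt n t i' = rt n t i → Y (tp t i') ≤ Y (tp t (rt n t i)) := by
    intro i'
    induction i' using Nat.strong_induction_on with
    | _ i' ih =>
      intro hi' hr
      by_cases hb : 0 < tp t i' → rt n t (tp t i' - 1) ≠ rt n t i'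
      · rw [← hr, hT.tp_rt_of_top hi' (by omega) hb]
      · push Not at hb
        have h1 := (hT.tp_spec hi').1
        have h2 := ih (tp t i' - 1) (by omega) (by omega) (by omega)
        have h3 := h.ndy (tp t i' - 1) (by omega)
        rw [hT.bo_pred_tp hi' hb.1] at h3
        exact h3.le.trans h2
  have hclear : R.Clear (X (rt n t i)) (Y (bo n t (rt n t i - 1))) (Y (tp t (rt n t i))) := by
    intro m hm1 hm2
    by_contra hcon
    push Not at hcon
    rw [hR m] at hm1 hm2 hcon
    change X (lf t m) < X (rt n t i) at hm1
    change X (rt n t i) < X (rt n t m) at hm2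
    obtain ⟨hc1, hc2⟩ := hcon
    change Y (bo n t m) < Y (tp t (rt n t i)) at hc1
    change Y (bo n t (rt n t i - 1)) < Y (tp t m) at hc2
    have key : ∀ d, ∀ j : ℕ, n - j = d → j < n → lf t j = rt n t i →
        Y (bo n t m) < Y (tp t j) → False := by
      intro d
      induction d using Nat.strong_induction_on with
      | _ d ih =>
        intro j hd hj hlj hlt
        by_cases hov : Y (bo n t j) < Y (tp t m)
        · have hxj := h.ndx j hj
          rw [hlj] at hxj
          have hmj : m = ⟨j, hj⟩ := by
            apply R.tile_eq
            · rw [hR, hR]; exact hm1.trans hxj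
            · rw [hR, hR]
              change X (lf t j) < X (rt n t m)
              rw [hlj]; exact hm2
            · rw [hR, hR]; exact hlt
            · rw [hR, hR]; exact hov
          rw [hmj] at hm1
          change X (lf t j) < _ at hm1
          rw [hlj] at hm1
          exact lt_irrefl _ hm1
        · by_cases hb : bo n t j < n → lf t (bo n t j) ≠ lf t j
          · rw [← hT.bo_lf_of_bot hj (by omega) hb, hlj] at hov
            exact hov hc2
          · push Not at hb
            have h1 := (hT.bo_spec hj).1
            refine ih (n - bo n t j) (by omega) _ rfl hb.1 (by omega) ?_
            rw [hT.tp_bo hj hb.1]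
            exact (h.ndy m m.2).trans_le (not_lt.1 hov)
    exact key _ (rt n t i) rfl hvn (hT.lf_rt i.2 hvn) hc1
  have hbi : Y (bo n t (rt n t i - 1)) ≤ Y (bo n t i) := by
    by_cases h1 : rt n t i - 1 = i
    · rw [h1]
    · have h2 := h.cy i (rt n t i - 1) (by omega) (by omega) (r2 _ (by omega) (by omega))
      exact (h.ndy (rt n t i - 1) (by omega)).le.trans h2
  have htj : Y (tp t j) ≤ Y (tp t (rt n t i)) := by
    by_cases h1 : rt n t i = j
    · rw [h1]
    · have h2 := h.cy (rt n t i) j (by omega) j.2 (l2 _ (by omega) (by omega))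
      exact h2.trans (h.ndy (rt n t i) hvn).le
  refine ⟨?_, ?_⟩
  · rw [hR, hR]; exact congrArg X hij
  · rw [hR, hR]
    refine hclear.mono (le_min hbi ?_) (max_le ?_ htj)
    · exact bot _ j rfl j.2 hij.symm
    · exact top i i.2 rfl

theorem Build.zigzag_ids (h : Build n t X Y) (hR : R.HasLines t X Y) {i j : Fin n}
    (hz : Zigzag (fun a b => (R.tile a).LeftOf (R.tile b)) (Sum.inl i) (Sum.inr j)) :
    rt n t i = lf t j := by
  refine Zigzag.elim (fun a : Fin n => rt n t a) (fun a : Fin n => lf t a) ?_ hz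
  intro a b hab
  obtain ⟨h1, h2, h3⟩ := (R.leftOf_iff a b).1 hab
  rw [hR, hR] at h1 h2 h3
  exact h.ids_of_leftOf a.2 b.2 h1 h2 h3

/-- In a generic tiling given by lines, the same vertical wall means the same id. -/
theorem Build.ids_iff_sameV (h : Build n t X Y) (hR : R.HasLines t X Y) (hg : R.IsGeneric)
    {i j : Fin n} : rt n t i = lf t j ↔ R.SameV i j :=
  ⟨h.sameV_of_ids hR, fun hs => h.zigzag_ids hR (hg.zigzag_of_sameV hs)⟩

theorem Build.ids_flip_iff (h : Build n t X Y) (i j : Fin n) :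
    rt n (flipT n t) (i.rev : Fin n) = lf (flipT n t) (j.rev : Fin n) ↔ tp t i = bo n t j := by
  have hT := h.inj
  rw [show ((i.rev : Fin n) : ℕ) = n - 1 - i by rw [Fin.val_rev]; omega,
    show ((j.rev : Fin n) : ℕ) = n - 1 - j by rw [Fin.val_rev]; omega,
    hT.rt_flip i.2, hT.lf_flip j.2]
  have h1 := hT.tp_spec i.2
  have h2 := hT.bo_spec j.2
  omega

theorem Tiling.flip_sameV {i j : Fin n} : R.flip.SameV i.rev j.rev ↔ R.swap.SameV i j := by
  unfold Tiling.flip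
  rw [Tiling.sameV_relabel]
  simp

/-- In a generic tiling given by lines, the same horizontal wall means the same id. -/
theorem Build.ids_iff_sameH (h : Build n t X Y) (hR : R.HasLines t X Y) (hg : R.IsGeneric)
    {i j : Fin n} : tp t i = bo n t j ↔ R.swap.SameV i j := by
  rw [← h.ids_flip_iff, ← Tiling.flip_sameV]
  exact h.flip.ids_iff_sameV (hR.flip h.inj) (hg.swap.relabel _)

end

end Rectangulation

namespace Rectangulation

/-! ### Realizing a permutation by coordinates -/

/-- The vertical lines after `k` steps: conditions on the rectangles drawn so far and on the gaps
of the staircase. -/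
structure Stage (n : ℕ) (t : ℕ → ℕ) (k : ℕ) (X : ℕ → ℝ) : Prop where
  injX : ∀ v w, v ≤ n → w ≤ n → X v = X w → v = w
  ndx : ∀ a, a < n → t a < k → X (lf t a) < X (rt n t a)
  cx : ∀ i j, i < j → j < n → t i < t j → t j < k → X (rt n t i) ≤ X (lf t j)
  mark : ∀ i j, i < n → j < n → tp t i = bo n t j → t i < t j → t j < k →
    X (lf t i) < X (rt n t j)
  gap : ∀ g, g < n → k ≤ t g → X (runStart (fun m => k ≤ t m) g) <
    X (runEnd n (fun m => t m < k) (runEnd n (fun m => k ≤ t m) (g + 1)))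
  left : ∀ i g, i < g → g < n → t i < k → k ≤ t g →
    X (rt n t i) ≤ X (runStart (fun m => k ≤ t m) g)

theorem stage_zero {n : ℕ} (t : ℕ → ℕ) : Stage n t 0 stdX where
  injX v w _ _ h := Nat.cast_injective h
  ndx _ _ h := absurd h (Nat.not_lt_zero _)
  cx _ _ _ _ _ h := absurd h (Nat.not_lt_zero _)
  mark _ _ _ _ _ _ h := absurd h (Nat.not_lt_zero _)
  gap g hg _ := by
    rw [runStart_eq (f := 0) (Nat.zero_le _) (fun m _ h => Nat.zero_le _) (fun h => by omega),
      runEnd_eq (P := fun m => 0 ≤ t m) (l := n) hg le_rfl (fun m _ _ => Nat.zero_le _)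
        (fun h => by omega),
      runEnd_eq (l := n) le_rfl le_rfl (fun m h1 h2 => by omega) (fun h => by omega)]
    exact Nat.cast_lt.2 (by omega)
  left _ _ _ _ h := absurd h (Nat.not_lt_zero _)

/-- Values of `X` on lines that have not been drawn are placeholders. Drawing `a` needs a new
vertical line only if `a + 1` is later than `a`; otherwise the right edge of `a` is the existing
line `l`, where the bump to the right of the gap ends. A new line is put immediately to the left of
`l`. Then it is to the right of the left edge of every tile on which `a` rests, which is what the
order of marks along the bottom wall of `a` requires, and it leaves room for the rest of the gap. -/
theorem Stage.succ {n : ℕ} {t : ℕ → ℕ} (hT : TimeInj n t) {X : ℕ → ℝ} {a : ℕ} (ha : a < n)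
    (h : Stage n t (t a) X) : ∃ X', Stage n t (t a + 1) X' := by
  classical
  obtain ⟨l1, l2, l3⟩ := hT.lf_spec ha
  obtain ⟨b1, b0, b2, b3⟩ := hT.bo_spec ha
  obtain ⟨r1, r0, r2, r3⟩ := hT.rt_spec ha
  obtain ⟨u1, u2, u3⟩ := hT.tp_spec ha
  have hne : ∀ m, m < n → t m = t a → m = a := fun m hm e => hT m a hm ha e
  set l := runEnd n (fun m => t m < t a) (bo n t a) with hl
  obtain ⟨e1, e0, e2, e3⟩ := runEnd_spec n (fun m => t m < t a) (bo n t a) b0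
  rw [← hl] at e1 e0 e2 e3
  have hgapa : X (lf t a) < X l := by
    have := h.gap a ha le_rfl
    rwa [hT.runStart_self ha, hT.runEnd_self ha] at this
  -- the right edge of the new rectangle is a new line
  have hX' : ∃ X' : ℕ → ℝ, (∀ w, (w ≠ a + 1 ∨ n ≤ a + 1 ∨ t (a + 1) < t a) → X' w = X w) ∧
      (∀ w, w ≤ n → X w < X l → X w < X' (rt n t a)) ∧
      X' (rt n t a) ≤ X l ∧ (a + 1 < n → t a < t (a + 1) → X' (rt n t a) < X l) ∧
      (∀ v w, v ≤ n → w ≤ n → X' v = X' w → v = w) := by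
    by_cases hnew : a + 1 < n ∧ t a < t (a + 1)
    · have hrt : rt n t a = a + 1 := rt_eq le_rfl ha (fun m _ _ => by omega) fun _ => hnew.2.le
      -- No other line lies between `x` and `l`, and `x` differs from all coordinates in use, so
      -- injectivity survives.
      obtain ⟨x, hx1, hx2⟩ := exists_lt_forall_gt
        ((Set.finite_Iic n).image X) (X l)
      have hx3 : ∀ w, w ≤ n → X w ≠ x := by
        intro w hw e
        have := hx2 (X w) ⟨w, hw, rfl⟩ (by rw [e]; exact hx1)
        rw [e] at this
        exact lt_irrefl _ this
      rw [hrt]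
      refine ⟨Function.update X (a + 1) x, ?_, ?_, ?_, ?_, ?_⟩
      · rintro w (hw | hw | hw)
        · exact Function.update_of_ne hw _ _
        · omega
        · omega
      · intro w hw hlt
        rw [Function.update_self]
        exact hx2 _ ⟨w, hw, rfl⟩ hlt
      · rw [Function.update_self]; exact hx1.le
      · intro _ _; rw [Function.update_self]; exact hx1
      · intro v w hv hw e
        by_cases h1 : v = a + 1
        · by_cases h2 : w = a + 1
          · rw [h1, h2]
          · rw [h1, Function.update_self, Function.update_of_ne h2] at e
            exact absurd e.symm (hx3 w hw)
        · by_cases h2 : w = a + 1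
          · rw [h2, Function.update_self, Function.update_of_ne h1] at e
            exact absurd e (hx3 v hv)
          · rw [Function.update_of_ne h1, Function.update_of_ne h2] at e
            exact h.injX v w hv hw e
    · have hrt : rt n t a = l := by
        by_cases h1 : a + 1 < n
        · have h2 : t (a + 1) < t a := by
            have := hne (a + 1) h1; omega
          have h3 : bo n t a = a + 1 := bo_eq le_rfl ha (fun m _ _ => by omega) fun _ => h2.le
          rw [hl, h3]; rfl
        · omega
      rw [hrt]
      refine ⟨X, fun _ _ => rfl, fun _ _ h => h, le_rfl, fun h1 h2 => absurd ⟨h1, h2⟩ hnew,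
        h.injX⟩
  obtain ⟨X', hX1, hX2, hX3, hX4, hinj⟩ := hX'
  have hlfold : ∀ i, i < n → t i ≤ t a → X' (lf t i) = X (lf t i) := by
    intro i hi hti
    apply hX1
    left
    intro e
    obtain ⟨g1, g2, g3⟩ := hT.lf_spec hi
    have h1 := g3 (by omega)
    rw [show lf t i - 1 = a by omega] at h1
    omega
  have hrtold : ∀ i, i < n → t i < t a → X' (rt n t i) = X (rt n t i) := by
    intro i hi hti
    apply hX1
    left
    intro e
    obtain ⟨g1, g0, g2, g3⟩ := hT.rt_spec hi
    by_cases h1 : i = a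
    · subst h1; omega
    · have := g2 a (by omega) (by omega); omega
  have hndxa : X' (lf t a) < X' (rt n t a) := by
    rw [hlfold a ha le_rfl]
    exact hX2 _ (by omega) hgapa
  have hlt1 : ∀ m, m < n → (t m < t a + 1 ↔ t m < t a ∨ m = a) := by
    intro m hm
    have := hne m hm
    constructor
    · intro h1
      by_cases h2 : m = a
      · exact Or.inr h2
      · left; omega
    · rintro (h1 | rfl) <;> omega
  -- The tiles in the bump to the right of the gap, followed along their right edges, lead to the
  -- line `l`.
  have hchain : ∀ d, ∀ i, n - i = d → i < n → t i < t a → bo n t a ≤ i →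
      (∀ m, bo n t a ≤ m → m < i → t m < t a) → X (rt n t i) ≤ X l := by
    intro d
    induction d using Nat.strong_induction_on with
    | _ d ih =>
      intro i hd hi hti hle hrun
      obtain ⟨g1, g0, g2, g3⟩ := hT.rt_spec hi
      have hrl : rt n t i ≤ l := by
        by_contra hlt
        have hln : l < n := by omega
        have h1 := e3 hln
        rcases lt_trichotomy l i with h2 | h2 | h2
        · exact h1 (hrun l e1 h2)
        · rw [h2] at h1; exact h1 hti
        · have := g2 l h2 (by omega); omega
      rcases Nat.lt_or_ge (rt n t i) l with h1 | h1
      · have h2 := e2 (rt n t i) (by omega) h1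
        have h3 := h.ndx (rt n t i) (by omega) h2
        rw [hT.lf_rt hi (by omega)] at h3
        refine h3.le.trans (ih (n - rt n t i) (by omega) _ rfl (by omega) h2 (by omega) ?_)
        intro m h4 h5
        exact e2 m h4 (by omega)
      · rw [le_antisymm hrl h1]
  refine ⟨X', hinj, ?_, ?_, ?_, ?_, ?_⟩
  · intro i hi hti
    rcases (hlt1 i hi).1 hti with h1 | rfl
    · rw [hlfold i hi h1.le, hrtold i hi h1]; exact h.ndx i hi h1
    · exact hndxa
  · intro i j hij hj htt htj
    rcases (hlt1 j hj).1 htj with h1 | rfl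
    · rw [hrtold i (by omega) (by omega), hlfold j hj h1.le]
      exact h.cx i j hij hj htt h1
    · rw [hrtold i (by omega) htt, hlfold j hj le_rfl]
      have := h.left i j hij hj htt le_rfl
      rwa [hT.runStart_self hj] at this
  · intro i j hi hj hw htt htj
    rcases (hlt1 j hj).1 htj with h1 | rfl
    · rw [hlfold i hi (by omega), hrtold j hj h1]
      exact h.mark i j hi hj hw htt h1
    · rw [hlfold i hi htt.le]
      obtain ⟨g1, g2, g3⟩ := hT.tp_spec hi
      have h1 := (hT.lf_spec hi).1
      refine hX2 _ (by omega) ?_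
      refine (h.ndx i hi htt).trans_le (hchain _ i rfl hi htt (by omega) ?_)
      intro m h2 h3
      exact (g2 m (by omega) h3).trans htt
  · intro g hg hk
    obtain ⟨s1, s2, s3⟩ := runStart_spec (fun m => t a ≤ t m) g
    obtain ⟨q1, q0, q2, q3⟩ := runEnd_spec n (fun m => t a ≤ t m) (g + 1) hg
    have hold := h.gap g hg (by omega)
    set lo := runStart (fun m => t a ≤ t m) g with hlo
    set hi := runEnd n (fun m => t a ≤ t m) (g + 1) with hhi
    have hga : g ≠ a := by rintro rfl; omega
    -- Only the gap that contains `a` changes its run. It is split at `a`: the bump after the left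
    -- part now ends at `rt n t a`, and the right part, if there is one, begins at the new line `a +
    -- 1`.
    by_cases hin : lo ≤ a ∧ a < hi
    · obtain ⟨hin1, hin2⟩ := hin
      have hall : ∀ m, lo ≤ m → m < hi → t a ≤ t m := by
        intro m h4 h5
        rcases lt_trichotomy m g with h6 | h6 | h6
        · exact s2 m h4 h6
        · rw [h6]; omega
        · exact q2 m h6 h5
      have hlo' : lo = lf t a := by
        rw [← hT.runStart_self ha]
        exact (runStart_eq hin1 (fun m h4 h5 => hall m h4 (by omega)) s3).symm
      have hhi' : hi = bo n t a := by
        rw [← hT.runEnd_self ha]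
        exact (runEnd_eq hin2 q0 (fun m h4 h5 => hall m (by omega) h5) q3).symm
      rcases lt_or_gt_of_ne hga with h1 | h1
      · have k1 : runStart (fun m => t a + 1 ≤ t m) g = lo := by
          apply runStart_eq s1
          · intro m h4 h5
            have h6 := s2 m h4 h5
            have := hne m (by omega)
            omega
          · intro h4
            have := s3 h4; omega
        have k2 : runEnd n (fun m => t a + 1 ≤ t m) (g + 1) = a := by
          apply runEnd_eq h1 ha.le
          · intro m h4 h5
            have h6 := q2 m h4 (by omega)
            have := hne m (by omega)
            omega
          · intro _; omega
        have k3 : runEnd n (fun m => t m < t a + 1) a = rt n t a := by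
          apply runEnd_eq (by omega) r0
          · intro m h4 h5
            by_cases h6 : m = a
            · rw [h6]; omega
            · have := r2 m (by omega) h5; omega
          · intro h4
            have := r3 h4; omega
        rw [k1, k2, k3, hlo']
        exact hndxa
      · have hnew : t a < t (a + 1) := by
          have h2 := hall (a + 1) (by omega) (by omega)
          have := hne (a + 1) (by omega)
          omega
        have hrt : rt n t a = a + 1 :=
          rt_eq le_rfl ha (fun m _ _ => by omega) fun _ => hnew.le
        have k1 : runStart (fun m => t a + 1 ≤ t m) g = a + 1 := by
          apply runStart_eq h1
          · intro m h4 h5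
            have h6 := s2 m (by omega) h5
            have := hne m (by omega)
            omega
          · intro _
            change ¬ t a + 1 ≤ t a; omega
        have k2 : runEnd n (fun m => t a + 1 ≤ t m) (g + 1) = bo n t a := by
          rw [← hhi']
          apply runEnd_eq q1 q0
          · intro m h4 h5
            have h6 := q2 m h4 h5
            have := hne m (by omega)
            omega
          · intro h4
            have := q3 h4; omega
        have k3 : runEnd n (fun m => t m < t a + 1) (bo n t a) = l := by
          apply runEnd_eq e1 e0
          · intro m h4 h5
            have := e2 m h4 h5
            omega
          · intro h4
            have := e3 h4
            have := hne l h4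
            omega
        rw [k1, k2, k3, ← hrt, hX1 l (by left; omega)]
        exact hX4 (by omega) hnew
    · have h1 : runStart (fun m => t a + 1 ≤ t m) g = lo := by
        apply runStart_eq s1
        · intro m h4 h5
          have h6 := s2 m h4 h5
          have := hne m (by omega)
          have : m ≠ a := by rintro rfl; exact hin ⟨h4, by omega⟩
          omega
        · intro h4
          have := s3 h4
          omega
      have h2 : runEnd n (fun m => t a + 1 ≤ t m) (g + 1) = hi := by
        apply runEnd_eq q1 q0
        · intro m h4 h5
          have h6 := q2 m h4 h5
          have := hne m (by omega)
          have : m ≠ a := by rintro rfl; exact hin ⟨by omega, h5⟩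
          omega
        · intro h4
          have := q3 h4
          omega
      have hlo' : X' lo = X lo := by
        apply hX1
        left
        intro e
        have := s3 (by omega)
        rw [e, Nat.add_sub_cancel] at this
        exact this le_rfl
      rw [h1, h2, hlo']
      obtain ⟨w1, w0, w2, w3⟩ := runEnd_spec n (fun m => t m < t a) hi q0
      set lg := runEnd n (fun m => t m < t a) hi with hlg
      -- The gap of `g` is unchanged, but the bump after it may have ended at `a`; it then grows
      -- through `a` as far as `rt n t a`.
      by_cases hla : lg = a
      · have hhia : hi ≠ a := by
          intro e
          have := q3 (by omega)
          rw [e] at this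
          exact this le_rfl
        have hlf : lf t a = a := by
          apply lf_eq le_rfl (fun m _ _ => by omega)
          intro _
          exact (w2 (a - 1) (by omega) (by omega)).le
        have k3 : runEnd n (fun m => t m < t a + 1) hi = rt n t a := by
          apply runEnd_eq (by omega) r0
          · intro m h4 h5
            rcases lt_trichotomy m a with h6 | h6 | h6
            · have := w2 m h4 (by omega); omega
            · rw [h6]; omega
            · have := r2 m h6 h5; omega
          · intro h4
            have := r3 h4; omega
        rw [k3]
        rw [hla] at hold
        refine hold.trans ?_
        rw [hlfold a ha le_rfl, hlf] at hndxa
        exact hndxa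
      · have k3 : runEnd n (fun m => t m < t a + 1) hi = lg := by
          apply runEnd_eq w1 w0
          · intro m h4 h5
            have := w2 m h4 h5
            omega
          · intro h4
            have := w3 h4
            have := hne lg h4
            omega
        rw [k3]
        have hlg' : X' lg = X lg := by
          apply hX1
          by_cases h4 : lg = a + 1
          · right
            rcases Nat.lt_or_ge (a + 1) n with h5 | h5
            · right
              by_cases h6 : hi ≤ a
              · exact absurd (w2 a h6 (by omega)) (lt_irrefl _)
              · have h7 := q3 (by omega)
                rw [show hi = a + 1 by omega] at h7
                exact not_le.1 h7
            · exact Or.inl h5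
          · exact Or.inl h4
        rw [hlg']
        exact hold
  · intro i g hig hg hti hk
    obtain ⟨s1, s2, s3⟩ := runStart_spec (fun m => t a ≤ t m) g
    set lo := runStart (fun m => t a ≤ t m) g with hlo
    have hga : g ≠ a := by rintro rfl; omega
    by_cases hin : lo ≤ a ∧ a < g
    · obtain ⟨hin1, hin2⟩ := hin
      have hlo' : lo = lf t a := by
        rw [← hT.runStart_self ha]
        exact (runStart_eq hin1 (fun m h4 h5 => s2 m h4 (by omega)) s3).symm
      have hnew : a + 1 = g ∨ t a < t (a + 1) := by
        by_cases h1 : a + 1 = g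
        · exact Or.inl h1
        · right
          have h2 := s2 (a + 1) (by omega) (by omega)
          have := hne (a + 1) (by omega)
          omega
      have hnew' : t a < t (a + 1) := by
        rcases hnew with h1 | h1
        · rw [h1]; omega
        · exact h1
      have hrt : rt n t a = a + 1 :=
        rt_eq le_rfl ha (fun m _ _ => by omega) fun _ => hnew'.le
      have k1 : runStart (fun m => t a + 1 ≤ t m) g = a + 1 := by
        apply runStart_eq hin2
        · intro m h4 h5
          have h6 := s2 m (by omega) h5
          have := hne m (by omega)
          omega
        · intro _
          change ¬ t a + 1 ≤ t a; omega
      rw [k1, ← hrt]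
      rcases (hlt1 i (by omega)).1 hti with h1 | rfl
      · have h2 : i < a := by
          rcases lt_trichotomy i a with h3 | h3 | h3
          · exact h3
          · rw [h3] at h1; omega
          · have := s2 i (by omega) hig; omega
        rw [hrtold i (by omega) h1]
        have h3 := h.left i a h2 ha h1 le_rfl
        rw [hT.runStart_self ha, ← hlfold a ha le_rfl] at h3
        exact h3.trans hndxa.le
      · exact le_rfl
    · have h1 : runStart (fun m => t a + 1 ≤ t m) g = lo := by
        apply runStart_eq s1
        · intro m h4 h5
          have h6 := s2 m h4 h5
          have := hne m (by omega)
          have : m ≠ a := by rintro rfl; exact hin ⟨h4, by omega⟩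
          omega
        · intro h4
          have := s3 h4
          omega
      have hlo' : X' lo = X lo := by
        apply hX1
        left
        intro e
        have := s3 (by omega)
        rw [e, Nat.add_sub_cancel] at this
        exact this le_rfl
      rw [h1, hlo']
      rcases (hlt1 i (by omega)).1 hti with h2 | rfl
      · rw [hrtold i (by omega) h2]
        exact h.left i g hig hg h2 (by omega)
      · refine hX3.trans ?_
        have hilo : i < lo := by
          by_contra h2
          exact hin ⟨by omega, hig⟩
        have hbl : bo n t i ≤ lo := by
          by_contra h2
          have := s3 (by omega)
          by_cases h3 : lo - 1 = i
          · rw [h3] at this; exact this le_rfl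
          · exact this (b2 (lo - 1) (by omega) (by omega)).le
        have hblo : bo n t i < lo := by
          refine lt_of_le_of_ne hbl fun e => ?_
          have h3 := b3 (by omega)
          rw [e] at h3
          by_cases h4 : lo = g
          · rw [h4] at h3; omega
          · have := s2 lo le_rfl (by omega); omega
        have hllo : l ≤ lo := by
          by_contra h2
          have h3 := e2 lo hbl (by omega)
          by_cases h4 : lo = g
          · rw [h4] at h3; omega
          · have := s2 lo le_rfl (by omega); omega
        have hlb : bo n t i < l := by
          by_contra h2
          have h3 := e3 (by omega)
          rw [show l = bo n t i by omega] at h3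
          exact h3 (b3 (by omega))
        -- The tile `l - 1` is the last one of the bump after the gap of `a`. It is drawn and its
        -- right edge is line `l`, so the `left` condition of the previous stage bounds `X l`.
        have h3 := e2 (l - 1) (by omega) (by omega)
        have h4 : rt n t (l - 1) = l := by
          apply rt_eq (by omega) e0 (fun m _ _ => by omega)
          intro h5
          have := e3 h5
          omega
        have h5 := h.left (l - 1) g (by omega) hg h3 (by omega)
        rwa [h4] at h5

theorem exists_stage {n : ℕ} {t : ℕ → ℕ} (hT : TimeInj n t)
    (hsurj : ∀ k, k < n → ∃ a, a < n ∧ t a = k) (k : ℕ) (hk : k ≤ n) : ∃ X, Stage n t k X := by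
  induction k with
  | zero => exact ⟨_, stage_zero t⟩
  | succ k ih =>
    obtain ⟨X, hX⟩ := ih (by omega)
    obtain ⟨a, ha, rfl⟩ := hsurj k (by omega)
    exact hX.succ hT ha

/-- Lines for which, along every wall, the marks come in the order of time. -/
structure MarkedBuild (n : ℕ) (t : ℕ → ℕ) (X Y : ℕ → ℝ) : Prop extends Build n t X Y where
  injX : ∀ v w, v ≤ n → w ≤ n → X v = X w → v = w
  injY : ∀ v w, v ≤ n → w ≤ n → Y v = Y w → v = w
  markV : ∀ i j, i < n → j < n → rt n t i = lf t j → t i < t j → Y (bo n t i) < Y (tp t j)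
  markH : ∀ i j, i < n → j < n → tp t i = bo n t j → t i < t j → X (lf t i) < X (rt n t j)

/-- The conditions on `X` and on `Y` are independent, because the ids depend on `t` alone. So `Y` is
found as the family of vertical lines for the reversed labels. -/
theorem exists_markedBuild {n : ℕ} {t : ℕ → ℕ} (hT : TimeInj n t)
    (hlt : ∀ a, a < n → t a < n) (hsurj : ∀ k, k < n → ∃ a, a < n ∧ t a = k) :
    ∃ X Y, MarkedBuild n t X Y := by
  obtain ⟨X, hX⟩ := exists_stage hT hsurj n le_rfl
  obtain ⟨Z, hZ⟩ := exists_stage hT.flip (fun k hk => by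
    obtain ⟨a, ha, e⟩ := hsurj k hk
    exact ⟨n - 1 - a, by omega, by rw [flipT_flip ha, e]⟩) n le_rfl
  have hle : ∀ a, a < n → tp t a ≤ n ∧ bo n t a ≤ n := fun a ha =>
    ⟨by have := hT.tp_spec ha; omega, (hT.bo_spec ha).2.1⟩
  have hb : ∀ a, a < n → flipLine n Z (bo n t a) = Z (lf (flipT n t) (n - 1 - a)) := by
    intro a ha; rw [hT.lf_flip ha]; rfl
  have ht : ∀ a, a < n → flipLine n Z (tp t a) = Z (rt n (flipT n t) (n - 1 - a)) := by
    intro a ha; rw [hT.rt_flip ha]; rfl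
  have hlt' : ∀ a, a < n → flipT n t (n - 1 - a) < n := by
    intro a ha; rw [flipT_flip ha]; exact hlt a ha
  refine ⟨X, flipLine n Z, ⟨⟨hT, ?_, ?_, ?_, ?_⟩, hX.injX, ?_, ?_, ?_⟩⟩
  · intro a ha; exact hX.ndx a ha (hlt a ha)
  · intro a ha
    rw [hb a ha, ht a ha]
    exact hZ.ndx _ (by omega) (hlt' a ha)
  · intro i j hij hj htt; exact hX.cx i j hij hj htt (hlt j hj)
  · intro i j hij hj htt
    rw [hb i (by omega), ht j hj]
    refine hZ.cx (n - 1 - j) (n - 1 - i) (by omega) (by omega) ?_ (hlt' i (by omega))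
    rw [flipT_flip hj, flipT_flip (by omega)]; exact htt
  · intro v w hv hw e
    have := hZ.injX _ _ (Nat.sub_le n v) (Nat.sub_le n w) e
    omega
  · intro i j hi hj hw htt
    rw [hb i hi, ht j hj]
    refine hZ.mark (n - 1 - i) (n - 1 - j) (by omega) (by omega) ?_ ?_ (hlt' j hj)
    · rw [hT.tp_flip hi, hT.bo_flip hj, hw]
    · rw [flipT_flip hj, flipT_flip hi]; exact htt
  · intro i j hi hj hw htt; exact hX.mark i j hi hj hw htt (hlt j hj)

end Rectangulation

namespace Rectangulation

/-! ### Tilings from marked builds -/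

/-- One of the two lines would have index `i + 1`. If it is the horizontal one, then `t j < t i`,
while the label `lf t j` is later than `i` and not later than `j`. If it is the vertical one, then
`t i < t j`, while the label `tp t j` is earlier than `i` and not earlier than `j`. So distinct
lines form no crossing, and opposite marks never share both ids. -/
theorem TimeInj.bo_ne_tp {n : ℕ} {t : ℕ → ℕ} (hT : TimeInj n t) {i j : ℕ} (hi : i < n)
    (hj : j < n) (hw : rt n t i = lf t j) : bo n t i ≠ tp t j := by
  intro e
  obtain ⟨r1, r0, r2, r3⟩ := hT.rt_spec hi
  obtain ⟨l1, l2, l3⟩ := hT.lf_spec hj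
  obtain ⟨b1, b0, b2, b3⟩ := hT.bo_spec hi
  obtain ⟨u1, u2, u3⟩ := hT.tp_spec hj
  have hvn := r3 (by omega)
  have hv0 := l3 (by omega)
  have hbn := b3 (by omega)
  have hu0 := u3 (by omega)
  rw [hw] at r1 r2 hvn
  rw [e] at b1 b2 hbn
  have hne := hT (i + 1) i (by omega) hi
  rcases Nat.lt_or_ge (t (i + 1)) (t i) with h1 | h1
  · have h2 : tp t j = i + 1 := by
      by_contra h3
      have := b2 (i + 1) (by omega) (by omega); omega
    rw [h2, Nat.add_sub_cancel] at hu0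
    rcases Nat.lt_or_ge (lf t j) j with h3 | h3
    · by_cases h4 : i + 1 = lf t j
      · rw [← h4] at hvn; omega
      · have := u2 (lf t j) (by omega) h3; omega
    · rw [show lf t j = j by omega] at hvn; omega
  · have h2 : lf t j = i + 1 := by
      by_contra h3
      have := r2 (i + 1) (by omega) (by omega)
      omega
    rw [h2, Nat.add_sub_cancel] at hv0
    rcases Nat.lt_or_ge (tp t j) j with h3 | h3
    · have := l2 (tp t j) (by omega) h3; omega
    · rw [show tp t j = j by omega] at hbn; omega

/-- At a crossing, the diagonal would have to pass through the open quadrant to the upper right and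
through the one to the lower left; a descending segment cannot meet both. -/
theorem Tiling.IsDiagonal.isGeneric {n : ℕ} {R : Tiling n} (h : R.IsDiagonal) : R.IsGeneric := by
  apply Tiling.isGeneric_of_no_cross
  rintro u v a b c d ⟨ha1, ha2⟩ _ ⟨hc1, hc2⟩ _
  obtain ⟨p, hp, ⟨hp1, _⟩, hp2, _⟩ := h.1 a
  obtain ⟨q, hq, ⟨_, hq1⟩, _, hq2⟩ := h.1 c
  rw [ha1] at hp1
  rw [ha2] at hp2
  rw [hc1] at hq1
  rw [hc2] at hq2
  obtain ⟨k1, m1, _, _, e1, rfl⟩ := hp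
  obtain ⟨k2, m2, _, _, e2, rfl⟩ := hq
  simp only [Prod.smul_mk, smul_eq_mul, Prod.mk_add_mk] at hp1 hp2 hq1 hq2
  have hx := R.outer_nondeg.1
  have hy := R.outer_nondeg.2
  have h1 : (m1 - m2) * (R.outer.x1 - R.outer.x0) > 0 := by
    have : k1 = 1 - m1 := by linarith
    have : k2 = 1 - m2 := by linarith
    subst k1 k2
    linarith
  have h2 : m1 - m2 > 0 := by
    by_contra hcon
    nlinarith
  have h3 : 0 < (m1 - m2) * (R.outer.y1 - R.outer.y0) := mul_pos h2 (by linarith)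
  have : k1 = 1 - m1 := by linarith
  have : k2 = 1 - m2 := by linarith
  subst k1 k2
  linarith

section marked
variable {n : ℕ} {t : ℕ → ℕ} {X Y : ℕ → ℝ}

theorem Build.isGeneric {R : Tiling n} (h : Build n t X Y) (hR : R.HasLines t X Y)
    (injX : ∀ v w, v ≤ n → w ≤ n → X v = X w → v = w)
    (injY : ∀ v w, v ≤ n → w ≤ n → Y v = Y w → v = w) : R.IsGeneric := by
  have hT := h.inj
  apply Tiling.isGeneric_of_no_cross
  rintro u v a b c d ⟨_, _⟩ ⟨hb1, hb2⟩ ⟨_, _⟩ ⟨hd1, hd2⟩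
  rw [hR] at hb1 hb2 hd1 hd2
  have h1 := hT.rt_spec b.2
  have h2 := hT.lf_spec d.2
  have h3 := hT.bo_spec b.2
  have h4 := hT.tp_spec d.2
  exact hT.bo_ne_tp b.2 d.2 (injX _ _ h1.2.1 (by omega) (hb1.trans hd1.symm))
    (injY _ _ h3.2.1 (by omega) (hb2.trans hd2.symm))

theorem MarkedBuild.flip (h : MarkedBuild n t X Y) :
    MarkedBuild n (flipT n t) (flipLine n Y) (flipLine n X) := by
  have hT := h.inj
  have rep : ∀ a, a < n → ∃ b, b < n ∧ a = n - 1 - b := fun a ha =>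
    ⟨n - 1 - a, by omega, by omega⟩
  have key : ∀ a, a < n → flipLine n Y (lf (flipT n t) (n - 1 - a)) = Y (bo n t a) ∧
      flipLine n Y (rt n (flipT n t) (n - 1 - a)) = Y (tp t a) ∧
      flipLine n X (bo n (flipT n t) (n - 1 - a)) = X (lf t a) ∧
      flipLine n X (tp (flipT n t) (n - 1 - a)) = X (rt n t a) := by
    intro a ha
    have := lineRect_flip hT X Y ha
    unfold lineRect at this
    simp only [Rect.mk.injEq] at this
    exact this
  refine ⟨h.toBuild.flip, ?_, ?_, ?_, ?_⟩
  · intro v w hv hw e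
    have := h.injY _ _ (Nat.sub_le n v) (Nat.sub_le n w) e
    omega
  · intro v w hv hw e
    have := h.injX _ _ (Nat.sub_le n v) (Nat.sub_le n w) e
    omega
  · intro i j hi hj hw htt
    obtain ⟨b, hb, rfl⟩ := rep i hi
    obtain ⟨c, hc, rfl⟩ := rep j hj
    rw [flipT_flip hb, flipT_flip hc] at htt
    rw [hT.rt_flip hb, hT.lf_flip hc] at hw
    rw [(key b hb).2.2.1, (key c hc).2.2.2]
    have := hT.tp_spec hb
    have := hT.bo_spec hc
    exact h.markH b c hb hc (by omega) htt
  · intro i j hi hj hw htt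
    obtain ⟨b, hb, rfl⟩ := rep i hi
    obtain ⟨c, hc, rfl⟩ := rep j hj
    rw [flipT_flip hb, flipT_flip hc] at htt
    rw [hT.tp_flip hb, hT.bo_flip hc] at hw
    rw [(key b hb).1, (key c hc).2.1]
    have := hT.rt_spec hb
    have := hT.lf_spec hc
    exact h.markV b c hb hc (by omega) htt

theorem MarkedBuild.bo_lt_tp_iff (h : MarkedBuild n t X Y) {i j : ℕ} (hi : i < n) (hj : j < n)
    (hw : rt n t i = lf t j) : Y (bo n t i) < Y (tp t j) ↔ t i < t j := by
  refine ⟨fun h1 => ?_, h.markV i j hi hj hw⟩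
  have h2 := h.inj.rt_spec hi
  have h3 := h.inj.lf_spec hj
  by_contra h4
  have h5 : t j ≠ t i := fun e => by
    have := h.inj j i hj hi e
    omega
  exact absurd h1 (h.cy i j (by omega) hj (by omega)).not_gt

theorem MarkedBuild.lf_lt_rt_iff (h : MarkedBuild n t X Y) {i j : ℕ} (hi : i < n) (hj : j < n)
    (hw : tp t i = bo n t j) : X (lf t i) < X (rt n t j) ↔ t i < t j := by
  refine ⟨fun h1 => ?_, h.markH i j hi hj hw⟩
  have h2 := h.inj.tp_spec hi
  have h3 := h.inj.bo_spec hj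
  by_contra h4
  have h5 : t j ≠ t i := fun e => by
    have := h.inj j i hj hi e
    omega
  exact absurd h1 (h.cx j i (by omega) hi (by omega)).not_gt

theorem MarkedBuild.bo_ne_tp (h : MarkedBuild n t X Y) {i j : ℕ} (hi : i < n) (hj : j < n)
    (hw : rt n t i = lf t j) : Y (bo n t i) ≠ Y (tp t j) := fun e =>
  h.inj.bo_ne_tp hi hj hw (h.injY _ _ (h.inj.bo_spec hi).2.1
    (by have := h.inj.tp_spec hj; omega) e)

theorem MarkedBuild.lf_ne_rt (h : MarkedBuild n t X Y) {i j : ℕ} (hi : i < n) (hj : j < n)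
    (hw : tp t i = bo n t j) : X (lf t i) ≠ X (rt n t j) := fun e => by
  have h1 := h.inj.lf_spec hi
  have h2 := h.inj.rt_spec hj
  exact h.inj.bo_ne_tp hj hi (h.injX _ _ (by omega) (by omega) e).symm hw.symm

/-- Adjacency in a marked build, in terms of times alone. -/
theorem MarkedBuild.leftOf_iff (h : MarkedBuild n t X Y) {i j : ℕ} (hi : i < n) (hj : j < n) :
    (lineRect n t X Y i).LeftOf (lineRect n t X Y j) ↔
      rt n t i = lf t j ∧ t i < t j ∧
      ∀ i' j', i' < n → j' < n → i' + 1 = tp t i → j' = bo n t j → rt n t i' = rt n t i →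
        lf t j' = lf t j → ¬ t i' < t j' := by
  rw [h.toBuild.leftOf_line_iff (fun i j hi hj hw => h.bo_ne_tp hi hj hw) hi hj]
  refine and_congr_right fun hw => and_congr (h.bo_lt_tp_iff hi hj hw) ?_
  refine forall_congr' fun i' => forall_congr' fun j' => forall_congr' fun hi' =>
    forall_congr' fun hj' => forall_congr' fun _ => forall_congr' fun _ =>
    forall_congr' fun h1 => forall_congr' fun h2 => not_congr ?_
  exact h.bo_lt_tp_iff hi' hj' (by rw [h1, h2, hw])

theorem MarkedBuild.below_iff (h : MarkedBuild n t X Y) {i j : ℕ} (hi : i < n) (hj : j < n) :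
    (lineRect n t X Y i).Below (lineRect n t X Y j) ↔
      tp t i = bo n t j ∧ t i < t j ∧
      ∀ i' j', i' < n → j' < n → i' = rt n t i → j' + 1 = lf t j → tp t i' = tp t i →
        bo n t j' = bo n t j → ¬ t i' < t j' := by
  rw [h.toBuild.below_line_iff (fun i j hi hj hw => h.lf_ne_rt hi hj hw) hi hj]
  refine and_congr_right fun hw => and_congr (h.lf_lt_rt_iff hi hj hw) ?_
  refine forall_congr' fun i' => forall_congr' fun j' => forall_congr' fun hi' =>
    forall_congr' fun hj' => forall_congr' fun _ => forall_congr' fun _ =>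
    forall_congr' fun h1 => forall_congr' fun h2 => not_congr ?_
  exact h.lf_lt_rt_iff hi' hj' (by rw [h1, h2, hw])

/-- The generic tiling given by a marked build. -/
noncomputable def MarkedBuild.tiling (h : MarkedBuild n t X Y) (hn : 1 ≤ n) : GenericTiling n :=
  ⟨h.toBuild.tiling hn, h.toBuild.isGeneric (fun _ => rfl) h.injX h.injY⟩

/-! ### Wall shuffles of marked builds -/

theorem Seg.markLU_swap (W : Seg) (r : Rect) (s : ℝ) : W.swap.MarkLU r.swap s ↔ W.MarkRD r s := by
  cases W <;> rfl

theorem Seg.markRD_swap (W : Seg) (r : Rect) (s : ℝ) : W.swap.MarkRD r.swap s ↔ W.MarkLU r s := by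
  cases W <;> rfl

theorem Seg.mark_swap (W : Seg) (r : Rect) (s : ℝ) : W.swap.Mark r.swap s ↔ W.Mark r s := by
  unfold Seg.Mark
  rw [Seg.markLU_swap, Seg.markRD_swap, or_comm]

/-- Tiles with edges in a common vertical wall. -/
theorem Tiling.IsWall.sameV {R : Tiling n} {u a b : ℝ} (hW : R.IsWall (Seg.vert u a b))
    {i j : Fin n} (hi : (R.tile i).x1 = u) (hj : (R.tile j).x0 = u) (h1 : a ≤ (R.tile i).y0)
    (h2 : (R.tile i).y1 ≤ b) (h3 : a ≤ (R.tile j).y0) (h4 : (R.tile j).y1 ≤ b) :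
    R.SameV i j := by
  obtain ⟨_, _, _, _, _, hc⟩ := Tiling.isWall_vert hW
  refine ⟨hi.trans hj.symm, ?_⟩
  rw [hi]
  exact hc.mono (le_min h1 h3) (max_le h2 h4)

/-- Tiles on one side of a vertical wall are not separated horizontally, so `cy` orders them in
height by time, whatever the coordinates. -/
theorem Build.markLU_lt {R : Tiling n} (h : Build n t X Y) (hR : R.HasLines t X Y)
    {u a b : ℝ} {i j : Fin n} (hij : t i < t j) {r s : ℝ}
    (hi : (Seg.vert u a b).MarkLU (R.tile i) r) (hj : (Seg.vert u a b).MarkLU (R.tile j) s) :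
    r < s := by
  obtain ⟨i1, _, _, rfl⟩ := hi
  obtain ⟨j1, _, _, rfl⟩ := hj
  rcases lt_trichotomy (i : ℕ) j with h1 | h1 | h1
  · have h2 := h.cx i j h1 j.2 hij
    have h3 := R.hx j
    rw [hR] at i1 j1 h3
    simp only [lineRect] at i1 j1 h3
    linarith
  · rw [h1] at hij; omega
  · have h2 := h.cy j i h1 i.2 hij
    have h3 := R.hy i
    rw [hR] at h3 ⊢
    rw [hR]
    exact h3.trans_le h2

theorem Build.markRD_lt {R : Tiling n} (h : Build n t X Y) (hR : R.HasLines t X Y)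
    {u a b : ℝ} {i j : Fin n} (hij : t i < t j) {r s : ℝ}
    (hi : (Seg.vert u a b).MarkRD (R.tile i) r) (hj : (Seg.vert u a b).MarkRD (R.tile j) s) :
    r < s := by
  obtain ⟨i1, _, _, rfl⟩ := hi
  obtain ⟨j1, _, _, rfl⟩ := hj
  rcases lt_trichotomy (i : ℕ) j with h1 | h1 | h1
  · have h2 := h.cx i j h1 j.2 hij
    have h3 := R.hx i
    rw [hR i] at i1 h3
    rw [hR j] at j1
    simp only [lineRect] at i1 j1 h3
    linarith
  · rw [h1] at hij; omega
  · have h2 := h.cy j i h1 i.2 hij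
    have h3 := R.hy j
    rw [hR j] at h3 ⊢
    rw [hR i]
    exact h2.trans_lt h3

theorem MarkedBuild.mark_lt_vert {R : Tiling n} (h : MarkedBuild n t X Y)
    (hR : R.HasLines t X Y) {u a b : ℝ} (hW : R.IsWall (Seg.vert u a b)) {i j : Fin n}
    (hij : t i < t j) {r s : ℝ} (hi : (Seg.vert u a b).Mark (R.tile i) r)
    (hj : (Seg.vert u a b).Mark (R.tile j) s) : r < s := by
  have hg := h.toBuild.isGeneric hR h.injX h.injY
  rcases hi with hi | hi <;> rcases hj with hj | hj
  · exact h.toBuild.markLU_lt hR hij hi hj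
  · obtain ⟨i1, i2, i3, rfl⟩ := hi
    obtain ⟨j1, j2, j3, rfl⟩ := hj
    have hs := (h.toBuild.ids_iff_sameV hR hg).2 (hW.sameV i1 j1 i2.le i3 j2 j3.le)
    rw [hR i, hR j]
    exact h.markV i j i.2 j.2 hs hij
  · obtain ⟨i1, i2, i3, rfl⟩ := hi
    obtain ⟨j1, j2, j3, rfl⟩ := hj
    have hs := (h.toBuild.ids_iff_sameV hR hg).2 (hW.sameV j1 i1 j2.le j3 i2 i3.le)
    have h1 := h.bo_ne_tp j.2 i.2 hs
    have h2 := (h.bo_lt_tp_iff j.2 i.2 hs).not.2 (by omega)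
    rw [hR i, hR j]
    exact lt_of_le_of_ne (not_lt.1 h2) h1.symm
  · exact h.toBuild.markRD_lt hR hij hi hj

theorem Tiling.IsWall.flip {R : Tiling n} {W : Seg} (h : R.IsWall W) : R.flip.IsWall W.swap :=
  (Tiling.isWall_relabel _ _).2 h.swap

theorem Tiling.flip_tile_rev (R : Tiling n) (i : Fin n) : R.flip.tile i.rev = (R.tile i).swap := by
  change (R.tile (Fin.rev i.rev)).swap = _
  rw [Fin.rev_rev]

theorem flipT_rev (t : ℕ → ℕ) (i : Fin n) : flipT n t (i.rev : Fin n) = t i := by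
  rw [show ((i.rev : Fin n) : ℕ) = n - 1 - i by rw [Fin.val_rev]; omega]
  exact flipT_flip i.2

theorem MarkedBuild.mark_lt {R : Tiling n} (h : MarkedBuild n t X Y)
    (hR : R.HasLines t X Y) {W : Seg} (hW : R.IsWall W) {i j : Fin n}
    (hij : t i < t j) {r s : ℝ} (hi : W.Mark (R.tile i) r) (hj : W.Mark (R.tile j) s) :
    r < s := by
  cases W with
  | vert u a b => exact h.mark_lt_vert hR hW hij hi hj
  | horiz u a b =>
    refine h.flip.mark_lt_vert (hR.flip h.inj) hW.flip (i := i.rev) (j := j.rev) ?_ ?_ ?_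
    · rwa [flipT_rev, flipT_rev]
    · rw [Tiling.flip_tile_rev]; exact (Seg.mark_swap _ _ _).2 hi
    · rw [Tiling.flip_tile_rev]; exact (Seg.mark_swap _ _ _).2 hj

theorem word_pairwise (x : Equiv.Perm (Fin n)) :
    (word x).Pairwise fun i j : Fin n => timeOf x i < timeOf x j := by
  unfold word
  rw [List.pairwise_ofFn]
  intro i j hij
  rw [timeOf_fin, timeOf_fin]
  simpa using hij

theorem mem_word (x : Equiv.Perm (Fin n)) (i : Fin n) : i ∈ word x := by
  unfold word
  rw [List.mem_ofFn']
  exact ⟨x.symm i, by simp⟩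

open Classical in
theorem MarkedBuild.exists_wallShuffle {R : Tiling n} {x : Equiv.Perm (Fin n)}
    (h : MarkedBuild n (timeOf x) X Y) (hR : R.HasLines (timeOf x) X Y) {W : Seg}
    (hW : R.IsWall W) : ∃ l, IsWallShuffle R.tile W l ∧ l.Sublist (word x) := by
  refine ⟨(word x).filter fun i => ∃ s, W.Mark (R.tile i) s, ⟨?_, ?_⟩, List.filter_sublist⟩
  · intro i
    simp [mem_word]
  · apply List.Pairwise.filter
    refine (word_pairwise x).imp ?_
    intro i j hij r s hi hj
    exact h.mark_lt hR hW hij hi hj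

theorem exists_markedBuild_timeOf (x : Equiv.Perm (Fin n)) :
    ∃ X Y, MarkedBuild n (timeOf x) X Y := by
  refine exists_markedBuild (timeOf_inj x) (fun a ha => timeOf_lt x ha) ?_
  intro k hk
  refine ⟨x ⟨k, hk⟩, (x ⟨k, hk⟩).2, ?_⟩
  rw [timeOf_fin]
  simp

end marked

end Rectangulation

namespace Rectangulation

/-! ### Exchanging two labels that are adjacent in time -/

/-- The order of the labels `p` and `q`, and no other, differs between `t` and `t'`. -/
structure Exchange (n : ℕ) (t t' : ℕ → ℕ) (p q : ℕ) : Prop where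
  hp : p < n
  hq : q < n
  lt : t p < t q
  lt' : t' q < t' p
  agree : ∀ i j, i < n → j < n → ¬ (i = p ∧ j = q) → ¬ (i = q ∧ j = p) →
    (t i < t j ↔ t' i < t' j)

namespace Exchange
variable {n : ℕ} {t t' : ℕ → ℕ} {p q : ℕ} (hs : Exchange n t t' p q)
include hs

/-- A label strictly between `p` and `q` in time would keep its order relative to both, which is
incompatible with the reversal of `p` and `q`. -/
theorem le_of_lt {m : ℕ} (hm : m < n) (h : t m < t q) : t m ≤ t p := by
  by_contra h1
  have hmp : m ≠ p := by rintro rfl; omega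
  have hmq : m ≠ q := by rintro rfl; omega
  have h2 := (hs.agree m q hm hs.hq (by tauto) (by tauto)).1 h
  have h3 := (hs.agree p m hs.hp hm (by tauto) (by tauto)).1 (by omega)
  have := hs.lt'
  omega

theorem symm : Exchange n t' t q p :=
  ⟨hs.hq, hs.hp, hs.lt', hs.lt, fun i j hi hj h1 h2 => (hs.agree i j hi hj h2 h1).symm⟩

theorem flip : Exchange n (flipT n t) (flipT n t') (n - 1 - p) (n - 1 - q) := by
  have hp := hs.hp
  have hq := hs.hq
  refine ⟨by omega, by omega, ?_, ?_, ?_⟩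
  · rw [flipT_flip hp, flipT_flip hq]; exact hs.lt
  · rw [flipT_flip hp, flipT_flip hq]; exact hs.lt'
  · intro i j hi hj h1 h2
    exact hs.agree _ _ (by omega) (by omega) (by omega) (by omega)

end Exchange

section slide
variable {n : ℕ} {t t' : ℕ → ℕ} {X Y X' Y' : ℕ → ℝ}

theorem MarkedBuild.leftOf_iff_of_sameIds (h : MarkedBuild n t' X Y) (hid : SameIds n t t')
    {i j : ℕ} (hi : i < n) (hj : j < n) :
    (lineRect n t' X Y i).LeftOf (lineRect n t' X Y j) ↔
      rt n t i = lf t j ∧ t' i < t' j ∧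
      ∀ i' j', i' < n → j' < n → i' + 1 = tp t i → j' = bo n t j → rt n t i' = rt n t i →
        lf t j' = lf t j → ¬ t' i' < t' j' := by
  rw [h.leftOf_iff hi hj, ← (hid i hi).2.1, ← (hid j hj).1, ← (hid i hi).2.2.1,
    ← (hid j hj).2.2.2]
  refine and_congr_right fun hw => and_congr Iff.rfl ?_
  refine forall_congr' fun i' => forall_congr' fun j' => forall_congr' fun hi' =>
    forall_congr' fun hj' => ?_
  rw [← (hid i' hi').2.1, ← (hid j' hj').1]

/-- As `p` and `q` are consecutive in time, their marks are consecutive on the wall `v`. The slide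
involves the tile `a` below `p`, which is the latest label in `[p + 1, v)`, and the tile `d` above
`q`, which is the earliest label in `[v, q)`. Reversing `p` and `q` destroys the contact of `p` and
`q` and creates that of `a` and `d`. -/
theorem MarkedBuild.slideRel (h : MarkedBuild n t X Y) (h' : MarkedBuild n t' X' Y')
    (hid : SameIds n t t') {p q : Fin n} (hpq : p < q) (hs : Exchange n t t' p q)
    (hw : rt n t p = lf t q)
    (hB : ∀ i j : Fin n, (lineRect n t' X' Y' i).Below (lineRect n t' X' Y' j) ↔
      (lineRect n t X Y i).Below (lineRect n t X Y j)) :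
    SlideRel (fun i j : Fin n => (lineRect n t X Y i).LeftOf (lineRect n t X Y j))
      (fun i j : Fin n => (lineRect n t X Y i).Below (lineRect n t X Y j))
      (fun i j : Fin n => (lineRect n t' X' Y' i).LeftOf (lineRect n t' X' Y' j))
      (fun i j : Fin n => (lineRect n t' X' Y' i).Below (lineRect n t' X' Y' j)) := by
  have hT := h.inj
  have hT' := h'.inj
  have hlt := hs.lt
  have hlt' := hs.lt'
  obtain ⟨v, hv⟩ : ∃ v, v = lf t q := ⟨_, rfl⟩
  obtain ⟨r1, r0, r2, r3⟩ := hT.rt_spec p.2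
  obtain ⟨l1, l2, l3⟩ := hT.lf_spec q.2
  rw [hw] at r1 r2 r3
  rw [← hv] at hw r1 r2 r3 l1 l2 l3
  -- Neither `p` nor `q` is the unrecorded extreme tile of its side: otherwise the common ids would
  -- force `p` before `q` under `t'` as well.
  have hp' : (p : ℕ) + 1 < v := by
    rcases Nat.lt_or_ge ((p : ℕ) + 1) v with h1 | h1
    · exact h1
    · have h2 := (hT'.lf_spec q.2).2.2
      rw [← (hid q q.2).1, ← hv, show v - 1 = p by omega] at h2
      have := h2 (by omega); omega
  have hq' : v < q := by
    rcases Nat.lt_or_ge v q with h1 | h1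
    · exact h1
    · have h2 := (hT'.rt_spec p.2).2.2.2
      rw [← (hid p p.2).2.1, hw, show v = q by omega] at h2
      have := h2 (by omega); omega
  have hbop : bo n t p = p + 1 :=
    bo_eq le_rfl p.2 (fun m _ _ => by omega) fun _ => (r2 _ (by omega) hp').le
  have htpq : tp t q = q :=
    tp_eq le_rfl (fun m _ _ => by omega) fun _ => (l2 _ (by omega) (by omega)).le
  have hv0 := l3 (by omega)
  have hvn := r3 (by omega)
  -- the tile below `p` on the wall
  obtain ⟨a, ha, hamax⟩ := Finset.exists_max_image (Finset.Ico ((p : ℕ) + 1) v) t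
    ⟨p + 1, by simp [hp']⟩
  rw [Finset.mem_Ico] at ha
  have han : a < n := by omega
  have hamax' : ∀ m, (p : ℕ) + 1 ≤ m → m < v → t m ≤ t a := fun m h1 h2 =>
    hamax m (Finset.mem_Ico.2 ⟨h1, h2⟩)
  have hap := r2 a (by omega) ha.2
  have hne : ∀ m m', m < n → m' < n → m ≠ m' → t m ≠ t m' := fun m m' h1 h2 h3 e =>
    h3 (hT m m' h1 h2 e)
  have htpa : tp t a = p + 1 := by
    apply tp_eq ha.1
    · intro m h1 h2
      have h3 := hamax' m h1 (by omega)
      have h4 := hne m a (by omega) han (by omega)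
      omega
    · intro _; exact hap.le
  have hrta : rt n t a = v := by
    apply rt_eq (by omega) (by omega)
    · intro m h1 h2
      have h3 := hamax' m (by omega) h2
      have h4 := hne m a (by omega) han (by omega)
      omega
    · intro _; omega
  have huniqa : ∀ i, i < n → tp t i = p + 1 → rt n t i = v → i = a := by
    intro i hi h1 h2
    obtain ⟨g1, g2, g3⟩ := hT.tp_spec hi
    obtain ⟨f1, f0, f2, f3⟩ := hT.rt_spec hi
    rcases lt_trichotomy i a with h3 | h3 | h3
    · have h4 := f2 a h3 (by omega)
      have h5 := hamax' i (by omega) (by omega)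
      omega
    · exact h3
    · have h4 := g2 a (by omega) h3
      have h5 := hamax' i (by omega) (by omega)
      omega
  -- the tile above `q` on the wall
  obtain ⟨d, hd, hdmin⟩ := Finset.exists_min_image (Finset.Ico v (q : ℕ)) t
    ⟨v, by simp [hq']⟩
  rw [Finset.mem_Ico] at hd
  have hdn : d < n := by omega
  have hdmin' : ∀ m, v ≤ m → m < (q : ℕ) → t d ≤ t m := fun m h1 h2 =>
    hdmin m (Finset.mem_Ico.2 ⟨h1, h2⟩)
  have hdq := l2 d hd.1 hd.2
  have hbod : bo n t d = q := by
    apply bo_eq (by omega) q.2.le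
    · intro m h1 h2
      have h3 := hdmin' m (by omega) h2
      have h4 := hne m d (by omega) hdn (by omega)
      omega
    · intro _; exact hdq.le
  have hlfd : lf t d = v := by
    apply lf_eq hd.1
    · intro m h1 h2
      have h3 := hdmin' m h1 (by omega)
      have h4 := hne m d (by omega) hdn (by omega)
      omega
    · intro _; omega
  have huniqd : ∀ j, j < n → bo n t j = q → lf t j = v → j = d := by
    intro j hj h1 h2
    obtain ⟨g1, g0, g2, g3⟩ := hT.bo_spec hj
    obtain ⟨f1, f2, f3⟩ := hT.lf_spec hj
    rcases lt_trichotomy j d with h3 | h3 | h3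
    · have h4 := g2 d h3 (by omega)
      have h5 := hdmin' j (by omega) (by omega)
      omega
    · exact h3
    · have h4 := f2 d (by omega) h3
      have h5 := hdmin' j (by omega) (by omega)
      omega
  have hlab : ∀ i j, i < n → j < n → rt n t i = lf t j → i < j := by
    intro i j hi hj e
    have := hT.rt_spec hi
    have := hT.lf_spec hj
    omega
  have hagree : ∀ i j, i < n → j < n → i < j → ¬ (i = p ∧ j = q) →
      (t i < t j ↔ t' i < t' j) := by
    intro i j hi hj hij h1
    apply hs.agree i j hi hj h1
    rintro ⟨rfl, rfl⟩
    exact absurd hpq (by rw [Fin.lt_def]; omega)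
  refine ⟨hB, ⟨a, han⟩, p, q, ⟨d, hdn⟩, ?_, ?_, ?_, ?_, ?_, ?_⟩
  · refine (h.below_iff han p.2).2 ⟨by rw [htpa, hbop], hap, ?_⟩
    intro i' j' hi' hj' h1 h2 h3 h4 _
    have h5 := (hT.tp_spec hi').2.1 p
    rw [h3, htpa] at h5
    rw [h1, hrta] at hi' h5 h3
    obtain ⟨g1, g2, g3⟩ := hT.lf_spec p.2
    have h6 := (hT.tp_spec hi').2.2 (by rw [h3, htpa]; omega)
    rw [h3, htpa, Nat.add_sub_cancel] at h6
    omega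
  · refine (h.below_iff q.2 hdn).2 ⟨by rw [htpq, hbod], hdq, ?_⟩
    intro i' j' hi' hj' h1 h2 h3 h4 _
    rw [hlfd] at h2
    rw [show j' = v - 1 by omega, hbod] at h4
    have h6 := (hT.bo_spec (show v - 1 < n by omega)).2.2.2 (by rw [h4]; exact q.2)
    rw [h4] at h6
    omega
  · refine (h.leftOf_iff han q.2).2 ⟨by rw [hrta, hv], by omega, ?_⟩
    intro i' j' hi' hj' h1 h2 h3 h4 h5
    rw [htpa] at h1
    rw [show i' = p by omega] at h5
    have h6 := (hT.bo_spec q.2).2.2.2 (by rw [← h2]; exact hj')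
    rw [← h2] at h6
    have := hs.le_of_lt hj' h6
    omega
  · refine (h.leftOf_iff p.2 q.2).2 ⟨by rw [hw, hv], hlt, ?_⟩
    intro i' j' hi' hj' h1 h2 h3 h4 h5
    have h6 := (hT.bo_spec q.2).2.2.2 (by rw [← h2]; exact hj')
    rw [← h2] at h6
    have h7 := hs.le_of_lt hj' h6
    have h8 := (hT.tp_spec p.2).2.2 (by omega)
    rw [← h1, Nat.add_sub_cancel] at h8
    omega
  · refine (h.leftOf_iff p.2 hdn).2 ⟨by rw [hw, hlfd], by omega, ?_⟩
    intro i' j' hi' hj' h1 h2 h3 h4 h5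
    rw [hbod] at h2
    rw [h2] at h5
    have h7 := hs.le_of_lt hi' h5
    have h8 := (hT.tp_spec p.2).2.2 (by omega)
    rw [← h1, Nat.add_sub_cancel] at h8
    omega
  -- In the criterion for adjacency the times of a pair are compared twice: for `(i, j)`, and for
  -- the tile above `i` with the tile below `j`. The pair `(p, q)` occurs in the first role only for
  -- `(i, j) = (p, q)`, and in the second only for `(i, j) = (a, d)`.
  · intro i j
    beta_reduce
    rw [h'.leftOf_iff_of_sameIds hid i.2 j.2, h.leftOf_iff i.2 j.2]
    constructor
    · rintro ⟨h1, h2, h3⟩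
      have hij := hlab i j i.2 j.2 h1
      have hne' : ¬ ((i : ℕ) = p ∧ (j : ℕ) = q) := by
        rintro ⟨e1, e2⟩; rw [e1, e2] at h2; omega
      by_cases hex : ∀ i' j', i' < n → j' < n → i' + 1 = tp t i → j' = bo n t j →
          rt n t i' = rt n t i → lf t j' = lf t j → ¬ t i' < t j'
      · exact Or.inl ⟨⟨h1, (hagree i j i.2 j.2 hij hne').2 h2, hex⟩, fun e =>
          hne' ⟨congrArg Fin.val e.1, congrArg Fin.val e.2⟩⟩
      · right
        push Not at hex
        obtain ⟨i', j', hi', hj', k1, k2, k3, k4, k5⟩ := hex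
        have k6 := h3 i' j' hi' hj' k1 k2 k3 k4
        have k7 : i' = p ∧ j' = q := by
          by_contra k8
          exact k6 ((hagree i' j' hi' hj' (hlab i' j' hi' hj' (by rw [k3, k4, h1])) k8).1 k5)
        obtain ⟨rfl, rfl⟩ := k7
        exact ⟨Fin.ext (huniqa i i.2 k1.symm (by rw [← k3, hw])),
          Fin.ext (huniqd j j.2 k2.symm (by rw [← k4, hv]))⟩
    · rintro (⟨⟨h1, h2, h3⟩, h4⟩ | ⟨rfl, rfl⟩)
      · have hij := hlab i j i.2 j.2 h1
        have hne' : ¬ ((i : ℕ) = p ∧ (j : ℕ) = q) := fun e => h4 ⟨Fin.ext e.1, Fin.ext e.2⟩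
        refine ⟨h1, (hagree i j i.2 j.2 hij hne').1 h2, ?_⟩
        intro i' j' hi' hj' k1 k2 k3 k4 k5
        have k6 := hlab i' j' hi' hj' (by rw [k3, k4, h1])
        refine h3 i' j' hi' hj' k1 k2 k3 k4 ((hagree i' j' hi' hj' k6 ?_).2 k5)
        rintro ⟨rfl, rfl⟩
        omega
      · refine ⟨by rw [hrta, hlfd], (hagree a d han hdn (by omega) (by omega)).1 (by omega), ?_⟩
        intro i' j' hi' hj' k1 k2 k3 k4 k5
        simp only [htpa, hbod] at k1 k2
        rw [k2, show i' = p by omega] at k5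
        omega

theorem MarkedBuild.sameRel (h : MarkedBuild n t X Y) (h' : MarkedBuild n t' X' Y')
    (hid : SameIds n t t')
    (hV : ∀ i j, i < n → j < n → rt n t i = lf t j → (t i < t j ↔ t' i < t' j))
    (hH : ∀ i j, i < n → j < n → tp t i = bo n t j → (t i < t j ↔ t' i < t' j)) :
    SameRel (fun i : Fin n => lineRect n t X Y i) (fun i => lineRect n t' X' Y' i) := by
  have e1 : ∀ i j, i < n → j < n → rt n t i = lf t j → rt n t' i = lf t' j := by
    intro i j hi hj e
    rw [← (hid i hi).2.1, ← (hid j hj).1, e]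
  have e2 : ∀ i j, i < n → j < n → tp t i = bo n t j → tp t' i = bo n t' j := by
    intro i j hi hj e
    rw [← (hid i hi).2.2.1, ← (hid j hj).2.2.2, e]
  refine h.toBuild.sameRel h'.toBuild hid (fun i j hi hj hw => h.bo_ne_tp hi hj hw) ?_
    (fun i j hi hj hw => h.lf_ne_rt hi hj hw) ?_ ?_ ?_
  · intro i j hi hj hw
    have := h'.bo_ne_tp hi hj (e1 i j hi hj hw)
    rwa [← (hid i hi).2.2.2, ← (hid j hj).2.2.1] at this
  · intro i j hi hj hw
    have := h'.lf_ne_rt hi hj (e2 i j hi hj hw)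
    rwa [← (hid i hi).1, ← (hid j hj).2.1] at this
  · intro i j hi hj hw
    have := h'.bo_lt_tp_iff hi hj (e1 i j hi hj hw)
    rw [← (hid i hi).2.2.2, ← (hid j hj).2.2.1] at this
    rw [this, h.bo_lt_tp_iff hi hj hw]
    exact hV i j hi hj hw
  · intro i j hi hj hw
    have := h'.lf_lt_rt_iff hi hj (e2 i j hi hj hw)
    rw [← (hid i hi).1, ← (hid j hj).2.1] at this
    rw [this, h.lf_lt_rt_iff hi hj hw]
    exact hH i j hi hj hw

theorem MarkedBuild.below_congr (h : MarkedBuild n t X Y) (h' : MarkedBuild n t' X' Y')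
    (hid : SameIds n t t')
    (hH : ∀ i j, i < n → j < n → tp t i = bo n t j → (t i < t j ↔ t' i < t' j))
    (i j : Fin n) : (lineRect n t' X' Y' i).Below (lineRect n t' X' Y' j) ↔
      (lineRect n t X Y i).Below (lineRect n t X Y j) := by
  rw [h.below_iff i.2 j.2, h'.below_iff i.2 j.2, ← (hid i i.2).2.1, ← (hid j j.2).1,
    ← (hid i i.2).2.2.1, ← (hid j j.2).2.2.2]
  refine and_congr_right fun hw => and_congr (hH i j i.2 j.2 hw).symm ?_
  refine forall_congr' fun i' => forall_congr' fun j' => forall_congr' fun hi' =>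
    forall_congr' fun hj' => ?_
  rw [← (hid i' hi').2.2.1, ← (hid j' hj').2.2.2]
  refine forall_congr' fun _ => forall_congr' fun _ =>
    forall_congr' fun h1 => forall_congr' fun h2 => not_congr ?_
  exact (hH i' j' hi' hj' (by rw [h1, h2, hw])).symm

theorem SlideRel.conj {L B L' B' : Fin n → Fin n → Prop} (h : SlideRel L B L' B') :
    SlideRel (fun i j => L i.rev j.rev) (fun i j => B i.rev j.rev)
      (fun i j => L' i.rev j.rev) (fun i j => B' i.rev j.rev) := by
  obtain ⟨h1, a, b, c, d, h2, h3, h4, h5, h6, h7⟩ := h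
  refine ⟨fun i j => h1 _ _, a.rev, b.rev, c.rev, d.rev, ?_⟩
  simp only [Fin.rev_rev]
  refine ⟨h2, h3, h4, h5, h6, fun i j => ?_⟩
  rw [h7]
  simp only [Fin.rev_eq_iff]

theorem lineRect_flip_rev (hT : TimeInj n t) (X Y : ℕ → ℝ) (i : Fin n) :
    lineRect n (flipT n t) (flipLine n Y) (flipLine n X) (i.rev : Fin n) =
      (lineRect n t X Y i).swap := by
  rw [show ((i.rev : Fin n) : ℕ) = n - 1 - i by rw [Fin.val_rev]; omega]
  exact lineRect_flip hT X Y i.2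

/-- The pair `p`, `q` faces each other across a vertical wall, or across a horizontal wall, or
across none; both at once is excluded by `TimeInj.bo_ne_tp`. In the horizontal case reversal of the
labels interchanges the two time functions, so the slide leads from `t'` to `t`. -/
theorem MarkedBuild.step_of_lt (h : MarkedBuild n t X Y) (h' : MarkedBuild n t' X' Y')
    (hid : SameIds n t t') {p q : Fin n} (hpq : p < q) (hs : Exchange n t t' p q) :
    SameRel (fun i : Fin n => lineRect n t X Y i) (fun i => lineRect n t' X' Y' i) ∨
    WallSlide (fun i : Fin n => lineRect n t X Y i) (fun i => lineRect n t' X' Y' i) ∨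
    WallSlide (fun i : Fin n => lineRect n t' X' Y' i) (fun i => lineRect n t X Y i) := by
  have hT := h.inj
  have hT' := h'.inj
  have agV : ¬ (rt n t p = lf t q) → ∀ i j, i < n → j < n → rt n t i = lf t j →
      (t i < t j ↔ t' i < t' j) := by
    intro hw i j hi hj e
    apply hs.agree i j hi hj
    · rintro ⟨rfl, rfl⟩; exact hw e
    · rintro ⟨rfl, rfl⟩
      have := hT.rt_spec hi
      have := hT.lf_spec hj
      rw [Fin.lt_def] at hpq
      omega
  have agH : ¬ (tp t q = bo n t p) → ∀ i j, i < n → j < n → tp t i = bo n t j →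
      (t i < t j ↔ t' i < t' j) := by
    intro hw i j hi hj e
    apply hs.agree i j hi hj
    · rintro ⟨rfl, rfl⟩
      have := hT.tp_spec hi
      have := hT.bo_spec hj
      rw [Fin.lt_def] at hpq
      omega
    · rintro ⟨rfl, rfl⟩; exact hw e
  by_cases hV : rt n t p = lf t q
  · right; left; left
    have hH : ¬ (tp t q = bo n t p) := fun e => hT.bo_ne_tp p.2 q.2 hV e.symm
    exact h.slideRel h' hid hpq hs hV (h.below_congr h' hid (agH hH))
  · by_cases hH : tp t q = bo n t p
    · right; right; right
      have hs' := hs.flip.symm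
      have e1 : ∀ i : Fin n, n - 1 - (i : ℕ) = ((i.rev : Fin n) : ℕ) := by
        intro i; rw [Fin.val_rev]; omega
      rw [e1, e1] at hs'
      have hid' := hid.flip hT hT'
      have hid'' : SameIds n (flipT n t') (flipT n t) := fun a ha => by
        obtain ⟨k1, k2, k3, k4⟩ := hid' a ha
        exact ⟨k1.symm, k2.symm, k3.symm, k4.symm⟩
      have hBV : ∀ i j : Fin n, (lineRect n t' X' Y' i).LeftOf (lineRect n t' X' Y' j) ↔
          (lineRect n t X Y i).LeftOf (lineRect n t X Y j) := by
        intro i j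
        rw [h'.leftOf_iff_of_sameIds hid i.2 j.2, h.leftOf_iff i.2 j.2]
        refine and_congr_right fun hw => and_congr (agV hV i j i.2 j.2 hw).symm ?_
        refine forall_congr' fun i' => forall_congr' fun j' => forall_congr' fun hi' =>
          forall_congr' fun hj' => forall_congr' fun _ => forall_congr' fun _ =>
          forall_congr' fun h1 => forall_congr' fun h2 => not_congr ?_
        exact (agV hV i' j' hi' hj' (by rw [h1, h2, hw])).symm
      have key := (h'.flip.slideRel h.flip hid'' (p := q.rev) (q := p.rev)
        (Fin.rev_lt_rev.2 hpq) hs' ?_ ?_).conj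
      · simp only [lineRect_flip_rev hT, lineRect_flip_rev hT', Rect.leftOf_swap,
          Rect.below_swap] at key
        exact key
      · rw [← (hid' _ q.rev.2).2.1, ← (hid' _ p.rev.2).1, ← e1, ← e1, hT.rt_flip q.2,
          hT.lf_flip p.2, hH]
      · intro i j
        have k1 := lineRect_flip_rev hT X Y i.rev
        have k2 := lineRect_flip_rev hT X Y j.rev
        have k3 := lineRect_flip_rev hT' X' Y' i.rev
        have k4 := lineRect_flip_rev hT' X' Y' j.rev
        rw [Fin.rev_rev] at k1 k2 k3 k4
        rw [k1, k2, k3, k4, Rect.below_swap, Rect.below_swap]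
        exact (hBV _ _).symm
    · exact Or.inl (h.sameRel h' hid (agV hV) (agH hH))

theorem SameRel.symm {R R' : Fin n → Rect} (h : SameRel R R') : SameRel R' R :=
  fun i j => ⟨(h i j).1.symm, (h i j).2.symm⟩

theorem MarkedBuild.mosaicEquiv_of_exchange (hn : 1 ≤ n) (h : MarkedBuild n t X Y)
    (h' : MarkedBuild n t' X' Y') (hid : SameIds n t t') {p q : Fin n}
    (hs : Exchange n t t' p q) : MosaicEquiv (h.tiling hn) (h'.tiling hn) := by
  rcases lt_trichotomy p q with hpq | hpq | hpq
  · rcases h.step_of_lt h' hid hpq hs with k | k | k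
    · exact Relation.EqvGen.rel _ _ (Or.inl k)
    · exact Relation.EqvGen.rel _ _ (Or.inr k)
    · exact Relation.EqvGen.symm _ _ (Relation.EqvGen.rel _ _ (Or.inr k))
  · have := hs.lt
    rw [hpq] at this; omega
  · have hid' : SameIds n t' t := fun a ha => by
      obtain ⟨k1, k2, k3, k4⟩ := hid a ha
      exact ⟨k1.symm, k2.symm, k3.symm, k4.symm⟩
    rcases h'.step_of_lt h hid' hpq hs.symm with k | k | k
    · exact Relation.EqvGen.symm _ _ (Relation.EqvGen.rel _ _ (Or.inl k))
    · exact Relation.EqvGen.symm _ _ (Relation.EqvGen.rel _ _ (Or.inr k))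
    · exact Relation.EqvGen.rel _ _ (Or.inr k)

end slide

end Rectangulation

namespace Rectangulation

/-! ### Permutations with the same ids -/

theorem SameIds.refl (n : ℕ) (t : ℕ → ℕ) : SameIds n t t := fun _ _ => ⟨rfl, rfl, rfl, rfl⟩

theorem SameIds.symm {n : ℕ} {t t' : ℕ → ℕ} (h : SameIds n t t') : SameIds n t' t := fun a ha => by
  obtain ⟨h1, h2, h3, h4⟩ := h a ha
  exact ⟨h1.symm, h2.symm, h3.symm, h4.symm⟩

theorem SameIds.trans {n : ℕ} {t t' t'' : ℕ → ℕ} (h : SameIds n t t') (h' : SameIds n t' t'') :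
    SameIds n t t'' := fun a ha => by
  obtain ⟨h1, h2, h3, h4⟩ := h a ha
  obtain ⟨k1, k2, k3, k4⟩ := h' a ha
  exact ⟨h1.trans k1, h2.trans k2, h3.trans k3, h4.trans k4⟩

/-- Time functions between two time functions with the same ids have these ids, too. -/
theorem SameIds.of_between {n : ℕ} {t t0 t' : ℕ → ℕ} (hT : TimeInj n t) (hT0 : TimeInj n t0)
    (h : SameIds n t t0) (hb : ∀ i j, i < n → j < n → t i < t j → t0 i < t0 j → t' i < t' j) :
    SameIds n t t' := by
  intro a ha
  obtain ⟨e1, e2, e3, e4⟩ := h a ha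
  refine ⟨?_, ?_, ?_, ?_⟩
  · obtain ⟨g1, g2, g3⟩ := hT.lf_spec ha
    obtain ⟨f1, f2, f3⟩ := hT0.lf_spec ha
    rw [← e1] at f1 f2 f3
    exact (lf_eq g1 (fun m h1 h2 => hb _ _ ha (by omega) (g2 m h1 h2) (f2 m h1 h2))
      fun h1 => (hb _ _ (by omega) ha (g3 h1) (f3 h1)).le).symm
  · obtain ⟨g1, g0, g2, g3⟩ := hT.rt_spec ha
    obtain ⟨f1, f0, f2, f3⟩ := hT0.rt_spec ha
    rw [← e2] at f1 f2 f3
    exact (rt_eq g1 g0 (fun m h1 h2 => hb m a (by omega) ha (g2 m h1 h2) (f2 m h1 h2))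
      fun h1 => (hb a _ ha h1 (g3 h1) (f3 h1)).le).symm
  · obtain ⟨g1, g2, g3⟩ := hT.tp_spec ha
    obtain ⟨f1, f2, f3⟩ := hT0.tp_spec ha
    rw [← e3] at f1 f2 f3
    exact (tp_eq g1 (fun m h1 h2 => hb m a (by omega) ha (g2 m h1 h2) (f2 m h1 h2))
      fun h1 => (hb _ _ ha (by omega) (g3 h1) (f3 h1)).le).symm
  · obtain ⟨g1, g0, g2, g3⟩ := hT.bo_spec ha
    obtain ⟨f1, f0, f2, f3⟩ := hT0.bo_spec ha
    rw [← e4] at f1 f2 f3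
    exact (bo_eq g1 g0 (fun m h1 h2 => hb _ _ ha (by omega) (g2 m h1 h2) (f2 m h1 h2))
      fun h1 => (hb _ _ h1 ha (g3 h1) (f3 h1)).le).symm

theorem eq_one_of_lt_succ {n : ℕ} (e : Equiv.Perm (Fin n))
    (h : ∀ k k' : Fin n, (k' : ℕ) = k + 1 → e k < e k') : e = 1 := by
  cases n with
  | zero => exact Subsingleton.elim _ _
  | succ m =>
    have h1 : StrictMono e := Fin.strictMono_iff_lt_succ.2 fun i => h _ _ (by simp)
    have h2 := (StrictMono.range_inj h1 strictMono_id).1 (by simp [e.surjective.range_eq])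
    exact Equiv.ext (congrFun h2)

theorem exchange_swap {n : ℕ} (x : Equiv.Perm (Fin n)) {k k' : Fin n} (hk : (k' : ℕ) = k + 1) :
    Exchange n (timeOf x) (timeOf ((Equiv.swap k k').trans x)) (x k) (x k') := by
  have key : ∀ a : Fin n, timeOf ((Equiv.swap k k').trans x) a = Equiv.swap k k' (x.symm a) := by
    intro a
    rw [timeOf_fin]
    rfl
  refine ⟨(x k).2, (x k').2, ?_, ?_, ?_⟩
  · rw [timeOf_fin, timeOf_fin]; simp; omega
  · rw [key, key]; simp; omega
  · intro i j hi hj h1 h2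
    obtain ⟨i, rfl⟩ : ∃ i' : Fin n, (i' : ℕ) = i := ⟨⟨i, hi⟩, rfl⟩
    obtain ⟨j, rfl⟩ : ∃ j' : Fin n, (j' : ℕ) = j := ⟨⟨j, hj⟩, rfl⟩
    rw [timeOf_fin, timeOf_fin, key, key]
    obtain ⟨a, rfl⟩ := x.surjective i
    obtain ⟨b, rfl⟩ := x.surjective j
    have h1' : ¬ (a = k ∧ b = k') := by rintro ⟨rfl, rfl⟩; exact h1 ⟨rfl, rfl⟩
    have h2' : ¬ (a = k' ∧ b = k) := by rintro ⟨rfl, rfl⟩; exact h2 ⟨rfl, rfl⟩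
    simp only [Equiv.symm_apply_apply, Equiv.swap_apply_def]
    simp only [Fin.ext_iff] at h1' h2' ⊢
    split_ifs <;> omega

/-- Bubble sort: unless `x = x₀`, two neighbouring entries of `x` are inverted with respect to `x₀`.
Exchanging them removes one inversion, and the new permutation agrees with `x` and `x₀` wherever
these agree, so by `SameIds.of_between` the ids do not change. -/
theorem mosaicEquiv_of_sameIds {n : ℕ} (hn : 1 ≤ n) (x₀ : Equiv.Perm (Fin n)) {X₀ Y₀ : ℕ → ℝ}
    (h₀ : MarkedBuild n (timeOf x₀) X₀ Y₀) (x : Equiv.Perm (Fin n)) {X Y : ℕ → ℝ}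
    (h : MarkedBuild n (timeOf x) X Y) (hid : SameIds n (timeOf x) (timeOf x₀)) :
    MosaicEquiv (h.tiling hn) (h₀.tiling hn) := by
  set inv : Equiv.Perm (Fin n) → Finset (Fin n × Fin n) := fun x => Finset.univ.filter fun ij =>
    timeOf x ij.1 < timeOf x ij.2 ∧ timeOf x₀ ij.2 < timeOf x₀ ij.1 with hinv
  induction hc : (inv x).card using Nat.strong_induction_on generalizing x X Y with
  | _ c ih =>
    subst hc
    by_cases hex : ∃ k k' : Fin n, (k' : ℕ) = k + 1 ∧ x₀.symm (x k') < x₀.symm (x k)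
    · obtain ⟨k, k', hk, hlt⟩ := hex
      have hs := exchange_swap x hk
      set x' := (Equiv.swap k k').trans x with hx'
      have hlt' : timeOf x₀ (x k') < timeOf x₀ (x k) := by
        rw [timeOf_fin, timeOf_fin]; exact hlt
      have hid' : SameIds n (timeOf x) (timeOf x') := by
        refine hid.of_between (timeOf_inj x) (timeOf_inj x₀) ?_
        intro i j hi hj h1 h2
        by_cases h3 : i = x k ∧ j = x k'
        · obtain ⟨rfl, rfl⟩ := h3; omega
        · by_cases h4 : i = x k' ∧ j = x k
          · obtain ⟨rfl, rfl⟩ := h4; exact hs.lt'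
          · exact (hs.agree i j hi hj h3 h4).1 h1
      obtain ⟨X', Y', h'⟩ := exists_markedBuild_timeOf x'
      refine (h.mosaicEquiv_of_exchange hn h' hid' hs).trans _ _ _ (ih _ ?_ x' h'
        (hid'.symm.trans hid) rfl)
      apply Finset.card_lt_card
      refine Finset.ssubset_iff_of_subset ?_ |>.2 ⟨(x k, x k'), ?_, ?_⟩
      · rintro ⟨i, j⟩ hij
        simp only [hinv, Finset.mem_filter, Finset.mem_univ, true_and] at hij ⊢
        obtain ⟨h1, h2⟩ := hij
        refine ⟨(hs.agree i j i.2 j.2 ?_ ?_).2 h1, h2⟩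
        · rintro ⟨e1, e2⟩
          have := hs.lt'
          rw [e1, e2] at h1; omega
        · rintro ⟨e1, e2⟩
          rw [e1, e2] at h2; omega
      · simp only [hinv, Finset.mem_filter, Finset.mem_univ, true_and]
        exact ⟨hs.lt, hlt'⟩
      · simp only [hinv, Finset.mem_filter, Finset.mem_univ, true_and]
        have := hs.lt'
        omega
    · push Not at hex
      have h1 : x.trans x₀.symm = 1 := by
        apply eq_one_of_lt_succ
        intro k k' hk
        refine lt_of_le_of_ne (hex k k' hk) fun e => ?_
        have := (x.trans x₀.symm).injective e
        rw [this] at hk; omega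
      have h2 : x = x₀ := by
        ext1 a
        have := Equiv.congr_fun h1 a
        simp only [Equiv.trans_apply, Equiv.Perm.coe_one, id] at this
        rw [Equiv.symm_apply_eq] at this
        exact this
      subst h2
      exact Relation.EqvGen.rel _ _ (Or.inl (h.sameRel h₀ hid (fun _ _ _ _ _ => Iff.rfl)
        (fun _ _ _ _ _ => Iff.rfl)))

end Rectangulation

namespace Rectangulation

/-! ### Comparators and blocked gaps -/

section blocked
variable {n : ℕ} {R : Tiling n} {vbef hbef : Fin n → Fin n → Prop}

/-- A prescription `bef a c` which of the marks of `a` (left) and `c` (right) on a common vertical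
wall comes first. -/
structure Comparator (R : Tiling n) (bef : Fin n → Fin n → Prop) : Prop where
  of_lt : ∀ a c, R.SameV a c → (R.tile a).y0 < (R.tile c).y1 → bef a c
  monoL : ∀ a a' c, R.SameV a c → R.SameV a' c → (R.tile a').y0 ≤ (R.tile a).y0 →
    bef a c → bef a' c
  monoR : ∀ a c c', R.SameV a c → R.SameV a c' → (R.tile c).y1 ≤ (R.tile c').y1 →
    bef a c → bef a c'

/-- The tile `z`, in a gap whose right end is at `u`, cannot be drawn before something to the right
of the gap has been drawn. -/
def Blocked (R : Tiling n) (vbef hbef : Fin n → Fin n → Prop) (U : Finset (Fin n)) (u : ℝ)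
    (z : Fin n) : Prop :=
  u < (R.tile z).x1 ∨ (∃ c ∈ U, R.SameV z c ∧ ¬ vbef z c) ∨ (∃ c ∈ U, R.swap.SameV c z ∧ hbef c z)

/-- At the intersection of a clear vertical and a clear horizontal segment, the tile in each of the
four quadrants must have a corner. -/
theorem Tiling.IsGeneric.not_clear_cross (hR : R.IsGeneric) {u v a b c d : ℝ}
    (h1 : R.Clear u a b) (h2 : R.swap.Clear v c d) (hav : a < v) (hvb : v < b) (hcu : c < u)
    (hud : u < d) (hu0 : R.outer.x0 < u) (hu1 : u < R.outer.x1) (hv0 : R.outer.y0 < v)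
    (hv1 : v < R.outer.y1) : False := by
  have key1 : ∀ m, (R.tile m).y0 ≤ v → v ≤ (R.tile m).y1 → (R.tile m).x0 ≤ u → u ≤ (R.tile m).x1 →
      (R.tile m).x0 = u ∨ (R.tile m).x1 = u := by
    intro m k1 k2 k3 k4
    by_contra hcon
    push Not at hcon
    rcases h1 m (lt_of_le_of_ne k3 hcon.1) (lt_of_le_of_ne k4 hcon.2.symm) with h | h
    · linarith
    · linarith
  have key2 : ∀ m, (R.tile m).y0 ≤ v → v ≤ (R.tile m).y1 → (R.tile m).x0 ≤ u → u ≤ (R.tile m).x1 →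
      (R.tile m).y0 = v ∨ (R.tile m).y1 = v := by
    intro m k1 k2 k3 k4
    by_contra hcon
    push Not at hcon
    have h : d ≤ (R.tile m).x0 ∨ (R.tile m).x1 ≤ c :=
      h2 m (lt_of_le_of_ne k1 hcon.1) (lt_of_le_of_ne k2 hcon.2.symm)
    rcases h with h | h
    · linarith
    · linarith
  obtain ⟨i, i1, i2, i3, i4⟩ := R.exists_ne hu0.le hu1 hv0.le hv1
  obtain ⟨j, j1, j2, j3, j4⟩ := R.exists_nw hu0 hu1.le hv0.le hv1
  obtain ⟨k, k1, k2, k3, k4⟩ := R.exists_sw hu0 hu1.le hv0 hv1.le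
  obtain ⟨l, l1, l2, l3, l4⟩ := R.exists_se hu0.le hu1 hv0 hv1.le
  refine hR.no_cross (u := u) (v := v) (a := i) (b := j) (c := k) (d := l) ⟨?_, ?_⟩ ⟨?_, ?_⟩ ⟨?_, ?_⟩ ⟨?_, ?_⟩
  · exact (key1 i i3 i4.le i1 i2.le).resolve_right i2.ne'
  · exact (key2 i i3 i4.le i1 i2.le).resolve_right i4.ne'
  · exact (key1 j j3 j4.le j1.le j2).resolve_left j1.ne
  · exact (key2 j j3 j4.le j1.le j2).resolve_right j4.ne'
  · exact (key1 k k3.le k4 k1.le k2).resolve_left k1.ne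
  · exact (key2 k k3.le k4 k1.le k2).resolve_left k3.ne
  · exact (key1 l l3.le l4 l1 l2.le).resolve_right l2.ne'
  · exact (key2 l l3.le l4 l1 l2.le).resolve_left l3.ne

/-- The tiles `g` and `g'` lie in the gaps to the left and to the right of a bump with top-right
corner `(u, v)`. -/
structure Corner (R : Tiling n) (U : Finset (Fin n)) (u0 u u1 v0 v v1 : ℝ) (g g' : Fin n) :
    Prop where
  hu0 : u0 < u
  hu1 : u < u1
  hv0 : v0 < v
  hv1 : v < v1
  bu0 : R.outer.x0 ≤ u0
  bu1 : u1 ≤ R.outer.x1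
  bv0 : R.outer.y0 ≤ v0
  bv1 : v1 ≤ R.outer.y1
  gx : (R.tile g).x0 = u0
  gy : (R.tile g).y0 = v
  gx' : (R.tile g').x0 = u
  gy' : (R.tile g').y0 = v0
  mid : ∀ c ∈ U, u ≤ (R.tile c).x0 ∨ v ≤ (R.tile c).y0
  left : ∀ c ∈ U, u0 ≤ (R.tile c).x0 ∨ v1 ≤ (R.tile c).y0
  right : ∀ c ∈ U, u1 ≤ (R.tile c).x0 ∨ v0 ≤ (R.tile c).y0

namespace Corner
variable {U : Finset (Fin n)} {u0 u u1 v0 v v1 : ℝ} {g g' : Fin n}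

theorem swap (h : Corner R U u0 u u1 v0 v v1 g g') : Corner R.swap U v0 v v1 u0 u u1 g' g :=
  ⟨h.hv0, h.hv1, h.hu0, h.hu1, h.bv0, h.bv1, h.bu0, h.bu1, h.gy', h.gx', h.gy, h.gx,
    fun c hc => (h.mid c hc).symm, fun c hc => (h.right c hc).symm,
    fun c hc => (h.left c hc).symm⟩

variable (h : Corner R U u0 u u1 v0 v v1 g g')
include h

theorem not_lt_lt (h1 : u < (R.tile g).x1) (h2 : v < (R.tile g').y1) : False := by
  have := h.gx
  have := h.gy
  have := h.gx'
  have := h.gy'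
  have := h.hu0
  have := h.hv0
  have hx := R.hx g'
  have hy := R.hy g
  have : g = g' := R.tile_eq (by linarith) (by linarith) (by linarith) (by linarith)
  subst this
  linarith

/-- An undrawn tile `d` to the left of the abscissa `u` lies above the bump. So a wall joining `d`
and `g'` passes beyond the corner `(u, v)`, just where the interior of `g` would cross it. -/
theorem not_lt_sameV (h1 : u < (R.tile g).x1) {d : Fin n} (hd : d ∈ U) (h2 : R.SameV d g') :
    False := by
  have := h.gx
  have := h.gy
  have := h.gx'
  have := h.gy'
  have := h.hu0
  have := h.hv0
  have hx := R.hx d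
  have hy := R.hy d
  have hyg := R.hy g
  obtain ⟨k1, k2⟩ := h2
  have k3 : v ≤ (R.tile d).y0 := (h.mid d hd).resolve_left (by linarith)
  have m1 := min_le_right (R.tile d).y0 (R.tile g').y0
  have m2 := le_max_left (R.tile d).y1 (R.tile g').y1
  rcases k2 g (by linarith) (by linarith) with k4 | k4
  · linarith
  · linarith

/-- Consequences of a tile in the upper left having to be drawn after `g'` by the comparator. -/
theorem of_not_bef (hH : Comparator R.swap hbef) {d : Fin n} (hd : d ∈ U)
    (h1 : R.swap.SameV g' d) (h2 : ¬ hbef g' d) (h3 : (R.tile g').y1 ≤ v) :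
    (R.tile g').y1 = v ∧ (R.tile d).y0 = v ∧ (R.tile d).x1 ≤ u ∧ u0 ≤ (R.tile d).x0 := by
  have := h.gx'
  have := h.hv1
  have hx := R.hx d
  have k1 : (R.tile d).x1 ≤ (R.tile g').x0 := by
    by_contra hcon
    exact h2 (hH.of_lt g' d h1 (not_le.1 hcon))
  have k2 : (R.tile g').y1 = (R.tile d).y0 := h1.1
  have k3 : v ≤ (R.tile d).y0 := (h.mid d hd).resolve_left (by linarith)
  have k4 : u0 ≤ (R.tile d).x0 := (h.left d hd).resolve_right (by linarith)
  exact ⟨by linarith, by linarith, by linarith, k4⟩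

theorem not_lt_not_bef (hH : Comparator R.swap hbef) (h1 : u < (R.tile g).x1) {d : Fin n}
    (hd : d ∈ U) (h2 : R.swap.SameV g' d) (h3 : ¬ hbef g' d) (h4 : (R.tile g').y1 ≤ v) : False := by
  obtain ⟨k1, k2, k3, k4⟩ := h.of_not_bef hH hd h2 h3 h4
  have := h.gx
  have := h.gy
  have := h.hu0
  have hx := R.hx d
  have hy := R.hy d
  have hyg := R.hy g
  have : d = g := R.tile_eq (by linarith) (by linarith) (by linarith) (by linarith)
  subst this
  linarith

/-- Both failures together make the right wall of `g` continue below `(u, v)` and the top wall of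
`g'` continue to the left of it, and these walls would cross. -/
theorem not_bef_not_bef (hR : R.IsGeneric) (hV : Comparator R vbef) (hH : Comparator R.swap hbef)
    {c d : Fin n} (hc : c ∈ U) (hd : d ∈ U) (h1 : R.SameV g c) (h2 : ¬ vbef g c)
    (h3 : R.swap.SameV g' d) (h4 : ¬ hbef g' d)
    (h5 : (R.tile g).x1 ≤ u) (h6 : (R.tile g').y1 ≤ v) : False := by
  obtain ⟨k1, k2, k3, k4⟩ := h.of_not_bef hH hd h3 h4 h6
  obtain ⟨l1, l2, l3, l4⟩ : (R.tile g).x1 = u ∧ (R.tile c).x0 = u ∧ (R.tile c).y1 ≤ v ∧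
    v0 ≤ (R.tile c).y0 := h.swap.of_not_bef hV hc h1 h2 h5
  have := h.gx'
  have := h.gy
  have hx := R.hx d
  have hy := R.hy c
  have hyg := R.hy g
  have hxg := R.hx g'
  have e1 : R.Clear (R.tile g).x1 (R.tile c).y0 (R.tile g).y1 :=
    h1.2.mono (min_le_right _ _) (le_max_left _ _)
  have e2 : R.swap.Clear (R.tile g').y1 (R.tile d).x0 (R.tile g').x1 :=
    h3.2.mono (min_le_right _ _) (le_max_left _ _)
  rw [l1] at e1
  rw [k1] at e2
  exact hR.not_clear_cross e1 e2 (by linarith) (by linarith) (by linarith) (by linarith)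
    (h.bu0.trans_lt h.hu0) (h.hu1.trans_le h.bu1) (h.bv0.trans_lt h.hv0) (h.hv1.trans_le h.bv1)

/-- The bottom wall of `g` continues to the right of the corner `(u, v)` and the left wall of `g'`
continues above it, which is a crossing again. -/
theorem not_sameV_sameV (hR : R.IsGeneric)
    {c d : Fin n} (hc : c ∈ U) (hd : d ∈ U) (h1 : R.swap.SameV c g) (h2 : R.SameV d g') :
    False := by
  have := h.gx
  have := h.gy
  have := h.gx'
  have := h.gy'
  have := h.hu0
  have := h.hv0
  have hxd := R.hx d
  have hyd := R.hy d
  have hxc := R.hx c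
  have hyc := R.hy c
  have k0 : (R.tile c).y1 = (R.tile g).y0 := h1.1
  have l0 : (R.tile d).x1 = (R.tile g').x0 := h2.1
  have k1 : u ≤ (R.tile c).x0 := (h.mid c hc).resolve_right (by linarith)
  have l1 : v ≤ (R.tile d).y0 := (h.mid d hd).resolve_left (by linarith)
  have e1 : R.Clear (R.tile d).x1 (R.tile g').y0 (R.tile d).y1 :=
    h2.2.mono (min_le_right _ _) (le_max_left _ _)
  have e2 : R.swap.Clear (R.tile c).y1 (R.tile g).x0 (R.tile c).x1 :=
    h1.2.mono (min_le_right _ _) (le_max_left _ _)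
  rw [l0, h.gx'] at e1
  rw [k0, h.gy] at e2
  exact hR.not_clear_cross e1 e2 (by linarith) (by linarith) (by linarith) (by linarith)
    (h.bu0.trans_lt h.hu0) (h.hu1.trans_le h.bu1) (h.bv0.trans_lt h.hv0) (h.hv1.trans_le h.bv1)

/-- All four tiles lie on one wall, with `g` not higher than `d` on the left and `g'` not higher
than `c` on the right. Monotonicity of the comparator carries `vbef d g'` over to `vbef g c`. -/
theorem not_not_bef_bef (hV : Comparator R vbef) {c d : Fin n} (hc : c ∈ U) (hd : d ∈ U)
    (h1 : R.SameV g c) (h2 : ¬ vbef g c) (h3 : R.SameV d g') (h4 : vbef d g')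
    (h5 : (R.tile g).x1 ≤ u) : False := by
  obtain ⟨l1, l2, l3, l4⟩ : (R.tile g).x1 = u ∧ (R.tile c).x0 = u ∧ (R.tile c).y1 ≤ v ∧
    v0 ≤ (R.tile c).y0 := h.swap.of_not_bef hV hc h1 h2 h5
  have := h.gx
  have hgy := h.gy
  have hgx' := h.gx'
  have := h.gy'
  have := h.hv0
  have hxd := R.hx d
  have hyd := R.hy d
  have hyc := R.hy c
  have hyg := R.hy g
  have hyg' := R.hy g'
  have l0 : (R.tile d).x1 = (R.tile g').x0 := h3.1
  have k1 : v ≤ (R.tile d).y0 := (h.mid d hd).resolve_left (by linarith)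
  have k2 : (R.tile g').y1 ≤ (R.tile c).y1 := by
    by_contra hcon
    have : g' = c := R.eq_of_x0 (by linarith) (by linarith) (by linarith)
    subst this
    exact hcon le_rfl
  have e1 := h1.2
  have e3 := h3.2
  rw [l1] at e1
  rw [l0, hgx'] at e3
  have e : R.SameV g g' := by
    refine ⟨l1.trans hgx'.symm, ?_⟩
    rw [l1]
    refine (e3.union e1 ?_).mono ?_ ?_
    · exact (min_le_left _ _).trans (by rw [le_max_iff]; left; linarith)
    · exact le_min ((min_le_right _ _).trans (by linarith)) (min_le_right _ _)
    · refine max_le (le_max_left _ _) (le_max_of_le_right k2)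
  exact h2 (hV.monoR g g' c e h1 k2 (hV.monoL d g g' h3 e (by linarith) h4))

/-- Each of `g` and `g'` has three possible reasons to wait: it extends over the bump between them;
an undrawn tile across its far wall is prescribed to come first; or an undrawn tile on the other
side of its base wall is prescribed to come first. The nine combinations are excluded one by one,
several of them by transposition. This is the step that keeps the greedy construction from getting
stuck. -/
theorem not_blocked (hR : R.IsGeneric) (hV : Comparator R vbef) (hH : Comparator R.swap hbef)
    (h1 : Blocked R vbef hbef U u g) (h2 : Blocked R.swap hbef vbef U v g') : False := by
  have hs := h.swap
  have hH' : Comparator R.swap.swap vbef := hV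
  rcases lt_or_ge u (R.tile g).x1 with k1 | k1
  · rcases lt_or_ge v (R.tile g').y1 with k2 | k2
    · exact h.not_lt_lt k1 k2
    · rcases h2 with h2 | ⟨d, hd, h2, h3⟩ | ⟨d, hd, h2, h3⟩
      · exact absurd h2 (not_lt.2 k2)
      · exact h.not_lt_not_bef hH k1 hd h2 h3 k2
      · exact h.not_lt_sameV k1 hd h2
  · rcases h1 with h1 | ⟨c, hc, h1, k3⟩ | ⟨c, hc, h1, k3⟩
    · exact absurd h1 (not_lt.2 k1)
    · rcases lt_or_ge v (R.tile g').y1 with k2 | k2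
      · exact hs.not_lt_not_bef hH' k2 hc h1 k3 k1
      · rcases h2 with h2 | ⟨d, hd, h2, h3⟩ | ⟨d, hd, h2, h3⟩
        · exact absurd h2 (not_lt.2 k2)
        · exact h.not_bef_not_bef hR hV hH hc hd h1 k3 h2 h3 k1 k2
        · exact h.not_not_bef_bef hV hc hd h1 k3 h2 h3 k1
    · rcases lt_or_ge v (R.tile g').y1 with k2 | k2
      · exact hs.not_lt_sameV k2 hc h1
      · rcases h2 with h2 | ⟨d, hd, h2, h3⟩ | ⟨d, hd, h2, h3⟩
        · exact absurd h2 (not_lt.2 k2)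
        · exact hs.not_not_bef_bef hH hd hc h2 h3 h1 k3 k2
        · exact h.not_sameV_sameV hR hc hd h1 h2

end Corner

/-- Nothing in the rightmost gap is blocked from the right. -/
theorem not_blocked_of_last (hV : Comparator R vbef) {U : Finset (Fin n)} {v : ℝ} {z : Fin n}
    (hz : (R.tile z).y0 = v) (hU : ∀ c ∈ U, R.outer.x1 ≤ (R.tile c).x0 ∨ v ≤ (R.tile c).y0) :
    ¬ Blocked R vbef hbef U R.outer.x1 z := by
  have hU' : ∀ c ∈ U, v ≤ (R.tile c).y0 := fun c hc => (hU c hc).resolve_left fun h => by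
    have := R.hx c
    have := (R.bounds c).2.1
    linarith
  rintro (h | ⟨c, hc, h1, h2⟩ | ⟨c, hc, h1, h2⟩)
  · exact absurd h (not_lt.2 (R.bounds z).2.1)
  · refine h2 (hV.of_lt z c h1 ?_)
    have := hU' c hc
    have := R.hy c
    linarith
  · have k1 : (R.tile c).y1 = (R.tile z).y0 := h1.1
    have := hU' c hc
    have := R.hy c
    linarith

end blocked

end Rectangulation

namespace Rectangulation

/-! ### The greedy construction: the state -/

/-- A bump of the staircase of the tiles drawn so far: the labels of its tiles, from left to right,
and its top-right corner. -/
structure Bump (n : ℕ) where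
  L : List (Fin n)
  X : ℝ
  Y : ℝ

/-! ### Words made of the blocks of bumps, with later labels inserted between them. -/

section fill
variable {n : ℕ}

/-- `Q` arises from the bumps in `C` by inserting labels in `W` before each bump. -/
def Post (W : List (Fin n)) : List (Bump n) → List (Fin n) → Prop
  | [], Q => Q = []
  | B :: C, Q => ∃ G Q', G ≠ [] ∧ (∀ i ∈ G, i ∈ W) ∧ Post W C Q' ∧ Q = G ++ (B.L ++ Q')

/-- `P` arises from the bumps in `A` by inserting labels in `W` after each bump. -/
def Pre (W : List (Fin n)) : List (Bump n) → List (Fin n) → Prop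
  | [], P => P = []
  | B :: A, P => ∃ Q G, Post W A Q ∧ G ≠ [] ∧ (∀ i ∈ G, i ∈ W) ∧ P = B.L ++ (Q ++ G)

/-- `l` arises from the bumps in `S` by inserting labels in `W` between consecutive bumps. -/
def Fill (W : List (Fin n)) : List (Bump n) → List (Fin n) → Prop
  | [], _ => False
  | B :: C, l => ∃ Q, Post W C Q ∧ l = B.L ++ Q

variable {W W' : List (Fin n)} {A C : List (Bump n)} {B : Bump n} {P Q l : List (Fin n)}

theorem post_append : Post W (A ++ C) Q ↔
    ∃ Q1 Q2, Post W A Q1 ∧ Post W C Q2 ∧ Q = Q1 ++ Q2 := by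
  induction A generalizing Q with
  | nil =>
    constructor
    · intro h; exact ⟨[], Q, rfl, h, rfl⟩
    · rintro ⟨_, Q2, rfl, h, rfl⟩; exact h
  | cons B A ih =>
    constructor
    · rintro ⟨G, Q', h1, h2, h3, rfl⟩
      obtain ⟨Q1, Q2, h4, h5, rfl⟩ := ih.1 h3
      exact ⟨G ++ (B.L ++ Q1), Q2, ⟨G, Q1, h1, h2, h4, rfl⟩, h5, by simp⟩
    · rintro ⟨_, Q2, ⟨G, Q1, h1, h2, h4, rfl⟩, h5, rfl⟩
      exact ⟨G, Q1 ++ Q2, h1, h2, ih.2 ⟨Q1, Q2, h4, h5, rfl⟩, by simp⟩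

theorem fill_append : Fill W (A ++ B :: C) l ↔
    ∃ P Q, Pre W A P ∧ Post W C Q ∧ l = P ++ (B.L ++ Q) := by
  cases A with
  | nil =>
    constructor
    · rintro ⟨Q, h, rfl⟩; exact ⟨[], Q, rfl, h, rfl⟩
    · rintro ⟨_, Q, rfl, h, rfl⟩; exact ⟨Q, h, rfl⟩
  | cons B0 A =>
    constructor
    · rintro ⟨Q, h, rfl⟩
      obtain ⟨Q1, _, h1, ⟨G, Q2, h2, h3, h4, rfl⟩, rfl⟩ := post_append.1 h
      exact ⟨B0.L ++ (Q1 ++ G), Q2, ⟨Q1, G, h1, h2, h3, rfl⟩, h4, by simp⟩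
    · rintro ⟨_, Q2, ⟨Q1, G, h1, h2, h3, rfl⟩, h4, rfl⟩
      exact ⟨Q1 ++ (G ++ (B.L ++ Q2)), post_append.2 ⟨Q1, _, h1, ⟨G, Q2, h2, h3, h4, rfl⟩, rfl⟩,
        by simp⟩

theorem pre_snoc (h : Pre W (A ++ [B]) P) :
    ∃ P0 G, Pre W A P0 ∧ G ≠ [] ∧ (∀ i ∈ G, i ∈ W) ∧ P = P0 ++ (B.L ++ G) := by
  cases A with
  | nil =>
    obtain ⟨Q, G, rfl, h1, h2, rfl⟩ := h
    exact ⟨[], G, rfl, h1, h2, rfl⟩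
  | cons B0 A =>
    obtain ⟨Q, G, h0, h1, h2, rfl⟩ := h
    obtain ⟨Q1, _, h3, ⟨G', _, h4, h5, rfl, rfl⟩, rfl⟩ := post_append.1 h0
    exact ⟨B0.L ++ (Q1 ++ G'), G, ⟨Q1, G', h3, h4, h5, rfl⟩, h1, h2, by simp⟩

theorem Post.mono (hW : ∀ i ∈ W, i ∈ W') (h : Post W C Q) : Post W' C Q := by
  induction C generalizing Q with
  | nil => exact h
  | cons B C ih =>
    obtain ⟨G, Q', h1, h2, h3, rfl⟩ := h
    exact ⟨G, Q', h1, fun i hi => hW i (h2 i hi), ih h3, rfl⟩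

theorem Pre.mono (hW : ∀ i ∈ W, i ∈ W') (h : Pre W A P) : Pre W' A P := by
  cases A with
  | nil => exact h
  | cons B A =>
    obtain ⟨Q, G, h1, h2, h3, rfl⟩ := h
    exact ⟨Q, G, h1.mono hW, h2, fun i hi => hW i (h3 i hi), rfl⟩

theorem Post.mem (h : Post W C Q) {i : Fin n} (hi : i ∈ Q) : i ∈ W ∨ ∃ D ∈ C, i ∈ D.L := by
  induction C generalizing Q with
  | nil =>
    have h : Q = [] := h
    subst h; simp at hi
  | cons B C ih =>
    obtain ⟨G, Q', h1, h2, h3, rfl⟩ := h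
    simp only [List.mem_append] at hi
    rcases hi with hi | hi | hi
    · exact Or.inl (h2 i hi)
    · exact Or.inr ⟨B, by simp, hi⟩
    · rcases ih h3 hi with h | ⟨D, hD, h⟩
      · exact Or.inl h
      · exact Or.inr ⟨D, by simp [hD], h⟩

theorem Pre.mem (h : Pre W A P) {i : Fin n} (hi : i ∈ P) : i ∈ W ∨ ∃ D ∈ A, i ∈ D.L := by
  cases A with
  | nil =>
    have h : P = [] := h
    subst h; simp at hi
  | cons B A =>
    obtain ⟨Q, G, h1, h2, h3, rfl⟩ := h
    simp only [List.mem_append] at hi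
    rcases hi with hi | hi | hi
    · exact Or.inr ⟨B, by simp, hi⟩
    · rcases h1.mem hi with h | ⟨D, hD, h⟩
      · exact Or.inl h
      · exact Or.inr ⟨D, by simp [hD], h⟩
    · exact Or.inl (h3 i hi)

theorem Post.head (h : Post W C Q) (hC : C ≠ []) : ∃ e, Q.head? = some e ∧ e ∈ W := by
  cases C with
  | nil => exact absurd rfl hC
  | cons B C =>
    obtain ⟨G, Q', h1, h2, h3, rfl⟩ := h
    cases G with
    | nil => exact absurd rfl h1
    | cons e G => exact ⟨e, by simp, h2 e (by simp)⟩

theorem Pre.last (h : Pre W A P) (hA : A ≠ []) : ∃ e, P.reverse.head? = some e ∧ e ∈ W := by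
  cases A with
  | nil => exact absurd rfl hA
  | cons B A =>
    obtain ⟨Q, G, h1, h2, h3, rfl⟩ := h
    rcases List.eq_nil_or_concat G with rfl | ⟨G', e, rfl⟩
    · exact absurd rfl h2
    · exact ⟨e, by simp, h3 e (by simp)⟩

theorem Post.eq_nil (h : Post W C Q) (hC : C = []) : Q = [] := by
  subst hC; exact h

theorem Pre.eq_nil (h : Pre W A P) (hA : A = []) : P = [] := by
  subst hA; exact h

end fill

/-! ### The invariant of the drawn staircase. -/

section state
variable {n : ℕ} {R : Tiling n} {vbef hbef : Fin n → Fin n → Prop}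

/-- The part of the staircase drawn so far, with the set `U` of tiles not yet drawn. -/
structure Inv (R : Tiling n) (S : List (Bump n)) (U : Finset (Fin n)) : Prop where
  mono : S.Pairwise fun B C => B.X < C.X ∧ C.Y < B.Y
  bounds : ∀ B ∈ S, R.outer.x0 ≤ B.X ∧ B.X ≤ R.outer.x1 ∧ R.outer.y0 ≤ B.Y ∧ B.Y ≤ R.outer.y1
  top : ∃ B ∈ S, B.Y = R.outer.y1
  right : ∃ B ∈ S, B.X = R.outer.x1
  empty : ∀ B ∈ S, B.L = [] →
    (B.X = R.outer.x0 ∧ B.Y = R.outer.y1) ∨ (B.X = R.outer.x1 ∧ B.Y = R.outer.y0)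
  first : ∀ B ∈ S, ∀ f, B.L.head? = some f → (R.tile f).y1 = B.Y
  last : ∀ B ∈ S, ∀ e, B.L.getLast? = some e → (R.tile e).x1 = B.X
  drawn : ∀ i, i ∉ U → ∃ B ∈ S, i ∈ B.L
  mem : ∀ B ∈ S, ∀ i ∈ B.L, i ∉ U ∧ (R.tile i).x1 ≤ B.X ∧ (R.tile i).y1 ≤ B.Y
  undrawn : ∀ c ∈ U, ∀ B ∈ S, B.X ≤ (R.tile c).x0 ∨ B.Y ≤ (R.tile c).y0

/-- Two empty bumps, at the top-left and at the bottom-right corner, stand for the left and the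
bottom edge of the outer rectangle. -/
theorem inv_init (R : Tiling n) : Inv R
    [⟨[], R.outer.x0, R.outer.y1⟩, ⟨[], R.outer.x1, R.outer.y0⟩] Finset.univ := by
  have hx := R.outer_nondeg.1
  have hy := R.outer_nondeg.2
  refine ⟨?_, ?_, ?_, ?_, ?_, ?_, ?_, ?_, ?_, ?_⟩
  · simp [hx, hy]
  · simp [hx.le, hy.le]
  · simp
  · simp
  · simp
  · simp
  · simp
  · simp
  · simp
  · intro c _ B hB
    simp only [List.mem_cons, List.not_mem_nil, or_false] at hB
    rcases hB with rfl | rfl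
    · exact Or.inl (R.bounds c).1
    · exact Or.inr (R.bounds c).2.2.1

section gap
variable {S A C : List (Bump n)} {U : Finset (Fin n)} {B B' : Bump n}

theorem Inv.pair (h : Inv R (A ++ B :: B' :: C) U) :
    (B.X < B'.X ∧ B'.Y < B.Y) ∧ (∀ D ∈ A, D.X < B.X ∧ B.Y < D.Y) ∧
      (∀ D ∈ C, B'.X < D.X ∧ D.Y < B'.Y) := by
  have h1 := h.mono
  simp only [List.pairwise_append, List.pairwise_cons, List.mem_cons] at h1
  obtain ⟨_, ⟨h2, h3, _⟩, h4⟩ := h1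
  exact ⟨h2 B' (Or.inl rfl), fun D hD => h4 D hD B (Or.inl rfl), h3⟩

/-- The tile at the inner corner of a gap has not been drawn. -/
theorem Inv.exists_gap_tile (h : Inv R (A ++ B :: B' :: C) U) :
    ∃ z ∈ U, (R.tile z).x0 = B.X ∧ (R.tile z).y0 = B'.Y := by
  obtain ⟨⟨h1, h2⟩, h3, h4⟩ := h.pair
  obtain ⟨b1, b2, b3, b4⟩ := h.bounds B (by simp)
  obtain ⟨c1, c2, c3, c4⟩ := h.bounds B' (by simp)
  obtain ⟨z, z1, z2, z3, z4⟩ := R.exists_ne (u := B.X) (v := B'.Y) b1 (by linarith) c3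
    (by linarith)
  have hz : z ∈ U := by
    by_contra hz
    obtain ⟨D, hD, hzD⟩ := h.drawn z hz
    obtain ⟨_, k1, k2⟩ := h.mem D hD z hzD
    simp only [List.mem_append, List.mem_cons] at hD
    rcases hD with hD | rfl | rfl | hD
    · have := h3 D hD; linarith
    · linarith
    · linarith
    · have := h4 D hD; linarith
  refine ⟨z, hz, le_antisymm z1 ?_, le_antisymm z3 ?_⟩
  · exact (h.undrawn z hz B (by simp)).resolve_right (by linarith)
  · exact (h.undrawn z hz B' (by simp)).resolve_left (by linarith)

theorem Inv.eq_top (h : Inv R (B :: C) U) : B.Y = R.outer.y1 := by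
  obtain ⟨D, hD, e⟩ := h.top
  rcases List.mem_cons.1 hD with rfl | hD
  · exact e
  · have h1 := (List.pairwise_cons.1 h.mono).1 D hD
    have := (h.bounds B (by simp)).2.2.2
    linarith

theorem Inv.eq_right (h : Inv R (A ++ [B]) U) : B.X = R.outer.x1 := by
  obtain ⟨D, hD, e⟩ := h.right
  rcases List.mem_append.1 hD with hD | hD
  · have h1 := (List.pairwise_append.1 h.mono).2.2 D hD B (by simp)
    have := (h.bounds B (by simp)).2.1
    linarith
  · rw [List.mem_singleton] at hD
    rw [← hD]; exact e

/-- Some gap can be filled. -/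
theorem Inv.exists_free (hR : R.IsGeneric) (hV : Comparator R vbef)
    (hH : Comparator R.swap hbef) (h : Inv R (B :: B' :: C) U) :
    ∃ A D D' E z, B :: B' :: C = A ++ D :: D' :: E ∧ z ∈ U ∧ (R.tile z).x0 = D.X ∧
      (R.tile z).y0 = D'.Y ∧ ¬ Blocked R vbef hbef U D'.X z ∧
      ¬ Blocked R.swap hbef vbef U D.Y z := by
  obtain ⟨S, hS⟩ : ∃ S, S = B :: B' :: C := ⟨_, rfl⟩
  rw [← hS] at h ⊢
  -- The gaps are scanned from left to right, under the assumption that the tile of the current gap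
  -- is not blocked from the left. If it is not blocked from the right either, it is free; otherwise
  -- `Corner.not_blocked` shows that the tile of the next gap is not blocked from the left. The last
  -- gap is never blocked from the right.
  have key : ∀ (E A : List (Bump n)) (D D' : Bump n), S = A ++ D :: D' :: E →
      (∀ z ∈ U, (R.tile z).x0 = D.X → (R.tile z).y0 = D'.Y →
        ¬ Blocked R.swap hbef vbef U D.Y z) →
      ∃ A D D' E z, S = A ++ D :: D' :: E ∧ z ∈ U ∧ (R.tile z).x0 = D.X ∧
      (R.tile z).y0 = D'.Y ∧ ¬ Blocked R vbef hbef U D'.X z ∧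
      ¬ Blocked R.swap hbef vbef U D.Y z := by
    intro E
    induction E with
    | nil =>
      intro A D D' e hz
      rw [e] at h
      obtain ⟨z, z1, z2, z3⟩ := h.exists_gap_tile
      refine ⟨A, D, D', [], z, e, z1, z2, z3, ?_, hz z z1 z2 z3⟩
      rw [show A ++ [D, D'] = (A ++ [D]) ++ [D'] by simp] at h
      have h1 := h.eq_right
      rw [h1]
      exact not_blocked_of_last hV z3 fun c hc => h1 ▸ h.undrawn c hc D' (by simp)
    | cons D'' E ih =>
      intro A D D' e hz
      by_cases hex : ∃ z ∈ U, (R.tile z).x0 = D.X ∧ (R.tile z).y0 = D'.Y ∧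
          ¬ Blocked R vbef hbef U D'.X z
      · obtain ⟨z, z1, z2, z3, z4⟩ := hex
        exact ⟨A, D, D', _, z, e, z1, z2, z3, z4, hz z z1 z2 z3⟩
      · push Not at hex
        have e' : S = (A ++ [D]) ++ D' :: D'' :: E := by rw [e]; simp
        refine ih (A ++ [D]) D' D'' e' ?_
        intro g' k1 k2 k3 k4
        have h' := h
        rw [e] at h
        rw [e'] at h'
        obtain ⟨g, z1, z2, z3⟩ := h.exists_gap_tile
        have hc : Corner R U D.X D'.X D''.X D''.Y D'.Y D.Y g g' :=
          ⟨h.pair.1.1, h'.pair.1.1, h'.pair.1.2, h.pair.1.2, (h.bounds D (by simp)).1,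
            (h.bounds D'' (by simp)).2.1, (h.bounds D'' (by simp)).2.2.1,
            (h.bounds D (by simp)).2.2.2, z2, z3, k2, k3,
            fun c hc => h.undrawn c hc D' (by simp), fun c hc => h.undrawn c hc D (by simp),
            fun c hc => h.undrawn c hc D'' (by simp)⟩
        exact hc.not_blocked hR hV hH (hex g z1 z2 z3) k4
  refine key C [] B B' hS ?_
  intro z z1 z2 z3
  rw [hS] at h
  have h1 := h.eq_top
  rw [h1]
  refine not_blocked_of_last (R := R.swap) hH z2 fun c hc => ?_
  have := (h.undrawn c hc B (by simp)).symm
  rw [h1] at this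
  exact this

end gap

end state

end Rectangulation

namespace Rectangulation

/-! ### The greedy construction: drawing a tile -/

section draw
variable {n : ℕ} {R : Tiling n} {vbef hbef : Fin n → Fin n → Prop}
  {A C : List (Bump n)} {U : Finset (Fin n)} {B B' : Bump n} {z : Fin n}

/-- The new bump and the bumps that survive when the tile `z` is drawn between `B` and `B'`: those
left of the new bump are `A ++ kb`, those right of it are `kb' ++ C`. -/
structure Draw (R : Tiling n) (B B' : Bump n) (z : Fin n) (kb kb' : List (Bump n))
    (dl dr : List (Fin n)) : Prop where
  left : (kb = [B] ∧ dl = [] ∧ (R.tile z).y1 < B.Y) ∨ (kb = [] ∧ dl = B.L ∧ (R.tile z).y1 = B.Y)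
  right : (kb' = [B'] ∧ dr = [] ∧ (R.tile z).x1 < B'.X) ∨
    (kb' = [] ∧ dr = B'.L ∧ (R.tile z).x1 = B'.X)

theorem exists_draw (h1 : (R.tile z).y1 ≤ B.Y) (h2 : (R.tile z).x1 ≤ B'.X) :
    ∃ kb kb' dl dr, Draw R B B' z kb kb' dl dr := by
  rcases h1.lt_or_eq with h1 | h1 <;> rcases h2.lt_or_eq with h2 | h2
  · exact ⟨_, _, _, _, Or.inl ⟨rfl, rfl, h1⟩, Or.inl ⟨rfl, rfl, h2⟩⟩
  · exact ⟨_, _, _, _, Or.inl ⟨rfl, rfl, h1⟩, Or.inr ⟨rfl, rfl, h2⟩⟩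
  · exact ⟨_, _, _, _, Or.inr ⟨rfl, rfl, h1⟩, Or.inl ⟨rfl, rfl, h2⟩⟩
  · exact ⟨_, _, _, _, Or.inr ⟨rfl, rfl, h1⟩, Or.inr ⟨rfl, rfl, h2⟩⟩

/-- The tile `z` becomes a bump of its own. It swallows `B` if it reaches the same height, and `B'`
if it reaches equally far to the right; a gap on either side otherwise survives. -/
theorem Inv.draw (h : Inv R (A ++ B :: B' :: C) U) (hz : z ∈ U) (hx : (R.tile z).x0 = B.X)
    (hy : (R.tile z).y0 = B'.Y) (h1 : (R.tile z).y1 ≤ B.Y) (h2 : (R.tile z).x1 ≤ B'.X)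
    {kb kb' : List (Bump n)} {dl dr : List (Fin n)} (hd : Draw R B B' z kb kb' dl dr) :
    Inv R ((A ++ kb) ++ ⟨dl ++ z :: dr, (R.tile z).x1, (R.tile z).y1⟩ :: (kb' ++ C))
      (U.erase z) := by
  obtain ⟨⟨p1, p2⟩, p3, p4⟩ := h.pair
  have hzx := R.hx z
  have hzy := R.hy z
  have hzb := R.bounds z
  have hkb : ∀ D ∈ kb, D = B ∧ (R.tile z).y1 < B.Y := by
    rcases hd.left with ⟨rfl, -, h3⟩ | ⟨rfl, -, -⟩ <;> simp [*]
  have hkb' : ∀ D ∈ kb', D = B' ∧ (R.tile z).x1 < B'.X := by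
    rcases hd.right with ⟨rfl, -, h3⟩ | ⟨rfl, -, -⟩ <;> simp [*]
  have hdl : ∀ i ∈ dl, i ∈ B.L ∧ (R.tile z).y1 = B.Y := by
    rcases hd.left with ⟨-, rfl, -⟩ | ⟨-, rfl, h3⟩ <;> simp [*]
  have hdr : ∀ i ∈ dr, i ∈ B'.L ∧ (R.tile z).x1 = B'.X := by
    rcases hd.right with ⟨-, rfl, -⟩ | ⟨-, rfl, h3⟩ <;> simp [*]
  have hold : ∀ D ∈ A ++ kb ++ (kb' ++ C), D ∈ A ++ B :: B' :: C := by
    intro D hD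
    simp only [List.mem_append, List.mem_cons] at hD ⊢
    rcases hD with (hD | hD) | (hD | hD)
    · exact Or.inl hD
    · exact Or.inr (Or.inl (hkb D hD).1)
    · exact Or.inr (Or.inr (Or.inl (hkb' D hD).1))
    · exact Or.inr (Or.inr (Or.inr hD))
  have hcase : ∀ D ∈ (A ++ kb) ++ (⟨dl ++ z :: dr, (R.tile z).x1, (R.tile z).y1⟩ : Bump n) ::
      (kb' ++ C), D = ⟨dl ++ z :: dr, (R.tile z).x1, (R.tile z).y1⟩ ∨
        D ∈ A ++ kb ++ (kb' ++ C) := by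
    intro D hD
    simp only [List.mem_append, List.mem_cons] at hD ⊢
    tauto
  have hnew : ∀ D ∈ A ++ B :: B' :: C,
      D ∈ (A ++ kb) ++ (⟨dl ++ z :: dr, (R.tile z).x1, (R.tile z).y1⟩ : Bump n) :: (kb' ++ C) ∨
      (D = B ∧ dl = B.L ∧ (R.tile z).y1 = B.Y) ∨ (D = B' ∧ dr = B'.L ∧ (R.tile z).x1 = B'.X) := by
    intro D hD
    simp only [List.mem_append, List.mem_cons] at hD ⊢
    rcases hD with hD | rfl | rfl | hD
    · exact Or.inl (Or.inl (Or.inl hD))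
    · rcases hd.left with ⟨rfl, -, -⟩ | ⟨-, h3, h4⟩
      · simp
      · exact Or.inr (Or.inl ⟨rfl, h3, h4⟩)
    · rcases hd.right with ⟨rfl, -, -⟩ | ⟨-, h3, h4⟩
      · simp
      · exact Or.inr (Or.inr ⟨rfl, h3, h4⟩)
    · exact Or.inl (Or.inr (Or.inr (Or.inr hD)))
  refine ⟨?_, ?_, ?_, ?_, ?_, ?_, ?_, ?_, ?_, ?_⟩
  · have hm := h.mono
    simp only [List.pairwise_append, List.pairwise_cons, List.mem_cons, List.mem_append] at hm ⊢
    obtain ⟨m1, ⟨m2, m3, m4⟩, m5⟩ := hm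
    have q1 : kb.Pairwise fun B C => B.X < C.X ∧ C.Y < B.Y := by
      rcases hd.left with ⟨rfl, -, -⟩ | ⟨rfl, -, -⟩ <;> simp
    have q2 : kb'.Pairwise fun B C => B.X < C.X ∧ C.Y < B.Y := by
      rcases hd.right with ⟨rfl, -, -⟩ | ⟨rfl, -, -⟩ <;> simp
    refine ⟨⟨m1, q1, ?_⟩, ⟨?_, q2, m4, ?_⟩, ?_⟩
    · intro D hD E hE
      obtain ⟨rfl, -⟩ := hkb E hE
      exact p3 D hD
    · rintro D (hD | hD)
      · obtain ⟨rfl, h4⟩ := hkb' D hD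
        exact ⟨h4, by linarith⟩
      · have := p4 D hD
        constructor <;> linarith
    · intro D hD E hE
      obtain ⟨rfl, -⟩ := hkb' D hD
      exact p4 E hE
    · rintro D hD E hE
      have hD' : D.X ≤ B.X ∧ B.Y ≤ D.Y ∧ (R.tile z).y1 < D.Y := by
        rcases hD with hD | hD
        · have := p3 D hD
          refine ⟨this.1.le, this.2.le, by linarith⟩
        · obtain ⟨rfl, h4⟩ := hkb D hD
          exact ⟨le_rfl, le_rfl, h4⟩
      rcases hE with rfl | hE | hE
      · exact ⟨by simp only; linarith, hD'.2.2⟩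
      · obtain ⟨rfl, -⟩ := hkb' E hE
        constructor <;> linarith
      · have := p4 E hE
        constructor <;> linarith
  · intro D hD
    rcases hcase D hD with rfl | hD
    · refine ⟨?_, hzb.2.1, ?_, hzb.2.2.2⟩ <;> simp only <;> linarith
    · exact h.bounds D (hold D hD)
  · obtain ⟨D, hD, e⟩ := h.top
    rcases hnew D hD with h3 | ⟨rfl, h3, h4⟩ | ⟨rfl, h3, h4⟩
    · exact ⟨D, h3, e⟩
    · exact ⟨_, List.mem_append_right _ (List.mem_cons_self ..), h4.trans e⟩
    · exfalso; linarith
  · obtain ⟨D, hD, e⟩ := h.right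
    rcases hnew D hD with h3 | ⟨rfl, h3, h4⟩ | ⟨rfl, h3, h4⟩
    · exact ⟨D, h3, e⟩
    · exfalso; linarith
    · exact ⟨_, List.mem_append_right _ (List.mem_cons_self ..), h4.trans e⟩
  · intro D hD e
    rcases hcase D hD with rfl | hD
    · simp at e
    · exact h.empty D (hold D hD) e
  · intro D hD f hf
    rcases hcase D hD with rfl | hD
    · rcases hd.left with ⟨-, rfl, -⟩ | ⟨-, rfl, h3⟩
      · simp only [List.nil_append, List.head?_cons, Option.some.injEq] at hf
        rw [← hf]
      · cases hL : B.L with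
        | nil =>
          rw [hL] at hf
          simp only [List.nil_append, List.head?_cons, Option.some.injEq] at hf
          rw [← hf]
        | cons b L =>
          rw [hL] at hf
          simp only [List.cons_append, List.head?_cons, Option.some.injEq] at hf
          rw [← hf, h.first B (by simp) b (by rw [hL]; rfl), ← h3]
    · exact h.first D (hold D hD) f hf
  · intro D hD f hf
    rcases hcase D hD with rfl | hD
    · rcases hd.right with ⟨-, rfl, -⟩ | ⟨-, rfl, h3⟩
      · simp only [List.getLast?_append, List.getLast?_singleton, Option.some_or,
          Option.some.injEq] at hf
        rw [← hf]
      · rcases List.eq_nil_or_concat B'.L with hL | ⟨L, b, hL⟩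
        · rw [hL] at hf
          simp only [List.getLast?_append, List.getLast?_singleton, Option.some_or,
            Option.some.injEq] at hf
          rw [← hf]
        · rw [hL, List.concat_eq_append] at hf
          simp only [List.getLast?_append, List.getLast?_cons, List.getLast?_nil,
            Option.getD_none, Option.some_or, Option.getD_some, Option.some.injEq] at hf
          rw [← hf, h.last B' (by simp) b (by rw [hL]; simp), ← h3]
    · exact h.last D (hold D hD) f hf
  · intro i hi
    by_cases hiz : i = z
    · exact ⟨_, List.mem_append_right _ (List.mem_cons_self ..), by simp [hiz]⟩
    · have hiU : i ∉ U := fun h3 => hi (Finset.mem_erase.2 ⟨hiz, h3⟩)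
      obtain ⟨D, hD, hiD⟩ := h.drawn i hiU
      rcases hnew D hD with h3 | ⟨rfl, h3, h4⟩ | ⟨rfl, h3, h4⟩
      · exact ⟨D, h3, hiD⟩
      · exact ⟨_, List.mem_append_right _ (List.mem_cons_self ..), by simp [h3, hiD]⟩
      · exact ⟨_, List.mem_append_right _ (List.mem_cons_self ..), by simp [h3, hiD]⟩
  · intro D hD i hi
    rcases hcase D hD with rfl | hD
    · simp only [List.mem_append, List.mem_cons] at hi
      rcases hi with hi | rfl | hi
      · obtain ⟨h3, h4⟩ := hdl i hi
        obtain ⟨k1, k2, k3⟩ := h.mem B (by simp) i h3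
        exact ⟨fun h5 => k1 (Finset.mem_of_mem_erase h5), by simp only; linarith,
          by simp only; linarith⟩
      · exact ⟨fun h5 => (Finset.mem_erase.1 h5).1 rfl, le_rfl, le_rfl⟩
      · obtain ⟨h3, h4⟩ := hdr i hi
        obtain ⟨k1, k2, k3⟩ := h.mem B' (by simp) i h3
        exact ⟨fun h5 => k1 (Finset.mem_of_mem_erase h5), by simp only; linarith,
          by simp only; linarith⟩
    · obtain ⟨k1, k2, k3⟩ := h.mem D (hold D hD) i hi
      exact ⟨fun h5 => k1 (Finset.mem_of_mem_erase h5), k2, k3⟩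
  -- By the bumps `B` and `B'`, an undrawn tile that starts below and to the left of the new corner
  -- would start inside `z`.
  · intro c hc D hD
    obtain ⟨hcz, hcU⟩ := Finset.mem_erase.1 hc
    rcases hcase D hD with rfl | hD
    · simp only
      by_contra hcon
      push Not at hcon
      obtain ⟨k1, k2⟩ := hcon
      have q1 := h.undrawn c hcU B (by simp)
      have q2 := h.undrawn c hcU B' (by simp)
      have hcx := R.hx c
      have hcy := R.hy c
      have q1' : B.X ≤ (R.tile c).x0 := q1.resolve_right (by linarith)
      have q2' : B'.Y ≤ (R.tile c).y0 := q2.resolve_left (by linarith)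
      exact hcz (R.tile_eq (by linarith) (by linarith) (by linarith) (by linarith))
    · exact h.undrawn c hcU D (hold D hD)

/-- What is known about the labels `Q` on the right of the tile `z`, listed from left to right,
when `z` is drawn and the tiles satisfying `later` are still to be drawn. -/
structure SideFacts (R : Tiling n) (Q : List (Fin n)) (z : Fin n) (later : Fin n → Prop) :
    Prop where
  near : ∃ Q2 Q1, Q = Q2 ++ Q1 ∧ (∀ i ∈ Q2, later i) ∧
    ((Q1 = [] ∧ (R.tile z).y0 = R.outer.y0) ∨
      ∃ e, Q1.head? = some e ∧ ¬ later e ∧ (R.tile e).y1 = (R.tile z).y0)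
  far : ∃ Q2 Q1, Q = Q2 ++ Q1 ∧ (∀ i ∈ Q2, ¬ later i) ∧
    ((Q1 = [] ∧ (R.tile z).x1 = R.outer.x1) ∨
      ∃ e f, Q1.head? = some e ∧ later e ∧ (z :: Q2).getLast? = some f ∧
        (R.tile f).x1 = (R.tile z).x1)
  compat : ∀ i ∈ Q, later i ∨ (R.tile i).y1 ≤ (R.tile z).y0

/-- The word to the right of `z` consists of labels `G` still to come in the gap, the block `L` of
the next bump, and the rest `Q0`. The bottom of `z` is at the top of the first tile of `L`. If `G`
is empty, `z` reaches the end of that bump, so its right edge is that of the last tile of `L`. -/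
theorem sideFacts_of {G L Q0 : List (Fin n)} {X' : ℝ} {later : Fin n → Prop}
    (hG : ∀ i ∈ G, later i)
    (hx : G ≠ [] ∨ (G = [] ∧ (R.tile z).x1 = X'))
    (hL : ∀ i ∈ L, ¬ later i ∧ (R.tile i).y1 ≤ (R.tile z).y0)
    (hfirst : ∀ f, L.head? = some f → (R.tile f).y1 = (R.tile z).y0)
    (hlast : ∀ f, L.getLast? = some f → (R.tile f).x1 = X')
    (hempty : L = [] → Q0 = [] ∧ (R.tile z).y0 = R.outer.y0)
    (hQ0 : (Q0 = [] ∧ X' = R.outer.x1) ∨ ∃ e, Q0.head? = some e ∧ later e)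
    (hQ : ∀ i ∈ Q0, later i ∨ (R.tile i).y1 ≤ (R.tile z).y0) :
    SideFacts R (G ++ (L ++ Q0)) z later := by
  refine ⟨⟨G, L ++ Q0, rfl, hG, ?_⟩, ?_, ?_⟩
  · cases hc : L with
    | nil =>
      obtain ⟨h1, h2⟩ := hempty hc
      left
      exact ⟨by simp [h1], h2⟩
    | cons f L' =>
      right
      exact ⟨f, by simp, (hL f (by simp [hc])).1, hfirst f (by simp [hc])⟩
  · rcases hx with hx | ⟨rfl, hx⟩
    · refine ⟨[], _, rfl, by simp, Or.inr ?_⟩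
      cases G with
      | nil => exact absurd rfl hx
      | cons e G => exact ⟨e, z, by simp, hG e (by simp), by simp, rfl⟩
    · refine ⟨L, Q0, by simp, fun i hi => (hL i hi).1, ?_⟩
      rcases hQ0 with ⟨h1, h2⟩ | ⟨e, h1, h2⟩
      · exact Or.inl ⟨h1, hx.trans h2⟩
      · right
        rcases List.eq_nil_or_concat L with rfl | ⟨L', f, rfl⟩
        · exact ⟨e, z, h1, h2, by simp, rfl⟩
        · exact ⟨e, f, h1, h2, by simp [List.getLast?_cons], by rw [hx]; exact hlast f (by simp)⟩
  · intro i hi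
    simp only [List.mem_append] at hi
    rcases hi with hi | hi | hi
    · exact Or.inl (hG i hi)
    · exact Or.inr (hL i hi).2
    · exact hQ i hi

end draw

end Rectangulation

namespace Rectangulation

/-! ### The greedy construction: the induction -/

section greedy
variable {n : ℕ} {R : Tiling n} {vbef hbef : Fin n → Fin n → Prop}
  {A C : List (Bump n)} {U : Finset (Fin n)} {B B' : Bump n} {z : Fin n}

theorem Inv.right_facts (h : Inv R (A ++ B :: B' :: C) U)
    (hy : (R.tile z).y0 = B'.Y) {W G Q0 : List (Fin n)} (hW : ∀ i ∈ W, i ∈ U)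
    (hG : ∀ i ∈ G, i ∈ W) (hx : G ≠ [] ∨ (G = [] ∧ (R.tile z).x1 = B'.X)) (hQ : Post W C Q0) :
    SideFacts R (G ++ (B'.L ++ Q0)) z (· ∈ W) := by
  obtain ⟨⟨p1, p2⟩, p3, p4⟩ := h.pair
  have hend : C = [] → B'.X = R.outer.x1 := by
    rintro rfl
    rw [show A ++ [B, B'] = (A ++ [B]) ++ [B'] by simp] at h
    exact h.eq_right
  refine sideFacts_of hG hx ?_ ?_ (fun f hf => h.last B' (by simp) f hf) ?_ ?_ ?_
  · intro i hi
    obtain ⟨k1, k2, k3⟩ := h.mem B' (by simp) i hi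
    exact ⟨fun h1 => k1 (hW i h1), k3.trans hy.ge⟩
  · intro f hf
    rw [hy]; exact h.first B' (by simp) f hf
  · intro e
    rcases h.empty B' (by simp) e with ⟨h1, -⟩ | ⟨h1, h2⟩
    · have := (h.bounds B (by simp)).1
      linarith
    · refine ⟨hQ.eq_nil ?_, hy.trans h2⟩
      cases C with
      | nil => rfl
      | cons D C =>
        have h3 := (p4 D (by simp)).1
        have := (h.bounds D (by simp)).2.1
        linarith
  · by_cases hC : C = []
    · exact Or.inl ⟨hQ.eq_nil hC, hend hC⟩
    · exact Or.inr (hQ.head hC)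
  · intro i hi
    rcases hQ.mem hi with h1 | ⟨D, hD, h1⟩
    · exact Or.inl h1
    · right
      have h2 := (h.mem D (by simp [hD]) i h1).2.2
      have := (p4 D hD).2
      linarith

/-- In the transposed tiling the labels to the left of `z` are read from right to left, and the gap
and the bump `B` take the roles of the gap and the bump `B'`. -/
theorem Inv.left_facts (h : Inv R (A ++ B :: B' :: C) U)
    (hx : (R.tile z).x0 = B.X) {W G P0 : List (Fin n)} (hW : ∀ i ∈ W, i ∈ U)
    (hG : ∀ i ∈ G, i ∈ W) (hy : G ≠ [] ∨ (G = [] ∧ (R.tile z).y1 = B.Y)) (hP : Pre W A P0) :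
    SideFacts R.swap (P0 ++ (B.L ++ G)).reverse z (· ∈ W) := by
  obtain ⟨⟨p1, p2⟩, p3, p4⟩ := h.pair
  have hend : A = [] → B.Y = R.outer.y1 := by
    rintro rfl
    exact h.eq_top
  rw [List.reverse_append, List.reverse_append, List.append_assoc]
  refine sideFacts_of (X' := B.Y) (fun i hi => hG i (List.mem_reverse.1 hi)) ?_ ?_ ?_ ?_ ?_ ?_ ?_
  · rcases hy with hy | ⟨rfl, hy⟩
    · exact Or.inl (by simpa using hy)
    · exact Or.inr ⟨rfl, hy⟩
  · intro i hi
    obtain ⟨k1, k2, k3⟩ := h.mem B (by simp) i (List.mem_reverse.1 hi)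
    exact ⟨fun h1 => k1 (hW i h1), k2.trans hx.ge⟩
  · intro f hf
    rw [List.head?_reverse] at hf
    exact (h.last B (by simp) f hf).trans hx.symm
  · intro f hf
    rw [List.getLast?_reverse] at hf
    exact h.first B (by simp) f hf
  · intro e
    rw [List.reverse_eq_nil_iff] at e ⊢
    rcases h.empty B (by simp) e with ⟨h1, h2⟩ | ⟨h1, h2⟩
    · refine ⟨hP.eq_nil ?_, hx.trans h1⟩
      cases A with
      | nil => rfl
      | cons D A =>
        have h3 := (p3 D (by simp)).2
        have := (h.bounds D (by simp)).2.2.2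
        linarith
    · have := (h.bounds B' (by simp)).2.2.1
      linarith
  · by_cases hA : A = []
    · exact Or.inl ⟨by rw [hP.eq_nil hA]; rfl, hend hA⟩
    · exact Or.inr (hP.last hA)
  · intro i hi
    rcases hP.mem (List.mem_reverse.1 hi) with h1 | ⟨D, hD, h1⟩
    · exact Or.inl h1
    · right
      have h2 := (h.mem D (by simp [hD]) i h1).2.1
      have := (p3 D hD).1
      change (R.tile i).x1 ≤ (R.tile z).x0
      linarith

/-- What is known when the tile `z` is drawn, about its position in the final list `l` of labels
and its relations to the tiles that are drawn later. -/
structure TileFacts (R : Tiling n) (vbef hbef : Fin n → Fin n → Prop) (l : List (Fin n))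
    (z : Fin n) (w : List (Fin n)) : Prop where
  side : ∃ P Q, l = P ++ z :: Q ∧ SideFacts R Q z (· ∈ w) ∧
    SideFacts R.swap P.reverse z (· ∈ w)
  vbef_of : ∀ c ∈ w, R.SameV z c → vbef z c
  not_vbef : ∀ c ∈ w, R.SameV c z → ¬ vbef c z
  hbef_of : ∀ c ∈ w, R.swap.SameV z c → hbef z c
  not_hbef : ∀ c ∈ w, R.swap.SameV c z → ¬ hbef c z

/-- Whether or not the new bump has swallowed its neighbours, the final word shows the labels of
`B`, the later labels of the gap on both sides of `z`, and the labels of `B'`. An empty side means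
that there the edges of `z` and of the neighbouring bump are aligned. -/
theorem fill_of_draw {W l : List (Fin n)} {kb kb' : List (Bump n)} {dl dr : List (Fin n)}
    (hd : Draw R B B' z kb kb' dl dr) {x y : ℝ}
    (hf : Fill W ((A ++ kb) ++ ⟨dl ++ z :: dr, x, y⟩ :: (kb' ++ C)) l) :
    ∃ P0 G G' Q0, Pre W A P0 ∧ Post W C Q0 ∧ (∀ i ∈ G, i ∈ W) ∧ (∀ i ∈ G', i ∈ W) ∧
      (G ≠ [] ∨ (G = [] ∧ (R.tile z).y1 = B.Y)) ∧ (G' ≠ [] ∨ (G' = [] ∧ (R.tile z).x1 = B'.X)) ∧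
      l = (P0 ++ (B.L ++ G)) ++ z :: (G' ++ (B'.L ++ Q0)) := by
  obtain ⟨P, Q, hP, hQ, rfl⟩ := fill_append.1 hf
  have h1 : ∃ P0 G, Pre W A P0 ∧ (∀ i ∈ G, i ∈ W) ∧
      (G ≠ [] ∨ (G = [] ∧ (R.tile z).y1 = B.Y)) ∧ P ++ dl = P0 ++ (B.L ++ G) := by
    rcases hd.left with ⟨rfl, rfl, -⟩ | ⟨rfl, rfl, h3⟩
    · obtain ⟨P0, G, k1, k2, k3, rfl⟩ := pre_snoc hP
      exact ⟨P0, G, k1, k3, Or.inl k2, by simp⟩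
    · rw [List.append_nil] at hP
      exact ⟨P, [], hP, by simp, Or.inr ⟨rfl, h3⟩, by simp⟩
  have h2 : ∃ G' Q0, Post W C Q0 ∧ (∀ i ∈ G', i ∈ W) ∧
      (G' ≠ [] ∨ (G' = [] ∧ (R.tile z).x1 = B'.X)) ∧ dr ++ Q = G' ++ (B'.L ++ Q0) := by
    rcases hd.right with ⟨rfl, rfl, -⟩ | ⟨rfl, rfl, h3⟩
    · obtain ⟨G', Q0, k1, k2, k3, rfl⟩ := hQ
      exact ⟨G', Q0, k3, k2, Or.inl k1, rfl⟩
    · exact ⟨[], Q, hQ, by simp, Or.inr ⟨rfl, h3⟩, rfl⟩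
  obtain ⟨P0, G, k1, k2, k3, k4⟩ := h1
  obtain ⟨G', Q0, m1, m2, m3, m4⟩ := h2
  refine ⟨P0, G, G', Q0, k1, m1, k2, m2, k3, m3, ?_⟩
  rw [← k4, ← m4]
  simp

/-- A free tile `z` is drawn, and the induction hypothesis is applied to the new staircase. The word
`w` receives `z` in front, while the list `l` is kept, because it already contains `z` inside its
bump. Freedom of `z` says precisely that the comparators place it before every later tile across its
walls. -/
theorem exists_list_of_inv (hR : R.IsGeneric) (hV : Comparator R vbef)
    (hH : Comparator R.swap hbef) (S : List (Bump n)) (U : Finset (Fin n)) (h : Inv R S U) :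
    ∃ l w : List (Fin n), w.Nodup ∧ (∀ i, i ∈ w ↔ i ∈ U) ∧ Fill w S l ∧
      l.Perm (S.flatMap (·.L) ++ w) ∧
      ∀ w1 z w2, w = w1 ++ z :: w2 → TileFacts R vbef hbef l z w2 := by
  induction hc : U.card using Nat.strong_induction_on generalizing S U with
  | _ c ih =>
    subst hc
    match S, h with
    | [], h =>
      obtain ⟨B, hB, -⟩ := h.top
      simp at hB
    | [B], h =>
      have hU : U = ∅ := by
        by_contra hU
        obtain ⟨c, hc⟩ := Finset.nonempty_iff_ne_empty.2 hU
        have h1 : B.Y = R.outer.y1 := h.eq_top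
        have h2 : B.X = R.outer.x1 := Inv.eq_right (A := []) h
        have h3 := R.hx c
        have h4 := R.hy c
        have h5 := R.bounds c
        rcases h.undrawn c hc B (by simp) with h6 | h6 <;> linarith
      refine ⟨B.L, [], by simp, by simp [hU], ⟨[], rfl, by simp⟩, by simp, ?_⟩
      intro w1 z w2 e
      simp at e
    | B0 :: B1 :: C0, h =>
      obtain ⟨A, B, B', C, z, hS, hz, hx, hy, hbr, hbl⟩ := h.exists_free hR hV hH
      rw [hS] at h ⊢
      have h1 : (R.tile z).y1 ≤ B.Y := by
        by_contra hcon
        exact hbl (Or.inl (not_le.1 hcon))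
      have h2 : (R.tile z).x1 ≤ B'.X := by
        by_contra hcon
        exact hbr (Or.inl (not_le.1 hcon))
      obtain ⟨kb, kb', dl, dr, hd⟩ := exists_draw h1 h2
      obtain ⟨l, w, hnd, hw, hf, hp, hfacts⟩ := ih _ (Finset.card_erase_lt_of_mem hz) _ _
        (h.draw hz hx hy h1 h2 hd) rfl
      obtain ⟨P0, G, G', Q0, hP, hQ, hG, hG', hy1, hx1, hl⟩ := fill_of_draw hd hf
      have hzw : z ∉ w := fun h3 => (Finset.mem_erase.1 ((hw z).1 h3)).1 rfl
      have hwU : ∀ i ∈ w, i ∈ U := fun i hi => Finset.mem_of_mem_erase ((hw i).1 hi)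
      refine ⟨l, z :: w, List.nodup_cons.2 ⟨hzw, hnd⟩, ?_, ?_, ?_, ?_⟩
      · intro i
        rw [List.mem_cons, hw, Finset.mem_erase]
        by_cases hiz : i = z
        · simp [hiz, hz]
        · simp [hiz]
      · rw [fill_append]
        have hmono : ∀ i ∈ w, i ∈ z :: w := fun i hi => List.mem_cons_of_mem _ hi
        refine ⟨P0, (G ++ z :: G') ++ (B'.L ++ Q0), hP.mono hmono,
          ⟨G ++ z :: G', Q0, by simp, ?_, hQ.mono hmono, rfl⟩, ?_⟩
        · intro i hi
          simp only [List.mem_append, List.mem_cons] at hi ⊢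
          rcases hi with hi | hi | hi
          · exact Or.inr (hG i hi)
          · exact Or.inl hi
          · exact Or.inr (hG' i hi)
        · rw [hl]; simp
      · refine hp.trans ?_
        rw [List.perm_iff_count]
        intro i
        rcases hd.left with ⟨rfl, rfl, -⟩ | ⟨rfl, rfl, -⟩ <;>
          rcases hd.right with ⟨rfl, rfl, -⟩ | ⟨rfl, rfl, -⟩ <;>
          simp [List.count_cons] <;> omega
      · intro w1 y w2 e
        cases w1 with
        | nil =>
          simp only [List.nil_append, List.cons.injEq] at e
          obtain ⟨rfl, rfl⟩ := e
          refine ⟨⟨_, _, hl, h.right_facts hy hwU hG' hx1 hQ, h.left_facts hx hwU hG hy1 hP⟩,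
            ?_, ?_, ?_, ?_⟩
          · intro c hc hs
            by_contra hcon
            exact hbr (Or.inr (Or.inl ⟨c, hwU c hc, hs, hcon⟩))
          · intro c hc hs hcon
            exact hbl (Or.inr (Or.inr ⟨c, hwU c hc, hs, hcon⟩))
          · intro c hc hs
            by_contra hcon
            exact hbl (Or.inr (Or.inl ⟨c, hwU c hc, hs, hcon⟩))
          · intro c hc hs hcon
            exact hbr (Or.inr (Or.inr ⟨c, hwU c hc, hs, hcon⟩))
        | cons y' w1 =>
          simp only [List.cons_append, List.cons.injEq] at e
          exact hfacts w1 y w2 e.2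

/-- The result of the greedy construction: the list of labels `l` and the word `w`. -/
theorem exists_lists (hR : R.IsGeneric) (hV : Comparator R vbef) (hH : Comparator R.swap hbef) :
    ∃ l w : List (Fin n), l.Nodup ∧ w.Nodup ∧ (∀ i, i ∈ l) ∧ (∀ i, i ∈ w) ∧
      ∀ w1 z w2, w = w1 ++ z :: w2 → TileFacts R vbef hbef l z w2 := by
  obtain ⟨l, w, h1, h2, -, h3, h4⟩ := exists_list_of_inv hR hV hH _ _ (inv_init R)
  have h5 : l.Perm w := by simpa using h3
  refine ⟨l, w, h5.nodup_iff.2 h1, h1, ?_, ?_, h4⟩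
  · intro i; rw [h5.mem_iff, h2]; simp
  · intro i; rw [h2]; simp

end greedy

end Rectangulation

namespace Rectangulation

/-! ### From the greedy construction to lines -/

theorem exists_perm_of_list {n : ℕ} (l : List (Fin n)) (hd : l.Nodup) (h : ∀ i, i ∈ l) :
    ∃ e : Equiv.Perm (Fin n), ∀ (k : ℕ) (c : Fin n), l[k]? = some c ↔ (e.symm c : ℕ) = k := by
  have hlen : n = l.length := by
    have := Fintype.card_congr (hd.getEquivOfForallMemList l h)
    simpa using this.symm
  refine ⟨(finCongr hlen).trans (hd.getEquivOfForallMemList l h), fun k c => ?_⟩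
  rw [List.getElem?_eq_some_iff]
  constructor
  · rintro ⟨hk, rfl⟩
    have : ((finCongr hlen).trans (hd.getEquivOfForallMemList l h)).symm l[k] =
        ⟨k, by omega⟩ := by
      rw [Equiv.symm_apply_eq]; rfl
    rw [this]
  · rintro rfl
    have := ((finCongr hlen).trans (hd.getEquivOfForallMemList l h)).apply_symm_apply c
    refine ⟨by have := (((finCongr hlen).trans
      (hd.getEquivOfForallMemList l h)).symm c).2; omega, ?_⟩
    exact this

theorem mem_of_split {n : ℕ} {w w1 w2 : List (Fin n)} {z : Fin n} (hw : w = w1 ++ z :: w2)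
    (e : Equiv.Perm (Fin n)) (he : ∀ (k : ℕ) (c : Fin n), w[k]? = some c ↔ (e.symm c : ℕ) = k) :
    (e.symm z : ℕ) = w1.length ∧ (∀ k c, w2[k]? = some c ↔ (e.symm c : ℕ) = w1.length + 1 + k) ∧
      (∀ c, c ∈ w2 ↔ (e.symm z : ℕ) < e.symm c) ∧ w1.length + 1 + w2.length = n := by
  have h1 : (e.symm z : ℕ) = w1.length := (he _ _).1 (by rw [hw]; simp)
  have h2 : ∀ k c, w2[k]? = some c ↔ (e.symm c : ℕ) = w1.length + 1 + k := by
    intro k c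
    rw [← he, hw, List.getElem?_append_right (by omega),
      show w1.length + 1 + k - w1.length = k + 1 by omega, List.getElem?_cons_succ]
  refine ⟨h1, h2, fun c => ⟨fun hc => ?_, fun hc => ?_⟩, ?_⟩
  · obtain ⟨k, hk⟩ := List.mem_iff_getElem?.1 hc
    have := (h2 k c).1 hk
    omega
  · apply List.mem_iff_getElem?.2
    exact ⟨(e.symm c : ℕ) - (w1.length + 1), (h2 _ _).2 (by omega)⟩
  · have h3 : ∀ k, k < n ↔ k < w.length := by
      intro k
      rw [← isSome_getElem? w k, Option.isSome_iff_exists]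
      constructor
      · intro hk
        exact ⟨e ⟨k, hk⟩, (he _ _).2 (by simp)⟩
      · rintro ⟨c, hc⟩
        have := (he _ _).1 hc
        omega
    have h4 : w.length = w1.length + 1 + w2.length := by rw [hw]; simp; omega
    have h5 := h3 n
    have h6 := h3 w.length
    omega

/-! ### Translation of the recorded facts into ids. -/

section lines
variable {n : ℕ} {R : Tiling n} {T : ℕ → ℕ} {lab : ℕ → Fin n} {Q : List (Fin n)} {a : ℕ}
  {later : Fin n → Prop}

/-- The run of later labels after `z` ends at `bo`, and the run of earlier labels ends at `rt`. The
first is measured by `near` and the second by `far`; these also say which other tile, or which outer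
edge, shares the coordinate. -/
theorem SideFacts.lines (hT : TimeInj n T) (ha : a < n) (h : SideFacts R Q (lab a) later)
    (hQ : ∀ k, k < Q.length → Q[k]? = some (lab (a + 1 + k))) (hlen : a + 1 + Q.length = n)
    (hl : ∀ m, m < n → (later (lab m) ↔ T a < T m)) :
    ((bo n T a = n ∧ (R.tile (lab a)).y0 = R.outer.y0) ∨
      (bo n T a < n ∧ (R.tile (lab (bo n T a))).y1 = (R.tile (lab a)).y0)) ∧
    ((rt n T a = n ∧ (R.tile (lab a)).x1 = R.outer.x1) ∨
      (rt n T a < n ∧ (R.tile (lab (rt n T a - 1))).x1 = (R.tile (lab a)).x1)) ∧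
    ∀ m, a < m → m < n → T m < T a → (R.tile (lab m)).y1 ≤ (R.tile (lab a)).y0 := by
  have hmem : ∀ (Q2 Q1 : List (Fin n)), Q = Q2 ++ Q1 → ∀ m, a < m → m < a + 1 + Q2.length →
      lab m ∈ Q2 := by
    intro Q2 Q1 e m h1 h2
    have h3 := hQ (m - (a + 1)) (by rw [e]; simp; omega)
    rw [e, List.getElem?_append_left (by omega), show a + 1 + (m - (a + 1)) = m by omega] at h3
    exact List.mem_iff_getElem?.2 ⟨_, h3⟩
  have hhead : ∀ (Q2 Q1 : List (Fin n)) f, Q = Q2 ++ Q1 → Q1.head? = some f →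
      a + 1 + Q2.length < n ∧ f = lab (a + 1 + Q2.length) := by
    intro Q2 Q1 f e hf
    have h1 : Q[Q2.length]? = some f := by
      rw [e, List.getElem?_append_right le_rfl, Nat.sub_self, ← List.head?_eq_getElem?, hf]
    have h2 : Q2.length < Q.length := by
      rw [e]
      cases Q1 with
      | nil => simp at hf
      | cons _ _ => simp
    have h3 := hQ _ h2
    rw [h1] at h3
    exact ⟨by omega, by simpa using h3⟩
  refine ⟨?_, ?_, ?_⟩
  · obtain ⟨Q2, Q1, e, h1, h2⟩ := h.near
    have hel : Q.length = Q2.length + Q1.length := by rw [e]; simp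
    have hbo : ∀ (h3 : a + 1 + Q2.length < n → T (a + 1 + Q2.length) ≤ T a),
        bo n T a = a + 1 + Q2.length := fun h3 =>
      bo_eq (by omega) (by omega)
        (fun m h4 h5 => (hl m (by omega)).1 (h1 _ (hmem Q2 Q1 e m h4 h5))) h3
    rcases h2 with ⟨rfl, h2⟩ | ⟨f, h2, h3, h4⟩
    · left
      have : a + 1 + Q2.length = n := by simp at hel; omega
      exact ⟨by rw [hbo (by omega), this], h2⟩
    · right
      obtain ⟨h5, rfl⟩ := hhead Q2 Q1 f e h2
      have h6 := hbo fun _ => not_lt.1 fun h7 => h3 ((hl _ h5).2 h7)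
      rw [h6]
      exact ⟨h5, h4⟩
  · obtain ⟨Q2, Q1, e, h1, h2⟩ := h.far
    have hel : Q.length = Q2.length + Q1.length := by rw [e]; simp
    have hrt : ∀ (h3 : a + 1 + Q2.length < n → T a ≤ T (a + 1 + Q2.length)),
        rt n T a = a + 1 + Q2.length := fun h3 => by
      refine rt_eq (by omega) (by omega) (fun m h4 h5 => ?_) h3
      have h6 := (hl m (by omega)).not.1 (h1 _ (hmem Q2 Q1 e m h4 h5))
      have h7 : T m ≠ T a := fun h8 => by
        have := hT m a (by omega) ha h8
        omega
      omega
    rcases h2 with ⟨rfl, h2⟩ | ⟨f, g, h2, h3, h4, h5⟩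
    · left
      have : a + 1 + Q2.length = n := by simp at hel; omega
      exact ⟨by rw [hrt (by omega), this], h2⟩
    · right
      obtain ⟨h6, rfl⟩ := hhead Q2 Q1 f e h2
      have h7 := hrt fun _ => ((hl _ h6).1 h3).le
      rw [h7]
      refine ⟨h6, ?_⟩
      rw [← h5]
      congr 2
      rcases List.eq_nil_or_concat Q2 with rfl | ⟨Q3, b, rfl⟩
      · simpa using h4
      · rw [List.concat_eq_append] at h4 e ⊢
        have h8 : b = g := by simpa [List.getLast?_cons] using h4
        have h9 := hQ Q3.length (by rw [e]; simp)
        rw [e, List.getElem?_append_left (by simp), List.getElem?_append_right le_rfl] at h9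
        simp only [Nat.sub_self, List.getElem?_cons_zero, Option.some.injEq] at h9
        rw [← h8, h9]
        congr 1
        simp
  · intro m h1 h2 h3
    rcases h.compat (lab m) (hmem Q [] (by simp) m h1 (by omega)) with h4 | h4
    · have := (hl m h2).1 h4
      omega
    · exact h4

end lines

/-- Every generic tiling, with prescribed orders of the marks along its walls, can be relabelled so
that it is given by lines for the time function of a permutation with these orders. -/
theorem exists_labelling {n : ℕ} (hn : 1 ≤ n) {R : Tiling n} {vbef hbef : Fin n → Fin n → Prop}
    (hR : R.IsGeneric) (hV : Comparator R vbef) (hH : Comparator R.swap hbef) :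
    ∃ (e x : Equiv.Perm (Fin n)) (X Y : ℕ → ℝ), Build n (timeOf x) X Y ∧
      (R.relabel e).HasLines (timeOf x) X Y ∧
      (∀ a c : Fin n, R.SameV (e a) (e c) → (timeOf x a < timeOf x c ↔ vbef (e a) (e c))) ∧
      (∀ a c : Fin n, R.swap.SameV (e a) (e c) →
        (timeOf x a < timeOf x c ↔ hbef (e a) (e c))) := by
  obtain ⟨l, w, hl1, hw1, hl2, hw2, hfacts⟩ := exists_lists hR hV hH
  obtain ⟨el, hel⟩ := exists_perm_of_list l hl1 hl2
  obtain ⟨ew, hew⟩ := exists_perm_of_list w hw1 hw2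
  -- The label of a tile is its position in `l` and its time is its position in `w`; so `x` maps a
  -- position in `w` to the position of the same tile in `l`.
  obtain ⟨x, hx⟩ : ∃ x : Equiv.Perm (Fin n), x = ew.trans el.symm := ⟨_, rfl⟩
  have htime : ∀ a : Fin n, timeOf x a = ew.symm (el a) := by
    intro a
    rw [timeOf_fin, hx]
    rfl
  have hT := timeOf_inj x
  obtain ⟨lab, hlab⟩ : ∃ lab : ℕ → Fin n, ∀ m (h : m < n), lab m = el ⟨m, h⟩ :=
    ⟨fun m => if h : m < n then el ⟨m, h⟩ else ⟨0, hn⟩, fun m h => dif_pos h⟩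
  have htlab : ∀ m, m < n → timeOf x m = ew.symm (lab m) := by
    intro m hm
    rw [hlab m hm]
    exact htime ⟨m, hm⟩
  have hellab : ∀ m, m < n → (el.symm (lab m) : ℕ) = m := by
    intro m hm
    rw [hlab m hm, Equiv.symm_apply_apply]
  have hlabel : ∀ c : Fin n, lab (el.symm c) = c := by
    intro c
    rw [hlab _ (el.symm c).2]
    simp
  -- the tile with label `a`
  have key : ∀ a, a < n → ∃ w2, TileFacts R vbef hbef l (lab a) w2 ∧
      ∀ m, m < n → (lab m ∈ w2 ↔ timeOf x a < timeOf x m) := by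
    intro a ha
    obtain ⟨w1, w2, hw⟩ := List.append_of_mem (hw2 (lab a))
    obtain ⟨-, -, h3, -⟩ := mem_of_split hw ew hew
    refine ⟨w2, hfacts w1 _ w2 hw, fun m hm => ?_⟩
    rw [h3, htlab a ha, htlab m hm]
  have right : ∀ a, a < n →
      ((bo n (timeOf x) a = n ∧ (R.tile (lab a)).y0 = R.outer.y0) ∨
        (bo n (timeOf x) a < n ∧
          (R.tile (lab (bo n (timeOf x) a))).y1 = (R.tile (lab a)).y0)) ∧
      ((rt n (timeOf x) a = n ∧ (R.tile (lab a)).x1 = R.outer.x1) ∨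
        (rt n (timeOf x) a < n ∧
          (R.tile (lab (rt n (timeOf x) a - 1))).x1 = (R.tile (lab a)).x1)) ∧
      ∀ m, a < m → m < n → timeOf x m < timeOf x a →
        (R.tile (lab m)).y1 ≤ (R.tile (lab a)).y0 := by
    intro a ha
    obtain ⟨w2, hf, hlater⟩ := key a ha
    obtain ⟨P, Q, hPQ, hq, -⟩ := hf.side
    obtain ⟨h1, h2, -, h4⟩ := mem_of_split hPQ el hel
    rw [hellab a ha] at h1
    refine hq.lines hT ha ?_ (by omega) hlater
    intro k hk
    rw [h2, hellab _ (by omega), h1]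
  have left : ∀ a, a < n →
      ((lf (timeOf x) a = 0 ∧ (R.tile (lab a)).x0 = R.outer.x0) ∨
        (0 < lf (timeOf x) a ∧
          (R.tile (lab (lf (timeOf x) a - 1))).x1 = (R.tile (lab a)).x0)) ∧
      ((tp (timeOf x) a = 0 ∧ (R.tile (lab a)).y1 = R.outer.y1) ∨
        (0 < tp (timeOf x) a ∧
          (R.tile (lab (tp (timeOf x) a))).y1 = (R.tile (lab a)).y1)) ∧
      ∀ m, m < a → timeOf x m < timeOf x a → (R.tile (lab m)).x1 ≤ (R.tile (lab a)).x0 := by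
    intro a ha
    obtain ⟨w2, hf, hlater⟩ := key a ha
    obtain ⟨P, Q, hPQ, -, hp⟩ := hf.side
    obtain ⟨h1, h2, -, h4⟩ := mem_of_split hPQ el hel
    rw [hellab a ha] at h1
    have hnn : n - 1 - (n - 1 - a) = a := by omega
    have hP : ∀ k, k < P.length → P[k]? = some (lab k) := by
      intro k hk
      rw [← List.getElem?_append_left (l₂ := lab a :: Q) hk, ← hPQ, hel, hellab _ (by omega)]
    -- The facts about the left side of `a` are those about the right side of `n - 1 - a` in the
    -- transposed tiling.
    have := SideFacts.lines (R := R.swap) (T := flipT n (timeOf x))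
      (lab := fun m => lab (n - 1 - m)) (Q := P.reverse) (a := n - 1 - a) (later := (· ∈ w2))
      hT.flip (by omega) (by rw [hnn]; exact hp) ?_ (by rw [List.length_reverse]; omega) ?_
    · rw [hT.bo_flip ha, hT.rt_flip ha, hnn] at this
      have hl := hT.lf_spec ha
      have ht := hT.tp_spec ha
      obtain ⟨c1, c2, c3⟩ := this
      refine ⟨?_, ?_, ?_⟩
      · rcases c1 with ⟨c, d⟩ | ⟨c, d⟩
        · exact Or.inl ⟨by omega, d⟩
        · refine Or.inr ⟨by omega, ?_⟩
          rw [show n - 1 - (n - lf (timeOf x) a) = lf (timeOf x) a - 1 by omega] at d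
          exact d
      · rcases c2 with ⟨c, d⟩ | ⟨c, d⟩
        · exact Or.inl ⟨by omega, d⟩
        · refine Or.inr ⟨by omega, ?_⟩
          rw [show n - 1 - (n - tp (timeOf x) a - 1) = tp (timeOf x) a by omega] at d
          exact d
      · intro m h5 h6
        have := c3 (n - 1 - m) (by omega) (by omega)
          (by rwa [flipT_flip (by omega), flipT_flip ha])
        rw [show n - 1 - (n - 1 - m) = m by omega] at this
        exact this
    · intro k hk
      rw [List.length_reverse] at hk
      rw [List.getElem?_reverse hk, hP _ (by omega)]
      congr 2
      omega
    · intro m hm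
      rw [hlater _ (by omega), flipT_flip ha]
      rfl
  -- A vertical wall with id `v` carries the right edge of the label `v - 1`, which therefore
  -- supplies the coordinate. If the wall with id `v` is horizontal, `X v` is never used.
  obtain ⟨X, hX0, hXn, hXm⟩ : ∃ X : ℕ → ℝ, X 0 = R.outer.x0 ∧ X n = R.outer.x1 ∧
      ∀ v, 0 < v → v < n → X v = (R.tile (lab (v - 1))).x1 :=
    ⟨fun v => if v = 0 then R.outer.x0 else if v = n then R.outer.x1 else
      (R.tile (lab (v - 1))).x1, by simp, by simp; omega, fun v h1 h2 => by
        simp [h1.ne', h2.ne]⟩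
  obtain ⟨Y, hY0, hYn, hYm⟩ : ∃ Y : ℕ → ℝ, Y 0 = R.outer.y1 ∧ Y n = R.outer.y0 ∧
      ∀ v, 0 < v → v < n → Y v = (R.tile (lab v)).y1 :=
    ⟨fun v => if v = 0 then R.outer.y1 else if v = n then R.outer.y0 else
      (R.tile (lab v)).y1, by simp, by simp; omega, fun v h1 h2 => by
        simp [h1.ne', h2.ne]⟩
  have hrect : ∀ a, a < n → R.tile (lab a) = lineRect n (timeOf x) X Y a := by
    intro a ha
    obtain ⟨r1, r2, -⟩ := right a ha
    obtain ⟨l1, l2, -⟩ := left a ha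
    have s1 := hT.bo_spec ha
    have s2 := hT.rt_spec ha
    have s3 := hT.lf_spec ha
    have s4 := hT.tp_spec ha
    have e1 : (R.tile (lab a)).x0 = X (lf (timeOf x) a) := by
      rcases l1 with ⟨h1, h2⟩ | ⟨h1, h2⟩
      · rw [h1, hX0, h2]
      · rw [hXm _ h1 (by omega), h2]
    have e2 : (R.tile (lab a)).x1 = X (rt n (timeOf x) a) := by
      rcases r2 with ⟨h1, h2⟩ | ⟨h1, h2⟩
      · rw [h1, hXn, h2]
      · rw [hXm _ (by omega) h1, h2]
    have e3 : (R.tile (lab a)).y0 = Y (bo n (timeOf x) a) := by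
      rcases r1 with ⟨h1, h2⟩ | ⟨h1, h2⟩
      · rw [h1, hYn, h2]
      · rw [hYm _ (by omega) h1, h2]
    have e4 : (R.tile (lab a)).y1 = Y (tp (timeOf x) a) := by
      rcases l2 with ⟨h1, h2⟩ | ⟨h1, h2⟩
      · rw [h1, hY0, h2]
      · rw [hYm _ h1 (by omega), h2]
    exact Rect.ext e1 e2 e3 e4
  have cmp : ∀ (bef : Fin n → Fin n → Prop) (S : Fin n → Fin n → Prop),
      (∀ z, ¬ S z z) → (∀ z w2, TileFacts R vbef hbef l z w2 → (∀ c ∈ w2, S z c → bef z c) ∧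
        (∀ c ∈ w2, S c z → ¬ bef c z)) →
      ∀ a c : Fin n, S (el a) (el c) → (timeOf x a < timeOf x c ↔ bef (el a) (el c)) := by
    intro bef S hS hf a c hac
    have ea : lab a = el a := hlab a a.2
    have ec : lab c = el c := hlab c c.2
    obtain ⟨w2, f2, m2⟩ := key a a.2
    obtain ⟨w3, f3, m3⟩ := key c c.2
    rw [ea] at f2
    rw [ec] at f3
    constructor
    · intro h1
      have := (m2 c c.2).2 h1
      rw [ec] at this
      exact (hf _ _ f2).1 _ this hac
    · intro h1
      by_contra h2
      have h3 : timeOf x c ≠ timeOf x a := fun h4 => by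
        have := hT _ _ c.2 a.2 h4
        rw [Fin.ext this] at hac
        exact hS _ hac
      have := (m3 a a.2).2 (by omega)
      rw [ea] at this
      exact (hf _ _ f3).2 _ this hac h1
  refine ⟨el, x, X, Y, ⟨hT, ?_, ?_, ?_, ?_⟩, ?_, ?_, ?_⟩
  · intro a ha
    have := R.hx (lab a)
    rw [hrect a ha] at this
    exact this
  · intro a ha
    have := R.hy (lab a)
    rw [hrect a ha] at this
    exact this
  · intro i j hij hj htt
    have := (left j hj).2.2 i hij htt
    rw [hrect i (by omega), hrect j hj] at this
    exact this
  · intro i j hij hj htt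
    have := (right i (by omega)).2.2 j hij hj htt
    rw [hrect i (by omega), hrect j hj] at this
    exact this
  · intro a
    have := hrect a a.2
    rw [hlab a a.2] at this
    exact this
  · exact cmp vbef R.SameV (fun z hz => (R.hx z).ne hz.1.symm) fun z w2 hf =>
      ⟨hf.vbef_of, hf.not_vbef⟩
  · exact cmp hbef R.swap.SameV (fun z hz => (R.swap.hx z).ne hz.1.symm) fun z w2 hf =>
      ⟨hf.hbef_of, hf.not_hbef⟩

end Rectangulation

namespace Rectangulation

/-! ### Labels and ids are determined by the walls -/

/-- Under `t'`, neighbouring labels `k` and `k + 1` face each other across a vertical wall if `k` is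
earlier and across a horizontal wall otherwise. The same holds for `e k` and `e (k + 1)` under `t`,
and there the ids force `e k < e (k + 1)`. So `e` is increasing, hence the identity, and
`sameIds_of_iff` applies. -/
theorem eq_one_and_sameIds {n : ℕ} {t t' : ℕ → ℕ} (hT : TimeInj n t) (hT' : TimeInj n t')
    {V H : Fin n → Fin n → Prop} {e : Equiv.Perm (Fin n)}
    (hV : ∀ i j : Fin n, rt n t i = lf t j ↔ V i j)
    (hH : ∀ i j : Fin n, tp t i = bo n t j ↔ H i j)
    (hV' : ∀ i j : Fin n, rt n t' i = lf t' j ↔ V (e i) (e j))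
    (hH' : ∀ i j : Fin n, tp t' i = bo n t' j ↔ H (e i) (e j)) : e = 1 ∧ SameIds n t t' := by
  have he : e = 1 := by
    apply eq_one_of_lt_succ
    intro k k' hk
    have hne : t' k ≠ t' k' := fun h => by
      have := hT' _ _ k.2 k'.2 h
      omega
    rcases lt_or_gt_of_ne hne with h | h
    · have h1 : rt n t' k = k' := rt_eq (by omega) k'.2.le (fun m _ _ => by omega) fun _ => h.le
      have h2 : lf t' k' = k' := lf_eq le_rfl (fun m _ _ => by omega) fun _ => by
        rw [show (k' : ℕ) - 1 = k by omega]; exact h.le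
      have h3 := (hV _ _).2 ((hV' k k').1 (by rw [h1, h2]))
      have h4 := hT.rt_spec (e k).2
      have h5 := hT.lf_spec (e k').2
      rw [Fin.lt_def]
      omega
    · have h1 : bo n t' k = k' := bo_eq (by omega) k'.2.le (fun m _ _ => by omega) fun _ => h.le
      have h2 : tp t' k' = k' := tp_eq le_rfl (fun m _ _ => by omega) fun _ => by
        rw [show (k' : ℕ) - 1 = k by omega]; exact h.le
      have h3 := (hH _ _).2 ((hH' k' k).1 (by rw [h1, h2]))
      have h4 := hT.bo_spec (e k).2
      have h5 := hT.tp_spec (e k').2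
      rw [Fin.lt_def]
      omega
  subst he
  refine ⟨rfl, sameIds_of_iff hT hT' ?_ ?_⟩
  · intro i j hi hj
    exact (hV ⟨i, hi⟩ ⟨j, hj⟩).trans (hV' ⟨i, hi⟩ ⟨j, hj⟩).symm
  · intro i j hi hj
    exact (hH ⟨i, hi⟩ ⟨j, hj⟩).trans (hH' ⟨i, hi⟩ ⟨j, hj⟩).symm

/-- This comparator is used when the permutation is to read the marks in the order in which the
tiling already has them. -/
theorem comparator_self {n : ℕ} (R : Tiling n) :
    Comparator R fun a c => (R.tile a).y0 < (R.tile c).y1 where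
  of_lt _ _ _ h := h
  monoL _ _ _ _ _ h h' := h.trans_lt h'
  monoR _ _ _ _ _ h h' := h'.trans_le h

/-- Every generic tiling can be relabelled so that it is given by lines for a permutation that
reads the marks on every wall in their geometric order. -/
theorem Tiling.IsGeneric.exists_labelling {n : ℕ} (hn : 1 ≤ n) {R : Tiling n} (hR : R.IsGeneric) :
    ∃ (e x : Equiv.Perm (Fin n)) (X Y : ℕ → ℝ), Build n (timeOf x) X Y ∧
      (R.relabel e).HasLines (timeOf x) X Y ∧
      (∀ a c : Fin n, rt n (timeOf x) a = lf (timeOf x) c →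
        (((R.relabel e).tile a).y0 < ((R.relabel e).tile c).y1 ↔ timeOf x a < timeOf x c)) ∧
      (∀ a c : Fin n, tp (timeOf x) a = bo n (timeOf x) c →
        (((R.relabel e).tile a).x0 < ((R.relabel e).tile c).x1 ↔ timeOf x a < timeOf x c)) := by
  obtain ⟨e, x, X, Y, h1, h2, h3, h4⟩ := Rectangulation.exists_labelling hn hR
    (comparator_self R) (comparator_self R.swap)
  have hg : (R.relabel e).IsGeneric := hR.relabel e
  refine ⟨e, x, X, Y, h1, h2, fun a c hac => (h3 a c ?_).symm, fun a c hac => (h4 a c ?_).symm⟩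
  · exact (Tiling.sameV_relabel e a c).1 ((h1.ids_iff_sameV h2 hg).1 hac)
  · exact (Tiling.sameV_relabel (R := R.swap) e a c).1 ((h1.ids_iff_sameH h2 hg).1 hac)

/-- For the converse the tiling is labelled: adjacency forces equal ids, so a zigzag does, and equal
ids mean a common wall. -/
theorem Tiling.IsGeneric.sameV_iff_zigzag {n : ℕ} {R : Tiling n} (hR : R.IsGeneric)
    (i j : Fin n) : R.SameV i j ↔
      Zigzag (fun a b => (R.tile a).LeftOf (R.tile b)) (Sum.inl i) (Sum.inr j) := by
  have hn : 1 ≤ n := by have := i.2; omega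
  refine ⟨hR.zigzag_of_sameV, fun hz => ?_⟩
  obtain ⟨e, x, X, Y, h1, h2, -, -⟩ := hR.exists_labelling hn
  obtain ⟨a, rfl⟩ := e.surjective i
  obtain ⟨b, rfl⟩ := e.surjective j
  rw [← Tiling.sameV_relabel, ← h1.ids_iff_sameV h2 (hR.relabel e)]
  apply h1.zigzag_ids h2
  have := hz.map (L' := fun a b => ((R.relabel e).tile a).LeftOf ((R.relabel e).tile b)) e.symm
    (fun a b hab => by simpa [Tiling.relabel] using hab)
  simpa using this

/-! ### Invariance under wall slides -/

/-- The contact of `b` and `c` that is lost is replaced by the path through `d` and `a`, and the new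
contact of `a` and `d` was a path through `c` and `b` before. -/
theorem SlideRel.zigzag {n : ℕ} {L B L' B' : Fin n → Fin n → Prop} (h : SlideRel L B L' B')
    (hB : ∀ i, ¬ B i i) (i j : Fin n) :
    (Zigzag L (Sum.inl i) (Sum.inr j) ↔ Zigzag L' (Sum.inl i) (Sum.inr j)) ∧
    (Zigzag B (Sum.inl i) (Sum.inr j) ↔ Zigzag B' (Sum.inl i) (Sum.inr j)) := by
  obtain ⟨h1, a, b, c, d, hab, hcd, hac, hbc, hbd, h2⟩ := h
  have hab' : a ≠ b := by rintro rfl; exact hB _ hab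
  have hcd' : c ≠ d := by rintro rfl; exact hB _ hcd
  have sub : ∀ {M M' : Fin n → Fin n → Prop},
      (∀ i j, M i j → Zigzag M' (Sum.inl i) (Sum.inr j)) → ∀ u v, Zigzag M u v → Zigzag M' u v := by
    intro M M' hM u v huv
    induction huv with
    | rel u v h =>
      obtain ⟨i, j, rfl, rfl, h⟩ := h
      exact hM i j h
    | refl u => exact Relation.EqvGen.refl _
    | symm u v _ ih => exact ih.symm
    | trans u v w _ _ ih1 ih2 => exact Relation.EqvGen.trans _ _ _ ih1 ih2
  refine ⟨⟨sub ?_ _ _, sub ?_ _ _⟩, ⟨sub ?_ _ _, sub ?_ _ _⟩⟩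
  · intro i j hij
    by_cases he : i = b ∧ j = c
    · obtain ⟨rfl, rfl⟩ := he
      have z1 : Zigzag L' (Sum.inl i) (Sum.inr d) :=
        Zigzag.of ((h2 i d).2 (Or.inl ⟨hbd, fun h => hcd' h.2.symm⟩))
      have z2 : Zigzag L' (Sum.inl a) (Sum.inr d) := Zigzag.of ((h2 a d).2 (Or.inr ⟨rfl, rfl⟩))
      have z3 : Zigzag L' (Sum.inl a) (Sum.inr j) :=
        Zigzag.of ((h2 a j).2 (Or.inl ⟨hac, fun h => hab' h.1⟩))
      exact Relation.EqvGen.trans _ _ _ z1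
        (Relation.EqvGen.trans _ _ _ (Relation.EqvGen.symm _ _ z2) z3)
    · exact Zigzag.of ((h2 i j).2 (Or.inl ⟨hij, he⟩))
  · intro i j hij
    rcases (h2 i j).1 hij with h | ⟨rfl, rfl⟩
    · exact Zigzag.of h.1
    · exact Relation.EqvGen.trans _ _ _ (Zigzag.of hac)
        (Relation.EqvGen.trans _ _ _ (Relation.EqvGen.symm _ _ (Zigzag.of hbc)) (Zigzag.of hbd))
  · exact fun i j hij => Zigzag.of ((h1 i j).2 hij)
  · exact fun i j hij => Zigzag.of ((h1 i j).1 hij)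

theorem MosaicEquiv.sameV_iff {n : ℕ} {R R' : GenericTiling n} (h : MosaicEquiv R R')
    (i j : Fin n) : (R.1.SameV i j ↔ R'.1.SameV i j) ∧
      (R.1.swap.SameV i j ↔ R'.1.swap.SameV i j) := by
  induction h with
  | rel R R' h =>
    have hz : ∀ R : GenericTiling n, R.1.swap.SameV i j ↔
        Zigzag (fun a b => (R.1.tile a).Below (R.1.tile b)) (Sum.inl i) (Sum.inr j) :=
      fun R => R.2.swap.sameV_iff_zigzag i j
    rw [R.2.sameV_iff_zigzag, R'.2.sameV_iff_zigzag, hz, hz]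
    rcases h with h | h | h
    · have e1 : (fun a b => (R.1.tile a).LeftOf (R.1.tile b)) =
          fun a b => (R'.1.tile a).LeftOf (R'.1.tile b) := by
        ext a b; exact (h a b).1
      have e2 : (fun a b => (R.1.tile a).Below (R.1.tile b)) =
          fun a b => (R'.1.tile a).Below (R'.1.tile b) := by
        ext a b; exact (h a b).2
      rw [e1, e2]
      exact ⟨Iff.rfl, Iff.rfl⟩
    · exact h.zigzag (fun a ha => (R.1.hy a).ne ha.1.symm) i j
    · exact (h.zigzag (fun a ha => (R.1.hx a).ne ha.1.symm) i j).symm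
  | refl R => exact ⟨Iff.rfl, Iff.rfl⟩
  | symm R R' _ ih => exact ⟨ih.1.symm, ih.2.symm⟩
  | trans R R' R'' _ _ ih1 ih2 => exact ⟨ih1.1.trans ih2.1, ih1.2.trans ih2.2⟩

/-! ### The order of the marks on the walls -/

section order
variable {n : ℕ} {t t' : ℕ → ℕ} {X Y X' Y' : ℕ → ℝ} {R : Tiling n}

/-- This is where the order of the marks pins down the generic rectangulation: ids and the order of
opposite marks are all that adjacency depends on, and the marked build realizes both. -/
theorem Build.sameRel_marked (h : Build n t' X' Y') (hR : R.HasLines t' X' Y')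
    (hg : R.IsGeneric) (h' : MarkedBuild n t X Y) (hid : SameIds n t' t)
    (cV : ∀ i j : Fin n, rt n t' i = lf t' j →
      ((R.tile i).y0 < (R.tile j).y1 ↔ t i < t j))
    (cH : ∀ i j : Fin n, tp t' i = bo n t' j →
      ((R.tile i).x0 < (R.tile j).x1 ↔ t i < t j)) :
    SameRel R.tile (fun i : Fin n => lineRect n t X Y i) := by
  have e1 : ∀ i j, i < n → j < n → rt n t' i = lf t' j → rt n t i = lf t j := by
    intro i j hi hj e
    rw [← (hid i hi).2.1, ← (hid j hj).1, e]
  have e2 : ∀ i j, i < n → j < n → tp t' i = bo n t' j → tp t i = bo n t j := by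
    intro i j hi hj e
    rw [← (hid i hi).2.2.1, ← (hid j hj).2.2.2, e]
  have key : SameRel (fun i : Fin n => lineRect n t' X' Y' i)
      (fun i : Fin n => lineRect n t X Y i) := by
    refine h.sameRel h'.toBuild hid ?_ ?_ ?_ ?_ ?_ ?_
    · intro i j hi hj hw
      have := hg.ne_of_sameV ((h.ids_iff_sameV hR hg (i := ⟨i, hi⟩) (j := ⟨j, hj⟩)).1 hw)
      rw [hR, hR] at this
      exact this
    · intro i j hi hj hw
      have := h'.bo_ne_tp hi hj (e1 i j hi hj hw)
      rwa [← (hid i hi).2.2.2, ← (hid j hj).2.2.1] at this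
    · intro i j hi hj hw
      have := hg.swap.ne_of_sameV ((h.ids_iff_sameH hR hg (i := ⟨i, hi⟩) (j := ⟨j, hj⟩)).1 hw)
      change (R.tile ⟨i, hi⟩).x0 ≠ (R.tile ⟨j, hj⟩).x1 at this
      rw [hR, hR] at this
      exact this
    · intro i j hi hj hw
      have := h'.lf_ne_rt hi hj (e2 i j hi hj hw)
      rwa [← (hid i hi).1, ← (hid j hj).2.1] at this
    · intro i j hi hj hw
      have h1 := cV ⟨i, hi⟩ ⟨j, hj⟩ hw
      have h2 := h'.bo_lt_tp_iff hi hj (e1 i j hi hj hw)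
      rw [← (hid i hi).2.2.2, ← (hid j hj).2.2.1] at h2
      rw [hR, hR] at h1
      rw [h2]
      exact h1
    · intro i j hi hj hw
      have h1 := cH ⟨i, hi⟩ ⟨j, hj⟩ hw
      have h2 := h'.lf_lt_rt_iff hi hj (e2 i j hi hj hw)
      rw [← (hid i hi).1, ← (hid j hj).2.1] at h2
      rw [hR, hR] at h1
      rw [h2]
      exact h1
  have e3 : R.tile = fun i : Fin n => lineRect n t' X' Y' i := funext hR
  rw [e3]
  exact key

/-- Along every wall of `R`, the marks come in the order of time. -/
def WallsOrdered (R : Tiling n) (t : ℕ → ℕ) : Prop :=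
  ∀ W, R.IsWall W → ∀ i j : Fin n, t i < t j → ∀ r s, W.Mark (R.tile i) r →
    W.Mark (R.tile j) s → r < s

theorem WallsOrdered.flip (h : WallsOrdered R t) : WallsOrdered R.flip (flipT n t) := by
  intro W hW i j hij r s hi hj
  have h1 : R.IsWall W.swap := ((Tiling.isWall_relabel (R := R.swap) _ _).1 hW).swap
  refine h W.swap h1 i.rev j.rev ?_ r s ?_ ?_
  · have h2 := flipT_rev t i.rev
    have h3 := flipT_rev t j.rev
    rw [Fin.rev_rev] at h2 h3
    rw [← h2, ← h3]
    exact hij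
  · rw [← Seg.mark_swap, Seg.swap_swap]; exact hi
  · rw [← Seg.mark_swap, Seg.swap_swap]; exact hj

theorem rel_or_rel_of_pairwise {α : Type*} {P : α → α → Prop} {l : List α} (h : l.Pairwise P)
    {i j : α} (hi : i ∈ l) (hj : j ∈ l) (hne : i ≠ j) : P i j ∨ P j i := by
  induction h with
  | nil => simp at hi
  | cons h1 _ ih =>
    rcases List.mem_cons.1 hi with e1 | hi' <;> rcases List.mem_cons.1 hj with e2 | hj'
    · exact absurd (e1.trans e2.symm) hne
    · exact Or.inl (e1 ▸ h1 j hj')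
    · exact Or.inr (e2 ▸ h1 i hi')
    · exact ih hi' hj'

theorem wallsOrdered_of_sublist {x : Equiv.Perm (Fin n)}
    (h : ∀ W, R.IsWall W → ∃ l, IsWallShuffle R.tile W l ∧ l.Sublist (word x)) :
    WallsOrdered R (timeOf x) := by
  intro W hW i j hij r s hi hj
  obtain ⟨l, ⟨h1, h2⟩, h3⟩ := h W hW
  have hne : i ≠ j := by rintro rfl; exact lt_irrefl _ hij
  rcases rel_or_rel_of_pairwise (h2.and ((word_pairwise x).sublist h3)) ((h1 i).2 ⟨r, hi⟩) ((h1 j).2 ⟨s, hj⟩)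
    hne with h4 | h4
  · exact h4.1 r s hi hj
  · have := h4.2
    omega

/-- Only the lowest tile on the left of a vertical wall is not recorded. -/
theorem Build.lt_of_not_bottom (h : Build n t X Y) (hR : R.HasLines t X Y) {u a b : ℝ}
    (hW : R.IsWall (Seg.vert u a b)) {i j : Fin n} (hij : rt n t i = lf t j)
    (hj : (R.tile j).x0 = u) (ha : a ≤ (R.tile j).y1) (hb : (R.tile j).y0 ≤ b)
    (hi : (i : ℕ) + 1 ≠ rt n t i) : a < (R.tile i).y0 := by
  have hT := h.inj
  have s1 := hT.rt_spec i.2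
  have s2 := hT.lf_spec j.2
  obtain ⟨k, hk⟩ : ∃ k : Fin n, (k : ℕ) = lf t j - 1 := ⟨⟨lf t j - 1, by omega⟩, rfl⟩
  have hkv : rt n t k = lf t j := by rw [hk]; exact hT.rt_pred_lf j.2 (by omega)
  have hs := h.sameV_of_ids hR hkv
  have h1 := h.cy i k (by omega) k.2 (s1.2.2.1 k (by omega) (by omega))
  have h2 : (R.tile k).y1 ≤ (R.tile i).y0 := by rw [hR, hR]; exact h1
  have h3 := R.hy k
  have h4 := R.bounds k
  have h5 := R.bounds j
  have h6 := R.hy j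
  have hc := hs.2
  rw [hs.1, hj] at hc
  have h7 := (hW.clear_le hc (le_min h4.2.2.1 h5.2.2.1) (max_le h4.2.2.2 h5.2.2.2)
    ((min_le_right _ _).trans hb) (ha.trans (le_max_right _ _))).1
  have h8 := min_le_left (R.tile k).y0 (R.tile j).y0
  linarith

/-- Only the highest tile on the right of a vertical wall is not recorded. -/
theorem Build.lt_of_not_top (h : Build n t X Y) (hR : R.HasLines t X Y) {u a b : ℝ}
    (hW : R.IsWall (Seg.vert u a b)) {i j : Fin n} (hij : rt n t i = lf t j)
    (hi : (R.tile i).x1 = u) (ha : a ≤ (R.tile i).y1) (hb : (R.tile i).y0 ≤ b)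
    (hj : (j : ℕ) ≠ lf t j) : (R.tile j).y1 < b := by
  have hT := h.inj
  have s1 := hT.rt_spec i.2
  have s2 := hT.lf_spec j.2
  obtain ⟨k, hk⟩ : ∃ k : Fin n, (k : ℕ) = rt n t i := ⟨⟨rt n t i, by omega⟩, rfl⟩
  have hkv : rt n t i = lf t k := by rw [hk]; exact (hT.lf_rt i.2 (by omega)).symm
  have hs := h.sameV_of_ids hR hkv
  have h1 := h.cy k j (by omega) j.2 (s2.2.1 k (by omega) (by omega))
  have h2 : (R.tile j).y1 ≤ (R.tile k).y0 := by rw [hR, hR]; exact h1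
  have h3 := R.hy k
  have h4 := R.bounds k
  have h5 := R.bounds i
  have h6 := R.hy i
  have hc := hs.2
  rw [hi] at hc
  have h7 := (hW.clear_le hc (le_min h5.2.2.1 h4.2.2.1) (max_le h5.2.2.2 h4.2.2.2)
    ((min_le_left _ _).trans hb) (ha.trans (le_max_left _ _))).2
  have h8 := le_max_right (R.tile i).y1 (R.tile k).y1
  linarith

/-- If both tiles are recorded on the wall, this is the order of their marks. Otherwise `i` is the
lowest tile on the left or `j` the highest on the right. Then the inequality of heights is clear,
and `t i < t j` follows from the ids because `i + 1` or `j` is the index of the wall. -/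
theorem Build.lt_iff_of_wallsOrdered (h : Build n t' X Y) (hR : R.HasLines t' X Y)
    (hT : TimeInj n t) (hid : SameIds n t' t) (ho : WallsOrdered R t) {i j : Fin n}
    (hij : rt n t' i = lf t' j) : (R.tile i).y0 < (R.tile j).y1 ↔ t i < t j := by
  have hs := h.sameV_of_ids hR hij
  have b1 := R.bounds i
  have b2 := R.bounds j
  have x1 := R.hx i
  have x2 := R.hx j
  have y1 := R.hy i
  have y2 := R.hy j
  have s1 := h.inj.rt_spec i.2
  have s2 := h.inj.lf_spec j.2
  obtain ⟨c, d, hc, hd, hW⟩ := Tiling.exists_wall (R := R)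
    ((min_le_left (R.tile i).y0 (R.tile j).y0).trans_lt
      (y1.trans_le (le_max_left (R.tile i).y1 (R.tile j).y1)))
    (by linarith) (by rw [hs.1]; linarith) (le_min b1.2.2.1 b2.2.2.1)
    (max_le b1.2.2.2 b2.2.2.2) hs.2
  have c1 := hc.trans (min_le_left _ _)
  have c2 := hc.trans (min_le_right _ _)
  have d1 := (le_max_left _ _).trans hd
  have d2 := (le_max_right _ _).trans hd
  rcases lt_or_ge c (R.tile i).y0 with hi | hi
  · rcases lt_or_ge (R.tile j).y1 d with hj | hj
    · have m1 : (Seg.vert (R.tile i).x1 c d).Mark (R.tile i) (R.tile i).y0 :=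
        Or.inl ⟨rfl, hi, d1, rfl⟩
      have m2 : (Seg.vert (R.tile i).x1 c d).Mark (R.tile j) (R.tile j).y1 :=
        Or.inr ⟨hs.1.symm, c2, hj, rfl⟩
      refine ⟨fun h1 => ?_, fun h1 => ho _ hW i j h1 _ _ m1 m2⟩
      by_contra h2
      have h3 : t j ≠ t i := fun h4 => by
        have := hT _ _ j.2 i.2 h4
        omega
      have := ho _ hW j i (by omega) _ _ m2 m1
      linarith
    · refine iff_of_true (by linarith) ?_
      have h1 : (j : ℕ) = lf t' j := by
        by_contra hne
        have := h.lt_of_not_top hR hW hij rfl (by linarith) (by linarith) hne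
        linarith
      have h2 := hT.rt_spec i.2
      rw [← (hid i i.2).2.1, hij, ← h1] at h2
      exact h2.2.2.2 j.2
  · refine iff_of_true (by linarith) ?_
    have h1 : (i : ℕ) + 1 = rt n t' i := by
      by_contra hne
      have := h.lt_of_not_bottom hR hW hij hs.1.symm (by linarith) (by linarith) hne
      linarith
    have h2 := hT.lf_spec j.2
    rw [← (hid j j.2).1, ← hij, ← h1, Nat.add_sub_cancel] at h2
    exact h2.2.2 (by omega)

theorem Build.lt_iff_of_wallsOrdered_horiz (h : Build n t' X Y) (hR : R.HasLines t' X Y)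
    (hT : TimeInj n t) (hid : SameIds n t' t) (ho : WallsOrdered R t) {i j : Fin n}
    (hij : tp t' i = bo n t' j) : (R.tile i).x0 < (R.tile j).x1 ↔ t i < t j := by
  have := h.flip.lt_iff_of_wallsOrdered (hR.flip h.inj) hT.flip (hid.flip h.inj hT) ho.flip
    ((h.ids_flip_iff i j).2 hij)
  rw [Tiling.flip_tile_rev, Tiling.flip_tile_rev, flipT_rev, flipT_rev] at this
  exact this

end order

/-! ### The map `γ` -/

section gamma
variable {n : ℕ}

theorem CombEquiv.of_sameRel {R R' : Fin n → Rect} (h : SameRel R R') : CombEquiv R R' :=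
  ⟨1, h⟩

theorem rho_hasLines (hn : 1 ≤ n) (x : Equiv.Perm (Fin n)) {R : Tiling n}
    (h : R.tile = rho x) : R.HasLines (timeOf x) stdX (stdY n) := fun i => by
  rw [h, rho_eq hn]

/-- The tiling `ρ(x)`. -/
noncomputable def rhoTiling (hn : 1 ≤ n) (x : Equiv.Perm (Fin n)) : GenericTiling n :=
  ⟨(timeOf_inj x).stdBuild.tiling hn, (timeOf_inj x).stdBuild.isGeneric (fun _ => rfl)
    (fun _ _ _ _ h => Nat.cast_injective h)
    (fun _ _ _ _ h => Nat.cast_injective (sub_right_injective h))⟩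

theorem rhoTiling_tile (hn : 1 ≤ n) (x : Equiv.Perm (Fin n)) :
    (rhoTiling hn x).1.tile = rho x := funext fun a => (rho_eq hn x a).symm

/-- The tiling `ρ(x)` is the marked build of a permutation `x₀` that reads its marks in their
geometric order. By uniqueness of labels and ids, `x₀` has the ids of `x`, and
`mosaicEquiv_of_sameIds` connects the two marked builds. -/
theorem mosaicEquiv_rho (hn : 1 ≤ n) (x : Equiv.Perm (Fin n)) {X Y : ℕ → ℝ}
    (h : MarkedBuild n (timeOf x) X Y) : MosaicEquiv (rhoTiling hn x) (h.tiling hn) := by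
  have hg := (rhoTiling hn x).2
  have hl := rho_hasLines hn x (rhoTiling_tile hn x)
  have hb := (timeOf_inj x).stdBuild
  obtain ⟨e, x₀, X₀, Y₀, h1, h2, h3, h4⟩ := hg.exists_labelling hn
  obtain ⟨rfl, hid⟩ := eq_one_and_sameIds (timeOf_inj x) (timeOf_inj x₀) (e := e)
    (V := (rhoTiling hn x).1.SameV) (H := (rhoTiling hn x).1.swap.SameV)
    (fun i j => hb.ids_iff_sameV hl hg) (fun i j => hb.ids_iff_sameH hl hg)
    (fun i j => (h1.ids_iff_sameV h2 (hg.relabel e)).trans (Tiling.sameV_relabel e i j))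
    (fun i j => (h1.ids_iff_sameH h2 (hg.relabel e)).trans
      (Tiling.sameV_relabel (R := (rhoTiling hn x).1.swap) e i j))
  obtain ⟨X', Y', h'⟩ := exists_markedBuild_timeOf x₀
  have h5 := h1.sameRel_marked h2 (hg.relabel 1) h' (SameIds.refl _ _) h3 h4
  exact Relation.EqvGen.trans _ (h'.tiling hn) _ (Relation.EqvGen.rel _ _ (Or.inl h5))
    (Relation.EqvGen.symm _ _ (mosaicEquiv_of_sameIds hn x₀ h' x h hid))

/-- Mosaic equivalence fixes which tiles share walls, hence the labels and the ids; the condition on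
wall shuffles fixes the order of the marks. So any candidate is equivalent to the marked build of
`x`, and this build qualifies. -/
theorem isGamma_iff (hn : 1 ≤ n) (x : Equiv.Perm (Fin n)) {X Y : ℕ → ℝ}
    (h : MarkedBuild n (timeOf x) X Y) (G : GRec n) :
    IsGamma x G ↔ G = Quotient.mk (genericTilingSetoid n) (h.tiling hn) := by
  constructor
  · rintro ⟨R₀, R, h0, hm, hw, rfl⟩
    have hl := rho_hasLines hn x h0
    have hb := (timeOf_inj x).stdBuild
    obtain ⟨e, x₁, X₁, Y₁, h1, h2, h3, h4⟩ := R.2.exists_labelling hn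
    obtain ⟨rfl, hid⟩ := eq_one_and_sameIds (timeOf_inj x) (timeOf_inj x₁) (e := e)
      (V := R.1.SameV) (H := R.1.swap.SameV)
      (fun i j => (hb.ids_iff_sameV hl R₀.2).trans (hm.sameV_iff i j).1)
      (fun i j => (hb.ids_iff_sameH hl R₀.2).trans (hm.sameV_iff i j).2)
      (fun i j => (h1.ids_iff_sameV h2 (R.2.relabel e)).trans (Tiling.sameV_relabel e i j))
      (fun i j => (h1.ids_iff_sameH h2 (R.2.relabel e)).trans
        (Tiling.sameV_relabel (R := R.1.swap) e i j))
    have ho := wallsOrdered_of_sublist hw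
    refine Quotient.sound (CombEquiv.of_sameRel ?_)
    exact h1.sameRel_marked (R := R.1) h2 R.2 h hid.symm
      (fun i j hij => h1.lt_iff_of_wallsOrdered (R := R.1) h2 (timeOf_inj x) hid.symm ho hij)
      (fun i j hij => h1.lt_iff_of_wallsOrdered_horiz (R := R.1) h2 (timeOf_inj x) hid.symm ho hij)
  · rintro rfl
    exact ⟨rhoTiling hn x, h.tiling hn, rhoTiling_tile hn x, mosaicEquiv_rho hn x h,
      fun W hW => h.exists_wallShuffle (fun _ => rfl) hW, rfl⟩

theorem exists_eq_mk (hn : 1 ≤ n) (G : GRec n) :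
    ∃ x : Equiv.Perm (Fin n), ∀ {X Y : ℕ → ℝ} (h : MarkedBuild n (timeOf x) X Y),
      G = Quotient.mk (genericTilingSetoid n) (h.tiling hn) := by
  obtain ⟨R, rfl⟩ := Quotient.exists_rep G
  obtain ⟨e, x, X₁, Y₁, h1, h2, h3, h4⟩ := R.2.exists_labelling hn
  refine ⟨x, fun {X Y} h => Quotient.sound (Setoid.symm ?_)⟩
  have := h1.sameRel_marked h2 (R.2.relabel e) h (SameIds.refl _ _) h3 h4
  exact ⟨e, this.symm⟩

end gamma

end Rectangulation

namespace Rectangulation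

/-! ### The diagonal -/

section diagonal
variable {n : ℕ} {R : Tiling n}

/-- The point of the diagonal with parameter `l` lies in the interior of the tile `i`. -/
def Tiling.DiagPt (R : Tiling n) (i : Fin n) (l : ℝ) : Prop :=
  ((R.tile i).x0 < R.outer.x0 + l * (R.outer.x1 - R.outer.x0) ∧
    R.outer.x0 + l * (R.outer.x1 - R.outer.x0) < (R.tile i).x1) ∧
  (R.tile i).y0 < R.outer.y1 - l * (R.outer.y1 - R.outer.y0) ∧
    R.outer.y1 - l * (R.outer.y1 - R.outer.y0) < (R.tile i).y1

/-- The interior of every tile meets the diagonal. -/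
def Tiling.MeetsDiag (R : Tiling n) : Prop := ∀ i, ∃ l, R.DiagPt i l

theorem Tiling.mem_diagonal {p : ℝ × ℝ} (hp : p ∈ R.outer.diagonal) :
    ∃ l, p.1 = R.outer.x0 + l * (R.outer.x1 - R.outer.x0) ∧
      p.2 = R.outer.y1 - l * (R.outer.y1 - R.outer.y0) := by
  obtain ⟨k, l, _, _, e, rfl⟩ := hp
  refine ⟨l, ?_, ?_⟩ <;>
  · obtain rfl : k = 1 - l := by linarith
    simp only [Prod.smul_mk, smul_eq_mul, Prod.mk_add_mk]
    ring

theorem Tiling.IsDiagonal.meetsDiag (h : R.IsDiagonal) : R.MeetsDiag := fun i => by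
  obtain ⟨p, hp, ⟨h1, h2⟩, h3, h4⟩ := h.1 i
  obtain ⟨l, e1, e2⟩ := Tiling.mem_diagonal hp
  rw [e1] at h1 h2
  rw [e2] at h3 h4
  exact ⟨l, ⟨h1, h2⟩, h3, h4⟩

theorem Tiling.IsDiagonal.lt_of_x (h : R.IsDiagonal) {i j : Fin n}
    (hij : (R.tile i).x1 = (R.tile j).x0) : i < j := by
  have h1 := R.hx i
  rcases lt_trichotomy i j with h2 | rfl | h2
  · exact h2
  · exact absurd hij h1.ne'
  · obtain ⟨p, hp⟩ := h.1 i
    obtain ⟨q, hq⟩ := h.1 j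
    have h3 := h.2 j i h2 q hq p hp
    have h4 := hp.2.1.2
    have h5 := hq.2.1.1
    linarith

theorem Tiling.IsDiagonal.lt_of_y (h : R.IsDiagonal) {i j : Fin n}
    (hij : (R.tile i).y0 = (R.tile j).y1) : i < j := by
  have h1 := R.hy i
  rcases lt_trichotomy i j with h2 | rfl | h2
  · exact h2
  · exact absurd hij h1.ne
  · obtain ⟨p, hp⟩ := h.1 i
    obtain ⟨q, hq⟩ := h.1 j
    have h3 := h.2 j i h2 q hq p hp
    have h4 := hp.2.2.1
    have h5 := hq.2.2.2
    obtain ⟨l, e1, e2⟩ := Tiling.mem_diagonal hp.1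
    obtain ⟨m, e3, e4⟩ := Tiling.mem_diagonal hq.1
    have hx := R.outer_nondeg.1
    have hy := R.outer_nondeg.2
    have h6 : m < l := by
      refine lt_of_mul_lt_mul_right (a := R.outer.x1 - R.outer.x0) ?_ (by linarith)
      linarith
    have := mul_lt_mul_of_pos_right h6 (sub_pos.2 hy)
    linarith

theorem Tiling.MeetsDiag.swap (h : R.MeetsDiag) : R.swap.MeetsDiag := fun i => by
  obtain ⟨l, ⟨h1, h2⟩, h3, h4⟩ := h i
  refine ⟨1 - l, ⟨?_, ?_⟩, ?_, ?_⟩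
  · change (R.tile i).y0 < R.outer.y0 + (1 - l) * (R.outer.y1 - R.outer.y0)
    linarith
  · change R.outer.y0 + (1 - l) * (R.outer.y1 - R.outer.y0) < (R.tile i).y1
    linarith
  · change (R.tile i).x0 < R.outer.x1 - (1 - l) * (R.outer.x1 - R.outer.x0)
    linarith
  · change R.outer.x1 - (1 - l) * (R.outer.x1 - R.outer.x0) < (R.tile i).x1
    linarith

theorem Tiling.MeetsDiag.flip (h : R.MeetsDiag) : R.flip.MeetsDiag := fun i => h.swap i.rev

/-- The height of the diagonal at the abscissa `u`. -/
noncomputable def Tiling.diagY (R : Tiling n) (u : ℝ) : ℝ :=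
  R.outer.y1 - (u - R.outer.x0) / (R.outer.x1 - R.outer.x0) * (R.outer.y1 - R.outer.y0)

theorem Tiling.MeetsDiag.diagY_lt (h : R.MeetsDiag) (i : Fin n) :
    R.diagY (R.tile i).x1 < (R.tile i).y1 := by
  obtain ⟨l, ⟨h1, h2⟩, h3, h4⟩ := h i
  have hx := R.outer_nondeg.1
  have hy := R.outer_nondeg.2
  have h5 : l < ((R.tile i).x1 - R.outer.x0) / (R.outer.x1 - R.outer.x0) := by
    rw [lt_div_iff₀ (by linarith)]
    linarith
  have := mul_lt_mul_of_pos_right h5 (sub_pos.2 hy)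
  unfold Tiling.diagY
  linarith

theorem Tiling.MeetsDiag.lt_diagY (h : R.MeetsDiag) (i : Fin n) :
    (R.tile i).y0 < R.diagY (R.tile i).x0 := by
  obtain ⟨l, ⟨h1, h2⟩, h3, h4⟩ := h i
  have hx := R.outer_nondeg.1
  have hy := R.outer_nondeg.2
  have h5 : ((R.tile i).x0 - R.outer.x0) / (R.outer.x1 - R.outer.x0) < l := by
    rw [div_lt_iff₀ (by linarith)]
    linarith
  have := mul_lt_mul_of_pos_right h5 (sub_pos.2 hy)
  unfold Tiling.diagY
  linarith

/-- The tile below a mark on the left of the wall meets the diagonal, so its top-right corner, which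
is not above the mark, lies above the diagonal. With the mirror image `mark_lt_diagY`, all marks
from the right come before all marks from the left. -/
theorem Tiling.MeetsDiag.diagY_lt_mark (h : R.MeetsDiag) {u a b s : ℝ} {i : Fin n}
    (hW : R.IsWall (Seg.vert u a b)) (hi : (Seg.vert u a b).MarkLU (R.tile i) s) :
    R.diagY u < s := by
  obtain ⟨i1, i2, i3, rfl⟩ := hi
  obtain ⟨_, g1, g2, g3, g4, hc⟩ := Tiling.isWall_vert hW
  have hy := R.hy i
  obtain ⟨k, k1, k2, k3⟩ := hc.exists_sw (v := (R.tile i).y0) g1 g2.le (by linarith) (by linarith)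
    i2 (by linarith)
  have h1 := h.diagY_lt k
  rw [k1] at h1
  refine h1.trans_le (not_lt.1 fun h2 => ?_)
  obtain rfl := R.eq_of_x1 (k1.trans i1.symm) (by linarith) h2
  exact lt_irrefl _ k2

theorem Tiling.MeetsDiag.mark_lt_diagY (h : R.MeetsDiag) {u a b s : ℝ} {i : Fin n}
    (hW : R.IsWall (Seg.vert u a b)) (hi : (Seg.vert u a b).MarkRD (R.tile i) s) :
    s < R.diagY u := by
  obtain ⟨i1, i2, i3, rfl⟩ := hi
  obtain ⟨_, g1, g2, g3, g4, hc⟩ := Tiling.isWall_vert hW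
  have hy := R.hy i
  obtain ⟨k, k1, k2, k3⟩ := hc.exists_ne (v := (R.tile i).y1) g1.le g2 (by linarith) (by linarith)
    (by linarith) i3
  have h1 := h.lt_diagY k
  rw [k1] at h1
  refine lt_of_le_of_lt (not_lt.1 fun h2 => ?_) h1
  obtain rfl := R.eq_of_x0 (k1.trans i1.symm) h2 (by linarith)
  exact lt_irrefl _ k3

end diagonal

/-! ### Tilings along the diagonal are determined by their lines -/

section lines
variable {n : ℕ} {t : ℕ → ℕ} {X Y X' Y' : ℕ → ℝ} {R R' : Tiling n}

/-- The diagonal separates the marks of the two sides, so `i` can start below the top of `j` only if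
one of them is the unrecorded tile of its side. Thus in a diagonal rectangulation the order of
opposite marks can be read off from the ids. -/
theorem Build.lt_iff_of_meetsDiag (h : Build n t X Y) (hR : R.HasLines t X Y)
    (hM : R.MeetsDiag) {i j : Fin n} (hij : rt n t i = lf t j) :
    (R.tile i).y0 < (R.tile j).y1 ↔ (i : ℕ) + 1 = rt n t i ∨ (j : ℕ) = lf t j := by
  have hT := h.inj
  have r := hT.rt_spec i.2
  have l := hT.lf_spec j.2
  have cy : ∀ i j : Fin n, i.1 < j → t j < t i → (R.tile j).y1 ≤ (R.tile i).y0 := by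
    intro i j h1 h2
    rw [hR, hR]
    exact h.cy i j h1 j.2 h2
  have ids : ∀ i j : Fin n, (R.tile i).x1 = (R.tile j).x0 → (R.tile i).y0 < (R.tile j).y1 →
      (R.tile j).y0 < (R.tile i).y1 → rt n t i = lf t j := by
    intro i j h1 h2 h3
    rw [hR, hR] at h1 h2 h3
    exact h.ids_of_leftOf i.2 j.2 h1 h2 h3
  obtain ⟨hx, hc⟩ := h.sameV_of_ids hR hij
  have yi := R.hy i
  have yj := R.hy j
  have xi := R.hx i
  have xj := R.hx j
  have bi := R.bounds i
  have bj := R.bounds j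
  constructor
  · intro h1
    by_contra hcon
    push Not at hcon
    obtain ⟨i', hi'⟩ : ∃ k : Fin n, (k : ℕ) = lf t j - 1 := ⟨⟨lf t j - 1, by omega⟩, rfl⟩
    obtain ⟨j', hj'⟩ : ∃ k : Fin n, (k : ℕ) = lf t j := ⟨⟨lf t j, by omega⟩, rfl⟩
    have e1 : rt n t i' = lf t j := by rw [hi']; exact hT.rt_pred_lf j.2 (by omega)
    have e2 : lf t j' = lf t j := by rw [hj', ← hij]; exact hT.lf_rt i.2 (by omega)
    have x1 : (R.tile i').x1 = (R.tile i).x1 := by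
      rw [hR, hR]; exact congrArg X (e1.trans hij.symm)
    have x2 : (R.tile j').x0 = (R.tile i).x1 := by
      rw [hx, hR, hR]; exact congrArg X e2
    have h2 := cy i i' (by omega) (r.2.2.1 i' (by omega) (by omega))
    have h3 := cy j' j (by omega) (l.2.1 j' (by omega) (by omega))
    have h4 := hM.diagY_lt i'
    have h5 := hM.lt_diagY j'
    rw [x1] at h4
    rw [x2] at h5
    linarith
  · rintro (h1 | h1)
    · by_contra h2
      push Not at h2
      obtain ⟨a, a1, a2, a3⟩ := hc.exists_sw (v := (R.tile j).y1) (by linarith) bi.2.1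
        (by linarith) bj.2.2.2 ((min_le_right _ _).trans_lt yj) (le_max_right _ _)
      have e := ids a j (a1.trans hx) a2 (by linarith)
      have ra := hT.rt_spec a.2
      have hne : (a : ℕ) ≠ i := fun h3 => by
        rw [Fin.ext h3] at a2
        linarith
      have := cy a i (by omega) (ra.2.2.1 i (by omega) (by omega))
      linarith
    · by_contra h2
      push Not at h2
      obtain ⟨c, c1, c2, c3⟩ := hc.exists_ne (v := (R.tile i).y0) (by linarith) (by linarith)
        bi.2.2.1 (by linarith) (min_le_left _ _) (yi.trans_le (le_max_left _ _))
      have e := ids i c c1.symm c3 (by linarith)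
      have lc := hT.lf_spec c.2
      have hne : (c : ℕ) ≠ j := fun h3 => by
        rw [Fin.ext h3] at c3
        linarith
      have := cy j c (by omega) (lc.2.1 j (by omega) (by omega))
      linarith

/-- Since the ids fix the order of the marks on the diagonal, two diagonal tilings with the same ids
are equivalent. This identifies a diagonal rectangulation given by lines with `ρ` of its
permutation. -/
theorem Build.sameRel_of_meetsDiag (h : Build n t X Y) (hR : R.HasLines t X Y)
    (hg : R.IsGeneric) (hM : R.MeetsDiag) (h' : Build n t X' Y') (hR' : R'.HasLines t X' Y')
    (hg' : R'.IsGeneric) (hM' : R'.MeetsDiag) : SameRel R.tile R'.tile := by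
  have neV : ∀ {X Y : ℕ → ℝ} {R : Tiling n} (h : Build n t X Y) (hR : R.HasLines t X Y)
      (hg : R.IsGeneric) (i j : ℕ), i < n → j < n → rt n t i = lf t j →
        Y (bo n t i) ≠ Y (tp t j) := by
    intro X Y R h hR hg i j hi hj hw
    have := hg.ne_of_sameV ((h.ids_iff_sameV hR hg (i := ⟨i, hi⟩) (j := ⟨j, hj⟩)).1 hw)
    rw [hR, hR] at this
    exact this
  have neH : ∀ {X Y : ℕ → ℝ} {R : Tiling n} (h : Build n t X Y) (hR : R.HasLines t X Y)
      (hg : R.IsGeneric) (i j : ℕ), i < n → j < n → tp t i = bo n t j →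
        X (lf t i) ≠ X (rt n t j) := by
    intro X Y R h hR hg i j hi hj hw
    have := hg.swap.ne_of_sameV ((h.ids_iff_sameH hR hg (i := ⟨i, hi⟩) (j := ⟨j, hj⟩)).1 hw)
    change (R.tile ⟨i, hi⟩).x0 ≠ (R.tile ⟨j, hj⟩).x1 at this
    rw [hR, hR] at this
    exact this
  have key : SameRel (fun i : Fin n => lineRect n t X Y i)
      (fun i : Fin n => lineRect n t X' Y' i) := by
    refine h.sameRel h' (SameIds.refl n t) (neV h hR hg) (neV h' hR' hg') (neH h hR hg)
      (neH h' hR' hg') ?_ ?_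
    · intro i j hi hj hw
      have h1 := h.lt_iff_of_meetsDiag hR hM (i := ⟨i, hi⟩) (j := ⟨j, hj⟩) hw
      have h2 := h'.lt_iff_of_meetsDiag hR' hM' (i := ⟨i, hi⟩) (j := ⟨j, hj⟩) hw
      rw [hR, hR] at h1
      rw [hR', hR'] at h2
      exact h1.trans h2.symm
    · intro i j hi hj hw
      have hw' := (h.ids_flip_iff ⟨i, hi⟩ ⟨j, hj⟩).2 hw
      have h1 := h.flip.lt_iff_of_meetsDiag (hR.flip h.inj) hM.flip hw'
      have h2 := h'.flip.lt_iff_of_meetsDiag (hR'.flip h.inj) hM'.flip hw'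
      rw [Tiling.flip_tile_rev, Tiling.flip_tile_rev, hR, hR] at h1
      rw [Tiling.flip_tile_rev, Tiling.flip_tile_rev, hR', hR'] at h2
      exact h1.trans h2.symm
  have e1 : R.tile = fun i : Fin n => lineRect n t X Y i := funext hR
  have e2 : R'.tile = fun i : Fin n => lineRect n t X' Y' i := funext hR'
  rw [e1, e2]
  exact key

theorem rhoTiling_meetsDiag (hn : 1 ≤ n) (x : Equiv.Perm (Fin n)) :
    (rhoTiling hn x).1.MeetsDiag := by
  intro i
  have hn' : (0 : ℝ) < n := by exact_mod_cast hn
  have hT := timeOf_inj x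
  have h1 : ((lf (timeOf x) i : ℕ) : ℝ) ≤ (i : ℕ) := by exact_mod_cast (hT.lf_spec i.2).1
  have h2 : ((i : ℕ) : ℝ) + 1 ≤ (rt n (timeOf x) i : ℕ) := by exact_mod_cast (hT.rt_spec i.2).1
  have h3 : ((tp (timeOf x) i : ℕ) : ℝ) ≤ (i : ℕ) := by exact_mod_cast (hT.tp_spec i.2).1
  have h4 : ((i : ℕ) : ℝ) + 1 ≤ (bo n (timeOf x) i : ℕ) := by exact_mod_cast (hT.bo_spec i.2).1
  have e1 : (0 : ℝ) + (((i : ℕ) : ℝ) + 1 / 2) / n * (n - 0) = (i : ℕ) + 1 / 2 := by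
    field_simp
    ring
  have e2 : (n : ℝ) - 0 - (((i : ℕ) : ℝ) + 1 / 2) / n * ((n - 0) - (n - n)) =
      n - ((i : ℕ) + 1 / 2) := by
    field_simp
    ring
  -- The parameter of the midpoint of the space between the diagonal points `i` and `i + 1`.
  refine ⟨(((i : ℕ) : ℝ) + 1 / 2) / n, ⟨?_, ?_⟩, ?_, ?_⟩
  · change ((lf (timeOf x) i : ℕ) : ℝ) < ((0 : ℕ) : ℝ) + _ * ((n : ℝ) - ((0 : ℕ) : ℝ))
    rw [Nat.cast_zero, e1]
    linarith
  · change ((0 : ℕ) : ℝ) + _ * ((n : ℝ) - ((0 : ℕ) : ℝ)) < ((rt n (timeOf x) i : ℕ) : ℝ)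
    rw [Nat.cast_zero, e1]
    linarith
  · change (n : ℝ) - ((bo n (timeOf x) i : ℕ) : ℝ) <
      (n : ℝ) - ((0 : ℕ) : ℝ) - _ * ((n : ℝ) - ((0 : ℕ) : ℝ) - (n - n))
    rw [Nat.cast_zero, e2]
    linarith
  · change (n : ℝ) - ((0 : ℕ) : ℝ) - _ * ((n : ℝ) - ((0 : ℕ) : ℝ) - (n - n)) <
      (n : ℝ) - ((tp (timeOf x) i : ℕ) : ℝ)
    rw [Nat.cast_zero, e2]
    linarith

end lines

/-! ### Choices of wall shuffles -/

theorem idxOf_rel {α : Type*} [DecidableEq α] {P : α → α → Prop} {l : List α}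
    (h : l.Pairwise P) {i j : α} (hi : i ∈ l) (hj : j ∈ l) (hij : l.idxOf i < l.idxOf j) :
    P i j := by
  have := List.pairwise_iff_getElem.1 h _ _ (List.idxOf_lt_length_of_mem hi)
    (List.idxOf_lt_length_of_mem hj) hij
  simpa using this

theorem pairwise_of_idxOf {α : Type*} [DecidableEq α] {P : α → α → Prop} {l : List α}
    (hl : l.Nodup) (h : ∀ i ∈ l, ∀ j ∈ l, l.idxOf i < l.idxOf j → P i j) : l.Pairwise P := by
  rw [List.pairwise_iff_getElem]
  intro i j hi hj hij
  refine h _ (List.getElem_mem hi) _ (List.getElem_mem hj) ?_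
  rwa [hl.idxOf_getElem, hl.idxOf_getElem]

theorem sublist_word {n : ℕ} {x : Equiv.Perm (Fin n)} {l : List (Fin n)}
    (h : l.Pairwise fun i j : Fin n => timeOf x i < timeOf x j) : l.Sublist (word x) := by
  have hn : l.Nodup := h.imp fun hij e => by rw [e] at hij; exact lt_irrefl _ hij
  have : Std.Antisymm fun i j : Fin n => timeOf x i ≤ timeOf x j :=
    ⟨fun i j h1 h2 => Fin.ext (timeOf_inj x _ _ i.2 j.2 (le_antisymm h1 h2))⟩
  refine List.sublist_of_subperm_of_pairwise (r := fun i j : Fin n => timeOf x i ≤ timeOf x j)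
    (hn.subperm fun i _ => mem_word x i) (h.imp le_of_lt) ((word_pairwise x).imp le_of_lt)

section choice
variable {n : ℕ} {R : Tiling n} {σ : Seg → List (Fin n)}

/-- The chosen order of the tiles `a` and `c` on opposite sides of a vertical wall. -/
def Before (R : Tiling n) (σ : Seg → List (Fin n)) (a c : Fin n) : Prop :=
  ∀ u p q, R.IsWall (Seg.vert u p q) → (∃ s, (Seg.vert u p q).MarkLU (R.tile a) s) →
    (∃ s, (Seg.vert u p q).MarkRD (R.tile c) s) →
    (σ (Seg.vert u p q)).idxOf a < (σ (Seg.vert u p q)).idxOf c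

theorem IsShuffleChoice.swap {W : Seg} {l : List (Fin n)} (h : IsShuffleChoice R.tile W.swap l) :
    IsShuffleChoice R.swap.tile W l := by
  have e1 : ∀ i s, W.MarkLU (R.swap.tile i) s ↔ W.swap.MarkRD (R.tile i) s := fun i s => by
    rw [← Seg.markLU_swap, Seg.swap_swap]; rfl
  have e2 : ∀ i s, W.MarkRD (R.swap.tile i) s ↔ W.swap.MarkLU (R.tile i) s := fun i s => by
    rw [← Seg.markRD_swap, Seg.swap_swap]; rfl
  have e3 : ∀ i s, W.Mark (R.swap.tile i) s ↔ W.swap.Mark (R.tile i) s := fun i s => by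
    unfold Seg.Mark
    rw [e1, e2, or_comm]
  refine ⟨h.1, fun i => ?_, h.2.2.imp fun {i j} hij => ⟨?_, ?_⟩⟩
  · simp only [e3, h.2.1]
  · simp only [e1]; exact hij.2
  · simp only [e2]; exact hij.1

theorem IsShuffleChoice.idxOf_lt_LU {W : Seg} {l : List (Fin n)} (h : IsShuffleChoice R.tile W l)
    {i j : Fin n} {r s : ℝ} (hi : W.MarkLU (R.tile i) r) (hj : W.MarkLU (R.tile j) s)
    (hrs : r < s) (hne : i ≠ j) : l.idxOf i < l.idxOf j := by
  have mi := (h.2.1 i).2 ⟨r, Or.inl hi⟩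
  have mj := (h.2.1 j).2 ⟨s, Or.inl hj⟩
  rcases lt_trichotomy (l.idxOf i) (l.idxOf j) with h1 | h1 | h1
  · exact h1
  · exact absurd ((List.idxOf_inj mi).1 h1) hne
  · have := (idxOf_rel h.2.2 mj mi h1).1 s r hj hi
    linarith

theorem IsShuffleChoice.idxOf_lt_RD {W : Seg} {l : List (Fin n)} (h : IsShuffleChoice R.tile W l)
    {i j : Fin n} {r s : ℝ} (hi : W.MarkRD (R.tile i) r) (hj : W.MarkRD (R.tile j) s)
    (hrs : r < s) (hne : i ≠ j) : l.idxOf i < l.idxOf j := by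
  have mi := (h.2.1 i).2 ⟨r, Or.inr hi⟩
  have mj := (h.2.1 j).2 ⟨s, Or.inr hj⟩
  rcases lt_trichotomy (l.idxOf i) (l.idxOf j) with h1 | h1 | h1
  · exact h1
  · exact absurd ((List.idxOf_inj mi).1 h1) hne
  · have := (idxOf_rel h.2.2 mj mi h1).2 s r hj hi
    linarith

theorem Tiling.IsWall.bounds_of_sameV {u p q : ℝ} (hW : R.IsWall (Seg.vert u p q)) {a c : Fin n}
    (hs : R.SameV a c) (hu : (R.tile a).x1 = u)
    (h : (p ≤ (R.tile a).y0 ∧ (R.tile a).y1 ≤ q) ∨ (p ≤ (R.tile c).y0 ∧ (R.tile c).y1 ≤ q)) :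
    (p ≤ (R.tile a).y0 ∧ (R.tile a).y1 ≤ q) ∧ p ≤ (R.tile c).y0 ∧ (R.tile c).y1 ≤ q := by
  have ba := R.bounds a
  have bc := R.bounds c
  have ya := R.hy a
  have yc := R.hy c
  have hc := hs.2
  rw [hu] at hc
  have h1 := min_le_left (R.tile a).y0 (R.tile c).y0
  have h2 := min_le_right (R.tile a).y0 (R.tile c).y0
  have h3 := le_max_left (R.tile a).y1 (R.tile c).y1
  have h4 := le_max_right (R.tile a).y1 (R.tile c).y1
  have h5 := hW.clear_le hc (le_min ba.2.2.1 bc.2.2.1) (max_le ba.2.2.2 bc.2.2.2)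
    (by rcases h with h | h <;> linarith) (by rcases h with h | h <;> linarith)
  exact ⟨⟨by linarith, by linarith⟩, by linarith, by linarith⟩

/-- For recorded tiles the hypothesis of `of_lt` never holds, because left marks are above the
diagonal and right marks below; for unrecorded ones `Before` is vacuously true. Monotonicity
expresses that a shuffle respects the order on each side. -/
theorem comparator_before (hM : R.MeetsDiag)
    (hσ : ∀ W, R.IsWall W → IsShuffleChoice R.tile W (σ W)) : Comparator R (Before R σ) where
  of_lt := by
    rintro a c - h u p q hW ⟨s, hs⟩ ⟨r, hr⟩
    have h1 := hM.diagY_lt_mark hW hs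
    have h2 := hM.mark_lt_diagY hW hr
    obtain ⟨_, _, _, rfl⟩ := hs
    obtain ⟨_, _, _, rfl⟩ := hr
    linarith
  monoL := by
    rintro a a' c h1 h2 h3 h4 u p q hW ⟨s, hs⟩ ⟨r, hr⟩
    have hs' := hs
    have hr' := hr
    obtain ⟨s1, s2, s3, rfl⟩ := hs'
    obtain ⟨r1, r2, r3, rfl⟩ := hr'
    have h5 := hW.bounds_of_sameV h1 (h1.1.trans r1) (Or.inr ⟨r2, r3.le⟩)
    have ha : (Seg.vert u p q).MarkLU (R.tile a) (R.tile a).y0 :=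
      ⟨h1.1.trans r1, s2.trans_le h3, h5.1.2, rfl⟩
    have h6 := h4 u p q hW ⟨_, ha⟩ ⟨_, hr⟩
    by_cases he : a' = a
    · rwa [he]
    · refine lt_trans ((hσ _ hW).idxOf_lt_LU hs ha (lt_of_le_of_ne h3 fun e => he ?_) he) h6
      have := R.hy a
      have := R.hy a'
      exact R.eq_of_x1 (s1.trans ha.1.symm) (by linarith) (by linarith)
  monoR := by
    rintro a c c' h1 h2 h3 h4 u p q hW ⟨s, hs⟩ ⟨r, hr⟩
    have hs' := hs
    have hr' := hr
    obtain ⟨s1, s2, s3, rfl⟩ := hs'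
    obtain ⟨r1, r2, r3, rfl⟩ := hr'
    have h5 := hW.bounds_of_sameV h1 s1 (Or.inl ⟨s2.le, s3⟩)
    have hc : (Seg.vert u p q).MarkRD (R.tile c) (R.tile c).y1 :=
      ⟨h1.1.symm.trans s1, h5.2.1, h3.trans_lt r3, rfl⟩
    have h6 := h4 u p q hW ⟨_, hs⟩ ⟨_, hc⟩
    by_cases he : c = c'
    · rwa [← he]
    · refine lt_trans h6 ((hσ _ hW).idxOf_lt_RD hc hr (lt_of_le_of_ne h3 fun e => he ?_) he)
      have := R.hy c
      have := R.hy c'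
      exact R.eq_of_x0 (hc.1.trans r1.symm) (by linarith) (by linarith)

/-- The wall that contains the right edge of `a` is unique, so the quantifier over walls in `Before`
concerns this wall only. -/
theorem IsShuffleChoice.before {u p q : ℝ} {a c : Fin n} {r s : ℝ}
    (hW : R.IsWall (Seg.vert u p q)) (ha : (Seg.vert u p q).MarkLU (R.tile a) r)
    (hc : (Seg.vert u p q).MarkRD (R.tile c) s) :
    Before R σ a c ↔ (σ (Seg.vert u p q)).idxOf a < (σ (Seg.vert u p q)).idxOf c := by
  refine ⟨fun h => h u p q hW ⟨r, ha⟩ ⟨s, hc⟩, ?_⟩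
  rintro h u' p' q' hW' ⟨r', ha'⟩ -
  obtain ⟨a1, a2, a3, _⟩ := ha
  obtain ⟨b1, b2, b3, _⟩ := ha'
  obtain rfl := a1.symm.trans b1
  have ya := R.hy a
  obtain ⟨_, _, _, g3, g4, g5⟩ := Tiling.isWall_vert hW
  obtain ⟨_, _, _, k3, k4, k5⟩ := Tiling.isWall_vert hW'
  have h1 := hW.clear_le k5 k3 k4 (by linarith) (by linarith)
  have h2 := hW'.clear_le g5 g3 g4 (by linarith) (by linarith)
  obtain rfl := le_antisymm h1.1 h2.1
  obtain rfl := le_antisymm h1.2 h2.2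
  exact h

/-- Labels from the same side follow the geometric order both in the shuffle and in time; labels
from opposite sides are governed by `Before`. -/
theorem IsShuffleChoice.pairwise {τ : Fin n → ℕ} (hτ : Function.Injective τ) {u p q : ℝ}
    (hW : R.IsWall (Seg.vert u p q))
    (hσ : IsShuffleChoice R.tile (Seg.vert u p q) (σ (Seg.vert u p q)))
    (hL : ∀ i j, τ i < τ j → ∀ r s, (Seg.vert u p q).MarkLU (R.tile i) r →
      (Seg.vert u p q).MarkLU (R.tile j) s → r < s)
    (hR : ∀ i j, τ i < τ j → ∀ r s, (Seg.vert u p q).MarkRD (R.tile i) r →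
      (Seg.vert u p q).MarkRD (R.tile j) s → r < s)
    (hb : ∀ a c, R.SameV a c → (τ a < τ c ↔ Before R σ a c)) :
    (σ (Seg.vert u p q)).Pairwise fun i j => τ i < τ j := by
  refine pairwise_of_idxOf hσ.1 fun i hi j hj hij => ?_
  by_contra hcon
  have hlt : τ j < τ i := lt_of_le_of_ne (not_lt.1 hcon) fun e => by
    rw [hτ e] at hij
    exact lt_irrefl _ hij
  have hp := idxOf_rel hσ.2.2 hi hj hij
  obtain ⟨r, hr⟩ := (hσ.2.1 i).1 hi
  obtain ⟨s, hs⟩ := (hσ.2.1 j).1 hj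
  rcases hr with hr | hr <;> rcases hs with hs | hs
  · exact lt_asymm (hp.1 r s hr hs) (hL j i hlt s r hs hr)
  · have h1 := hW.sameV hr.1 hs.1 hr.2.1.le hr.2.2.1 hs.2.1 hs.2.2.1.le
    exact hcon ((hb i j h1).2 ((IsShuffleChoice.before hW hr hs).2 hij))
  · have h1 := hW.sameV hs.1 hr.1 hs.2.1.le hs.2.2.1 hr.2.1 hr.2.2.1.le
    exact lt_asymm hij ((IsShuffleChoice.before hW hs hr).1 ((hb j i h1).1 hlt))
  · exact lt_asymm (hp.2 r s hr hs) (hR j i hlt s r hs hr)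

/-- The greedy construction, run with the chosen shuffles as comparators, gives a permutation whose
time order extends all of them. It also presents the rectangulation by lines, and a tiling that
meets the diagonal has no freedom beyond its ids. -/
theorem exists_rho_of_shuffleChoice (hn : 1 ≤ n) (hD : R.IsDiagonal)
    (hσ : ∀ W, R.IsWall W → IsShuffleChoice R.tile W (σ W)) :
    ∃ x : Equiv.Perm (Fin n), SameRel (rho x) R.tile ∧
      ∀ W, R.IsWall W → (σ W).Sublist (word x) := by
  have hg := hD.isGeneric
  have hM := hD.meetsDiag
  have hσ' : ∀ W, R.swap.IsWall W → IsShuffleChoice R.swap.tile W ((σ ∘ Seg.swap) W) :=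
    fun W hW => (hσ W.swap (Tiling.IsWall.swap hW)).swap
  obtain ⟨e, x, X, Y, h1, h2, h3, h4⟩ := exists_labelling hn hg (comparator_before hM hσ)
    (comparator_before hM.swap hσ')
  have hT := timeOf_inj x
  -- Tiles with neighbouring new labels lie on opposite sides of a common line, so the diagonal
  -- meets them in this order; hence the new labels agree with the given numbering.
  obtain rfl : e = 1 := by
    apply eq_one_of_lt_succ
    intro k k' hk
    have hne : timeOf x k ≠ timeOf x k' := fun h => by
      have := hT _ _ k.2 k'.2 h
      omega
    rcases lt_or_gt_of_ne hne with h | h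
    · have e1 : rt n (timeOf x) k = k' :=
        rt_eq (by omega) k'.2.le (fun m _ _ => by omega) fun _ => h.le
      have e2 : lf (timeOf x) k' = k' := lf_eq le_rfl (fun m _ _ => by omega) fun _ => by
        rw [show (k' : ℕ) - 1 = k by omega]; exact h.le
      apply hD.lt_of_x
      change ((R.relabel e).tile k).x1 = ((R.relabel e).tile k').x0
      rw [h2, h2]
      exact congrArg X (e1.trans e2.symm)
    · have e1 : bo n (timeOf x) k = k' :=
        bo_eq (by omega) k'.2.le (fun m _ _ => by omega) fun _ => h.le
      have e2 : tp (timeOf x) k' = k' := tp_eq le_rfl (fun m _ _ => by omega) fun _ => by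
        rw [show (k' : ℕ) - 1 = k by omega]; exact h.le
      apply hD.lt_of_y
      change ((R.relabel e).tile k).y0 = ((R.relabel e).tile k').y1
      rw [h2, h2]
      exact congrArg Y (e1.trans e2.symm)
  have h2' : R.HasLines (timeOf x) X Y := h2
  have hτ : Function.Injective fun i : Fin n => timeOf x i := fun i j h =>
    Fin.ext (hT _ _ i.2 j.2 h)
  refine ⟨x, ?_, fun W hW => sublist_word ?_⟩
  · rw [← rhoTiling_tile hn x]
    exact hT.stdBuild.sameRel_of_meetsDiag (fun _ => rfl) (rhoTiling hn x).2
      (rhoTiling_meetsDiag hn x) h1 h2' hg hM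
  · cases W with
    | vert u p q =>
      exact IsShuffleChoice.pairwise (R := R) hτ hW (hσ _ hW)
        (fun i j hij r s => h1.markLU_lt h2' hij) (fun i j hij r s => h1.markRD_lt h2' hij) h3
    | horiz u p q =>
      have hf := h2'.flip h1.inj
      have tl : ∀ i, R.swap.tile i = R.flip.tile i.rev := fun i =>
        (Tiling.flip_tile_rev R i).symm
      have hW' := hW.swap
      refine IsShuffleChoice.pairwise (R := R.swap) (σ := σ ∘ Seg.swap) hτ hW' (hσ' _ hW') ?_ ?_ h4
      · intro i j hij r s hi hj
        rw [tl] at hi hj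
        exact h1.flip.markLU_lt hf (by rw [flipT_rev, flipT_rev]; exact hij) hi hj
      · intro i j hij r s hi hj
        rw [tl] at hi hj
        exact h1.flip.markRD_lt hf (by rw [flipT_rev, flipT_rev]; exact hij) hi hj

end choice

end Rectangulation

/-- The first part says that the defining property of `γ(x)` determines a map `γ` from permutations
to generic rectangulations, and that this map is surjective. The second part is the equivalent
form: every diagonal rectangulation with every choice of wall shuffles comes from a permutation. -/
theorem proposition4p2 (n : ℕ) (hn : 1 ≤ n) :
    (∃ γ : Equiv.Perm (Fin n) → Rectangulation.GRec n,
      (∀ (x : Equiv.Perm (Fin n)) (G : Rectangulation.GRec n),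
        Rectangulation.IsGamma x G ↔ G = γ x) ∧
      Function.Surjective γ) ∧
    (∀ R' : Rectangulation.Tiling n, R'.IsDiagonal →
      ∀ σ : Rectangulation.Seg → List (Fin n),
      (∀ W : Rectangulation.Seg, R'.IsWall W → Rectangulation.IsShuffleChoice R'.tile W (σ W)) →
      ∃ x : Equiv.Perm (Fin n), Rectangulation.SameRel (Rectangulation.rho x) R'.tile ∧
        ∀ W : Rectangulation.Seg, R'.IsWall W → (σ W).Sublist (Rectangulation.word x)) := by
  refine ⟨?_, fun R' hD σ hσ => Rectangulation.exists_rho_of_shuffleChoice hn hD hσ⟩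
  choose X Y h using fun x : Equiv.Perm (Fin n) => Rectangulation.exists_markedBuild_timeOf x
  refine ⟨fun x => Quotient.mk _ ((h x).tiling hn),
    fun x G => Rectangulation.isGamma_iff hn x (h x) G, fun G => ?_⟩
  obtain ⟨x, hx⟩ := Rectangulation.exists_eq_mk hn G
  exact ⟨x, (hx (h x)).symm⟩
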